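/- **Setting.** Let $G$ be the group of bijections of $\mathbb Z\setminus\{0\}$ that move only finitely many points, and for $n\ge 0$ let $K_n$ be the subgroup of all $g\in G$ with $g(-i)=-g(i)$ for all $i$ and $g(i)=i$ for $|i|\le n$; $K=K_0$. Let $\pi$ be a unitary representation of $G$ in a Hilbert space $H(\pi)$, and let $H(\pi)_n$ be the space of $K_n$-invariant vectors. $\pi$ is an *admissible* representation of the pair $(G,K)$ if $\bigcup_n H(\pi)_n$ is dense in $H(\pi)$. The *depth* $d(\pi)$ is the least $n$ with $H(\pi)_n\ne 0$, and $R(\pi)=H(\pi)_{d(\pi)}$ is the *root*. For $i\in\mathbb Z\setminus\{0\}$ let $A_i$ be the weak operator limit of the transpositions $\pi((i\,n))$, $n\to\infty$. Let $\pi$ have depth $d$. Its *Thoma measure* is the spectral measure (a probability measure on $[-1,1]$) of $A_{d+1}$ with respect to a unit vector of $R(\pi)$, when it is the same for all unit vectors of $R(\pi)$ (for irreducible $\pi$ this is so). A *Young distribution* $\Lambda$ is a function from $[-1,1]$ to Young diagrams that is empty at all but finitely many points; it is extended by $\emptyset$ to $\mathbb R$, $|\Lambda|=\sum_x|\Lambda(x)|$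 and $\operatorname{supp}\Lambda=\{x:\Lambda(x)\neq\emptyset\}$. $\pi$ *has the Young distribution* $\Lambda$ if $|\Lambda|=2d$ and $R(\pi)$, as a module over the symmetric group of $\{\pm1,\dots,\pm d\}$ and the operators $A_i$, $1\le|i|\le d$, is isomorphic to the module induced from $\bigotimes_x V_{\Lambda(x),x}$, where $V_{\lambda,x}$ is the irreducible module of the symmetric group $S(|\lambda|)$ labelled by $\lambda$ with all operators $A$ acting as the scalar $x$. **Mixtures.** Let $\pi_1,\pi_2,\dots$ be irreducible admissible representations of $(G,K)$ of depths $d_i$ with $d=\sum_i d_i<\infty$, and let $p_i>0$, $\sum_i p_i=1$. Let $\xi_i\in H(\pi_i)$ be unit vectors, $K$-invariant (spherical) whenever $d_i=0$, and let $E=\bigotimes_i H(\pi_i)$ be the infinite tensor product along the $\xi_i$, i.e. the direct limit of $\bigotimes_{i\le N}H(\pi_i)$ under $u\mapsto u\otimes\xi_{N+1}$. Let $X_n$ be the set of $f:\mathbb Z\setminus\{0\}\to\{1,2,\dots\}$ with $f(i)=f(-i)$ for $|i|>n$, let $X=\bigcup_nX_n$, and let $\omega$ be the measure on $X$ that gives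 the measure $\prod_{|i|\le n}p_{f_i}^{1/2}$ to the set of all $f\in X_n$ with prescribed values $f(i)=f_i$, $|i|\le n$. Let $Y\subset X$ be the set of $f$ for which every $f^{-1}(i)$ is infinite and $|f^{-1}(i)\cap\{-N,\dots,N\}|$ is even for all large $N$. For $f\in Y$ let $\eta_i^f:f^{-1}(i)\to\mathbb Z\setminus\{0\}$ be the unique increasing bijection with $\eta_i^f(-a)=-\eta_i^f(a)$ for all but finitely many $a$, and for $g\in G$ let $c(g,f)=(c(g,f)_i)_i$, where $c(g,f)_i=\eta_i^{g f}\circ g\circ(\eta_i^f)^{-1}\in G$ (trivial for almost all $i$), $(gf)(x)=f(g^{-1}x)$. Then $G$ acts in $L^2(Y,\omega;E)$ by the unitary representation $$[g\cdot F](f)=\Big(\bigotimes_i\pi_i\big(c(g,g^{-1}f)_i\big)\Big)F(g^{-1}f).$$ Let $H_{d_1,d_2,\dots}$ be the space of all $F$ that vanish unless $f\in X_d$ and $|f^{-1}(i)\cap\{-d,\dots,d\}|=2d_i$ for all $i$, that depend on such $f$ only through $f(\pm1),\dots,f(\pm d)$, and that take values in $\bigotimes_i R(\pi_i)\subset E$.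 The *mixture* of the $\pi_i$ with weights $p_i$ is the representation in the closed cyclic span of $H_{d_1,d_2,\dots}$. **Theorem 7.** Let $\pi_i$, $i=1,2,\dots$, be irreducible admissible representations of the pair $(G,K)$ with Thoma measures $\mu_i$ and Young distributions $\Lambda_i$ such that $\sum_i|\Lambda_i|<\infty$, and let $\pi$ be their mixture with weights $p_i>0$, $\sum_ip_i=1$. Then $\pi$ is admissible, and it is an orthogonal direct sum of irreducible admissible representations with Thoma measure $$\mu(x)=\sum_i p_i\,\mu_i(x/p_i),$$ that is, $\mu$ is the sum over $i$ of $p_i$ times the image of $\mu_i$ under $t\mapsto p_it$. The representation $\pi$ is irreducible if and only if $$\operatorname{supp}\Lambda_i(\,\cdot\,/p_i)\cap\operatorname{supp}\Lambda_j(\,\cdot\,/p_j)=\emptyset\qquad(i\ne j).$$ In this case $\pi$ has the Young distribution $\Lambda(x)=\bigcup_i\Lambda_i(x/p_i)$. -/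

import Mathlib

open MeasureTheory Filter Topology
open scoped ENNReal InnerProductSpace

noncomputable section

namespace Mixture

/-! ### The pair `(G, K)` -/

/-- The set `ℤ \ {0}`. -/
abbrev NZ : Type := {z : ℤ // z ≠ 0}

instance instNegNZ : Neg NZ := ⟨fun x => ⟨-x.1, neg_ne_zero.2 x.2⟩⟩

/-- The positive element `n + 1` of `ℤ \ {0}`. -/
def posNZ (n : ℕ) : NZ := ⟨(n : ℤ) + 1, by omega⟩

/-- The set `{±1, …, ±n}`. -/
def window (n : ℕ) : Set NZ := {x | |x.1| ≤ (n : ℤ)}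

theorem window_finite (n : ℕ) : (window n).Finite := by
  have h : ((fun x : NZ => x.1) '' window n).Finite :=
    (Set.finite_Icc (-(n : ℤ)) n).subset (by
      rintro _ ⟨x, hx, rfl⟩
      exact abs_le.1 hx)
  exact Set.Finite.of_finite_image h Subtype.val_injective.injOn

instance instFintypeWindow (n : ℕ) : Fintype (window n) := (window_finite n).fintype

/-- The group `G` of finite bijections of `ℤ \ {0}`. -/
def G : Subgroup (Equiv.Perm NZ) where
  carrier := {g | {x | g x ≠ x}.Finite}
  one_mem' := by simp
  mul_mem' := by
    intro a b ha hb
    refine (Set.Finite.union ha hb).subset fun x hx => ?_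
    by_contra h
    simp only [Set.mem_union, Set.mem_ofPred_eq, not_or, not_not] at h
    exact hx (by simp [h.1, h.2])
  inv_mem' := by
    intro a ha
    refine Set.Finite.subset ha fun x hx h => hx ?_
    exact Equiv.Perm.inv_eq_iff_eq.2 h.symm

/-- The subgroup `K_n` of `G`: bijections that commute with `i ↦ -i` and fix `±1, …, ±n`.
In particular `K = K_0`. -/
def K (n : ℕ) : Subgroup G where
  carrier := {g | (∀ x, g.1 (-x) = -g.1 x) ∧ ∀ x ∈ window n, g.1 x = x}
  one_mem' := by simp
  mul_mem' := by
    rintro a b ⟨ha, ha'⟩ ⟨hb, hb'⟩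
    refine ⟨fun x => by simp [hb, ha], fun x hx => by simp [hb' x hx, ha' x hx]⟩
  inv_mem' := by
    rintro a ⟨ha, ha'⟩
    refine ⟨fun x => ?_, fun x hx => ?_⟩
    · change a.1⁻¹ (-x) = -(a.1⁻¹ x)
      rw [Equiv.Perm.inv_eq_iff_eq, ha]
      simp
    · change a.1⁻¹ x = x
      rw [Equiv.Perm.inv_eq_iff_eq, ha' x hx]

/-- The transposition `(x y)`, as an element of `G`. -/
def transposition (x y : NZ) : G :=
  ⟨Equiv.swap x y, by
    refine (Set.toFinite {x, y}).subset fun z hz => ?_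
    by_contra h
    simp only [Set.mem_insert_iff, Set.mem_singleton_iff, not_or] at h
    exact hz (Equiv.swap_apply_of_ne_of_ne h.1 h.2)⟩

open Classical in
/-- A permutation of `{±1, …, ±n}`, as an element of `G` (fixing all other points). -/
def ofWindow (n : ℕ) (τ : Equiv.Perm (window n)) : G :=
  ⟨Equiv.Perm.ofSubtype τ, by
    refine (window_finite n).subset fun x hx => ?_
    by_contra h
    exact hx (Equiv.Perm.ofSubtype_apply_of_not_mem τ h)⟩

/-! ### Unitary representations of `G` -/

section Representations

variable {V : Type*} [NormedAddCommGroup V] [InnerProductSpace ℂ V]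

/-- Unitary representations of the discrete group `G` in `V`. -/
abbrev URep (V : Type*) [NormedAddCommGroup V] [InnerProductSpace ℂ V] : Type _ :=
  G →* (V ≃ₗᵢ[ℂ] V)

/-- The space of `K_n`-invariant vectors. -/
def fixed (ρ : URep V) (n : ℕ) : Submodule ℂ V where
  carrier := {v | ∀ k ∈ K n, ρ k v = v}
  add_mem' := by
    intro a b ha hb k hk
    rw [map_add, ha k hk, hb k hk]
  zero_mem' := fun k _ => map_zero _
  smul_mem' := by
    intro c v hv k hk
    rw [map_smul, hv k hk]

/-- A representation is admissible if the vectors that are invariant under some `K_n` are dense. -/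
def IsAdmissible (ρ : URep V) : Prop :=
  Dense (⋃ n, (fixed ρ n : Set V))

/-- A closed invariant subspace. -/
structure Subrep (ρ : URep V) where
  carrier : Submodule ℂ V
  isClosed : IsClosed (carrier : Set V)
  invariant : ∀ g, ∀ v ∈ carrier, ρ g v ∈ carrier

/-- The representation in a closed invariant subspace. -/
def Subrep.rep {ρ : URep V} (W : Subrep ρ) : URep W.carrier where
  toFun g :=
    { toFun := fun v => ⟨ρ g v, W.invariant g v v.2⟩
      invFun := fun v => ⟨ρ g⁻¹ v, W.invariant g⁻¹ v v.2⟩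
      map_add' := fun v w => by ext; simp
      map_smul' := fun c v => by ext; simp
      left_inv := fun v => by
        ext
        change ρ g⁻¹ (ρ g v) = v
        simp
      right_inv := fun v => by
        ext
        change ρ g (ρ g⁻¹ v) = v
        simp
      norm_map' := fun v => (ρ g).norm_map v }
  map_one' := by ext; simp
  map_mul' g h := by ext; simp

/-- Irreducibility: the space is not zero and has no proper closed invariant subspaces. -/
def IsIrreducible (ρ : URep V) : Prop :=
  Nontrivial V ∧ ∀ W : Subrep ρ, W.carrier = ⊥ ∨ W.carrier = ⊤

/-- The cyclic span of a set of vectors: the least closed invariant subspace that contains it. -/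
def cyclicSpan (ρ : URep V) (S : Set V) : Subrep ρ where
  carrier := ⨅ W : {W : Subrep ρ // S ⊆ W.carrier}, W.1.carrier
  isClosed := by
    rw [Submodule.coe_iInf]
    exact isClosed_iInter fun W => W.1.isClosed
  invariant := by
    intro g v hv
    rw [Submodule.mem_iInf] at hv ⊢
    exact fun W => W.1.invariant g v (hv W)

/-- The depth: the least `n` for which there are nonzero `K_n`-invariant vectors. -/
def depth (ρ : URep V) : ℕ := sInf {n | fixed ρ n ≠ ⊥}

/-- The root `R(ρ)`: the space of `K_d`-invariant vectors, where `d` is the depth. -/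
def root (ρ : URep V) : Submodule ℂ V := fixed ρ (depth ρ)

open Classical in
/-- The operator `A_x`: the limit of the transpositions `(x n)`, `n → ∞`, in the weak operator
topology (which exists for every admissible representation). -/
def opA (ρ : URep V) (x : NZ) : V →L[ℂ] V :=
  if h : ∃ T : V →L[ℂ] V, ∀ u v : V,
      Tendsto (fun n : ℕ => ⟪u, ρ (transposition x (posNZ n)) v⟫_ℂ) atTop (𝓝 ⟪u, T v⟫_ℂ)
  then h.choose else 0

/-- `μ` is the Thoma measure of `ρ`: the spectral measure, a probability measure on `[-1, 1]`, of
the operator `A_{d+1}` with respect to every unit vector of the root, where `d` is the depth.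
(A measure on `[-1, 1]` is the spectral measure if it has the right moments.) -/
def HasThomaMeasure (ρ : URep V) (μ : Measure ℝ) : Prop :=
  IsProbabilityMeasure μ ∧ μ (Set.Icc (-1) 1)ᶜ = 0 ∧
    ∀ ζ ∈ root ρ, ‖ζ‖ = 1 → ∀ k : ℕ,
      ⟪ζ, (opA ρ (posNZ (depth ρ)) ^ k) ζ⟫_ℂ = ((∫ t, t ^ k ∂μ : ℝ) : ℂ)

end Representations

/-! ### Young distributions -/

/-- A function from `[-1, 1]` to the set of Young diagrams which is empty at all but finitely many
points (extended by the empty diagram to all of `ℝ`). -/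
structure YoungDistribution where
  toFun : ℝ → YoungDiagram
  finite_supp : {x | toFun x ≠ ⊥}.Finite
  supp_subset : {x | toFun x ≠ ⊥} ⊆ Set.Icc (-1) 1

namespace YoungDistribution

instance instCoeFun : CoeFun YoungDistribution fun _ => ℝ → YoungDiagram := ⟨toFun⟩

/-- The disjoint union of the diagrams: pairs of a point `x` and a cell of the diagram at `x`. -/
def Cell (L : YoungDistribution) : Type :=
  {q : ℝ × (ℕ × ℕ) // q.2 ∈ L q.1}

instance instFiniteCell (L : YoungDistribution) : Finite L.Cell := by
  have h : {q : ℝ × (ℕ × ℕ) | q.2 ∈ L q.1}.Finite := by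
    refine (L.finite_supp.biUnion fun x _ =>
      ((L x).cells.finite_toSet.image fun c => (x, c))).subset ?_
    rintro ⟨x, c⟩ hc
    simp only [Set.mem_iUnion]
    refine ⟨x, fun h0 => ?_, c, hc, rfl⟩
    simp only [Set.mem_ofPred_eq, h0] at hc
    exact YoungDiagram.notMem_bot c hc
  exact h.to_subtype

instance instFintypeCell (L : YoungDistribution) : Fintype L.Cell := Fintype.ofFinite _

instance instDecidableEqCell (L : YoungDistribution) : DecidableEq L.Cell := Classical.decEq _

/-- The total number of cells. -/
def size (L : YoungDistribution) : ℕ := Fintype.card L.Cell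

/-- The point of `[-1, 1]` at which the diagram of a cell grows. -/
def Cell.pt {L : YoungDistribution} (z : L.Cell) : ℝ := z.1.1

/-- The product, over all points `x`, of the row groups of the diagrams at `x`. -/
def IsRowPerm (L : YoungDistribution) (σ : Equiv.Perm L.Cell) : Prop :=
  ∀ z, (σ z).pt = z.pt ∧ (σ z).1.2.1 = z.1.2.1

/-- The product, over all points `x`, of the column groups of the diagrams at `x`. -/
def IsColPerm (L : YoungDistribution) (σ : Equiv.Perm L.Cell) : Prop :=
  ∀ z, (σ z).pt = z.pt ∧ (σ z).1.2.2 = z.1.2.2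

open Classical in
/-- The product of the Young symmetrizers of all diagrams: an element of the group algebra of the
Young subgroup `∏_x S(Λ(x))`, viewed in the group algebra of the group of all permutations of the
cells. -/
def symmetrizer (L : YoungDistribution) : MonoidAlgebra ℂ (Equiv.Perm L.Cell) :=
  (∑ r : {σ // L.IsRowPerm σ}, MonoidAlgebra.single r.1 1) *
    ∑ c : {σ // L.IsColPerm σ}, MonoidAlgebra.single c.1 ((Equiv.Perm.sign c.1 : ℤ) : ℂ)

/-- The generator `σ · c` of the left ideal generated by the symmetrizer `c`. -/
def gen (L : YoungDistribution) (σ : Equiv.Perm L.Cell) : MonoidAlgebra ℂ (Equiv.Perm L.Cell) :=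
  MonoidAlgebra.single σ 1 * L.symmetrizer

/-- The left ideal `ℂ[S] · c`, where `S` is the group of all permutations of the cells. As an
`S`-module it is induced from the module `⨂_x V_{Λ(x)} = ℂ[∏_x S(Λ(x))] · c` of the Young subgroup
`∏_x S(Λ(x))`. -/
def youngModule (L : YoungDistribution) : Submodule ℂ (MonoidAlgebra ℂ (Equiv.Perm L.Cell)) :=
  Submodule.span ℂ (Set.range L.gen)

/-- The vector `σ · c` of `youngModule L`. -/
def vec (L : YoungDistribution) (σ : Equiv.Perm L.Cell) : L.youngModule :=
  ⟨L.gen σ, Submodule.subset_span ⟨σ, rfl⟩⟩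

end YoungDistribution

/-- `ρ` has the Young distribution `Λ`: after some identification `e` of the cells of `Λ` with
`{±1, …, ±d}`, where `d` is the depth, the root, with the action of the symmetric group of
`{±1, …, ±d}` and of the commuting operators `A_i`, `i = ±1, …, ±d`, is isomorphic to the module
induced from `⨂_x V_{Λ(x), x}`, that is, to the left ideal `ℂ[S] · c`, in which permutations act by
left multiplication and the operator with index `z` multiplies `τ · c` by the point of
`τ⁻¹ z`. -/
def HasYoungDistribution {V : Type*} [NormedAddCommGroup V] [InnerProductSpace ℂ V]
    (ρ : URep V) (L : YoungDistribution) : Prop :=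
  ∃ (e : L.Cell ≃ window (depth ρ)) (φ : L.youngModule →ₗ[ℂ] V),
    Function.Injective φ ∧ LinearMap.range φ = root ρ ∧
    (∀ σ τ : Equiv.Perm L.Cell,
      ρ (ofWindow (depth ρ) (e.permCongr σ)) (φ (L.vec τ)) = φ (L.vec (σ * τ))) ∧
    (∀ (z : L.Cell) (τ : Equiv.Perm L.Cell),
      opA ρ (e z).1 (φ (L.vec τ)) = ((τ⁻¹ z).pt : ℂ) • φ (L.vec τ))

/-! ### Infinite tensor products of Hilbert spaces -/

section Tensor

variable {H : ℕ → Type*} [∀ i, NormedAddCommGroup (H i)] [∀ i, InnerProductSpace ℂ (H i)]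

/-- Families of vectors that agree with the unit vectors `ξ i` at all but finitely many places. -/
def Family (ξ : ∀ i, Metric.sphere (0 : H i) 1) : Type _ :=
  {v : ∀ i, H i // {i | v i ≠ ξ i}.Finite}

variable {ξ : ∀ i, Metric.sphere (0 : H i) 1}

theorem Family.inner_eq_one (v w : Family ξ) (i : ℕ) (hv : v.1 i = ξ i) (hw : w.1 i = ξ i) :
    ⟪v.1 i, w.1 i⟫_ℂ = 1 := by
  have h : ‖(ξ i : H i)‖ = 1 := by simp
  rw [hv, hw, inner_self_eq_norm_sq_to_K, h]
  simp

/-- The inner product of the tensors `⨂ v i` and `⨂ w i` (a product with finitely many factors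
different from one). -/
def Family.kernel (v w : Family ξ) : ℂ := ∏ᶠ i, ⟪v.1 i, w.1 i⟫_ℂ

/-- Formal linear combinations of families. -/
abbrev PreTensor (ξ : ∀ i, Metric.sphere (0 : H i) 1) : Type _ := Family ξ →₀ ℂ

/-- The sesquilinear extension of the inner product of tensors. -/
def preInner (a b : Family ξ →₀ ℂ) : ℂ :=
  a.sum fun v s => b.sum fun w t => star s * t * Family.kernel v w

theorem kernel_eq_prod (v w : Family ξ) (I : Finset ℕ) (hv : ∀ i ∉ I, v.1 i = ξ i)
    (hw : ∀ i ∉ I, w.1 i = ξ i) : Family.kernel v w = ∏ i ∈ I, ⟪v.1 i, w.1 i⟫_ℂ := by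
  refine finprod_eq_prod_of_mulSupport_subset _ fun i hi => ?_
  by_contra h
  exact hi (Family.inner_eq_one v w i (hv i h) (hw i h))

theorem kernel_conj (v w : Family ξ) : star (Family.kernel v w) = Family.kernel w v := by
  have h := kernel_eq_prod v w (v.2.toFinset ∪ w.2.toFinset)
    (fun i hi => by by_contra h; exact hi (by simp [h]))
    (fun i hi => by by_contra h; exact hi (by simp [h]))
  have h' := kernel_eq_prod w v (v.2.toFinset ∪ w.2.toFinset)
    (fun i hi => by by_contra h; exact hi (by simp [h]))
    (fun i hi => by by_contra h; exact hi (by simp [h]))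
  rw [h, h', star_prod]
  exact Finset.prod_congr rfl fun i _ => inner_conj_symm _ _

open scoped ComplexOrder in
theorem posSemidef_prod {ι : Type*} [Finite ι] (u : ι → Family ξ) (I : Finset ℕ) :
    (Matrix.of fun v w : ι => ∏ i ∈ I, ⟪(u v).1 i, (u w).1 i⟫_ℂ).PosSemidef := by
  classical
  induction I using Finset.induction_on with
  | empty =>
    have h := Matrix.posSemidef_gram ℂ (fun _ : ι => (1 : ℂ))
    have he : (Matrix.of fun v w : ι => ∏ i ∈ (∅ : Finset ℕ), ⟪(u v).1 i, (u w).1 i⟫_ℂ) =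
        Matrix.gram ℂ (fun _ : ι => (1 : ℂ)) := by
      ext v w
      simp [Matrix.gram]
    rw [he]
    exact h
  | insert i I hi ih =>
    have h := (Matrix.posSemidef_gram ℂ (fun v : ι => (u v).1 i)).hadamard ih
    have he : (Matrix.of fun v w : ι => ∏ i ∈ insert i I, ⟪(u v).1 i, (u w).1 i⟫_ℂ) =
        (Matrix.gram ℂ (fun v : ι => (u v).1 i)).hadamard
          (Matrix.of fun v w : ι => ∏ i ∈ I, ⟪(u v).1 i, (u w).1 i⟫_ℂ) := by
      ext v w
      simp [Matrix.gram, Finset.prod_insert hi]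
    rw [he]
    exact h

open scoped ComplexOrder in
theorem preInner_self_nonneg (a : Family ξ →₀ ℂ) : 0 ≤ (preInner a a).re := by
  classical
  let I : Finset ℕ := a.support.biUnion fun v => v.2.toFinset
  have hI : ∀ v ∈ a.support, ∀ i ∉ I, v.1 i = ξ i := by
    intro v hv i hi
    by_contra h
    exact hi (Finset.mem_biUnion.2 ⟨v, hv, by simp [h]⟩)
  have h := (posSemidef_prod (fun v : a.support => (v : Family ξ)) I).dotProduct_mulVec_nonneg
    (fun v => a v)
  have he : preInner a a = star (fun v : a.support => a v) ⬝ᵥ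
      Matrix.mulVec (Matrix.of fun v w : a.support => ∏ i ∈ I, ⟪v.1.1 i, w.1.1 i⟫_ℂ)
        (fun v : a.support => a v) := by
    simp only [preInner, Finsupp.sum, dotProduct, Matrix.mulVec, Matrix.of_apply]
    rw [← Finset.sum_coe_sort]
    refine Finset.sum_congr rfl fun v _ => ?_
    rw [← Finset.sum_coe_sort, Finset.mul_sum]
    refine Finset.sum_congr rfl fun w _ => ?_
    rw [kernel_eq_prod v.1 w.1 I (hI v v.2) (hI w w.2), Pi.star_apply]
    ring
  rw [he]
  exact (Complex.le_def.1 h).1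

instance instCorePreTensor : PreInnerProductSpace.Core ℂ (PreTensor ξ) where
  inner a b := preInner a b
  conj_inner_symm a b := by
    change star (preInner b a) = preInner a b
    unfold preInner
    rw [Finsupp.sum_comm]
    simp only [Finsupp.sum, star_sum, star_mul', star_star, kernel_conj]
    refine Finset.sum_congr rfl fun v _ => Finset.sum_congr rfl fun w _ => by ring
  re_inner_nonneg a := preInner_self_nonneg a
  add_left a b c := by
    change preInner (a + b : Family ξ →₀ ℂ) c = _
    unfold preInner
    rw [Finsupp.sum_add_index'] <;> simp [← Finsupp.sum_add, add_mul]
  smul_left a b r := by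
    change preInner (r • a : Family ξ →₀ ℂ) b = _ * preInner a b
    unfold preInner
    rw [Finsupp.sum_smul_index] <;> simp [Finsupp.mul_sum, mul_assoc]

instance instSeminormedPreTensor : SeminormedAddCommGroup (PreTensor ξ) :=
  InnerProductSpace.Core.toSeminormedAddCommGroup (𝕜 := ℂ)

instance instInnerProductSpacePreTensor : InnerProductSpace ℂ (PreTensor ξ) := .ofCore _

/-- The infinite tensor product of the Hilbert spaces `H i` along the unit vectors `ξ i`: the
Hilbert space generated by the tensors `⨂ v i`, where `v i = ξ i` for all but finitely many `i`,
with inner products `∏ ⟪v i, w i⟫`. It is the direct limit of the Hilbert spaces `⨂_{i < N} H i`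
with respect to the inclusions `u ↦ u ⊗ ξ N`. -/
abbrev InfTensor (ξ : ∀ i, Metric.sphere (0 : H i) 1) : Type _ :=
  UniformSpace.Completion (PreTensor ξ)

/-- The tensor `⨂ v i`. -/
def tprod (v : Family ξ) : InfTensor ξ :=
  ((Finsupp.single v 1 : PreTensor ξ) : InfTensor ξ)

theorem inner_tprod (v w : Family ξ) : ⟪tprod v, tprod w⟫_ℂ = ∏ᶠ i, ⟪v.1 i, w.1 i⟫_ℂ := by
  unfold tprod
  rw [UniformSpace.Completion.inner_coe]
  change preInner (Finsupp.single v 1) (Finsupp.single w 1) = _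
  simp [preInner, Family.kernel]

/-- Families of elements of `G`, almost all of which are trivial. -/
abbrev GFamily : Type := {γ : ℕ → G // (Function.mulSupport γ).Finite}

/-- The family of vectors `π_i(γ_i) v_i`. -/
def Family.act (π : ∀ i, URep (H i)) (γ : GFamily) (v : Family ξ) : Family ξ :=
  ⟨fun i => π i (γ.1 i) (v.1 i), by
    refine (v.2.union γ.2).subset fun i hi => ?_
    by_contra h
    simp only [Set.mem_union, Set.mem_ofPred_eq, Function.mem_mulSupport, not_or, not_not] at h
    exact hi (by simp [h.1, h.2])⟩

/-- The linear extension of `Family.act` to formal linear combinations. -/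
def preAct (π : ∀ i, URep (H i)) (γ : GFamily) : PreTensor ξ →ₗᵢ[ℂ] PreTensor ξ where
  toLinearMap := Finsupp.lmapDomain ℂ ℂ (Family.act π γ)
  norm_map' a := by
    have h : preInner (Finsupp.mapDomain (Family.act π γ) a)
        (Finsupp.mapDomain (Family.act π γ) a) = preInner a a := by
      unfold preInner
      rw [Finsupp.sum_mapDomain_index (by simp)
        (by intro v s t; simp [Finsupp.sum, ← Finset.sum_add_distrib, add_mul])]
      refine Finset.sum_congr rfl fun v _ => ?_
      dsimp only
      rw [Finsupp.sum_mapDomain_index (by simp) (by intro v s t; ring)]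
      refine Finset.sum_congr rfl fun w _ => ?_
      simp [Family.kernel, Family.act]
    exact congrArg (fun z : ℂ => √z.re) h

/-- The operator `⨂ π_i(γ_i)` in the infinite tensor product. -/
def tensorAct (π : ∀ i, URep (H i)) (γ : GFamily) : InfTensor ξ → InfTensor ξ :=
  UniformSpace.Completion.map (preAct π γ)

theorem tensorAct_tprod (π : ∀ i, URep (H i)) (γ : GFamily) (v : Family ξ) :
    tensorAct π γ (tprod v) = tprod (Family.act π γ v) := by
  unfold tensorAct tprod
  rw [UniformSpace.Completion.map_coe (preAct π γ).isometry.uniformContinuous]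
  congr 1
  exact Finsupp.mapDomain_single

/-- The infinite tensor product of the roots of the `π i`, a closed subspace. -/
def tensorRoot (π : ∀ i, URep (H i)) (ξ : ∀ i, Metric.sphere (0 : H i) 1) :
    Submodule ℂ (InfTensor ξ) :=
  (Submodule.span ℂ {u | ∃ v : Family ξ, (∀ i, v.1 i ∈ root (π i)) ∧ u = tprod v}).topologicalClosure

end Tensor

/-! ### Colorings and the measure `ω` -/

/-- Positive weights with sum one. -/
structure Weights where
  toFun : ℕ → ℝ
  pos : ∀ i, 0 < toFun i
  hasSum : HasSum toFun 1

namespace Weights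

instance instCoeFun : CoeFun Weights fun _ => ℕ → ℝ := ⟨toFun⟩

/-- The probability measure on `ℕ` with `i` having the probability `p i`. -/
def law (p : Weights) : Measure ℕ :=
  Measure.sum fun i => ENNReal.ofReal (p i) • Measure.dirac i

instance instIsProbabilityMeasureLaw (p : Weights) : IsProbabilityMeasure p.law := by
  constructor
  rw [law, Measure.sum_apply _ MeasurableSet.univ]
  simp only [Measure.smul_apply, measure_univ, smul_eq_mul, mul_one]
  rw [← ENNReal.ofReal_tsum_of_nonneg (fun i => (p.pos i).le) p.hasSum.summable,
    p.hasSum.tsum_eq, ENNReal.ofReal_one]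

end Weights

/-- Functions `f : ℤ \ {0} → ℕ`; the values are called colors. -/
abbrev Coloring : Type := NZ → ℕ

/-- The action of `G` on colorings. -/
def colorAct (g : G) (f : Coloring) : Coloring := fun x => f ((g⁻¹).1 x)

/-- The set `X_n` of all colorings with `f(i) = f(-i)` for `|i| > n`. -/
def symColorings (n : ℕ) : Set Coloring := {f | ∀ x ∉ window n, f (-x) = f x}

/-- The coloring from `X_n` with given colors at `±1, …, ±n` and with color `t m` at `±m` for
`m > n`. -/
def glue (n : ℕ) (w : window n → ℕ) (t : ℕ → ℕ) : Coloring := by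
  classical
  exact fun x => if h : x ∈ window n then w ⟨x, h⟩ else t x.1.natAbs

/-- The measure `ω` on `X_n`: the set of all `f ∈ X_n` with given values `f_i` for `|i| ≤ n` has
measure `∏_{|i| ≤ n} p_{f_i}^{1/2}`, and the colors of the pairs `{i, -i}`, `i > n`, are independent
with distribution `p`. -/
def omegaOn (p : Weights) (n : ℕ) : Measure Coloring :=
  Measure.sum fun w : window n → ℕ =>
    ENNReal.ofReal (∏ i, √(p (w i))) • (Measure.infinitePi fun _ : ℕ => p.law).map (glue n w)

/-- The measure `ω` on `X = ⋃ X_n` (the measures on the sets `X_n` are compatible). -/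
def omega (p : Weights) : Measure Coloring :=
  Measure.sum fun n => (omegaOn p n).restrict (symColorings n \ ⋃ m < n, symColorings m)

/-- The set `Y`: colorings with `f(i) = f(-i)` for all but finitely many `i` in which every color
occurs infinitely often and an even number of times in `{±1, …, ±N}` for all large `N`. -/
def goodColorings : Set Coloring :=
  {f | (∃ n, f ∈ symColorings n) ∧ ∀ i, {x | f x = i}.Infinite ∧
    ∀ᶠ N : ℕ in atTop, Even (Set.ncard {x | x ∈ window N ∧ f x = i})}

/-- For `s = f⁻¹(i)`, `f ∈ Y`, there is a unique order isomorphism `η` from `s` to `ℤ \ {0}` with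
`η(-a) = -η(a)` for all but finitely many `a`. -/
def IsLabelling (s : Set NZ) (η : NZ → NZ) : Prop :=
  Set.BijOn η s Set.univ ∧ StrictMonoOn η s ∧ ∀ᶠ a in cofinite, a ∈ s → η (-a) = -η a

/-- `γ` is the value `c(g, f)` of the cocycle `c`: its component of color `i` is `g`, as a map from
the points of color `i` of `f` to the points of color `i` of `g · f`, after both sets are identified
with `ℤ \ {0}` through their labellings `η_i`. For a transposition `g = (a b)` of neighbours
`a < b` this is the transposition of `η_i(a)` and `η_i(b)` if both have the color `i`, and the
identity in all other colors. -/
def IsCocycleValue (g : G) (f : Coloring) (γ : GFamily) : Prop :=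
  ∀ i, ∃ η η' : NZ → NZ, IsLabelling {x | f x = i} η ∧ IsLabelling {x | colorAct g f x = i} η' ∧
    ∀ x, f x = i → (γ.1 i).1 (η x) = η' (g.1 x)

/-! ### Mixtures -/

section Mix

variable {H : ℕ → Type*} [∀ i, NormedAddCommGroup (H i)] [∀ i, InnerProductSpace ℂ (H i)]

/-- The Hilbert space of square integrable maps from `Y` to the infinite tensor product. -/
abbrev MixSpace (ξ : ∀ i, Metric.sphere (0 : H i) 1) (p : Weights) : Type _ :=
  Lp (InfTensor ξ) 2 ((omega p).restrict goodColorings)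

/-- The representation `ρ` of `G` is given by
`[g · F](f) = (⨂ π_i)(c(g, g⁻¹ · f)) F(g⁻¹ · f)`. -/
def IsMixAction (π : ∀ i, URep (H i)) (ξ : ∀ i, Metric.sphere (0 : H i) 1) (p : Weights)
    (ρ : URep (MixSpace ξ p)) : Prop :=
  ∀ (g : G) (F : MixSpace ξ p), ∀ᵐ f ∂((omega p).restrict goodColorings),
    ∃ γ : GFamily, IsCocycleValue g (colorAct g⁻¹ f) γ ∧
      (ρ g F : Coloring → InfTensor ξ) f =
        tensorAct π γ ((F : Coloring → InfTensor ξ) (colorAct g⁻¹ f))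

/-- The number `d = ∑ d_i`, where the `d_i` are the depths of the `π_i`. -/
def totalDepth (π : ∀ i, URep (H i)) : ℕ := ∑ᶠ i, depth (π i)

/-- The set `Y_{d_1, d_2, …}` of all `f ∈ Y` with `f(i) = f(-i)` for `|i| > d` such that, for every
`i`, exactly `2 d_i` of the points `±1, …, ±d` have the color `i`. -/
def rootColorings (π : ∀ i, URep (H i)) : Set Coloring :=
  {f | f ∈ goodColorings ∧ f ∈ symColorings (totalDepth π) ∧
    ∀ i, Set.ncard {x | x ∈ window (totalDepth π) ∧ f x = i} = 2 * depth (π i)}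

open Classical in
/-- The space `H_{d_1, d_2, …}`: maps that vanish outside of `Y_{d_1, d_2, …}`, depend there only on
the colors of `±1, …, ±d`, and take values in the tensor product of the roots of the `π_i`. -/
def mixRoot (π : ∀ i, URep (H i)) (ξ : ∀ i, Metric.sphere (0 : H i) 1) (p : Weights) :
    Set (MixSpace ξ p) :=
  {F | ∃ u : (window (totalDepth π) → ℕ) → InfTensor ξ, (∀ w, u w ∈ tensorRoot π ξ) ∧
    (F : Coloring → InfTensor ξ) =ᵐ[(omega p).restrict goodColorings] fun f =>
      if f ∈ rootColorings π then u (fun x => f x.1) else 0}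

/-- The mixture of the `π_i`: the representation in the cyclic span of `H_{d_1, d_2, …}`. -/
def mixture (π : ∀ i, URep (H i)) (ξ : ∀ i, Metric.sphere (0 : H i) 1) (p : Weights)
    (ρ : URep (MixSpace ξ p)) : URep (cyclicSpan ρ (mixRoot π ξ p)).carrier :=
  (cyclicSpan ρ (mixRoot π ξ p)).rep

end Mix

/-- The measure `μ(x) = ∑ p_i μ_i(x / p_i)`. -/
def mixMeasure (p : Weights) (μ : ℕ → Measure ℝ) : Measure ℝ :=
  Measure.sum fun i => ENNReal.ofReal (p i) • (μ i).map (fun t => p i * t)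

end Mixture

end

noncomputable section

set_option linter.unusedSectionVars false
set_option linter.unusedVariables false

namespace Mixture

/-! ### Weak limits of contractions -/

section WeakLimit

variable {V : Type*} [NormedAddCommGroup V] [InnerProductSpace ℂ V]

/-! Everything is reduced to the finite-dimensional root of the mixture, with the permutations of
`{±1, …, ±d}` and the operators `A_x` acting on it.

General theory. An element of `K_n` conjugates `(x m)` into `(x m')` when `m` and `m'` are far out,
so matrix coefficients of `(x m)` between `K_n`-invariant vectors are eventually constant. Hence the
weak limits `A_x` exist; they are self-adjoint, commute, and are permuted by `G`. A star product `(x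
y_1) ⋯ (x y_m)` with outer points beyond `n` has between `K_n`-invariant vectors the coefficients of
`A_x ^ m` (`inner_starProd`), and the weak limits of `A_n ^ m` as `n → ∞` commute with `G`
(`exists_central`). If there are no invariant vectors below `d` and the central operators are
scalars on the `K_d`-invariant vectors, an induction on the support of `g` removes the outer points
of `g` one by one: each of them turns into an operator `A_b`, a scalar, or zero
(`inner_eq_zero_of_invariant`). Consequently the root of an irreducible representation has no proper
subspace invariant under the permutations and the `A_x`, and Schur's lemma holds for it
(`IsIrreducible.form_eq`). A representation with a finite-dimensional cyclic space of
`K_d`-invariant vectors is a finite orthogonal sum of irreducible ones (`exists_decomposition`).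

The root of the mixture. Let `F` be a `K_n`-invariant vector of `L²(Y, E)`. Its norm is a
`K_n`-invariant function with integrable square; since `K_n` moves an asymmetric pair of a coloring
to infinitely many other places, `F` vanishes outside of `X_n`. The stabilizer in `K_n` of a
coloring in `X_n` contains a lift of the appropriate `K_m` for every color, so the values of `F` are
tensors of invariant vectors. By the Hewitt–Savage zero-one law the remaining dependence is on the
colors in the window only. Counting points of each color shows that there are no invariant vectors
below `d = ∑ d_i`, and that the `K_d`-invariant ones are the space `H_{d_1, d_2, …}`: functions on
the finitely many root words with values in the tensor product of the roots.

The Thoma measure. A star product contributes to a coefficient between such vectors only where all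
its outer points share the color `i` of the center. These colors are independent with law `p`, which
produces the factors `p_i`: for a center in the window, `A_x` is `p_i` times the operator `A` at the
place `i`, and for the center `d + 1` the `m`-th moment is `∑ p_i ^ (m + 1) ∫ t ^ m dμ_i`.

Irreducibility. If the rescaled supports are disjoint, different root words are separated by
eigenvalues of the `A_x`. The matrix of a projection to a subrepresentation is therefore diagonal
with respect to the words, each diagonal entry is a scalar by Schur's lemma for tensor products
(`IsMixable.tensor_form_eq`), and the permutations make the scalars equal. If two supports meet at a
common eigenvalue, exchanging points of the two colors inside the joint eigenspaces of their
operators gives an invariant form that is not a multiple of the inner product (`swapForm`), contrary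
to Schur's lemma for the root.

The Young distribution. For disjoint supports the row and column groups of the union are the
products of those of the parts, so the Young symmetrizer factors (`CellUnion.symmetrizer_glue`).
Hence the generators `σ · c` of the ideal for the union satisfy the same linear relations as the
corresponding tensors on root words (`RootModel.relations`), and the two modules are isomorphic. -/

theorem cauchySeq_inner_of_dense {T : ℕ → V →L[ℂ] V} (hT : ∀ n v, ‖T n v‖ ≤ ‖v‖) {D : Set V}
    (hD : Dense D)
    (h : ∀ u ∈ D, ∀ v ∈ D, ∃ c, Tendsto (fun n => ⟪u, T n v⟫_ℂ) atTop (𝓝 c)) (u v : V) :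
    CauchySeq fun n => ⟪u, T n v⟫_ℂ := by
  rw [Metric.cauchySeq_iff]
  intro ε hε
  -- Replacing `u, v` by vectors of the dense set costs at most `δ * (‖u‖ + ‖v‖ + 1)`. This happens
  -- twice, in addition to `ε / 2` from the Cauchy property on the dense set.
  obtain ⟨δ, hδ, hδ1, hδε⟩ : ∃ δ : ℝ, 0 < δ ∧ δ ≤ 1 ∧ 4 * δ * (‖u‖ + ‖v‖ + 1) < ε := by
    refine ⟨min 1 (ε / (8 * (‖u‖ + ‖v‖ + 1))), by positivity, min_le_left _ _, ?_⟩
    have := min_le_right 1 (ε / (8 * (‖u‖ + ‖v‖ + 1)))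
    have hpos : 0 < ‖u‖ + ‖v‖ + 1 := by positivity
    calc 4 * min 1 (ε / (8 * (‖u‖ + ‖v‖ + 1))) * (‖u‖ + ‖v‖ + 1)
        ≤ 4 * (ε / (8 * (‖u‖ + ‖v‖ + 1))) * (‖u‖ + ‖v‖ + 1) := by gcongr
      _ = ε / 2 := by field_simp; norm_num
      _ < ε := by linarith
  obtain ⟨u', hu', hud⟩ := hD.exists_dist_lt u hδ
  obtain ⟨v', hv', hvd⟩ := hD.exists_dist_lt v hδ
  rw [dist_eq_norm] at hud hvd
  obtain ⟨c, hc⟩ := h u' hu' v' hv'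
  have key : ∀ n, ‖⟪u, T n v⟫_ℂ - ⟪u', T n v'⟫_ℂ‖ ≤ δ * (‖u‖ + ‖v‖ + 1) := by
    intro n
    have e : ⟪u, T n v⟫_ℂ - ⟪u', T n v'⟫_ℂ = ⟪u - u', T n v⟫_ℂ + ⟪u', T n (v - v')⟫_ℂ := by
      rw [map_sub, inner_sub_left, inner_sub_right]; ring
    have hu'n : ‖u'‖ ≤ ‖u‖ + 1 := by
      have := norm_sub_norm_le u' u
      rw [norm_sub_rev] at this
      linarith
    rw [e]
    calc _ ≤ ‖u - u'‖ * ‖T n v‖ + ‖u'‖ * ‖T n (v - v')‖ :=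
          (norm_add_le _ _).trans (add_le_add (norm_inner_le_norm _ _) (norm_inner_le_norm _ _))
      _ ≤ δ * ‖v‖ + (‖u‖ + 1) * δ := by
          gcongr
          · exact hT n v
          · exact (hT n _).trans hvd.le
      _ = _ := by ring
  obtain ⟨N, hN⟩ := Metric.cauchySeq_iff.1 hc.cauchySeq (ε / 2) (by positivity)
  refine ⟨N, fun m hm n hn => ?_⟩
  have h1 := key m
  have h2 := key n
  have h3 := hN m hm n hn
  rw [dist_eq_norm] at h3 ⊢
  have e : ⟪u, T m v⟫_ℂ - ⟪u, T n v⟫_ℂ = (⟪u, T m v⟫_ℂ - ⟪u', T m v'⟫_ℂ)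
      + (⟪u', T m v'⟫_ℂ - ⟪u', T n v'⟫_ℂ) - (⟪u, T n v⟫_ℂ - ⟪u', T n v'⟫_ℂ) := by ring
  rw [e]
  refine (norm_sub_le _ _).trans_lt ?_
  have := norm_add_le (⟪u, T m v⟫_ℂ - ⟪u', T m v'⟫_ℂ) (⟪u', T m v'⟫_ℂ - ⟪u', T n v'⟫_ℂ)
  nlinarith

/-- A sequence of contractions whose matrix coefficients converge on a dense set converges in the
weak operator topology. -/
theorem exists_weakLimit [CompleteSpace V] {T : ℕ → V →L[ℂ] V} (hT : ∀ n v, ‖T n v‖ ≤ ‖v‖)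
    {D : Set V} (hD : Dense D)
    (h : ∀ u ∈ D, ∀ v ∈ D, ∃ c, Tendsto (fun n => ⟪u, T n v⟫_ℂ) atTop (𝓝 c)) :
    ∃ S : V →L[ℂ] V, ∀ u v, Tendsto (fun n => ⟪u, T n v⟫_ℂ) atTop (𝓝 ⟪u, S v⟫_ℂ) := by
  have hc := fun v u => cauchySeq_tendsto_of_complete (cauchySeq_inner_of_dense hT hD h u v)
  choose b hb using hc
  -- The limit is linear in `v` and antilinear in `u`; its conjugate has the variance that
  -- `InnerProductSpace.continuousLinearMapOfBilin` expects.
  let B : V →ₗ⋆[ℂ] V →ₗ[ℂ] ℂ := LinearMap.mk₂'ₛₗ (starRingEnd ℂ) (RingHom.id ℂ)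
    (fun v u => starRingEnd ℂ (b v u))
    (fun v v' u => by
      rw [← map_add]
      congr 1
      refine tendsto_nhds_unique (hb _ _) ?_
      simpa [inner_add_right] using (hb v u).add (hb v' u))
    (fun c v u => by
      rw [smul_eq_mul, ← map_mul]
      congr 1
      refine tendsto_nhds_unique (hb _ _) ?_
      simpa [inner_smul_right] using (hb v u).const_mul c)
    (fun v u u' => by
      rw [← map_add]
      congr 1
      refine tendsto_nhds_unique (hb _ _) ?_
      simpa [inner_add_left] using (hb v u).add (hb v u'))
    (fun c v u => by
      rw [RingHom.id_apply, smul_eq_mul, ← Complex.conj_conj c, ← map_mul]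
      congr 1
      refine tendsto_nhds_unique (hb _ _) ?_
      simpa [inner_smul_left, mul_comm] using (hb v u).const_mul (starRingEnd ℂ c))
  let B' : V →L⋆[ℂ] V →L[ℂ] ℂ := LinearMap.mkContinuous₂ B 1 (fun v u => by
    change ‖starRingEnd ℂ (b v u)‖ ≤ _
    rw [RCLike.norm_conj, one_mul]
    refine le_of_tendsto (hb v u).norm (Eventually.of_forall fun n => ?_)
    refine (norm_inner_le_norm _ _).trans ?_
    rw [mul_comm]
    gcongr
    exact hT n v)
  refine ⟨InnerProductSpace.continuousLinearMapOfBilin B', fun u v => ?_⟩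
  have e : ⟪u, InnerProductSpace.continuousLinearMapOfBilin B' v⟫_ℂ = b v u := by
    rw [← inner_conj_symm, InnerProductSpace.continuousLinearMapOfBilin_apply]
    exact Complex.conj_conj _
  rw [e]
  exact hb v u

end WeakLimit

/-! ### The group `G`, its transpositions and the subgroups `K_n` -/

section Group

@[simp] theorem NZ.neg_val (x : NZ) : (-x).1 = -x.1 := rfl

@[simp] theorem NZ.neg_neg' (x : NZ) : - -x = x := Subtype.ext (neg_neg _)

theorem NZ.neg_ne (x : NZ) : -x ≠ x := fun h => x.2 (by
  have := congrArg Subtype.val h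
  simp only [NZ.neg_val] at this
  omega)

theorem NZ.neg_eq_iff {x y : NZ} : -x = y ↔ x = -y :=
  ⟨fun h => by rw [← h, NZ.neg_neg'], fun h => by rw [h, NZ.neg_neg']⟩

theorem NZ.neg_inj' {x y : NZ} : -x = -y ↔ x = y := by rw [NZ.neg_eq_iff, NZ.neg_neg']

@[simp] theorem posNZ_val (n : ℕ) : (posNZ n).1 = (n : ℤ) + 1 := rfl

theorem mem_window {x : NZ} {n : ℕ} : x ∈ window n ↔ |x.1| ≤ (n : ℤ) := Iff.rfl

theorem mem_window' {x : NZ} {n : ℕ} : x ∈ window n ↔ x.1.natAbs ≤ n := by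
  rw [mem_window, Int.abs_eq_natAbs]; omega

@[simp] theorem neg_mem_window {x : NZ} {n : ℕ} : -x ∈ window n ↔ x ∈ window n := by
  simp [mem_window]

theorem window_mono {m n : ℕ} (h : m ≤ n) : window m ⊆ window n := fun x hx => by
  rw [mem_window'] at *
  omega

@[simp] theorem posNZ_mem_window {m n : ℕ} : posNZ m ∈ window n ↔ m < n := by
  rw [mem_window', posNZ_val]; omega

theorem mem_window_succ {x : NZ} {n : ℕ} :
    x ∈ window (n + 1) ↔ x ∈ window n ∨ x = posNZ n ∨ x = -posNZ n := by
  simp only [mem_window', Subtype.ext_iff, NZ.neg_val, posNZ_val]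
  omega

theorem posNZ_inj {m n : ℕ} : posNZ m = posNZ n ↔ m = n := by
  rw [Subtype.ext_iff]; simp

theorem neg_posNZ_ne (m n : ℕ) : -posNZ m ≠ posNZ n := fun h => by
  have := congrArg Subtype.val h
  simp only [NZ.neg_val, posNZ_val] at this
  omega

theorem posNZ_cases (x : NZ) : ∃ n, x = posNZ n ∨ x = -posNZ n := by
  refine ⟨x.1.natAbs - 1, ?_⟩
  have := x.2
  simp only [Subtype.ext_iff, NZ.neg_val, posNZ_val]
  omega

theorem exists_mem_window (x : NZ) : ∃ n, x ∈ window n := ⟨x.1.natAbs, mem_window'.2 le_rfl⟩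

/-- `g` moves only points of `{±1, …, ±n}`. -/
def SuppIn (n : ℕ) (g : G) : Prop := ∀ x, x ∉ window n → g.1 x = x

theorem exists_suppIn (g : G) : ∃ n, SuppIn n g := by
  obtain ⟨g, hg⟩ := g
  have hg' : {x | g x ≠ x}.Finite := hg
  obtain ⟨n, hn⟩ := (hg'.image fun x : NZ => x.1.natAbs).bddAbove
  refine ⟨n, fun x hx => ?_⟩
  by_contra h
  exact hx (mem_window'.2 (hn ⟨x, h, rfl⟩))

theorem SuppIn.mono {m n : ℕ} (h : m ≤ n) {g : G} (hg : SuppIn m g) : SuppIn n g :=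
  fun x hx => hg x fun hm => hx (window_mono h hm)

theorem SuppIn.mul {n : ℕ} {g h : G} (hg : SuppIn n g) (hh : SuppIn n h) : SuppIn n (g * h) :=
  fun x hx => by
    change g.1 (h.1 x) = x
    rw [hh x hx, hg x hx]

@[simp] theorem inv_apply_self' (g : G) (x : NZ) : (g⁻¹).1 (g.1 x) = x := g.1.symm_apply_apply x

@[simp] theorem apply_inv_self' (g : G) (x : NZ) : g.1 ((g⁻¹).1 x) = x := g.1.apply_symm_apply x

theorem mul_apply' (g h : G) (x : NZ) : (g * h).1 x = g.1 (h.1 x) := rfl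

theorem one_apply' (x : NZ) : (1 : G).1 x = x := rfl

theorem SuppIn.inv {n : ℕ} {g : G} (hg : SuppIn n g) : SuppIn n g⁻¹ := fun x hx => by
  conv_lhs => rw [← hg x hx]
  simp

theorem SuppIn.apply_mem {n : ℕ} {g : G} (hg : SuppIn n g) {x : NZ} : g.1 x ∈ window n ↔
    x ∈ window n := by
  constructor
  · intro h
    by_contra hx
    exact hx (hg x hx ▸ h)
  · intro h
    by_contra hx
    have := hg.inv _ hx
    rw [inv_apply_self'] at this
    exact hx (this ▸ h)

theorem G.ext' {g h : G} (H : ∀ x, g.1 x = h.1 x) : g = h := Subtype.ext (Equiv.ext H)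

theorem transposition_apply (x y z : NZ) :
    (transposition x y).1 z = if z = x then y else if z = y then x else z :=
  Equiv.swap_apply_def x y z

@[simp] theorem transposition_left (x y : NZ) : (transposition x y).1 x = y :=
  Equiv.swap_apply_left x y

@[simp] theorem transposition_right (x y : NZ) : (transposition x y).1 y = x :=
  Equiv.swap_apply_right x y

theorem transposition_of_ne {x y z : NZ} (h : z ≠ x) (h' : z ≠ y) :
    (transposition x y).1 z = z := Equiv.swap_apply_of_ne_of_ne h h'

theorem transposition_comm (x y : NZ) : transposition x y = transposition y x :=
  Subtype.ext (Equiv.swap_comm x y)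

@[simp] theorem transposition_mul_self (x y : NZ) : transposition x y * transposition x y = 1 :=
  Subtype.ext (Equiv.swap_mul_self x y)

@[simp] theorem transposition_inv (x y : NZ) : (transposition x y)⁻¹ = transposition x y :=
  inv_eq_of_mul_eq_one_left (transposition_mul_self x y)

theorem mul_transposition (g : G) (x y : NZ) :
    g * transposition x y = transposition (g.1 x) (g.1 y) * g :=
  Subtype.ext (Equiv.mul_swap_eq_swap_mul g.1 x y)

theorem mul_transposition_mul (g : G) (x y z w : NZ) :
    g * (transposition x y * transposition z w) =
      transposition (g.1 x) (g.1 y) * transposition (g.1 z) (g.1 w) * g := by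
  conv_rhs => rw [mul_assoc, ← mul_transposition g z w, ← mul_assoc, ← mul_transposition, mul_assoc]

theorem transposition_mul_comm {x y z w : NZ} (h1 : x ≠ z) (h2 : x ≠ w) (h3 : y ≠ z)
    (h4 : y ≠ w) :
    transposition x y * transposition z w = transposition z w * transposition x y := by
  rw [mul_transposition, transposition_of_ne h1.symm h3.symm, transposition_of_ne h2.symm h4.symm]

theorem suppIn_transposition {n : ℕ} {x y : NZ} (hx : x ∈ window n) (hy : y ∈ window n) :
    SuppIn n (transposition x y) := fun _ hz =>
  transposition_of_ne (fun h => hz (h ▸ hx)) fun h => hz (h ▸ hy)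

/-- The element `(x y)(-x -y)` of `K`. -/
def signedSwap (x y : NZ) : G := transposition x y * transposition (-x) (-y)

theorem signedSwap_apply (x y z : NZ) (h : x ≠ -y) : (signedSwap x y).1 z =
    if z = x then y else if z = y then x else if z = -x then -y else if z = -y then -x else z := by
  have h1 := x.neg_ne
  have h2 := y.neg_ne
  simp only [signedSwap, mul_apply', transposition_apply]
  grind [NZ.neg_neg', NZ.neg_inj', NZ.neg_eq_iff]

theorem signedSwap_neg (x : NZ) : signedSwap x (-x) = 1 := by
  rw [signedSwap, NZ.neg_neg', transposition_comm (-x) x, transposition_mul_self]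

theorem K_mono {m n : ℕ} (h : m ≤ n) : K n ≤ K m :=
  fun _ hk => ⟨hk.1, fun x hx => hk.2 x (window_mono h hx)⟩

theorem signedSwap_mem_K {n : ℕ} {x y : NZ} (hx : x ∉ window n) (hy : y ∉ window n) :
    signedSwap x y ∈ K n := by
  -- In this case the two transpositions coincide and cancel, so the formula for the values of
  -- `signedSwap` does not apply.
  by_cases h : x = -y
  · rw [NZ.neg_eq_iff.symm] at h
    rw [← h, signedSwap_neg]
    exact one_mem _
  refine ⟨fun z => ?_, fun z hz => ?_⟩
  · simp only [signedSwap_apply _ _ _ h]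
    have h1 := x.neg_ne
    have h2 := y.neg_ne
    grind [NZ.neg_neg', NZ.neg_inj', NZ.neg_eq_iff]
  · have hnz := neg_mem_window.2 hz
    rw [signedSwap_apply _ _ _ h]
    grind [NZ.neg_neg']

theorem signedSwap_left {x y : NZ} (h : x ≠ -y) : (signedSwap x y).1 x = y := by
  rw [signedSwap_apply _ _ _ h, if_pos rfl]

theorem signedSwap_right {x y : NZ} (h : x ≠ -y) : (signedSwap x y).1 y = x := by
  rw [signedSwap_apply _ _ _ h, if_pos rfl]
  split_ifs with h'
  · exact h'
  · rfl

theorem signedSwap_of_ne {x y z : NZ} (h1 : z ≠ x) (h2 : z ≠ y) (h3 : z ≠ -x) (h4 : z ≠ -y) :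
    (signedSwap x y).1 z = z := by
  rw [signedSwap, mul_apply', transposition_of_ne h3 h4, transposition_of_ne h1 h2]

theorem suppIn_signedSwap {n : ℕ} {x y : NZ} (hx : x ∈ window n) (hy : y ∈ window n) :
    SuppIn n (signedSwap x y) :=
  (suppIn_transposition hx hy).mul
    (suppIn_transposition (neg_mem_window.2 hx) (neg_mem_window.2 hy))

theorem flip_mem_K {n : ℕ} {x : NZ} (hx : x ∉ window n) : transposition x (-x) ∈ K n := by
  refine ⟨fun z => ?_, fun z hz => ?_⟩
  · simp only [transposition_apply]
    have h1 := x.neg_ne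
    grind [NZ.neg_neg', NZ.neg_inj', NZ.neg_eq_iff]
  · have hnz := neg_mem_window.2 hz
    rw [transposition_apply]
    grind [NZ.neg_neg']

open Classical in
theorem suppIn_ofWindow (n : ℕ) (τ : Equiv.Perm (window n)) : SuppIn n (ofWindow n τ) :=
  fun _ hx => Equiv.Perm.ofSubtype_apply_of_not_mem τ hx

open Classical in
theorem ofWindow_apply (n : ℕ) (τ : Equiv.Perm (window n)) (x : window n) :
    (ofWindow n τ).1 x = τ x := Equiv.Perm.ofSubtype_apply_coe τ x

theorem SuppIn.exists_ofWindow {n : ℕ} {g : G} (hg : SuppIn n g) : ∃ τ, g = ofWindow n τ := by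
  have hmem : ∀ x, g.1 x ∈ window n ↔ x ∈ window n := fun x => hg.apply_mem
  refine ⟨g.1.subtypePerm hmem, G.ext' fun x => ?_⟩
  by_cases hx : x ∈ window n
  · exact (ofWindow_apply n (g.1.subtypePerm hmem) ⟨x, hx⟩).symm
  · rw [hg x hx, suppIn_ofWindow n _ x hx]

/-- Countability allows almost everywhere statements to be made for all elements of `K_n` at once.
-/
instance instCountableG : Countable G := by
  have h : (Set.univ : Set G) = ⋃ n, Set.range (ofWindow n) := by
    refine (Set.eq_univ_of_forall fun g => ?_).symm
    obtain ⟨n, hn⟩ := exists_suppIn g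
    obtain ⟨τ, hτ⟩ := hn.exists_ofWindow
    exact Set.mem_iUnion.2 ⟨n, τ, hτ.symm⟩
  rw [← Set.countable_univ_iff, h]
  exact Set.countable_iUnion fun n => Set.countable_range _

/-- The two permutations move disjoint sets of points. -/
theorem SuppIn.commute_K {n : ℕ} {g k : G} (hg : SuppIn n g) (hk : k ∈ K n) :
    k * g = g * k := G.ext' fun x => by
  simp only [mul_apply']
  by_cases hx : x ∈ window n
  · rw [hk.2 x hx, hk.2 _ (hg.apply_mem.2 hx)]
  · have : k.1 x ∉ window n := fun h => hx (by
      have h' := hk.2 _ h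
      have := k.1.injective h'
      rwa [this] at h)
    rw [hg x hx, hg _ this]

end Group

/-! ### Unitary representations and `K_n`-invariant vectors -/

section Rep

variable {V : Type*} [NormedAddCommGroup V] [InnerProductSpace ℂ V]

theorem rho_mul (ρ : URep V) (g h : G) (v : V) : ρ (g * h) v = ρ g (ρ h v) := by
  rw [map_mul]; rfl

@[simp] theorem rho_one (ρ : URep V) (v : V) : ρ 1 v = v := by
  rw [map_one]; rfl

@[simp] theorem rho_rho_inv (ρ : URep V) (g : G) (v : V) : ρ g (ρ g⁻¹ v) = v := by
  rw [← rho_mul, mul_inv_cancel, rho_one]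

theorem inner_rho_left (ρ : URep V) (g : G) (u v : V) : ⟪ρ g u, v⟫_ℂ = ⟪u, ρ g⁻¹ v⟫_ℂ := by
  rw [← (ρ g).inner_map_map u, rho_rho_inv]

theorem inner_rho_right (ρ : URep V) (g : G) (u v : V) : ⟪u, ρ g v⟫_ℂ = ⟪ρ g⁻¹ u, v⟫_ℂ := by
  rw [inner_rho_left, inv_inv]

theorem fixed_mono (ρ : URep V) {m n : ℕ} (h : m ≤ n) : fixed ρ m ≤ fixed ρ n :=
  fun _ hv k hk => hv k (K_mono h hk)

theorem SuppIn.rho_mem_fixed {ρ : URep V} {n : ℕ} {g : G} (hg : SuppIn n g) {v : V}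
    (hv : v ∈ fixed ρ n) : ρ g v ∈ fixed ρ n := fun k hk => by
  rw [← rho_mul, hg.commute_K hk, rho_mul, hv k hk]

theorem isClosed_fixed (ρ : URep V) (n : ℕ) : IsClosed (fixed ρ n : Set V) := by
  have : (fixed ρ n : Set V) = ⋂ k ∈ K n, {v | ρ k v = v} := by
    ext v
    simp [fixed]
  rw [this]
  exact isClosed_biInter fun k _ => isClosed_eq (ρ k).continuous continuous_id

theorem ext_of_admissible {ρ : URep V} (hρ : IsAdmissible ρ) {a b : V}
    (h : ∀ n, ∀ u ∈ fixed ρ n, ⟪u, a⟫_ℂ = ⟪u, b⟫_ℂ) : a = b := by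
  have key : (fun u : V => ⟪u, a⟫_ℂ) = fun u => ⟪u, b⟫_ℂ := by
    refine Continuous.ext_on hρ (by fun_prop) (by fun_prop) fun u hu => ?_
    obtain ⟨n, hn⟩ := Set.mem_iUnion.1 hu
    exact h n u hn
  exact ext_inner_left ℂ fun u => congrFun key u

end Rep

/-! ### The operators `A_x` as weak limits -/

section OpA

variable {V : Type*} [NormedAddCommGroup V] [InnerProductSpace ℂ V] {ρ : URep V}

/-- The operator `ρ g` as a continuous linear map. -/
def rhoL (ρ : URep V) (g : G) : V →L[ℂ] V := (ρ g).toContinuousLinearEquiv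

@[simp] theorem rhoL_apply (ρ : URep V) (g : G) (v : V) : rhoL ρ g v = ρ g v := rfl

/-- Weak limits of sequences of operators that are compatible with the action of the groups
`K n`. -/
theorem exists_weakLimit_of_equivariant [CompleteSpace V] (hρ : IsAdmissible ρ) {T : ℕ → V →L[ℂ] V}
    (hT : ∀ n v, ‖T n v‖ ≤ ‖v‖) (N : ℕ)
    (h : ∀ m n, N ≤ m → N ≤ n → ∀ v, ρ (signedSwap (posNZ m) (posNZ n)) (T m v) =
      T n (ρ (signedSwap (posNZ m) (posNZ n)) v)) :
    ∃ S : V →L[ℂ] V, (∀ u v, Tendsto (fun n => ⟪u, T n v⟫_ℂ) atTop (𝓝 ⟪u, S v⟫_ℂ)) ∧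
      ∀ n m, N ≤ n → n ≤ m → ∀ u ∈ fixed ρ n, ∀ v ∈ fixed ρ n, ⟪u, T m v⟫_ℂ = ⟪u, S v⟫_ℂ := by
  -- The signed swap of two points beyond `n` lies in `K n`. It fixes both vectors and carries `T m`
  -- to `T m'`.
  have const : ∀ n, N ≤ n → ∀ u ∈ fixed ρ n, ∀ v ∈ fixed ρ n, ∀ m m', n ≤ m → n ≤ m' →
      ⟪u, T m v⟫_ℂ = ⟪u, T m' v⟫_ℂ := by
    intro n hn u hu v hv m m' hm hm'
    have hk : signedSwap (posNZ m) (posNZ m') ∈ K n := signedSwap_mem_K (by simpa) (by simpa)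
    rw [← (ρ (signedSwap (posNZ m) (posNZ m'))).inner_map_map, h m m' (hn.trans hm) (hn.trans hm'),
      hu _ hk, hv _ hk]
  have hconst : ∀ n, N ≤ n → ∀ u ∈ fixed ρ n, ∀ v ∈ fixed ρ n, ∀ m, n ≤ m →
      Tendsto (fun k => ⟪u, T k v⟫_ℂ) atTop (𝓝 ⟪u, T m v⟫_ℂ) := by
    intro n hn u hu v hv m hm
    refine tendsto_const_nhds.congr' ?_
    filter_upwards [eventually_ge_atTop n] with k hk
    exact const n hn u hu v hv _ _ hm hk
  obtain ⟨S, hS⟩ := exists_weakLimit hT hρ (fun u hu v hv => by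
    obtain ⟨a, ha⟩ := Set.mem_iUnion.1 hu
    obtain ⟨b, hb⟩ := Set.mem_iUnion.1 hv
    exact ⟨_, hconst (max N (max a b)) (le_max_left _ _) u (fixed_mono ρ (by simp) ha) v
      (fixed_mono ρ (by simp) hb) _ le_rfl⟩)
  exact ⟨S, hS, fun n m hn hm u hu v hv =>
    tendsto_nhds_unique (hconst n hn u hu v hv m hm) (hS u v)⟩

/-- The element of `K_n` that exchanges two far points conjugates the corresponding transpositions
into each other. Besides convergence this gives exact values: between `K_n`-invariant vectors, a
single transposition with a point beyond `n` already has the coefficients of the limit. The index `m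
= n` is allowed because `posNZ n` is the point `n + 1`. -/
theorem opA_spec [CompleteSpace V] (hρ : IsAdmissible ρ) (x : NZ) :
    (∀ u v, Tendsto (fun n => ⟪u, ρ (transposition x (posNZ n)) v⟫_ℂ) atTop
      (𝓝 ⟪u, opA ρ x v⟫_ℂ)) ∧
    ∀ n m, x ∈ window n → n ≤ m → ∀ u ∈ fixed ρ n, ∀ v ∈ fixed ρ n,
      ⟪u, ρ (transposition x (posNZ m)) v⟫_ℂ = ⟪u, opA ρ x v⟫_ℂ := by
  have key : ∀ N, x ∈ window N → ∃ S : V →L[ℂ] V,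
      (∀ u v, Tendsto (fun n => ⟪u, rhoL ρ (transposition x (posNZ n)) v⟫_ℂ) atTop
        (𝓝 ⟪u, S v⟫_ℂ)) ∧
      ∀ n m, N ≤ n → n ≤ m → ∀ u ∈ fixed ρ n, ∀ v ∈ fixed ρ n,
        ⟪u, rhoL ρ (transposition x (posNZ m)) v⟫_ℂ = ⟪u, S v⟫_ℂ := by
    intro N hN
    refine exists_weakLimit_of_equivariant hρ (fun n v => ((ρ _).norm_map v).le) N
      fun m n hm hn v => ?_
    simp only [rhoL_apply, ← rho_mul]
    have hk : signedSwap (posNZ m) (posNZ n) ∈ K N :=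
      signedSwap_mem_K (by simpa) (by simpa)
    rw [mul_transposition, hk.2 x hN, signedSwap_left (neg_posNZ_ne _ _ ·.symm)]
  simp only [rhoL_apply] at key
  obtain ⟨N, hN⟩ := exists_mem_window x
  have hex : ∃ T : V →L[ℂ] V, ∀ u v : V,
      Tendsto (fun n : ℕ => ⟪u, ρ (transposition x (posNZ n)) v⟫_ℂ) atTop (𝓝 ⟪u, T v⟫_ℂ) := by
    obtain ⟨S, hS, -⟩ := key N hN
    exact ⟨S, hS⟩
  have h1 : ∀ u v, Tendsto (fun n => ⟪u, ρ (transposition x (posNZ n)) v⟫_ℂ) atTop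
      (𝓝 ⟪u, opA ρ x v⟫_ℂ) := by
    unfold opA
    rw [dif_pos hex]
    exact hex.choose_spec
  refine ⟨h1, fun n m hx hm u hu v hv => ?_⟩
  obtain ⟨S, hS, hS'⟩ := key n hx
  rw [hS' n m le_rfl hm u hu v hv]
  exact tendsto_nhds_unique (hS u v) (h1 u v)

theorem opA_unique [CompleteSpace V] (hρ : IsAdmissible ρ) {x : NZ} {v w : V}
    (h : ∀ n, ∀ u ∈ fixed ρ n,
      Tendsto (fun n => ⟪u, ρ (transposition x (posNZ n)) v⟫_ℂ) atTop (𝓝 ⟪u, w⟫_ℂ)) :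
    opA ρ x v = w :=
  ext_of_admissible hρ fun n u hu => tendsto_nhds_unique ((opA_spec hρ x).1 u v) (h n u hu)

variable [CompleteSpace V]

theorem inner_opA_left (hρ : IsAdmissible ρ) (x : NZ) (u v : V) :
    ⟪opA ρ x u, v⟫_ℂ = ⟪u, opA ρ x v⟫_ℂ := by
  have h1 := (opA_spec hρ x).1 u v
  have h2 := ((opA_spec hρ x).1 v u).star
  refine tendsto_nhds_unique ?_ h1
  have e : star ⟪v, opA ρ x u⟫_ℂ = ⟪opA ρ x u, v⟫_ℂ := inner_conj_symm _ _
  rw [← e]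
  refine h2.congr fun n => ?_
  change starRingEnd ℂ _ = _
  rw [inner_conj_symm, inner_rho_left, transposition_inv]

theorem norm_opA_le (hρ : IsAdmissible ρ) (x : NZ) (v : V) : ‖opA ρ x v‖ ≤ ‖v‖ := by
  have h : ‖⟪opA ρ x v, opA ρ x v⟫_ℂ‖ ≤ ‖opA ρ x v‖ * ‖v‖ := by
    refine le_of_tendsto ((opA_spec hρ x).1 (opA ρ x v) v).norm (Eventually.of_forall fun n => ?_)
    refine (norm_inner_le_norm _ _).trans ?_
    rw [LinearIsometryEquiv.norm_map]
  rw [inner_self_eq_norm_sq_to_K] at h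
  simp only [Complex.coe_algebraMap, norm_pow, Complex.norm_real, norm_norm] at h
  by_contra! hlt
  have : 0 ≤ ‖v‖ := norm_nonneg v
  nlinarith

theorem norm_opA_pow_le (hρ : IsAdmissible ρ) (x : NZ) (m : ℕ) (v : V) :
    ‖(opA ρ x ^ m) v‖ ≤ ‖v‖ := by
  induction m with
  | zero => simp
  | succ m ih =>
    rw [pow_succ']
    exact (norm_opA_le hρ x _).trans ih

theorem rho_opA (hρ : IsAdmissible ρ) (g : G) (x : NZ) (v : V) :
    ρ g (opA ρ x v) = opA ρ (g.1 x) (ρ g v) := by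
  refine (opA_unique hρ fun n u _ => ?_).symm
  have h := (opA_spec hρ x).1 (ρ g⁻¹ u) v
  rw [inner_rho_left, inv_inv] at h
  refine h.congr' ?_
  obtain ⟨N, hN⟩ := exists_suppIn g
  filter_upwards [eventually_ge_atTop N] with m hm
  rw [inner_rho_left, inv_inv, ← rho_mul, ← rho_mul, mul_transposition,
    hN (posNZ m) (by simpa using hm)]

theorem rho_opA_pow (hρ : IsAdmissible ρ) (g : G) (x : NZ) (m : ℕ) (v : V) :
    ρ g ((opA ρ x ^ m) v) = (opA ρ (g.1 x) ^ m) (ρ g v) := by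
  induction m generalizing v with
  | zero => simp
  | succ m ih =>
    rw [pow_succ, pow_succ]
    change ρ g ((opA ρ x ^ m) (opA ρ x v)) = (opA ρ (g.1 x) ^ m) (opA ρ (g.1 x) (ρ g v))
    rw [ih, rho_opA hρ]

theorem inner_opA_pow_left (hρ : IsAdmissible ρ) (x : NZ) (m : ℕ) (u v : V) :
    ⟪(opA ρ x ^ m) u, v⟫_ℂ = ⟪u, (opA ρ x ^ m) v⟫_ℂ := by
  induction m generalizing u v with
  | zero => simp
  | succ m ih =>
    conv_lhs => rw [pow_succ]
    rw [pow_succ']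
    change ⟪(opA ρ x ^ m) (opA ρ x u), v⟫_ℂ = ⟪u, opA ρ x ((opA ρ x ^ m) v)⟫_ℂ
    rw [ih, inner_opA_left hρ]

theorem opA_mem_fixed (hρ : IsAdmissible ρ) {n : ℕ} {x : NZ} (hx : x ∈ window n) {v : V}
    (hv : v ∈ fixed ρ n) : opA ρ x v ∈ fixed ρ n := fun k hk => by
  rw [rho_opA hρ, hv k hk, hk.2 x hx]

theorem opA_pow_mem_fixed (hρ : IsAdmissible ρ) {n : ℕ} {x : NZ} (hx : x ∈ window n) (m : ℕ)
    {v : V} (hv : v ∈ fixed ρ n) : (opA ρ x ^ m) v ∈ fixed ρ n := fun k hk => by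
  rw [rho_opA_pow hρ, hv k hk, hk.2 x hx]

/-- For `x ≠ y` both products have, between `K_n`-invariant vectors, the coefficients of one product
of two transpositions with different outer points, which commute. The second order of factors
follows from the first by self-adjointness. -/
theorem opA_comm (hρ : IsAdmissible ρ) (x y : NZ) (v : V) :
    opA ρ x (opA ρ y v) = opA ρ y (opA ρ x v) := by
  by_cases hxy : x = y
  · rw [hxy]
  obtain ⟨a, ha⟩ := exists_mem_window x
  obtain ⟨b, hb⟩ := exists_mem_window y
  have key : ∀ n, a ≤ n → b ≤ n → ∀ u ∈ fixed ρ n, ∀ v ∈ fixed ρ n,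
      ⟪u, opA ρ x (opA ρ y v)⟫_ℂ =
        ⟪u, ρ (transposition x (posNZ n) * transposition y (posNZ (n + 1))) v⟫_ℂ := by
    intro n han hbn u hu v hv
    have hx := window_mono han ha
    have hy := window_mono hbn hb
    rw [← (opA_spec hρ x).2 n n hx le_rfl u hu _ (opA_mem_fixed hρ hy hv), rho_mul,
      inner_rho_right, inner_rho_right]
    have hs : SuppIn (n + 1) (transposition x (posNZ n))⁻¹ :=
      (suppIn_transposition (window_mono (Nat.le_succ n) hx) (by simp)).inv
    exact ((opA_spec hρ y).2 (n + 1) (n + 1) (window_mono (Nat.le_succ n) hy) le_rfl _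
      (hs.rho_mem_fixed (fixed_mono ρ (Nat.le_succ n) hu)) _
      (fixed_mono ρ (Nat.le_succ n) hv)).symm
  have key' : ∀ n, a ≤ n → b ≤ n → ∀ u ∈ fixed ρ n, ∀ v ∈ fixed ρ n,
      ⟪u, opA ρ y (opA ρ x v)⟫_ℂ =
        ⟪u, ρ (transposition x (posNZ n) * transposition y (posNZ (n + 1))) v⟫_ℂ := by
    intro n han hbn u hu v hv
    have hx := window_mono han ha
    have hy := window_mono hbn hb
    have hx1 : x ≠ posNZ (n + 1) := by rintro rfl; simp at hx
    have hy1 : y ≠ posNZ n := by rintro rfl; simp at hy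
    rw [← inner_opA_left hρ, ← inner_opA_left hρ, ← inner_conj_symm, key n han hbn v hv u hu,
      inner_conj_symm, inner_rho_left, mul_inv_rev, transposition_inv, transposition_inv,
      transposition_mul_comm (Ne.symm hxy) hy1 hx1.symm (by simp [posNZ_inj])]
  have dense_ext : ∀ S T : V →L[ℂ] V, (∀ n, a ≤ n → b ≤ n → ∀ u ∈ fixed ρ n, ∀ v ∈ fixed ρ n,
      ⟪u, S v⟫_ℂ = ⟪u, T v⟫_ℂ) → S = T := by
    intro S T h
    have : (S : V → V) = T := by
      refine Continuous.ext_on hρ S.continuous T.continuous fun v hv => ?_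
      obtain ⟨n, hn⟩ := Set.mem_iUnion.1 hv
      refine ext_of_admissible hρ fun m u hu => ?_
      exact h (max (max a b) (max m n)) (by simp) (by simp) u (fixed_mono ρ (by simp) hu) v
        (fixed_mono ρ (by simp) hn)
    exact DFunLike.coe_injective this
  have := dense_ext (opA ρ x ∘L opA ρ y) (opA ρ y ∘L opA ρ x) fun n h1 h2 u hu v hv =>
    (key n h1 h2 u hu v hv).trans (key' n h1 h2 u hu v hv).symm
  exact congrArg (fun S : V →L[ℂ] V => S v) this

/-- On `v`, the element `(x j)(-x -j)` of `K_n` allows `(x j)` to be replaced by `(-x -j)`. The flip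
`(j -j)` fixes `u` and `v` for large `j` and turns this into `(-x j)`. -/
theorem opA_neg (hρ : IsAdmissible ρ) {n : ℕ} {x : NZ} (hx : x ∉ window n) {v : V}
    (hv : v ∈ fixed ρ n) : opA ρ (-x) v = opA ρ x v := by
  refine opA_unique hρ fun m u hu => ?_
  refine ((opA_spec hρ x).1 u v).congr' ?_
  obtain ⟨a, ha⟩ := exists_mem_window x
  filter_upwards [eventually_ge_atTop (max (max m n) a)] with j hj
  simp only [max_le_iff] at hj
  obtain ⟨⟨hjm, hjn⟩, hja⟩ := hj
  have hxa := window_mono hja ha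
  have h1 : x ≠ posNZ j := by rintro rfl; simp at hxa
  have h2 : x ≠ -posNZ j := by rintro rfl; simp at hxa
  have e1 : ρ (transposition x (posNZ j)) v = ρ (transposition (-x) (-posNZ j)) v := by
    have hk : signedSwap x (posNZ j) ∈ K n := signedSwap_mem_K hx (by simpa)
    conv_lhs => rw [← hv _ hk, ← rho_mul, signedSwap, ← mul_assoc, transposition_mul_self, one_mul]
  have hf : transposition (posNZ j) (-posNZ j) ∈ K (max m n) := flip_mem_K (by simp; omega)
  have hf1 := K_mono (le_max_left m n) hf
  have hf2 := K_mono (le_max_right m n) hf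
  rw [e1, ← (ρ (transposition (posNZ j) (-posNZ j))).inner_map_map u, ← rho_mul,
    mul_transposition, rho_mul, hu _ hf1, hv _ hf2, transposition_right,
    transposition_of_ne (by rw [Ne, NZ.neg_eq_iff]; exact h2)
      (by rw [Ne, NZ.neg_inj']; exact h1)]

end OpA

/-! ### Star products and powers of `A_x` -/

section Star

/-- The product `(x y_1)(x y_2) ⋯ (x y_m)`, where `y_j = n + j`. -/
def starProd (x : NZ) (n : ℕ) : ℕ → G
  | 0 => 1
  | m + 1 => starProd x n m * transposition x (posNZ (n + m))

theorem suppIn_starProd {x : NZ} {n : ℕ} (hx : x ∈ window n) (m : ℕ) :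
    SuppIn (n + m) (starProd x n m) := by
  induction m with
  | zero => exact fun _ _ => rfl
  | succ m ih =>
    exact (ih.mono (by omega)).mul
      (suppIn_transposition (window_mono (by omega) hx) (by simp))

variable {V : Type*} [NormedAddCommGroup V] [InnerProductSpace ℂ V] [CompleteSpace V] {ρ : URep V}

/-- The last transposition has its outer point beyond the support of the other factors, so it can be
replaced by `A_x`, and `A_x` preserves `K_n`-invariance. -/
theorem inner_starProd (hρ : IsAdmissible ρ) {x : NZ} {n : ℕ} (hx : x ∈ window n) (m : ℕ)
    {u v : V} (hu : u ∈ fixed ρ n) (hv : v ∈ fixed ρ n) :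
    ⟪u, ρ (starProd x n m) v⟫_ℂ = ⟪u, (opA ρ x ^ m) v⟫_ℂ := by
  induction m generalizing v with
  | zero => simp [starProd]
  | succ m ih =>
    rw [starProd, rho_mul, inner_rho_right, (opA_spec hρ x).2 (n + m) (n + m)
      (window_mono (by omega) hx) le_rfl _
      ((suppIn_starProd hx m).inv.rho_mem_fixed (fixed_mono ρ (by omega) hu)) _
      (fixed_mono ρ (by omega) hv), ← inner_rho_right, ih (opA_mem_fixed hρ hx hv), pow_succ]
    rfl

end Star

/-! ### Central operators -/

section Central

variable {V : Type*} [NormedAddCommGroup V] [InnerProductSpace ℂ V] [CompleteSpace V] {ρ : URep V}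

theorem opA_pow_comm (hρ : IsAdmissible ρ) (x y : NZ) (m : ℕ) (v : V) :
    opA ρ x ((opA ρ y ^ m) v) = (opA ρ y ^ m) (opA ρ x v) := by
  induction m generalizing v with
  | zero => simp
  | succ m ih =>
    rw [pow_succ]
    change opA ρ x ((opA ρ y ^ m) (opA ρ y v)) = (opA ρ y ^ m) (opA ρ y (opA ρ x v))
    rw [ih, opA_comm hρ x y]

/-- The weak limits of `A_n ^ m` as `n → ∞` commute with `G`. -/
theorem exists_central (hρ : IsAdmissible ρ) (m : ℕ) : ∃ B : V →L[ℂ] V,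
    (∀ u v, ⟪B u, v⟫_ℂ = ⟪u, B v⟫_ℂ) ∧ (∀ g v, ρ g (B v) = B (ρ g v)) ∧
    ∀ n k, n ≤ k → ∀ u ∈ fixed ρ n, ∀ v ∈ fixed ρ n,
      ⟪u, (opA ρ (posNZ k) ^ m) v⟫_ℂ = ⟪u, B v⟫_ℂ := by
  obtain ⟨B, hB, hB'⟩ := exists_weakLimit_of_equivariant hρ
    (T := fun n => opA ρ (posNZ n) ^ m) (fun n v => norm_opA_pow_le hρ _ m v) 0
    (fun a b _ _ v => by
      rw [rho_opA_pow hρ, signedSwap_left (neg_posNZ_ne _ _ ·.symm)])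
  refine ⟨B, fun u v => ?_, fun g v => ?_, fun n k hk => hB' n k (Nat.zero_le _) hk⟩
  · have h2 := (hB v u).star
    have e : star ⟪v, B u⟫_ℂ = ⟪B u, v⟫_ℂ := inner_conj_symm _ _
    rw [← e]
    refine tendsto_nhds_unique h2 ((hB u v).congr fun n => ?_)
    rw [← inner_opA_pow_left hρ, ← inner_conj_symm]
    rfl
  · refine ext_inner_left ℂ fun u => ?_
    refine tendsto_nhds_unique ?_ (hB u (ρ g v))
    rw [inner_rho_right]
    refine (hB (ρ g⁻¹ u) v).congr' ?_
    obtain ⟨N, hN⟩ := exists_suppIn g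
    filter_upwards [eventually_ge_atTop N] with j hj
    rw [← inner_rho_right, rho_opA_pow hρ, hN _ (by simpa using hj)]

end Central

/-! ### Reduction of matrix coefficients to the window `{±1, …, ±d}` -/

section Semigroup

variable {V : Type*} [NormedAddCommGroup V] [InnerProductSpace ℂ V] [CompleteSpace V] {ρ : URep V}

/-- The vectors obtained from `R` by the operators `A_c`, `d < c ≤ N`. -/
inductive Mono (ρ : URep V) (R : Submodule ℂ V) (d N : ℕ) : V → Prop
  | base (v : V) (hv : v ∈ R) : Mono ρ R d N v
  | step (c : ℕ) (h1 : d ≤ c) (h2 : c < N) (v : V) (hv : Mono ρ R d N v) :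
      Mono ρ R d N (opA ρ (posNZ c) v)

variable {R : Submodule ℂ V} {d N : ℕ}

theorem Mono.mem_fixed (hρ : IsAdmissible ρ) (hR : R ≤ fixed ρ d) (hdN : d ≤ N) {v : V}
    (h : Mono ρ R d N v) : v ∈ fixed ρ N := by
  induction h with
  | base v hv => exact fixed_mono ρ hdN (hR hv)
  | step c h1 h2 v hv ih => exact opA_mem_fixed hρ (by simpa) ih

theorem Mono.opA_window (hρ : IsAdmissible ρ)
    (hA : ∀ x ∈ window d, ∀ r ∈ R, opA ρ x r ∈ R) {x : NZ} (hx : x ∈ window d) {v : V}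
    (h : Mono ρ R d N v) : Mono ρ R d N (opA ρ x v) := by
  induction h with
  | base v hv => exact .base _ (hA x hx v hv)
  | step c h1 h2 v hv ih =>
    rw [opA_comm hρ]
    exact .step c h1 h2 _ ih

theorem Mono.opA_neg (hρ : IsAdmissible ρ) (hR : R ≤ fixed ρ d) {x : NZ} (hx : x ∉ window d)
    {v : V} (h : Mono ρ R d N v) : opA ρ (-x) v = opA ρ x v := by
  induction h with
  | base v hv => exact Mixture.opA_neg hρ hx (hR hv)
  | step c h1 h2 v hv ih => rw [opA_comm hρ, ih, opA_comm hρ]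

theorem Mono.opA (hρ : IsAdmissible ρ) (hR : R ≤ fixed ρ d)
    (hA : ∀ x ∈ window d, ∀ r ∈ R, opA ρ x r ∈ R) {x : NZ} (hx : x ∈ window N) {v : V}
    (h : Mono ρ R d N v) : Mono ρ R d N (opA ρ x v) := by
  by_cases hxd : x ∈ window d
  · exact h.opA_window hρ hA hxd
  obtain ⟨c, rfl | rfl⟩ := posNZ_cases x
  · exact .step c (by simpa using hxd) (by simpa using hx) v h
  · rw [h.opA_neg hρ hR (by simpa using hxd)]
    exact .step c (by simpa using hxd) (by simpa using hx) v h

theorem Mono.opA_pow (hρ : IsAdmissible ρ) (hR : R ≤ fixed ρ d)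
    (hA : ∀ x ∈ window d, ∀ r ∈ R, Mixture.opA ρ x r ∈ R) {x : NZ} (hx : x ∈ window N) (m : ℕ)
    {v : V} (h : Mono ρ R d N v) : Mono ρ R d N ((Mixture.opA ρ x ^ m) v) := by
  induction m with
  | zero => simpa
  | succ m ih =>
    rw [pow_succ']
    exact ih.opA hρ hR hA hx

/-- The operators commute, so all factors with the largest index can be collected in front. -/
theorem Mono.exists_eq (hρ : IsAdmissible ρ) {M : ℕ} {v : V} (h : Mono ρ R d (M + 1) v) :
    ∃ (m : ℕ) (w : V), Mono ρ R d M w ∧ v = (Mixture.opA ρ (posNZ M) ^ m) w := by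
  induction h with
  | base v hv => exact ⟨0, v, .base v hv, by simp⟩
  | step c h1 h2 v hv ih =>
    obtain ⟨m, w, hw, rfl⟩ := ih
    rcases Nat.lt_succ_iff_lt_or_eq.1 h2 with h | rfl
    · exact ⟨m, _, hw.step c h1 h, by rw [opA_pow_comm hρ]⟩
    · exact ⟨m + 1, w, hw, by rw [pow_succ']; rfl⟩

/-- The flip exchanges `A_x` and `A_{-x}`, which agree on these vectors. -/
theorem Mono.flip (hρ : IsAdmissible ρ) (hR : R ≤ fixed ρ d) {x : NZ} (hx : x ∉ window d)
    {v : V} (h : Mono ρ R d N v) : ρ (transposition x (-x)) v = v := by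
  induction h with
  | base v hv => exact hR hv _ (flip_mem_K hx)
  | step c h1 h2 v hv ih =>
    rw [rho_opA hρ, ih, transposition_apply]
    split_ifs with h h'
    · rw [hv.opA_neg hρ hR hx, h]
    · rw [h', hv.opA_neg hρ hR hx]
    · rfl

/-- If there are no nonzero vectors of smaller depth, then vectors of `fixed ρ d` with a pair of
points of the window moved to infinity tend to zero. -/
theorem inner_eq_zero_of_cap (hρ : IsAdmissible ρ) (hdepth : ∀ n < d, fixed ρ n = ⊥) {M : ℕ}
    (hdM : d ≤ M) {g : G} (hg : SuppIn (M + 1) g) (h1 : g.1 (posNZ M) ∈ window d)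
    (h2 : g.1 (-posNZ M) ∈ window d) {r u : V} (hr : r ∈ fixed ρ d) (hu : u ∈ fixed ρ M) :
    ⟪r, ρ g u⟫_ℂ = 0 := by
  obtain ⟨e, rfl⟩ : ∃ e, d = e + 1 := by
    refine Nat.exists_eq_succ_of_ne_zero ?_
    rintro rfl
    rw [mem_window'] at h1
    have := (g.1 (posNZ M)).2
    omega
  set a := g.1 (posNZ M) with ha
  set a' := g.1 (-posNZ M) with ha'
  have haa' : a ≠ a' := fun h => (NZ.neg_ne (posNZ M)) (g.1.injective h).symm
  set b := posNZ e with hb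
  have hb1 : b ∈ window (e + 1) := by simp [hb]
  have hb2 : -b ∈ window (e + 1) := by simp [hb]
  -- A permutation of the window that carries the outermost pair `b, -b` to `a, a'`. It reduces the
  -- claim to the case where the pair sent to infinity is the outermost one.
  obtain ⟨σ, hσ, hσ1, hσ2⟩ : ∃ σ : G, SuppIn (e + 1) σ ∧ σ.1 b = a ∧ σ.1 (-b) = a' := by
    set τ := transposition b a with hτ
    have hτs : SuppIn (e + 1) τ := suppIn_transposition hb1 h1
    refine ⟨transposition (τ.1 (-b)) a' * τ,
      (suppIn_transposition (hτs.apply_mem.2 hb2) h2).mul hτs, ?_, ?_⟩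
    · rw [mul_apply', hτ, transposition_left, transposition_of_ne _ haa']
      intro h
      have : τ.1 (-b) = τ.1 b := by rw [← h, hτ, transposition_left]
      exact b.neg_ne (τ.1.injective this)
    · rw [mul_apply', transposition_left]
  have hr0 := hσ.inv.rho_mem_fixed hr
  set r0 := ρ σ⁻¹ r with hr0d
  have hrr : r = ρ σ r0 := by simp [hr0d]
  obtain ⟨S, hS, -⟩ := exists_weakLimit_of_equivariant hρ
    (T := fun n => rhoL ρ (signedSwap b (posNZ n))) (fun n v => ((ρ _).norm_map v).le) (e + 1)
    (fun m n hm hn v => by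
      have hk : signedSwap (posNZ m) (posNZ n) ∈ K (e + 1) :=
        signedSwap_mem_K (by simpa) (by simpa)
      simp only [rhoL_apply, ← rho_mul]
      congr 2
      rw [signedSwap.eq_1 b (posNZ m), mul_transposition_mul, hk.2 b hb1, hk.1, hk.1, hk.2 b hb1,
        signedSwap_left (neg_posNZ_ne _ _ ·.symm), signedSwap.eq_1 b (posNZ n)])
  -- The limit is `K_e`-invariant with `e < d`. Once `n` exceeds the support of `k`, conjugation by
  -- the swap of `b` and `posNZ n` puts `k` into `K_{e+1}`, which fixes `r0`.
  have hS0 : S r0 = 0 := by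
    have hmem : S r0 ∈ fixed ρ e := by
      intro k hk
      refine ext_inner_left ℂ fun w => ?_
      refine tendsto_nhds_unique ?_ (hS w r0)
      rw [inner_rho_right]
      refine (hS (ρ k⁻¹ w) r0).congr' ?_
      obtain ⟨N, hN⟩ := exists_suppIn k
      filter_upwards [eventually_ge_atTop (max N (e + 1))] with n hn
      simp only [max_le_iff] at hn
      simp only [rhoL_apply]
      rw [← inner_rho_right]
      have hks : (signedSwap b (posNZ n))⁻¹ * k * signedSwap b (posNZ n) ∈ K (e + 1) := by
        have hsw : signedSwap b (posNZ n) ∈ K e := signedSwap_mem_K (by simp [hb]) (by simp; omega)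
        have hmem := mul_mem (mul_mem (inv_mem hsw) hk) hsw
        refine ⟨hmem.1, fun x hx => ?_⟩
        have key : ((signedSwap b (posNZ n))⁻¹ * k * signedSwap b (posNZ n)).1 b = b := by
          rw [mul_apply', mul_apply', signedSwap_left (neg_posNZ_ne _ _ ·.symm),
            hN _ (by simp; omega)]
          have h := inv_apply_self' (signedSwap b (posNZ n)) b
          rwa [signedSwap_left (neg_posNZ_ne _ _ ·.symm)] at h
        rcases mem_window_succ.1 hx with hx | rfl | rfl
        · exact hmem.2 x hx
        · exact key
        · rw [hmem.1, ← hb, key]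
      have := hr0 _ hks
      rw [rho_mul, rho_mul] at this
      have := congrArg (ρ (signedSwap b (posNZ n))) this
      rw [rho_rho_inv] at this
      rw [this]
    rw [hdepth e (Nat.lt_succ_self e)] at hmem
    exact (Submodule.mem_bot ℂ).1 hmem
  have hlim : Tendsto (fun n => ⟪ρ σ⁻¹ (ρ g u), rhoL ρ (signedSwap b (posNZ n)) r0⟫_ℂ) atTop
      (𝓝 0) := by
    simpa [hS0] using hS (ρ σ⁻¹ (ρ g u)) r0
  -- Pulled back through `g`, the swap becomes `signedSwap (posNZ M) (posNZ n)`, an element of `K_M`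
  -- that fixes `u`. So the sequence is eventually constant, while it tends to zero.
  have hev : ∀ᶠ n in atTop, ⟪ρ σ⁻¹ (ρ g u), rhoL ρ (signedSwap b (posNZ n)) r0⟫_ℂ =
      ⟪ρ g u, r⟫_ℂ := by
    filter_upwards [eventually_ge_atTop (M + 1)] with n hn
    have hk : signedSwap (posNZ M) (posNZ n) ∈ K M :=
      signedSwap_mem_K (by simp) (by simp; omega)
    have hconj : σ * signedSwap b (posNZ n) * σ⁻¹ * g = g * signedSwap (posNZ M) (posNZ n) := by
      have e1 : σ * signedSwap b (posNZ n) = transposition a (posNZ n) *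
          transposition a' (-posNZ n) * σ := by
        rw [signedSwap, mul_transposition_mul, hσ1, hσ2,
          hσ (posNZ n) (by simp; omega), hσ (-posNZ n) (by simp; omega)]
      have e2 : g * signedSwap (posNZ M) (posNZ n) = transposition a (posNZ n) *
          transposition a' (-posNZ n) * g := by
        rw [signedSwap, mul_transposition_mul, ← ha, ← ha',
          hg (posNZ n) (by simp; omega), hg (-posNZ n) (by simp; omega)]
      rw [e1, e2, mul_inv_cancel_right]
    have hinv : (signedSwap b (posNZ n))⁻¹ = signedSwap b (posNZ n) := by
      have h1 : b ≠ -posNZ n := (neg_posNZ_ne _ _ ·.symm)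
      rw [signedSwap, mul_inv_rev, transposition_inv, transposition_inv,
        transposition_mul_comm b.neg_ne (fun h => h1 (NZ.neg_eq_iff.1 h))
        (fun h => h1 h.symm) (NZ.neg_ne _)]
    rw [rhoL_apply, inner_rho_right, hinv, hr0d, inner_rho_right, inv_inv, ← rho_mul, ← rho_mul,
      ← rho_mul, hconj, rho_mul, hu _ hk]
  have := tendsto_nhds_unique (tendsto_const_nhds.congr' (hev.mono fun n hn => hn.symm)) hlim
  rw [← inner_conj_symm, this, map_zero]

/-- Let `R` be a space of `K_d`-invariant vectors that is invariant under the permutations of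
`±1, …, ±d` and the operators `A_x`. If the central operators are scalars and there are no
nonzero vectors of depth less than `d`, then all `K_d`-invariant vectors that are orthogonal to `R`
are orthogonal to the cyclic span of `R`. -/
theorem inner_eq_zero_of_invariant (hρ : IsAdmissible ρ) (hdepth : ∀ n < d, fixed ρ n = ⊥)
    {β : ℕ → ℂ} (hβ : ∀ m, ∀ u ∈ fixed ρ d, ∀ v ∈ fixed ρ d,
      ⟪u, (opA ρ (posNZ d) ^ m) v⟫_ℂ = β m * ⟪u, v⟫_ℂ)
    (hR : R ≤ fixed ρ d) (hS : ∀ g, SuppIn d g → ∀ r ∈ R, ρ g r ∈ R)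
    (hA : ∀ x ∈ window d, ∀ r ∈ R, opA ρ x r ∈ R) {s : V} (hs : s ∈ fixed ρ d)
    (hsR : ∀ r ∈ R, ⟪s, r⟫_ℂ = 0) (g : G) {r : V} (hr : r ∈ R) : ⟪s, ρ g r⟫_ℂ = 0 := by
  -- The induction is on a window that contains the support of `g`. The claim must allow monomials
  -- in the operators `A_c`, because removing an outer point of `g` creates such operators.
  suffices key : ∀ N, d ≤ N → ∀ g, SuppIn N g → ∀ u, Mono ρ R d N u → ∀ s ∈ fixed ρ d,
      (∀ r ∈ R, ⟪s, r⟫_ℂ = 0) → ⟪s, ρ g u⟫_ℂ = 0 by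
    obtain ⟨N, hN⟩ := exists_suppIn g
    exact key (max d N) (le_max_left _ _) g (hN.mono (le_max_right _ _)) r (.base r hr) s hs hsR
  intro N hN
  induction N, hN using Nat.le_induction with
  | base =>
    intro g hg u hu s _ hsR
    refine hsR _ (hS g hg u ?_)
    cases hu with
    | base _ hv => exact hv
    | step c h1 h2 => omega
  | succ M hdM ih =>
    intro g hg u hu s hs hsR
    have hsA : ∀ x ∈ window d, ∀ m : ℕ, ∀ s ∈ fixed ρ d, (∀ r ∈ R, ⟪s, r⟫_ℂ = 0) →
        ∀ r ∈ R, ⟪(opA ρ x ^ m) s, r⟫_ℂ = 0 := by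
      intro x hx m s _ hsR r hr
      rw [inner_opA_pow_left hρ]
      refine hsR _ ?_
      induction m with
      | zero => simpa
      | succ m ihm =>
        rw [pow_succ']
        exact hA x hx _ ihm
    have hflip : ∀ u, Mono ρ R d (M + 1) u → ρ (transposition (posNZ M) (-posNZ M)) u = u :=
      fun u hu => hu.flip hρ hR (by simpa using hdM)
    have orth_of_fixes : ∀ g, SuppIn (M + 1) g → g.1 (-posNZ M) = -posNZ M → ⟪s, ρ g u⟫_ℂ = 0 := by
      intro g hg hge
      obtain ⟨m, w, hw, rfl⟩ := hu.exists_eq hρ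
      have hwM := hw.mem_fixed hρ hR hdM
      -- If `g` fixes both outer points, the power of the operator at `posNZ M` has the coefficients
      -- of a central operator `B`, and `B s = β m • s`.
      by_cases hb : g.1 (posNZ M) = posNZ M
      · have hgM : SuppIn M g := by
          intro x hx
          by_cases hx' : x ∈ window (M + 1)
          · rcases mem_window_succ.1 hx' with h | rfl | rfl
            · exact absurd h hx
            · exact hb
            · exact hge
          · exact hg x hx'
        obtain ⟨B, hB1, hB2, hB3⟩ := exists_central hρ m
        have hBs : B s = β m • s := by
          have hBmem : B s ∈ fixed ρ d := fun k hk => by rw [hB2, hs k hk]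
          have : ∀ u ∈ fixed ρ d, ⟪u, B s - β m • s⟫_ℂ = 0 := by
            intro u hu
            rw [inner_sub_right, ← hB3 d d le_rfl u hu s hs, hβ m u hu s hs, inner_smul_right,
              sub_self]
          have h0 := this _ (sub_mem hBmem ((fixed ρ d).smul_mem (β m) hs))
          exact sub_eq_zero.1 (inner_self_eq_zero.1 h0)
        rw [inner_rho_right, hB3 M M le_rfl _
          (hgM.inv.rho_mem_fixed (fixed_mono ρ hdM hs)) _ hwM, ← inner_rho_right, hB2, ← hB1, hBs,
          inner_smul_left, ih g hgM w hw s hs hsR, mul_zero]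
      -- Otherwise `g` is `h` times the transposition of `b` and `posNZ M`, with `h` supported in
      -- `window M`. Between `K_M`-invariant vectors this transposition has the coefficients of
      -- `A_b`.
      · set b := (g⁻¹).1 (posNZ M) with hbd
        have hgb : g.1 b = posNZ M := by simp [hbd]
        have hb1 : b ≠ posNZ M := fun h => hb (by rw [← h, hgb, h])
        have hb2 : b ≠ -posNZ M := fun h => by
          rw [h, hge] at hgb
          exact NZ.neg_ne _ hgb
        have hbM : b ∈ window M := by
          have : b ∈ window (M + 1) := hg.inv.apply_mem.2 (by simp)
          rcases mem_window_succ.1 this with h | h | h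
          · exact h
          · exact absurd h hb1
          · exact absurd h hb2
        set h := g * transposition b (posNZ M) with hh
        have hgh : g = h * transposition b (posNZ M) := by
          rw [hh, mul_assoc, transposition_mul_self, mul_one]
        have hhM : SuppIn M h := by
          intro x hx
          by_cases hx' : x ∈ window (M + 1)
          · rcases mem_window_succ.1 hx' with h | rfl | rfl
            · exact absurd h hx
            · rw [hh, mul_apply', transposition_right, hgb]
            · rw [hh, mul_apply', transposition_of_ne hb2.symm (NZ.neg_ne _), hge]
          · rw [hh]
            exact (hg.mul (suppIn_transposition (window_mono (by omega) hbM) (by simp))) x hx'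
        rw [hgh, rho_mul, rho_opA_pow hρ, transposition_right, inner_rho_right,
          ← inner_opA_pow_left hρ, (opA_spec hρ b).2 M M hbM le_rfl _
            (opA_pow_mem_fixed hρ hbM m (hhM.inv.rho_mem_fixed (fixed_mono ρ hdM hs))) _ hwM,
          inner_opA_pow_left hρ, ← inner_rho_right]
        exact ih h hhM _ ((hw.opA hρ hR hA hbM).opA_pow hρ hR hA hbM m) s hs hsR
    -- An element of `K_d` brings the image back to `-posNZ M` and fixes `s`.
    have orth_of_moves_out : ∀ g, SuppIn (M + 1) g → g.1 (-posNZ M) ∉ window d → ⟪s, ρ g u⟫_ℂ = 0 := by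
      intro g hg hy
      set y := g.1 (-posNZ M) with hyd
      have hyM : y ∈ window (M + 1) := hg.apply_mem.2 (by simp)
      have hMd : posNZ M ∉ window d := by simpa using hdM
      obtain ⟨k, hk, hkM, hky⟩ : ∃ k ∈ K d, SuppIn (M + 1) k ∧ k.1 y = -posNZ M := by
        by_cases h : y = posNZ M
        · exact ⟨_, flip_mem_K hMd, suppIn_transposition (by simp) (by simp), by
            rw [h, transposition_left]⟩
        · exact ⟨signedSwap y (-posNZ M), signedSwap_mem_K hy (by simpa using hdM),
            suppIn_signedSwap hyM (by simp), signedSwap_left (by simpa using h)⟩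
      have := orth_of_fixes (k * g) (hkM.mul hg) (by rw [mul_apply', ← hyd, hky])
      rw [rho_mul] at this
      rw [← (ρ k).inner_map_map, hs k hk, this]
    -- If both outer points are sent into the window of size `d`, the coefficient vanishes because
    -- there are no vectors of smaller depth. If only `posNZ M` is sent outside, the flip, which
    -- fixes `u`, exchanges the roles of the two points.
    by_cases h1 : g.1 (-posNZ M) ∈ window d
    · by_cases h2 : g.1 (posNZ M) ∈ window d
      · obtain ⟨m, w, hw, rfl⟩ := hu.exists_eq hρ
        rw [rho_opA_pow hρ, ← inner_opA_pow_left hρ]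
        exact inner_eq_zero_of_cap hρ hdepth hdM hg h2 h1 (opA_pow_mem_fixed hρ h2 m hs)
          (hw.mem_fixed hρ hR hdM)
      · have := orth_of_moves_out (g * transposition (posNZ M) (-posNZ M))
          (hg.mul (suppIn_transposition (by simp) (by simp)))
          (by rwa [mul_apply', transposition_right])
        rwa [rho_mul, hflip u hu] at this
    · exact orth_of_moves_out g hg h1

end Semigroup

/-! ### Subrepresentations, decomposition and Schur's lemma for the root -/

section Subreps

variable {V : Type*} [NormedAddCommGroup V] [InnerProductSpace ℂ V] {ρ : URep V}

/-- The orthogonal projection to a subspace commutes with operators that, together with their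
adjoints, preserve it. -/
theorem starProjection_comm {S : Submodule ℂ V} [S.HasOrthogonalProjection] {T T' : V → V}
    (hsub : ∀ u v, T (u - v) = T u - T v) (hadj : ∀ u v, ⟪T' u, v⟫_ℂ = ⟪u, T v⟫_ℂ)
    (hT : ∀ v ∈ S, T v ∈ S) (hT' : ∀ v ∈ S, T' v ∈ S) (v : V) :
    S.starProjection (T v) = T (S.starProjection v) := by
  refine Submodule.eq_starProjection_of_mem_orthogonal (hT _ (S.starProjection_apply_mem v)) ?_
  rw [← hsub, Submodule.mem_orthogonal]
  intro u hu
  rw [← hadj]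
  exact (Submodule.mem_orthogonal _ _).1 (S.sub_starProjection_mem_orthogonal v) _ (hT' u hu)

theorem subset_cyclicSpan (ρ : URep V) (S : Set V) : S ⊆ (cyclicSpan ρ S).carrier := fun v hv => by
  change v ∈ ⨅ W : {W : Subrep ρ // S ⊆ W.carrier}, W.1.carrier
  rw [Submodule.mem_iInf]
  exact fun W => W.2 hv

theorem cyclicSpan_le {S : Set V} {W : Subrep ρ} (h : S ⊆ W.carrier) :
    (cyclicSpan ρ S).carrier ≤ W.carrier := iInf_le (fun W : {W : Subrep ρ // S ⊆ W.carrier} =>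
      W.1.carrier) ⟨W, h⟩

/-- The orthogonal complement of a closed invariant subspace. -/
def Subrep.compl (W : Subrep ρ) : Subrep ρ where
  carrier := W.carrierᗮ
  isClosed := W.carrier.isClosed_orthogonal
  invariant g v hv := by
    rw [Submodule.mem_orthogonal] at hv ⊢
    intro u hu
    rw [inner_rho_right]
    exact hv _ (W.invariant _ _ hu)

/-- The intersection of two closed invariant subspaces. -/
def Subrep.inf (W W' : Subrep ρ) : Subrep ρ where
  carrier := W.carrier ⊓ W'.carrier
  isClosed := W.isClosed.inter W'.isClosed
  invariant g v hv := ⟨W.invariant g v hv.1, W'.invariant g v hv.2⟩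

/-- The largest closed invariant subspace in the orthogonal complement of a vector. -/
def annihilator (ρ : URep V) (s : V) : Subrep ρ where
  carrier :=
    { carrier := {v | ∀ g, ⟪s, ρ g v⟫_ℂ = 0}
      add_mem' := fun {a b} ha hb g => by rw [map_add, inner_add_right, ha, hb, add_zero]
      zero_mem' := fun g => by rw [map_zero, inner_zero_right]
      smul_mem' := fun c v hv g => by rw [map_smul, inner_smul_right, hv, mul_zero] }
  isClosed := by
    have : {v : V | ∀ g, ⟪s, ρ g v⟫_ℂ = 0} = ⋂ g, {v | ⟪s, ρ g v⟫_ℂ = 0} := by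
      ext; simp
    change IsClosed {v : V | ∀ g, ⟪s, ρ g v⟫_ℂ = 0}
    rw [this]
    exact isClosed_iInter fun g =>
      isClosed_eq (continuous_const.inner (ρ g).continuous) continuous_const
  invariant g v hv h := by
    rw [← rho_mul]
    exact hv _

/-- The image of a closed invariant subspace of a closed invariant subspace. -/
def Subrep.map (W : Subrep ρ) (U : Subrep W.rep) : Subrep ρ where
  carrier := U.carrier.map W.carrier.subtype
  isClosed := by
    rw [Submodule.map_coe]
    exact W.isClosed.isClosedMap_subtype_val _ U.isClosed
  invariant := by
    rintro g _ ⟨v, hv, rfl⟩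
    exact ⟨W.rep g v, U.invariant g v hv, rfl⟩

theorem Subrep.mem_fixed_rep (W : Subrep ρ) {n : ℕ} {v : W.carrier} :
    v ∈ fixed W.rep n ↔ (v : V) ∈ fixed ρ n := by
  constructor
  · exact fun h k hk => congrArg Subtype.val (h k hk)
  · exact fun h k hk => Subtype.ext (h k hk)

theorem Subrep.isIrreducible_rep (W : Subrep ρ) (hW : W.carrier ≠ ⊥)
    (h : ∀ U : Subrep ρ, U.carrier ≤ W.carrier → U.carrier = ⊥ ∨ U.carrier = W.carrier) :
    IsIrreducible W.rep := by
  refine ⟨Submodule.nontrivial_iff_ne_bot.2 hW, fun U => ?_⟩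
  rcases h (W.map U) (Submodule.map_subtype_le _ _) with h | h
  · left
    refine Submodule.map_injective_of_injective W.carrier.injective_subtype ?_
    rw [Submodule.map_bot]
    exact h
  · right
    refine Submodule.map_injective_of_injective W.carrier.injective_subtype ?_
    rw [Submodule.map_subtype_top]
    exact h

theorem mem_fixed_proj (W : Subrep ρ) [W.carrier.HasOrthogonalProjection] {n : ℕ} {v : V}
    (hv : v ∈ fixed ρ n) : W.carrier.starProjection v ∈ fixed ρ n := fun k hk => by
  rw [← starProjection_comm (T := ρ k) (T' := ρ k⁻¹) (fun _ _ => map_sub _ _ _)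
    (fun u v => by rw [inner_rho_left, inv_inv]) (W.invariant k) (W.invariant k⁻¹), hv k hk]

theorem Subrep.proj_rho (W : Subrep ρ) [W.carrier.HasOrthogonalProjection] (g : G) (v : V) :
    W.carrier.starProjection (ρ g v) = ρ g (W.carrier.starProjection v) :=
  starProjection_comm (T := ρ g) (T' := ρ g⁻¹) (fun _ _ => map_sub _ _ _)
    (fun u v => by rw [inner_rho_left, inv_inv]) (W.invariant g) (W.invariant g⁻¹) v

theorem depth_eq {d : ℕ} (hd : fixed ρ d ≠ ⊥) (hlt : ∀ n < d, fixed ρ n = ⊥) : depth ρ = d := by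
  refine le_antisymm (Nat.sInf_le hd) ?_
  by_contra! h
  exact Nat.sInf_mem (s := {n | fixed ρ n ≠ ⊥}) ⟨d, hd⟩ (hlt _ h)

theorem fixed_eq_bot_of_lt_depth {n : ℕ} (h : n < depth ρ) : fixed ρ n = ⊥ := by
  by_contra h'
  exact Nat.notMem_of_lt_sInf h h'

theorem root_ne_bot [Nontrivial V] (hρ : IsAdmissible ρ) : root ρ ≠ ⊥ := by
  have hne : {n | fixed ρ n ≠ ⊥}.Nonempty := by
    by_contra h
    rw [Set.not_nonempty_iff_eq_empty] at h
    have hb : ∀ n, fixed ρ n = ⊥ := fun n => by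
      by_contra hn
      exact (Set.eq_empty_iff_forall_notMem.1 h n) hn
    obtain ⟨v, hv⟩ := exists_ne (0 : V)
    refine hv (ext_of_admissible hρ fun n u hu => ?_)
    rw [hb n, Submodule.mem_bot] at hu
    simp [hu]
  exact Nat.sInf_mem hne

theorem Subrep.depth_rep {d : ℕ} (hlt : ∀ n < d, fixed ρ n = ⊥) (W : Subrep ρ)
    (hW : W.carrier ⊓ fixed ρ d ≠ ⊥) : depth W.rep = d := by
  refine depth_eq ?_ fun n hn => ?_
  · obtain ⟨v, hv, hv0⟩ := Submodule.exists_mem_ne_zero_of_ne_bot hW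
    intro h
    have : (⟨v, hv.1⟩ : W.carrier) ∈ fixed W.rep d := W.mem_fixed_rep.2 hv.2
    rw [h, Submodule.mem_bot] at this
    exact hv0 (congrArg Subtype.val this)
  · rw [Submodule.eq_bot_iff]
    intro v hv
    have := W.mem_fixed_rep.1 hv
    rw [hlt n hn, Submodule.mem_bot] at this
    exact Subtype.ext this

variable [CompleteSpace V]

instance instCompleteSubrep (W : Subrep ρ) : CompleteSpace W.carrier :=
  W.isClosed.completeSpace_coe

/-- A closed subspace is its own double orthogonal complement, hence closed under weak limits. -/
theorem Subrep.opA_mem (hρ : IsAdmissible ρ) (W : Subrep ρ) (x : NZ) {v : V}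
    (hv : v ∈ W.carrier) : opA ρ x v ∈ W.carrier := by
  rw [← Submodule.orthogonal_orthogonal W.carrier, Submodule.mem_orthogonal]
  intro u hu
  refine tendsto_nhds_unique ((opA_spec hρ x).1 u v) ?_
  refine tendsto_const_nhds.congr fun n => ?_
  rw [← inner_conj_symm, (Submodule.mem_orthogonal _ _).1 hu _ (W.invariant _ _ hv), map_zero]

theorem Subrep.proj_opA (hρ : IsAdmissible ρ) (W : Subrep ρ) (x : NZ) (v : V) :
    W.carrier.starProjection (opA ρ x v) = opA ρ x (W.carrier.starProjection v) :=
  starProjection_comm (T := opA ρ x) (T' := opA ρ x) (fun _ _ => map_sub _ _ _)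
    (fun u v => inner_opA_left hρ x u v) (fun _ => W.opA_mem hρ x) (fun _ => W.opA_mem hρ x) v

/-- The orthogonal projection commutes with `G`, so it maps the dense union of the spaces `fixed ρ
n` to a dense set of vectors of the same kind. -/
theorem Subrep.isAdmissible_rep (hρ : IsAdmissible ρ) (W : Subrep ρ) : IsAdmissible W.rep := by
  have h1 : DenseRange (W.carrier.orthogonalProjectionOnto) :=
    Function.Surjective.denseRange (fun v => ⟨v, by simp⟩)
  have h2 := h1.dense_image (W.carrier.orthogonalProjectionOnto).continuous hρ
  refine h2.mono ?_
  rintro _ ⟨v, hv, rfl⟩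
  obtain ⟨n, hn⟩ := Set.mem_iUnion.1 hv
  exact Set.mem_iUnion.2 ⟨n, W.mem_fixed_rep.2 (mem_fixed_proj W hn)⟩

theorem Subrep.coe_opA_rep (hρ : IsAdmissible ρ) (W : Subrep ρ) (x : NZ) (v : W.carrier) :
    (opA W.rep x v : V) = opA ρ x v := by
  have h := opA_unique (W.isAdmissible_rep hρ) (x := x) (v := v)
    (w := ⟨opA ρ x v, W.opA_mem hρ x v.2⟩) (fun n u _ => (opA_spec hρ x).1 (u : V) v)
  rw [h]

theorem Subrep.coe_opA_pow_rep (hρ : IsAdmissible ρ) (W : Subrep ρ) (x : NZ) (m : ℕ)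
    (v : W.carrier) : ((opA W.rep x ^ m) v : V) = (opA ρ x ^ m) v := by
  induction m generalizing v with
  | zero => simp
  | succ m ih =>
    rw [pow_succ, pow_succ]
    change (((opA W.rep x ^ m) (opA W.rep x v) : W.carrier) : V) = (opA ρ x ^ m) (opA ρ x v)
    rw [ih, W.coe_opA_rep hρ]

/-- The space of `K_d`-invariant vectors is cyclic. -/
def IsCyclicFixed (ρ : URep V) (d : ℕ) : Prop :=
  ∀ W : Subrep ρ, fixed ρ d ≤ W.carrier → W.carrier = ⊤

/-- The projection to `W` preserves `K_d`-invariance, so all `K_d`-invariant vectors are orthogonal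
to `W`. By cyclicity the complement of `W` is everything. -/
theorem IsCyclicFixed.eq_bot {d : ℕ} (hc : IsCyclicFixed ρ d) (W : Subrep ρ)
    (hW : W.carrier ⊓ fixed ρ d = ⊥) : W.carrier = ⊥ := by
  have h := hc W.compl fun v hv => by
    change v ∈ W.carrierᗮ
    have : W.carrier.starProjection v ∈ W.carrier ⊓ fixed ρ d :=
      ⟨W.carrier.starProjection_apply_mem v, mem_fixed_proj W hv⟩
    rw [hW, Submodule.mem_bot] at this
    have h2 := W.carrier.sub_starProjection_mem_orthogonal v
    rwa [this, sub_zero] at h2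
  exact (Submodule.orthogonal_eq_top_iff _).1 h

theorem Subrep.sup_compl (W W' : Subrep ρ) (h : W.carrier ≤ W'.carrier) :
    W.carrier ⊔ (W.compl.inf W').carrier = W'.carrier :=
  Submodule.sup_orthogonal_inf_of_hasOrthogonalProjection h

/-- If the space of `K_d`-invariant vectors is finite-dimensional and cyclic, then the
representation is a finite orthogonal direct sum of irreducible ones. -/
theorem exists_decomposition {d : ℕ} (hc : IsCyclicFixed ρ d) [FiniteDimensional ℂ (fixed ρ d)]
    (W : Subrep ρ) : ∃ (ι : Type) (F : ι → Subrep ρ),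
      (∀ j k, j ≠ k → (F j).carrier ⟂ (F k).carrier) ∧ (⨆ j, (F j).carrier) = W.carrier ∧
      ∀ j, IsIrreducible (F j).rep := by
  induction h : Module.finrank ℂ ↥(W.carrier ⊓ fixed ρ d) using Nat.strong_induction_on
    generalizing W with
  | _ n ih =>
  by_cases hW : W.carrier = ⊥
  · refine ⟨Empty, Empty.elim, fun j => j.elim, ?_, fun j => j.elim⟩
    rw [hW, iSup_of_empty]
  have hfin : ∀ U : Subrep ρ, FiniteDimensional ℂ ↥(U.carrier ⊓ fixed ρ d) := fun U =>
    Submodule.finiteDimensional_of_le (inf_le_right : _ ≤ fixed ρ d)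
  -- A nonzero subrepresentation whose space of `K_d`-invariant vectors has the least dimension is
  -- irreducible. Its complement in `W` has a smaller space of such vectors, and the induction
  -- continues there.
  have hex : ∃ m, ∃ U : Subrep ρ, U.carrier ≤ W.carrier ∧ U.carrier ≠ ⊥ ∧
      Module.finrank ℂ ↥(U.carrier ⊓ fixed ρ d) = m := ⟨_, W, le_rfl, hW, rfl⟩
  classical
  obtain ⟨U, hUW, hU, hUm⟩ := Nat.find_spec hex
  have hmin : ∀ U' : Subrep ρ, U'.carrier ≤ W.carrier → U'.carrier ≠ ⊥ →
      Module.finrank ℂ ↥(U.carrier ⊓ fixed ρ d) ≤ Module.finrank ℂ ↥(U'.carrier ⊓ fixed ρ d) :=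
    fun U' h1 h2 => by rw [hUm]; exact Nat.find_min' hex ⟨U', h1, h2, rfl⟩
  have hUirr : IsIrreducible U.rep := by
    refine U.isIrreducible_rep hU fun U' hU' => ?_
    by_cases hb : U'.carrier = ⊥
    · exact Or.inl hb
    right
    have hle : U'.carrier ⊓ fixed ρ d ≤ U.carrier ⊓ fixed ρ d := inf_le_inf_right _ hU'
    have := hfin U
    have heq := Submodule.eq_of_le_of_finrank_le hle (hmin U' (hU'.trans hUW) hb)
    have hz : (U'.compl.inf U).carrier = ⊥ := by
      refine hc.eq_bot _ ?_
      rw [Submodule.eq_bot_iff]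
      rintro v ⟨⟨h1, h2⟩, h3⟩
      have h4 : v ∈ U'.carrier ⊓ fixed ρ d := by rw [heq]; exact ⟨h2, h3⟩
      exact inner_self_eq_zero.1 ((Submodule.mem_orthogonal _ _).1 h1 v h4.1)
    have := U'.sup_compl U hU'
    rwa [hz, sup_bot_eq] at this
  have hlt : Module.finrank ℂ ↥((U.compl.inf W).carrier ⊓ fixed ρ d) < n := by
    rw [← h]
    have := hfin W
    refine Submodule.finrank_lt_finrank_of_lt (lt_of_le_of_ne
      (inf_le_inf_right _ inf_le_right) fun heq => ?_)
    have hne : U.carrier ⊓ fixed ρ d ≠ ⊥ := fun hb => hU (hc.eq_bot U hb)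
    obtain ⟨v, hv, hv0⟩ := Submodule.exists_mem_ne_zero_of_ne_bot hne
    have h1 : v ∈ (U.compl.inf W).carrier ⊓ fixed ρ d := by
      rw [heq]
      exact ⟨hUW hv.1, hv.2⟩
    exact hv0 (inner_self_eq_zero.1 ((Submodule.mem_orthogonal _ _).1 h1.1.1 v hv.1))
  obtain ⟨ι, F, h1, h2, h3⟩ := ih _ hlt (U.compl.inf W) rfl
  have horth : ∀ j, U.carrier ⟂ (F j).carrier := fun j => by
    refine (Submodule.isOrtho_orthogonal_right U.carrier).mono_right ?_
    refine (le_iSup (fun j => (F j).carrier) j).trans ?_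
    rw [h2]
    exact inf_le_left
  refine ⟨Option ι, fun o => o.elim U F, ?_, ?_, ?_⟩
  · rintro (_ | j) (_ | k) hjk
    · exact absurd rfl hjk
    · exact horth k
    · exact (horth j).symm
    · exact h1 j k fun h => hjk (h ▸ rfl)
  · rw [iSup_option]
    change U.carrier ⊔ ⨆ b, (F b).carrier = _
    rw [h2]
    exact U.sup_compl W hUW
  · rintro (_ | j)
    · exact hUirr
    · exact h3 j

/-- A `K_d`-invariant vector `s` orthogonal to `R` is orthogonal to all translates of `R`. Its
annihilator is then a subrepresentation containing `R`, hence everything, and `s = 0`. -/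
theorem IsIrreducible.invariant_eq (hirr : IsIrreducible ρ) (hρ : IsAdmissible ρ) {d : ℕ}
    (hdepth : ∀ n < d, fixed ρ n = ⊥)
    {β : ℕ → ℂ} (hβ : ∀ m, ∀ u ∈ fixed ρ d, ∀ v ∈ fixed ρ d,
      ⟪u, (opA ρ (posNZ d) ^ m) v⟫_ℂ = β m * ⟪u, v⟫_ℂ) [FiniteDimensional ℂ (fixed ρ d)]
    {R : Submodule ℂ V}
    (hR : R ≤ fixed ρ d) (hS : ∀ g, SuppIn d g → ∀ r ∈ R, ρ g r ∈ R)
    (hA : ∀ x ∈ window d, ∀ r ∈ R, opA ρ x r ∈ R) : R = ⊥ ∨ R = fixed ρ d := by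
  by_cases hb : R = ⊥
  · exact Or.inl hb
  right
  have := Submodule.finiteDimensional_of_le hR
  have h0 : Rᗮ ⊓ fixed ρ d = ⊥ := by
    rw [Submodule.eq_bot_iff]
    rintro s ⟨hs, hsd⟩
    have hle : R ≤ (annihilator ρ s).carrier := fun r hr g =>
      inner_eq_zero_of_invariant hρ hdepth hβ hR hS hA hsd
        (fun r hr => by rw [← inner_conj_symm, (Submodule.mem_orthogonal _ _).1 hs r hr, map_zero])
        g hr
    rcases hirr.2 (annihilator ρ s) with h | h
    · rw [h, le_bot_iff] at hle
      exact absurd hle hb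
    · have : s ∈ (annihilator ρ s).carrier := by rw [h]; trivial
      have := this 1
      rw [rho_one] at this
      exact inner_self_eq_zero.1 this
  have := Submodule.sup_orthogonal_inf_of_hasOrthogonalProjection hR
  rwa [h0, sup_bot_eq] at this

/-- Schur's lemma for the root. -/
theorem IsIrreducible.form_eq (hirr : IsIrreducible ρ) (hρ : IsAdmissible ρ) {d : ℕ}
    (hdepth : ∀ n < d, fixed ρ n = ⊥)
    {β : ℕ → ℂ} (hβ : ∀ m, ∀ u ∈ fixed ρ d, ∀ v ∈ fixed ρ d,
      ⟪u, (opA ρ (posNZ d) ^ m) v⟫_ℂ = β m * ⟪u, v⟫_ℂ) [FiniteDimensional ℂ (fixed ρ d)]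
    (hne : fixed ρ d ≠ ⊥)
    (B : V →ₗ⋆[ℂ] V →ₗ[ℂ] ℂ)
    (hS : ∀ g, SuppIn d g → ∀ u ∈ fixed ρ d, ∀ v ∈ fixed ρ d, B u (ρ g v) = B (ρ g⁻¹ u) v)
    (hA : ∀ x ∈ window d, ∀ u ∈ fixed ρ d, ∀ v ∈ fixed ρ d, B u (opA ρ x v) = B (opA ρ x u) v) :
    ∃ c : ℂ, ∀ u ∈ fixed ρ d, ∀ v ∈ fixed ρ d, B u v = c * ⟪u, v⟫_ℂ := by
  let b := stdOrthonormalBasis ℂ (fixed ρ d)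
  -- `T` is the operator that represents the form. An eigenspace of `T` is invariant under the
  -- permutations and the `A_x`, hence is the whole space.
  let T : fixed ρ d →ₗ[ℂ] fixed ρ d := ∑ k, ((B (b k)).comp (fixed ρ d).subtype).smulRight (b k)
  have hT : ∀ u v : fixed ρ d, B u v = ⟪u, T v⟫_ℂ := by
    intro u v
    conv_lhs => rw [← b.sum_repr' u]
    simp only [T, LinearMap.sum_apply, LinearMap.smulRight_apply, LinearMap.comp_apply,
      Submodule.subtype_apply, inner_sum, inner_smul_right, Submodule.coe_sum, map_sum,
      Submodule.coe_smul, LinearMap.map_smulₛₗ, LinearMap.smul_apply, smul_eq_mul, inner_conj_symm]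
    exact Finset.sum_congr rfl fun k _ => mul_comm _ _
  have hnt : Nontrivial (fixed ρ d) := Submodule.nontrivial_iff_ne_bot.2 hne
  obtain ⟨c, hc⟩ := Module.End.exists_eigenvalue T
  have hmem : ∀ {v : fixed ρ d}, v ∈ Module.End.eigenspace T c ↔
      ∀ u ∈ fixed ρ d, B u v = c * ⟪u, v⟫_ℂ := by
    intro v
    rw [Module.End.mem_eigenspace_iff]
    constructor
    · intro h u hu
      rw [hT ⟨u, hu⟩ v, h, inner_smul_right]
      rfl
    · intro h
      refine ext_inner_left ℂ fun u => ?_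
      rw [← hT, inner_smul_right, h u u.2]
      rfl
  have hex := hirr.invariant_eq hρ hdepth hβ
    (R := (Module.End.eigenspace T c).map (fixed ρ d).subtype) (Submodule.map_subtype_le _ _)
    (by
      rintro g hg _ ⟨v, hv, rfl⟩
      have hgv := hg.rho_mem_fixed v.2
      refine ⟨⟨_, hgv⟩, hmem.2 fun u hu => ?_, rfl⟩
      have := hmem.1 hv _ (hg.inv.rho_mem_fixed hu)
      change B u (ρ g v) = c * ⟪u, ρ g v⟫_ℂ
      rw [hS g hg u hu v v.2, this, inner_rho_right])
    (by
      rintro x hx _ ⟨v, hv, rfl⟩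
      refine ⟨⟨_, opA_mem_fixed hρ hx v.2⟩, hmem.2 fun u hu => ?_, rfl⟩
      have := hmem.1 hv _ (opA_mem_fixed hρ hx hu)
      change B u (opA ρ x v) = c * ⟪u, opA ρ x v⟫_ℂ
      rw [hA x hx u hu v v.2, this, inner_opA_left hρ])
  rcases hex with h | h
  · rw [← Submodule.map_bot (fixed ρ d).subtype] at h
    exact absurd (Submodule.map_injective_of_injective (fixed ρ d).injective_subtype h) hc
  · refine ⟨c, fun u hu v hv => ?_⟩
    have : v ∈ (Module.End.eigenspace T c).map (fixed ρ d).subtype := by rwa [h]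
    obtain ⟨v', hv', rfl⟩ := this
    exact hmem.1 hv' u hu

end Subreps

/-! ### The group of finitely supported families -/

section GFamilies

instance instMulGFamily : Mul GFamily := ⟨fun a b => ⟨a.1 * b.1, by
  refine (a.2.union b.2).subset fun i hi => ?_
  by_contra h
  simp only [Set.mem_union, Function.mem_mulSupport, not_or, not_not] at h
  exact hi (by simp [h.1, h.2])⟩⟩

instance instOneGFamily : One GFamily := ⟨⟨1, by simp⟩⟩

instance instInvGFamily : Inv GFamily := ⟨fun a => ⟨a.1⁻¹, by
  rw [Function.mulSupport_inv]
  exact a.2⟩⟩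

@[simp] theorem GFamily.mul_val (a b : GFamily) (i : ℕ) : (a * b).1 i = a.1 i * b.1 i := rfl

@[simp] theorem GFamily.one_val (i : ℕ) : (1 : GFamily).1 i = 1 := rfl

theorem GFamily.ext' {a b : GFamily} (h : ∀ i, a.1 i = b.1 i) : a = b := Subtype.ext (funext h)

instance instGroupGFamily : Group GFamily :=
  Group.ofLeftAxioms (fun a b c => GFamily.ext' fun i => mul_assoc _ _ _)
    (fun a => GFamily.ext' fun i => one_mul _) (fun a => GFamily.ext' fun i => inv_mul_cancel _)

/-- The family with component `g` at the place `i`. -/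
def singleG (i : ℕ) : G →* GFamily where
  toFun g := ⟨Pi.mulSingle i g, (Set.finite_singleton i).subset (by
    intro j hj
    by_contra h
    exact hj (Pi.mulSingle_eq_of_ne (M := fun _ : ℕ => G) h g))⟩
  map_one' := GFamily.ext' fun j => by simp
  map_mul' g h := GFamily.ext' fun j => by simp [Pi.mulSingle_mul]

theorem singleG_same (i : ℕ) (g : G) : (singleG i g).1 i = g :=
  Pi.mulSingle_eq_same (M := fun _ : ℕ => G) i g

theorem singleG_ne {i j : ℕ} (h : j ≠ i) (g : G) : (singleG i g).1 j = 1 :=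
  Pi.mulSingle_eq_of_ne (M := fun _ : ℕ => G) h g

end GFamilies

/-! ### Operators and invariant vectors in the infinite tensor product -/

section Tensor

variable {H : ℕ → Type*} [∀ i, NormedAddCommGroup (H i)] [∀ i, InnerProductSpace ℂ (H i)]
  {ξ : ∀ i, Metric.sphere (0 : H i) 1}

theorem dense_span_tprod :
    (Submodule.span ℂ (Set.range (tprod (ξ := ξ)))).topologicalClosure = ⊤ := by
  rw [eq_top_iff]
  rintro u -
  induction u using UniformSpace.Completion.induction_on with
  | hp => exact (Submodule.span ℂ (Set.range (tprod (ξ := ξ)))).isClosed_topologicalClosure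
  | ih a =>
    refine Submodule.le_topologicalClosure _ ?_
    induction a using Finsupp.induction_linear with
    | zero => exact (UniformSpace.Completion.coe_zero (α := PreTensor ξ)) ▸ Submodule.zero_mem _
    | add f g hf hg => exact (UniformSpace.Completion.coe_add (α := PreTensor ξ) f g) ▸
        Submodule.add_mem _ hf hg
    | single v s =>
      have h : ((Finsupp.single v s : PreTensor ξ) : InfTensor ξ) = s • tprod v := by
        unfold tprod
        rw [← UniformSpace.Completion.coe_smul]
        congr 1
        exact (Finsupp.smul_single_one v s).symm
      rw [h]
      exact Submodule.smul_mem _ _ (Submodule.subset_span ⟨v, rfl⟩)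

theorem ext_tprod {a b : InfTensor ξ} (h : ∀ v, ⟪tprod v, a⟫_ℂ = ⟪tprod v, b⟫_ℂ) : a = b := by
  have h1 : a - b ∈ (Submodule.span ℂ (Set.range (tprod (ξ := ξ))))ᗮ := by
    rw [Submodule.mem_orthogonal]
    intro u hu
    induction hu using Submodule.span_induction with
    | mem x hx =>
      obtain ⟨v, rfl⟩ := hx
      rw [inner_sub_right, h, sub_self]
    | zero => exact inner_zero_left _
    | add x y _ _ hx hy => rw [inner_add_left, hx, hy, add_zero]
    | smul c x _ hx => rw [inner_smul_left, hx, mul_zero]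
  rw [← Submodule.orthogonal_closure, dense_span_tprod, Submodule.top_orthogonal_eq_bot,
    Submodule.mem_bot, sub_eq_zero] at h1
  exact h1

theorem ext_tprod_map {S T : InfTensor ξ → InfTensor ξ} (hS : Continuous S) (hT : Continuous T)
    (hS' : IsLinearMap ℂ S) (hT' : IsLinearMap ℂ T) (h : ∀ v, S (tprod v) = T (tprod v)) :
    S = T := by
  have h1 : Dense (Submodule.span ℂ (Set.range (tprod (ξ := ξ))) : Set (InfTensor ξ)) := by
    rw [← Submodule.dense_iff_topologicalClosure_eq_top.symm]
    exact dense_span_tprod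
  refine hS.ext_on h1 hT fun u hu => ?_
  have : Set.EqOn (hS'.mk' S) (hT'.mk' T) (Submodule.span ℂ (Set.range (tprod (ξ := ξ)))) :=
    LinearMap.eqOn_span (by rintro _ ⟨v, rfl⟩; exact h v)
  exact this hu

variable (π : ∀ i, URep (H i))

theorem continuous_tensorAct (γ : GFamily) : Continuous (tensorAct (ξ := ξ) π γ) :=
  UniformSpace.Completion.continuous_map

theorem isLinearMap_tensorAct (γ : GFamily) : IsLinearMap ℂ (tensorAct (ξ := ξ) π γ) := by
  have hc := continuous_tensorAct (ξ := ξ) π γ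
  have he : ∀ a : PreTensor ξ, tensorAct π γ (a : InfTensor ξ) = ((preAct π γ a : PreTensor ξ) :
      InfTensor ξ) := fun a =>
    UniformSpace.Completion.map_coe (preAct π γ).isometry.uniformContinuous a
  refine ⟨fun u v => ?_, fun c u => ?_⟩
  · induction u, v using UniformSpace.Completion.induction_on₂ with
    | hp =>
      exact isClosed_eq (hc.comp continuous_add)
        ((hc.comp continuous_fst).add (hc.comp continuous_snd))
    | ih a b => rw [← UniformSpace.Completion.coe_add, he, he, he, map_add,
        UniformSpace.Completion.coe_add]
  · induction u using UniformSpace.Completion.induction_on with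
    | hp =>
      exact isClosed_eq (hc.comp (continuous_const_smul c)) (hc.const_smul c)
    | ih a => rw [← UniformSpace.Completion.coe_smul, he, he, map_smul,
        UniformSpace.Completion.coe_smul]

theorem norm_tensorAct (γ : GFamily) (u : InfTensor ξ) : ‖tensorAct π γ u‖ = ‖u‖ := by
  have hc := continuous_tensorAct (ξ := ξ) π γ
  induction u using UniformSpace.Completion.induction_on with
  | hp => exact isClosed_eq (by fun_prop) (by fun_prop)
  | ih a =>
    have he : tensorAct π γ (a : InfTensor ξ) = ((preAct π γ a : PreTensor ξ) :
      InfTensor ξ) := UniformSpace.Completion.map_coe (preAct π γ).isometry.uniformContinuous a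
    rw [he, UniformSpace.Completion.norm_coe, UniformSpace.Completion.norm_coe]
    exact (preAct π γ).norm_map a

theorem Family.act_mul (γ δ : GFamily) (v : Family ξ) :
    Family.act π (γ * δ) v = Family.act π γ (Family.act π δ v) :=
  Subtype.ext (funext fun i => by simp [Family.act])

theorem Family.act_one (v : Family ξ) : Family.act π 1 v = v :=
  Subtype.ext (funext fun i => by simp [Family.act])

theorem tensorAct_mul (γ δ : GFamily) (u : InfTensor ξ) :
    tensorAct π (γ * δ) u = tensorAct π γ (tensorAct π δ u) := by
  have h := ext_tprod_map (ξ := ξ) (S := tensorAct π (γ * δ))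
    (T := fun u => tensorAct π γ (tensorAct π δ u)) (continuous_tensorAct π _)
    ((continuous_tensorAct π γ).comp (continuous_tensorAct π δ)) (isLinearMap_tensorAct π _)
    ⟨fun a b => by rw [(isLinearMap_tensorAct π δ).map_add, (isLinearMap_tensorAct π γ).map_add],
      fun a b => by rw [(isLinearMap_tensorAct π δ).map_smul,
        (isLinearMap_tensorAct π γ).map_smul]⟩
    (fun v => by simp only [tensorAct_tprod, Family.act_mul])
  exact congrFun h u

theorem tensorAct_one (u : InfTensor ξ) : tensorAct π 1 u = u := by
  have h := ext_tprod_map (ξ := ξ) (S := tensorAct π 1) (T := id) (continuous_tensorAct π _)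
    continuous_id (isLinearMap_tensorAct π _) ⟨fun _ _ => rfl, fun _ _ => rfl⟩
    (fun v => by rw [tensorAct_tprod, Family.act_one]; rfl)
  exact congrFun h u

/-- The unitary representation of the group of families in the infinite tensor product. -/
def tensorRep : GFamily →* (InfTensor ξ ≃ₗᵢ[ℂ] InfTensor ξ) where
  toFun γ :=
    { toFun := tensorAct π γ
      invFun := tensorAct π γ⁻¹
      map_add' := (isLinearMap_tensorAct π γ).map_add
      map_smul' := (isLinearMap_tensorAct π γ).map_smul
      left_inv := fun u => by rw [← tensorAct_mul, inv_mul_cancel, tensorAct_one]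
      right_inv := fun u => by rw [← tensorAct_mul, mul_inv_cancel, tensorAct_one]
      norm_map' := norm_tensorAct π γ }
  map_one' := by ext u; exact tensorAct_one π u
  map_mul' γ δ := by ext u; exact tensorAct_mul π γ δ u

/-- The representation of `G` in the infinite tensor product that acts at the place `i`. -/
def placeRep (ξ : ∀ i, Metric.sphere (0 : H i) 1) (i : ℕ) : URep (InfTensor ξ) :=
  (tensorRep π).comp (singleG i)

theorem placeRep_apply (i : ℕ) (g : G) (u : InfTensor ξ) :
    placeRep π ξ i g u = tensorAct π (singleG i g) u := rfl

/-- Replacement of the vector at the place `i`. -/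
def Family.update (v : Family ξ) (i : ℕ) (a : H i) : Family ξ :=
  ⟨Function.update v.1 i a, by
    refine (v.2.union (Set.finite_singleton i)).subset fun j hj => ?_
    by_contra h
    simp only [Set.mem_union, Set.mem_ofPred_eq, Set.mem_singleton_iff, not_or, not_not] at h
    exact hj (by rw [Function.update_of_ne h.2, h.1])⟩

theorem Family.ext' {v w : Family ξ} (h : ∀ i, v.1 i = w.1 i) : v = w := Subtype.ext (funext h)

@[simp] theorem Family.update_same (v : Family ξ) (i : ℕ) (a : H i) : (v.update i a).1 i = a :=
  Function.update_self _ _ _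

theorem Family.update_ne (v : Family ξ) {i j : ℕ} (h : j ≠ i) (a : H i) :
    (v.update i a).1 j = v.1 j := Function.update_of_ne h _ _

@[simp] theorem Family.update_eq_self (v : Family ξ) (i : ℕ) : v.update i (v.1 i) = v :=
  Subtype.ext (Function.update_eq_self _ _)

theorem inner_tprod_eq (v w : Family ξ) (i : ℕ) :
    ⟪tprod v, tprod w⟫_ℂ = ⟪v.1 i, w.1 i⟫_ℂ * ∏ᶠ (j) (_ : j ≠ i), ⟪v.1 j, w.1 j⟫_ℂ := by
  rw [inner_tprod]
  have hfin : (Function.mulSupport fun j => ⟪v.1 j, w.1 j⟫_ℂ).Finite := by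
    refine (v.2.union w.2).subset fun j hj => ?_
    by_contra h
    simp only [Set.mem_union, Set.mem_ofPred_eq, not_or, not_not] at h
    exact hj (Family.inner_eq_one v w j h.1 h.2)
  rw [← finprod_mem_mul_sdiff' (f := fun j => ⟪v.1 j, w.1 j⟫_ℂ) (s := {i}) (t := Set.univ)
    (Set.subset_univ _) (hfin.subset Set.inter_subset_right) |>.trans (finprod_mem_univ _)]
  rw [finprod_mem_singleton]
  congr 1
  exact finprod_mem_congr (by ext j; simp; rfl) fun _ _ => rfl

theorem inner_tprod_update (v w : Family ξ) (i : ℕ) (a : H i) :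
    ⟪tprod v, tprod (w.update i a)⟫_ℂ =
      ⟪v.1 i, a⟫_ℂ * ∏ᶠ (j) (_ : j ≠ i), ⟪v.1 j, w.1 j⟫_ℂ := by
  rw [inner_tprod_eq _ _ i, Family.update_same]
  congr 1
  exact finprod_mem_congr rfl fun j hj => by rw [Family.update_ne _ hj]

/-- The tensor `⨂ v j` as a function of the vector at the place `i`. -/
def tprodAt (v : Family ξ) (i : ℕ) : H i →L[ℂ] InfTensor ξ :=
  LinearMap.mkContinuous
    { toFun := fun a => tprod (v.update i a)
      map_add' := fun a b => ext_tprod fun w => by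
        simp only [inner_add_right, inner_tprod_update, add_mul]
      map_smul' := fun c a => ext_tprod fun w => by
        simp only [inner_smul_right, inner_tprod_update, RingHom.id_apply, mul_assoc] }
    -- The constant is the norm of the tensor formed by the factors at the other places.
    (√‖∏ᶠ (j) (_ : j ≠ i), ⟪v.1 j, v.1 j⟫_ℂ‖) (fun a => by
      have h := congrArg norm (inner_tprod_update (v.update i a) v i a)
      rw [norm_mul, Family.update_same, inner_self_eq_norm_sq_to_K, inner_self_eq_norm_sq_to_K]
        at h
      simp only [Complex.coe_algebraMap, norm_pow, Complex.norm_real, norm_norm] at h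
      have h2 : ∏ᶠ (j) (_ : j ≠ i), ⟪(v.update i a).1 j, v.1 j⟫_ℂ =
          ∏ᶠ (j) (_ : j ≠ i), ⟪v.1 j, v.1 j⟫_ℂ :=
        finprod_mem_congr rfl fun j hj => by rw [Family.update_ne _ hj]
      rw [h2] at h
      refine abs_le_of_sq_le_sq' ?_ (by positivity) |>.2
      rw [mul_pow, Real.sq_sqrt (norm_nonneg _), mul_comm]
      exact h.le)

theorem tprodAt_apply (v : Family ξ) (i : ℕ) (a : H i) :
    tprodAt v i a = tprod (v.update i a) := rfl

theorem tprodAt_self (v : Family ξ) (i : ℕ) : tprodAt v i (v.1 i) = tprod v := by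
  rw [tprodAt_apply, Family.update_eq_self]

theorem placeRep_tprodAt (v : Family ξ) (i : ℕ) (g : G) (a : H i) :
    placeRep π ξ i g (tprodAt v i a) = tprodAt v i (π i g a) := by
  rw [placeRep_apply, tprodAt_apply, tprodAt_apply, tensorAct_tprod]
  congr 1
  refine Family.ext' fun j => ?_
  by_cases h : j = i
  · subst h
    rw [Family.update_same]
    change π j ((singleG j g).1 j) _ = _
    rw [singleG_same, Family.update_same]
  · rw [Family.update_ne _ h]
    change π j ((singleG i g).1 j) _ = _
    rw [singleG_ne h, Family.update_ne _ h, rho_one]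

variable {π}

theorem tprodAt_mem_fixed (v : Family ξ) (i : ℕ) {n : ℕ} {a : H i} (ha : a ∈ fixed (π i) n) :
    tprodAt v i a ∈ fixed (placeRep π ξ i) n := fun k hk => by
  rw [placeRep_tprodAt, ha k hk]

theorem isAdmissible_placeRep {i : ℕ} (h : IsAdmissible (π i)) :
    IsAdmissible (placeRep π ξ i) := by
  have hdir : Directed (· ≤ ·) (fixed (placeRep π ξ i)) := fun a b =>
    ⟨max a b, fixed_mono _ (le_max_left _ _), fixed_mono _ (le_max_right _ _)⟩
  have hU : (⋃ n, (fixed (placeRep π ξ i) n : Set (InfTensor ξ))) =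
      ((⨆ n, fixed (placeRep π ξ i) n : Submodule ℂ (InfTensor ξ)) : Set (InfTensor ξ)) :=
    (Submodule.coe_iSup_of_directed _ hdir).symm
  unfold IsAdmissible
  rw [hU, Submodule.dense_iff_topologicalClosure_eq_top, eq_top_iff, ← dense_span_tprod]
  refine Submodule.topologicalClosure_minimal _ ?_ (Submodule.isClosed_topologicalClosure _)
  rw [Submodule.span_le]
  rintro _ ⟨v, rfl⟩
  rw [← tprodAt_self v i]
  have h1 : v.1 i ∈ closure (⋃ n, (fixed (π i) n : Set (H i))) := h _
  have h2 := map_mem_closure (tprodAt v i).continuous h1 (t := ((⨆ n, fixed (placeRep π ξ i) n :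
    Submodule ℂ (InfTensor ξ)) : Set (InfTensor ξ))) (by
      intro a ha
      obtain ⟨n, hn⟩ := Set.mem_iUnion.1 ha
      exact Submodule.mem_iSup_of_mem n (tprodAt_mem_fixed v i hn))
  exact h2

variable [∀ i, CompleteSpace (H i)]

theorem opA_placeRep_tprodAt {i : ℕ} (h : IsAdmissible (π i)) (v : Family ξ) (x : NZ) (a : H i) :
    opA (placeRep π ξ i) x (tprodAt v i a) = tprodAt v i (opA (π i) x a) := by
  refine opA_unique (isAdmissible_placeRep h) fun n u _ => ?_
  have h1 : ∀ b, ⟪u, tprodAt v i b⟫_ℂ = ⟪(ContinuousLinearMap.adjoint (tprodAt v i)) u, b⟫_ℂ :=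
    fun b => (ContinuousLinearMap.adjoint_inner_left _ _ _).symm
  simp only [placeRep_tprodAt, h1]
  exact (opA_spec h x).1 _ _

/-- The closed span of the tensor products of vectors of `fixed (π i) (e i)`. -/
def fixedTensor (π : ∀ i, URep (H i)) (ξ : ∀ i, Metric.sphere (0 : H i) 1) (e : ℕ → ℕ) :
    Submodule ℂ (InfTensor ξ) :=
  (Submodule.span ℂ {u | ∃ v : Family ξ, (∀ i, v.1 i ∈ fixed (π i) (e i)) ∧
    u = tprod v}).topologicalClosure

theorem tensorAct_eq_self {e : ℕ → ℕ} {γ : GFamily} (hγ : ∀ i, γ.1 i ∈ K (e i)) {u : InfTensor ξ}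
    (hu : u ∈ fixedTensor π ξ e) : tensorAct π γ u = u := by
  have hle : fixedTensor π ξ e ≤ LinearMap.eqLocus
      (tensorRep π γ).toLinearEquiv.toLinearMap LinearMap.id := by
    refine Submodule.topologicalClosure_minimal _ ?_
      (isClosed_eq (continuous_tensorAct π γ) continuous_id)
    rw [Submodule.span_le]
    rintro _ ⟨v, hv, rfl⟩
    change tensorAct π γ (tprod v) = tprod v
    rw [tensorAct_tprod]
    congr 1
    exact Family.ext' fun i => hv i _ (hγ i)
  exact hle hu

theorem fixedTensor_le_fixed (e : ℕ → ℕ) (i : ℕ) :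
    fixedTensor π ξ e ≤ fixed (placeRep π ξ i) (e i) := fun u hu k hk => by
  refine tensorAct_eq_self (e := e) (fun j => ?_) hu
  by_cases h : j = i
  · subst h
    rwa [singleG_same]
  · rw [singleG_ne h]
    exact one_mem _

/-- The adjoint of `tprodAt v i` maps a vector that is invariant at the place `i` to an invariant
vector of `H i`, so only the invariant component of `a` contributes. -/
theorem inner_tprodAt_proj {i n : ℕ} [(fixed (π i) n).HasOrthogonalProjection] (v : Family ξ)
    {u : InfTensor ξ} (hu : u ∈ fixed (placeRep π ξ i) n) (a : H i) :
    ⟪tprodAt v i a, u⟫_ℂ = ⟪tprodAt v i ((fixed (π i) n).starProjection a), u⟫_ℂ := by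
  rw [← ContinuousLinearMap.adjoint_inner_right, ← ContinuousLinearMap.adjoint_inner_right]
  have hb : (ContinuousLinearMap.adjoint (tprodAt v i)) u ∈ fixed (π i) n := by
    intro k hk
    refine ext_inner_left ℂ fun c => ?_
    rw [inner_rho_right, ContinuousLinearMap.adjoint_inner_right,
      ContinuousLinearMap.adjoint_inner_right, ← placeRep_tprodAt, inner_rho_left, inv_inv,
      hu k hk]
  have h0 := (Submodule.mem_orthogonal' _ _).1
    ((fixed (π i) n).sub_starProjection_mem_orthogonal a) _ hb
  rw [inner_sub_left, sub_eq_zero] at h0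
  exact h0

/-- A pure tensor differs from `ξ` at finitely many places, and almost all `ξ i` are already
invariant. At the remaining places the factors can be projected to the invariant vectors without
changing inner products with a vector that is invariant at every place. So such a vector is zero if
it is orthogonal to `fixedTensor π ξ e`. -/
theorem mem_fixedTensor {e : ℕ → ℕ} (hξ : {i | (ξ i : H i) ∉ fixed (π i) (e i)}.Finite)
    {u : InfTensor ξ} (hu : ∀ i, u ∈ fixed (placeRep π ξ i) (e i)) : u ∈ fixedTensor π ξ e := by
  have hproj : ∀ i, (fixed (π i) (e i)).HasOrthogonalProjection := fun i =>
    haveI := (isClosed_fixed (π i) (e i)).completeSpace_coe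
    inferInstance
  have key : ∀ (v : Family ξ) (u : InfTensor ξ), (∀ i, u ∈ fixed (placeRep π ξ i) (e i)) →
      ∀ I : Finset ℕ, ∃ w : Family ξ, (∀ i ∈ I, w.1 i ∈ fixed (π i) (e i)) ∧
        (∀ i ∉ I, w.1 i = v.1 i) ∧ ⟪tprod v, u⟫_ℂ = ⟪tprod w, u⟫_ℂ := by
    intro v u hu I
    induction I using Finset.induction_on with
    | empty => exact ⟨v, by simp, by simp, rfl⟩
    | insert i I hi ih =>
      obtain ⟨w, h1, h2, h3⟩ := ih
      refine ⟨w.update i ((fixed (π i) (e i)).starProjection (w.1 i)), ?_, ?_, ?_⟩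
      · intro j hj
        by_cases hji : j = i
        · subst hji
          rw [Family.update_same]
          exact Submodule.starProjection_apply_mem _ _
        · rw [Family.update_ne _ hji]
          exact h1 j (Finset.mem_of_mem_insert_of_ne hj hji)
      · intro j hj
        rw [Finset.mem_insert, not_or] at hj
        rw [Family.update_ne _ hj.1, h2 j hj.2]
      · rw [h3, ← tprodAt_apply, ← inner_tprodAt_proj w (hu i), tprodAt_self]
  have hfull : ∀ (v : Family ξ) (u : InfTensor ξ), (∀ i, u ∈ fixed (placeRep π ξ i) (e i)) →
      u ∈ (fixedTensor π ξ e)ᗮ → ⟪tprod v, u⟫_ℂ = 0 := by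
    intro v u hu hu'
    obtain ⟨w, h1, h2, h3⟩ := key v u hu (hξ.toFinset ∪ v.2.toFinset)
    rw [h3]
    refine (Submodule.mem_orthogonal _ _).1 hu' _ (Submodule.le_topologicalClosure _
      (Submodule.subset_span ⟨w, fun i => ?_, rfl⟩))
    by_cases hi : i ∈ hξ.toFinset ∪ v.2.toFinset
    · exact h1 i hi
    · rw [h2 i hi]
      simp only [Finset.mem_union, Set.Finite.mem_toFinset, Set.mem_ofPred_eq, not_or,
        not_not] at hi
      rw [hi.2]
      exact hi.1
  have : CompleteSpace (fixedTensor π ξ e) :=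
    (Submodule.isClosed_topologicalClosure _).completeSpace_coe
  set T := fixedTensor π ξ e with hT
  have hd : u - T.starProjection u = 0 := by
    refine ext_tprod fun v => ?_
    rw [inner_zero_right]
    refine hfull v _ (fun i => sub_mem (hu i) ?_) (T.sub_starProjection_mem_orthogonal u)
    exact fixedTensor_le_fixed e i (T.starProjection_apply_mem u)
  rw [sub_eq_zero] at hd
  rw [hd]
  exact T.starProjection_apply_mem u

theorem tprod_eq_zero {v : Family ξ} {i : ℕ} (h : v.1 i = 0) : tprod v = 0 := by
  rw [← tprodAt_self v i, h, map_zero]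

theorem fixedTensor_eq_bot {e : ℕ → ℕ} {i : ℕ} (h : fixed (π i) (e i) = ⊥) :
    fixedTensor π ξ e = ⊥ := by
  rw [eq_bot_iff]
  refine Submodule.topologicalClosure_minimal _ ?_ isClosed_singleton
  rw [Submodule.span_le]
  rintro _ ⟨v, hv, rfl⟩
  have := hv i
  rw [h, Submodule.mem_bot] at this
  exact tprod_eq_zero this

/-- By multilinearity the factors at the finitely many places of `J` are expanded one at a time. -/
theorem tprod_mem_span (S : ∀ i, Set (H i)) (J : Finset ℕ) (v : Family ξ)
    (h1 : ∀ i ∉ J, v.1 i ∈ S i) (h2 : ∀ i ∈ J, v.1 i ∈ Submodule.span ℂ (S i)) :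
    tprod v ∈ Submodule.span ℂ {u | ∃ s : Family ξ, (∀ i, s.1 i ∈ S i) ∧ u = tprod s} := by
  induction J using Finset.induction_on generalizing v with
  | empty => exact Submodule.subset_span ⟨v, fun i => h1 i (Finset.notMem_empty i), rfl⟩
  | insert i J hi ih =>
    have key : ∀ a ∈ Submodule.span ℂ (S i), tprodAt v i a ∈
        Submodule.span ℂ {u | ∃ s : Family ξ, (∀ i, s.1 i ∈ S i) ∧ u = tprod s} := by
      intro a ha
      induction ha using Submodule.span_induction with
      | mem a ha =>
        refine ih _ (fun j hj => ?_) (fun j hj => ?_)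
        · by_cases hji : j = i
          · subst hji
            rwa [Family.update_same]
          · rw [Family.update_ne _ hji]
            exact h1 j (by simp [hji, hj])
        · have hji : j ≠ i := fun h => hi (h ▸ hj)
          rw [Family.update_ne _ hji]
          exact h2 j (Finset.mem_insert_of_mem hj)
      | zero => rw [map_zero]; exact Submodule.zero_mem _
      | add x y _ _ hx hy => rw [map_add]; exact Submodule.add_mem _ hx hy
      | smul c x _ hx => rw [map_smul]; exact Submodule.smul_mem _ _ hx
    rw [← tprodAt_self v i]
    exact key _ (h2 i (Finset.mem_insert_self _ _))

end Tensor

/-! ### Order isomorphisms of the integers -/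

section Integers

/-- The order isomorphism from `ℤ \ {0}` to `ℤ` that maps `1` to `0` and `-1` to `-1`. -/
def zEquiv : NZ ≃ ℤ where
  toFun x := if 0 < x.1 then x.1 - 1 else x.1
  invFun z := if h : 0 ≤ z then ⟨z + 1, by omega⟩ else ⟨z, by omega⟩
  left_inv x := by
    have := x.2
    apply Subtype.ext
    dsimp only
    split_ifs <;> simp <;> omega
  right_inv z := by
    dsimp only
    split_ifs <;> simp_all <;> omega

theorem zEquiv_apply (x : NZ) : zEquiv x = if 0 < x.1 then x.1 - 1 else x.1 := rfl

theorem zEquiv_lt {x y : NZ} : zEquiv x < zEquiv y ↔ x < y := by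
  have hx := x.2
  have hy := y.2
  rw [← Subtype.coe_lt_coe, zEquiv_apply, zEquiv_apply]
  split_ifs <;> omega

theorem zEquiv_neg (x : NZ) : zEquiv (-x) = -zEquiv x - 1 := by
  have hx := x.2
  rw [zEquiv_apply, zEquiv_apply, NZ.neg_val]
  split_ifs <;> omega

theorem zEquiv_mem_window {x : NZ} {n : ℕ} : x ∈ window n ↔ -(n : ℤ) ≤ zEquiv x ∧ zEquiv x < n := by
  have hx := x.2
  rw [mem_window', zEquiv_apply]
  split_ifs <;> omega

theorem zEquiv_posNZ (n : ℕ) : zEquiv (posNZ n) = n := by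
  rw [zEquiv_apply, posNZ_val, if_pos (by omega)]
  omega

/-- Strict monotonicity and surjectivity force consecutive integers to have consecutive values. This
is what makes labellings unique up to a shift. -/
theorem int_strictMono_surjective {φ : ℤ → ℤ} (h1 : StrictMono φ) (h2 : Function.Surjective φ)
    (n : ℤ) : φ n = n + φ 0 := by
  have hstep : ∀ n, φ (n + 1) = φ n + 1 := by
    intro n
    obtain ⟨m, hm⟩ := h2 (φ n + 1)
    have h3 : n < m := h1.lt_iff_lt.1 (by omega)
    have h4 : φ n < φ (n + 1) := h1 (by omega)
    have h5 : φ (n + 1) ≤ φ m := h1.monotone (by omega)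
    omega
  induction n using Int.induction_on with
  | zero => simp
  | succ n ih => rw [hstep, ih]; ring
  | pred n ih =>
    have := hstep (-n - 1)
    rw [sub_add_cancel, ih] at this
    omega

end Integers

/-! ### Labellings of the color classes -/

section Labelling

/-- There is at most one labelling of an infinite set. -/
theorem IsLabelling.eqOn {s : Set NZ} (hs : s.Infinite)
    (hsymm : ∀ᶠ a in cofinite, a ∈ s → -a ∈ s) {η η' : NZ → NZ} (h : IsLabelling s η)
    (h' : IsLabelling s η') : Set.EqOn η η' s := by
  obtain ⟨hb, hm, ha⟩ := h
  obtain ⟨hb', hm', ha'⟩ := h'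
  have hinv : ∀ y, ∃ x ∈ s, η x = y := fun y => hb.surjOn (Set.mem_univ y)
  choose ι hι hηι using hinv
  have hιη : ∀ x ∈ s, ι (η x) = x := fun x hx => hb.injOn (hι _) hx (hηι _)
  -- The comparison of the two labellings is an order automorphism of `ℤ`, hence a translation.
  set φ : ℤ → ℤ := fun z => zEquiv (η' (ι (zEquiv.symm z))) with hφ
  have hφm : StrictMono φ := by
    intro a b hab
    rw [hφ]
    dsimp only
    rw [zEquiv_lt]
    refine hm' (hι _) (hι _) ?_
    rw [← hm.lt_iff_lt (hι _) (hι _), hηι, hηι, ← zEquiv_lt, Equiv.apply_symm_apply,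
      Equiv.apply_symm_apply]
    exact hab
  have hφs : Function.Surjective φ := by
    intro z
    obtain ⟨x, hx, hxz⟩ := hb'.surjOn (Set.mem_univ (zEquiv.symm z))
    refine ⟨zEquiv (η x), ?_⟩
    rw [hφ]
    dsimp only
    rw [Equiv.symm_apply_apply, hιη x hx, hxz, Equiv.apply_symm_apply]
  have key : ∀ x ∈ s, zEquiv (η' x) = zEquiv (η x) + φ 0 := by
    intro x hx
    rw [← int_strictMono_surjective hφm hφs, hφ]
    dsimp only
    rw [Equiv.symm_apply_apply, hιη x hx]
  have hsinf : ∃ᶠ a in cofinite, a ∈ s := Filter.frequently_cofinite_iff_infinite.2 hs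
  -- At a point where both labellings are odd, the shift at `a` is `φ 0` and the shift at `-a` is
  -- `-φ 0`. Both are equal to `φ 0`, so the translation is trivial.
  obtain ⟨a, haS, h1, h2, h3⟩ := (hsinf.and_eventually (ha.and (ha'.and hsymm))).exists
  have e1 := key a haS
  have e2 := key _ (h3 haS)
  rw [h1 haS, h2 haS, zEquiv_neg, zEquiv_neg] at e2
  intro x hx
  have e3 := key x hx
  exact zEquiv.injective (by omega)

variable {f : Coloring} {i n : ℕ} {x y : NZ}

/-- The points of color `i` in `{±1, …, ±n}`. -/
def colorClass (f : Coloring) (i n : ℕ) : Finset NZ :=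
  (window_finite n).toFinset.filter fun x => f x = i

theorem mem_colorClass : x ∈ colorClass f i n ↔ x ∈ window n ∧ f x = i := by
  simp [colorClass]

theorem ncard_eq_card_colorClass (f : Coloring) (i n : ℕ) :
    Set.ncard {x | x ∈ window n ∧ f x = i} = (colorClass f i n).card := by
  rw [← Set.ncard_coe_finset]
  congr 1
  ext x
  simp [mem_colorClass]

/-- Half of the number of points of color `i` in `{±1, …, ±n}`. -/
def half (f : Coloring) (i n : ℕ) : ℕ := (colorClass f i n).card / 2

/-- The coloring is symmetric outside of `{±1, …, ±n}` and every color occurs an even number of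
times in `{±1, …, ±n}`. -/
def Balanced (f : Coloring) (n : ℕ) : Prop :=
  f ∈ symColorings n ∧ ∀ i, Even (colorClass f i n).card

theorem Balanced.two_mul_half (h : Balanced f n) (i : ℕ) :
    (colorClass f i n).card = 2 * half f i n :=
  (Nat.two_mul_div_two_of_even (h.2 i)).symm

theorem colorClass_succ_filter (hf : f ∈ symColorings n) (P : NZ → Prop) [DecidablePred P] :
    ((colorClass f i (n + 1)).filter P).card = ((colorClass f i n).filter P).card +
      ((if f (posNZ n) = i ∧ P (posNZ n) then 1 else 0) +
        (if f (posNZ n) = i ∧ P (-posNZ n) then 1 else 0)) := by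
  have hneg : f (-posNZ n) = f (posNZ n) := hf _ (by simp)
  have h1 : colorClass f i (n + 1) = colorClass f i n ∪
      (({posNZ n, -posNZ n} : Finset NZ).filter fun x => f x = i) := by
    ext x
    simp only [mem_colorClass, mem_window_succ, Finset.mem_union, Finset.mem_filter,
      Finset.mem_insert, Finset.mem_singleton]
    tauto
  rw [h1, Finset.filter_union, Finset.card_union_of_disjoint]
  · congr 1
    rw [Finset.filter_filter, Finset.card_filter, Finset.sum_pair (NZ.neg_ne _).symm, hneg]
  · rw [Finset.disjoint_left]
    intro x hx hx'
    simp only [Finset.mem_filter, mem_colorClass, Finset.mem_insert, Finset.mem_singleton] at hx hx'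
    have := hx.1.1
    rcases hx'.1.1 with rfl | rfl <;> simp at this

theorem card_colorClass_succ (hf : f ∈ symColorings n) :
    (colorClass f i (n + 1)).card =
      (colorClass f i n).card + if f (posNZ n) = i then 2 else 0 := by
  have h := colorClass_succ_filter (i := i) hf (fun _ => True)
  simp only [and_true, Finset.filter_true] at h
  rw [h]
  split_ifs <;> rfl

theorem symColorings_mono {m n : ℕ} (h : m ≤ n) : symColorings m ⊆ symColorings n :=
  fun f hf x hx => hf x fun hm => hx (window_mono h hm)

theorem Balanced.mono (h : Balanced f n) {m : ℕ} (hm : n ≤ m) : Balanced f m := by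
  induction m, hm using Nat.le_induction with
  | base => exact h
  | succ m hm ih =>
    refine ⟨symColorings_mono (Nat.le_succ m) ih.1, fun i => ?_⟩
    rw [card_colorClass_succ ih.1, Nat.even_add]
    simp only [ih.2 i, true_iff]
    split_ifs <;> simp

theorem balanced_of_good (hf : f ∈ goodColorings) (hn : f ∈ symColorings n) : Balanced f n := by
  refine ⟨hn, fun i => ?_⟩
  obtain ⟨N, hN⟩ := ((hf.2 i).2.and (eventually_ge_atTop n)).exists
  obtain ⟨h1, h2⟩ := hN
  rw [ncard_eq_card_colorClass] at h1
  induction N, h2 using Nat.le_induction with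
  | base => exact h1
  | succ m hm ih =>
    refine ih ?_
    rw [card_colorClass_succ (symColorings_mono hm hn), Nat.even_add] at h1
    exact h1.2 (by split_ifs <;> simp)

theorem half_succ (h : Balanced f n) :
    half f i (n + 1) = half f i n + if f (posNZ n) = i then 1 else 0 := by
  have h1 := h.two_mul_half i
  have h2 := (h.mono (m := n + 1) (by omega)).two_mul_half i
  rw [card_colorClass_succ h.1] at h2
  split_ifs at * <;> omega

/-- The position of `x` among the points of color `i` in `{±1, …, ±n}`, where the middle gets the
position zero. -/
def rank (f : Coloring) (i n : ℕ) (x : NZ) : ℤ :=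
  (((colorClass f i n).filter fun y => y < x).card : ℤ) - half f i n

theorem lt_of_mem_window (hx : x ∈ window n) : x < posNZ n ∧ -posNZ n < x := by
  rw [mem_window'] at hx
  rw [← Subtype.coe_lt_coe, ← Subtype.coe_lt_coe, NZ.neg_val, posNZ_val]
  omega

/-- If the new pair has the color `i`, exactly one of its points lies below `x`, and `half` also
grows by one. -/
theorem rank_succ (h : Balanced f n) (hx : x ∈ window n) : rank f i (n + 1) x = rank f i n x := by
  obtain ⟨h1, h2⟩ := lt_of_mem_window hx
  rw [rank, rank, colorClass_succ_filter h.1, half_succ h]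
  simp only [h2, and_true, h1.not_gt, and_false, if_false]
  split_ifs <;> push_cast <;> ring

theorem rank_eq (h : Balanced f n) (hx : x ∈ window n) {m : ℕ} (hm : n ≤ m) :
    rank f i m x = rank f i n x := by
  induction m, hm using Nat.le_induction with
  | base => rfl
  | succ m hm ih => rw [rank_succ (h.mono hm) (window_mono hm hx), ih]

theorem rank_lt_rank (hx : x ∈ colorClass f i n) (hxy : x < y) : rank f i n x < rank f i n y := by
  have : ((colorClass f i n).filter fun z => z < x).card <
      ((colorClass f i n).filter fun z => z < y).card := by
    refine Finset.card_lt_card (Finset.ssubset_iff_of_subset (fun z hz => ?_) |>.2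
      ⟨x, by simp [hx, hxy], by simp⟩)
    simp only [Finset.mem_filter] at hz ⊢
    exact ⟨hz.1, hz.2.trans hxy⟩
  unfold rank
  omega

theorem neg_half_le_rank : -(half f i n : ℤ) ≤ rank f i n x := by
  unfold rank
  omega

theorem rank_lt_half (h : Balanced f n) (hx : x ∈ colorClass f i n) :
    rank f i n x < half f i n := by
  have h1 : ((colorClass f i n).filter fun z => z < x).card < (colorClass f i n).card := by
    refine Finset.card_lt_card (Finset.ssubset_iff_of_subset (Finset.filter_subset _ _) |>.2
      ⟨x, hx, by simp⟩)
  rw [h.two_mul_half] at h1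
  unfold rank
  omega

theorem exists_rank_eq (h : Balanced f n) {z : ℤ} (h1 : -(half f i n : ℤ) ≤ z)
    (h2 : z < half f i n) : ∃ x ∈ colorClass f i n, rank f i n x = z := by
  have hsurj := Finset.surj_on_of_inj_on_of_card_le (s := colorClass f i n)
    (t := Finset.Ico (-(half f i n : ℤ)) (half f i n)) (fun x _ => rank f i n x)
    (fun x hx => Finset.mem_Ico.2 ⟨neg_half_le_rank, rank_lt_half h hx⟩)
    (fun x y hx hy hxy => by
      rcases lt_trichotomy x y with hlt | heq | hlt
      · exact absurd hxy (rank_lt_rank hx hlt).ne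
      · exact heq
      · exact absurd hxy (rank_lt_rank hy hlt).ne')
    (by rw [Int.card_Ico, h.two_mul_half]; omega)
  obtain ⟨x, hx, hxz⟩ := hsurj z (Finset.mem_Ico.2 ⟨h1, h2⟩)
  exact ⟨x, hx, hxz.symm⟩

theorem rank_posNZ (h : Balanced f n) (hx : f (posNZ n) = i) :
    rank f i (n + 1) (posNZ n) = half f i n := by
  have h0 := fun x => lt_of_mem_window (x := x) (n := n)
  have h1 : (colorClass f i n).filter (fun y => y < posNZ n) = colorClass f i n :=
    Finset.filter_true_of_mem fun y hy => (h0 y (mem_colorClass.1 hy).1).1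
  have h2 : -posNZ n < posNZ n := by
    rw [← Subtype.coe_lt_coe, NZ.neg_val, posNZ_val]
    omega
  rw [rank, colorClass_succ_filter h.1, half_succ h, h1, h.two_mul_half]
  simp [hx, h2]
  ring

theorem rank_neg_posNZ (h : Balanced f n) (hx : f (posNZ n) = i) :
    rank f i (n + 1) (-posNZ n) = -(half f i n : ℤ) - 1 := by
  have h0 := fun x => lt_of_mem_window (x := x) (n := n)
  have h1 : (colorClass f i n).filter (fun y => y < -posNZ n) = ∅ :=
    Finset.filter_false_of_mem fun y hy => (h0 y (mem_colorClass.1 hy).1).2.not_gt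
  have h2 : ¬ posNZ n < -posNZ n := by
    rw [← Subtype.coe_lt_coe, NZ.neg_val, posNZ_val]
    omega
  rw [rank, colorClass_succ_filter h.1, half_succ h, h1]
  simp [hx, h2]
  ring

open Classical in
/-- The labelling of the points of color `i`. -/
def lab (f : Coloring) (i : ℕ) (x : NZ) : NZ :=
  -- Every window that contains `x` and outside of which `f` is symmetric gives the same rank for a
  -- coloring in `Y`. The value `0` is only a default for colorings outside of `X`.
  zEquiv.symm (rank f i
    (max (if h : ∃ n, f ∈ symColorings n then h.choose else 0) x.1.natAbs) x)

variable (hf : f ∈ goodColorings)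

include hf

theorem zEquiv_lab (hn : f ∈ symColorings n) (hx : x ∈ window n) (i : ℕ) :
    zEquiv (lab f i x) = rank f i n x := by
  rw [lab, Equiv.apply_symm_apply, dif_pos hf.1]
  have hb1 := balanced_of_good hf (symColorings_mono (le_max_left _ x.1.natAbs) hf.1.choose_spec)
  have hb2 := balanced_of_good hf hn
  set m := max hf.1.choose x.1.natAbs with hm
  have hxm : x ∈ window m := mem_window'.2 (le_max_right _ _)
  rw [← rank_eq hb1 hxm (le_max_left m n), ← rank_eq hb2 hx (le_max_right m n)]

theorem exists_symColorings (x : NZ) : ∃ n, f ∈ symColorings n ∧ x ∈ window n := by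
  obtain ⟨n, hn⟩ := hf.1
  obtain ⟨m, hm⟩ := exists_mem_window x
  exact ⟨max n m, symColorings_mono (le_max_left _ _) hn, window_mono (le_max_right _ _) hm⟩

theorem exists_half_gt (i M : ℕ) : ∃ n, f ∈ symColorings n ∧ M < half f i n := by
  obtain ⟨t, ht, htc⟩ := (hf.2 i).1.exists_subset_card_eq (2 * M + 2)
  obtain ⟨n, hn⟩ := hf.1
  obtain ⟨m, hm⟩ := (t.image fun x : NZ => x.1.natAbs).bddAbove
  refine ⟨max n m, symColorings_mono (le_max_left _ _) hn, ?_⟩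
  have hsub : t ⊆ colorClass f i (max n m) := fun x hx => mem_colorClass.2
    ⟨mem_window'.2 ((hm (by simpa using ⟨x.1, ⟨x.2, hx⟩, rfl⟩)).trans (le_max_right _ _)), ht hx⟩
  have := Finset.card_le_card hsub
  unfold half
  omega

theorem lab_lt_lab (hx : f x = i) (hxy : x < y) : lab f i x < lab f i y := by
  obtain ⟨n, hn, hxn⟩ := exists_symColorings hf x
  obtain ⟨m, hm, hym⟩ := exists_symColorings hf y
  have hM := symColorings_mono (le_max_left n m) hn
  have hxM := window_mono (le_max_left n m) hxn
  rw [← zEquiv_lt, zEquiv_lab hf hM hxM, zEquiv_lab hf hM (window_mono (le_max_right n m) hym)]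
  exact rank_lt_rank (mem_colorClass.2 ⟨hxM, hx⟩) hxy

theorem lab_injOn : Set.InjOn (lab f i) {x | f x = i} := by
  intro x hx y hy h
  rcases lt_trichotomy x y with hlt | heq | hlt
  · exact absurd h (lab_lt_lab hf hx hlt).ne
  · exact heq
  · exact absurd h (lab_lt_lab hf hy hlt).ne'

theorem lab_mem_window (hn : f ∈ symColorings n) (hx : f x = i) (hxn : x ∈ window n) :
    lab f i x ∈ window (half f i n) := by
  rw [zEquiv_mem_window, zEquiv_lab hf hn hxn]
  exact ⟨neg_half_le_rank, rank_lt_half (balanced_of_good hf hn) (mem_colorClass.2 ⟨hxn, hx⟩)⟩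

theorem exists_lab_eq (hn : f ∈ symColorings n) (hy : y ∈ window (half f i n)) :
    ∃ x, x ∈ window n ∧ f x = i ∧ lab f i x = y := by
  rw [zEquiv_mem_window] at hy
  obtain ⟨x, hx, hxy⟩ := exists_rank_eq (balanced_of_good hf hn) hy.1 hy.2
  rw [mem_colorClass] at hx
  refine ⟨x, hx.1, hx.2, zEquiv.injective ?_⟩
  rw [zEquiv_lab hf hn hx.1, hxy]

theorem lab_mem_window_iff (hn : f ∈ symColorings n) (hx : f x = i) :
    lab f i x ∈ window (half f i n) ↔ x ∈ window n := by
  refine ⟨fun h => ?_, lab_mem_window hf hn hx⟩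
  obtain ⟨x', hx', hfx', he⟩ := exists_lab_eq hf hn h
  rwa [← lab_injOn hf hfx' hx he]

theorem exists_lab (i : ℕ) (y : NZ) : ∃ x, f x = i ∧ lab f i x = y := by
  obtain ⟨m, hm⟩ := exists_mem_window y
  obtain ⟨n, hn, hmn⟩ := exists_half_gt hf i m
  obtain ⟨x, -, h⟩ := exists_lab_eq hf hn (window_mono hmn.le hm)
  exact ⟨x, h⟩

theorem lab_posNZ (hn : f ∈ symColorings n) (hx : f (posNZ n) = i) :
    lab f i (posNZ n) = posNZ (half f i n) := by
  refine zEquiv.injective ?_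
  rw [zEquiv_lab hf (symColorings_mono (Nat.le_succ n) hn) (by simp),
    rank_posNZ (balanced_of_good hf hn) hx, zEquiv_posNZ]

theorem lab_neg_posNZ (hn : f ∈ symColorings n) (hx : f (posNZ n) = i) :
    lab f i (-posNZ n) = -posNZ (half f i n) := by
  refine zEquiv.injective ?_
  rw [zEquiv_lab hf (symColorings_mono (Nat.le_succ n) hn) (by simp),
    rank_neg_posNZ (balanced_of_good hf hn) hx, zEquiv_neg, zEquiv_posNZ]

theorem lab_neg (hn : f ∈ symColorings n) (hx : f x = i) (hxn : x ∉ window n) :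
    lab f i (-x) = -lab f i x := by
  obtain ⟨m, rfl | rfl⟩ := posNZ_cases x
  · have hnm : n ≤ m := by simpa using hxn
    have hm := symColorings_mono hnm hn
    rw [lab_posNZ hf hm hx, lab_neg_posNZ hf hm hx]
  · have hnm : n ≤ m := by simpa using hxn
    have hm := symColorings_mono hnm hn
    rw [hm _ (by simp)] at hx
    rw [NZ.neg_neg', lab_posNZ hf hm hx, lab_neg_posNZ hf hm hx, NZ.neg_neg']

theorem isLabelling_lab (i : ℕ) : IsLabelling {x | f x = i} (lab f i) := by
  refine ⟨⟨fun _ _ => Set.mem_univ _, lab_injOn hf, fun y _ => exists_lab hf i y⟩,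
    fun x hx y _ hxy => lab_lt_lab hf hx hxy, ?_⟩
  obtain ⟨n, hn⟩ := hf.1
  refine (window_finite n).subset fun x hx => ?_
  by_contra hxn
  exact hx fun hxi => lab_neg hf hn hxi hxn

theorem eventually_neg_mem (i : ℕ) : ∀ᶠ a in cofinite, a ∈ {x | f x = i} → -a ∈ {x | f x = i} := by
  obtain ⟨n, hn⟩ := hf.1
  refine (window_finite n).subset fun x hx => ?_
  by_contra hxn
  exact hx fun hxi => (hn x hxn).trans hxi

/-- The labelling of the points of color `i`, as a bijection. -/
def labEquiv (i : ℕ) : {x // f x = i} ≃ NZ :=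
  Equiv.ofBijective (fun x => lab f i x.1)
    ⟨fun x y h => Subtype.ext (lab_injOn hf x.2 y.2 h), fun y => by
      obtain ⟨x, hx, h⟩ := exists_lab hf i y
      exact ⟨⟨x, hx⟩, h⟩⟩

theorem labEquiv_apply (i : ℕ) (x : {x // f x = i}) : labEquiv hf i x = lab f i x.1 := rfl

end Labelling

/-! ### The action of `G` on colorings -/

section ColorAct

variable {f f' : Coloring} {i n : ℕ} {x y : NZ} {g h : G}

theorem colorAct_mul (g h : G) (f : Coloring) : colorAct (g * h) f = colorAct g (colorAct h f) := by
  funext x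
  rw [colorAct, mul_inv_rev]
  rfl

@[simp] theorem colorAct_one (f : Coloring) : colorAct 1 f = f := by
  funext x
  rw [colorAct, inv_one]
  rfl

@[simp] theorem colorAct_apply_apply (g : G) (f : Coloring) (x : NZ) :
    colorAct g f (g.1 x) = f x := by
  rw [colorAct, inv_apply_self']

@[simp] theorem colorAct_inv_colorAct (g : G) (f : Coloring) : colorAct g⁻¹ (colorAct g f) = f := by
  rw [← colorAct_mul, inv_mul_cancel, colorAct_one]

@[simp] theorem colorAct_colorAct_inv (g : G) (f : Coloring) : colorAct g (colorAct g⁻¹ f) = f := by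
  rw [← colorAct_mul, mul_inv_cancel, colorAct_one]

theorem SuppIn.colorAct_mem (hg : SuppIn n g) (hf : f ∈ symColorings n) :
    colorAct g f ∈ symColorings n := fun x hx => by
  have hx' := mt neg_mem_window.1 hx
  rw [colorAct, colorAct, hg.inv x hx, hg.inv _ hx', hf x hx]

theorem colorAct_mem_symColorings_K {k : G} (hk : k ∈ K n) (hf : f ∈ symColorings n) :
    colorAct k f ∈ symColorings n := fun x hx => by
  have hki := inv_mem hk
  rw [colorAct, colorAct, hki.1, hf]
  intro hx'
  have := hk.2 _ hx'
  rw [apply_inv_self'] at this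
  exact hx (this ▸ hx')

theorem colorAct_K_apply {k : G} (hk : k ∈ K n) (hx : x ∈ window n) :
    colorAct k f x = f x := by
  rw [colorAct, (inv_mem hk).2 x hx]

theorem SuppIn.card_colorClass (hg : SuppIn n g) (f : Coloring) (i : ℕ) :
    (colorClass (colorAct g f) i n).card = (colorClass f i n).card := by
  refine (Finset.card_nbij' g.1 (g⁻¹).1 ?_ ?_ ?_ ?_).symm
  · intro x hx
    rw [Finset.mem_coe, mem_colorClass] at *
    exact ⟨hg.apply_mem.2 hx.1, by rw [colorAct_apply_apply, hx.2]⟩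
  · intro x hx
    rw [Finset.mem_coe, mem_colorClass] at *
    exact ⟨hg.inv.apply_mem.2 hx.1, hx.2⟩
  · intro x _
    simp
  · intro x _
    simp

theorem SuppIn.half_colorAct (hg : SuppIn n g) (f : Coloring) (i : ℕ) :
    half (colorAct g f) i n = half f i n := by
  rw [half, hg.card_colorClass, half]

theorem colorAct_mem_good (g : G) (hf : f ∈ goodColorings) : colorAct g f ∈ goodColorings := by
  obtain ⟨N, hN⟩ := exists_suppIn g
  refine ⟨?_, fun i => ⟨?_, ?_⟩⟩
  · obtain ⟨n, hn⟩ := hf.1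
    exact ⟨max n N, (hN.mono (le_max_right _ _)).colorAct_mem
      (symColorings_mono (le_max_left _ _) hn)⟩
  · refine Set.Infinite.mono ?_ ((hf.2 i).1.image (g.1.injective.injOn))
    rintro _ ⟨x, hx, rfl⟩
    exact (colorAct_apply_apply g f x).trans hx
  · filter_upwards [(hf.2 i).2, eventually_ge_atTop N] with M hM hNM
    rw [ncard_eq_card_colorClass] at hM ⊢
    rwa [(hN.mono hNM).card_colorClass]

theorem colorAct_mem_good_iff (g : G) : colorAct g f ∈ goodColorings ↔ f ∈ goodColorings :=
  ⟨fun h => by simpa using colorAct_mem_good g⁻¹ h, colorAct_mem_good g⟩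

theorem colorClass_congr (h : ∀ x ∈ window n, f x = f' x) (i : ℕ) :
    colorClass f i n = colorClass f' i n := by
  ext x
  rw [mem_colorClass, mem_colorClass]
  exact and_congr_right fun hx => by rw [h x hx]

theorem half_congr (h : ∀ x ∈ window n, f x = f' x) (i : ℕ) : half f i n = half f' i n := by
  rw [half, half, colorClass_congr h]

theorem lab_congr (hf : f ∈ goodColorings) (hf' : f' ∈ goodColorings) (hn : f ∈ symColorings n)
    (hn' : f' ∈ symColorings n) (h : ∀ x ∈ window n, f x = f' x) (i : ℕ) (hx : x ∈ window n) :
    lab f i x = lab f' i x := by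
  refine zEquiv.injective ?_
  rw [zEquiv_lab hf hn hx, zEquiv_lab hf' hn' hx, rank, rank, colorClass_congr h, half_congr h]

/-- Beyond the window a label is determined by half the number of points of the color in a smaller
window, and `g` preserves this number. -/
theorem lab_colorAct_of_notMem (hf : f ∈ goodColorings) (hn : f ∈ symColorings n)
    (hg : SuppIn n g) (hx : x ∉ window n) (hi : f x = i) :
    lab (colorAct g f) i x = lab f i x := by
  have hgf := colorAct_mem_good g hf
  have hfx : colorAct g f x = i := by rw [colorAct, hg.inv x hx, hi]
  obtain ⟨m, rfl | rfl⟩ := posNZ_cases x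
  · have hnm : n ≤ m := by simpa using hx
    have hm := symColorings_mono hnm hn
    rw [lab_posNZ hgf ((hg.mono hnm).colorAct_mem hm) hfx, lab_posNZ hf hm hi,
      (hg.mono hnm).half_colorAct]
  · have hnm : n ≤ m := by simpa using hx
    have hm := symColorings_mono hnm hn
    have hm' := (hg.mono hnm).colorAct_mem hm
    rw [hm _ (by simp)] at hi
    rw [hm' _ (by simp)] at hfx
    rw [lab_neg_posNZ hgf hm' hfx, lab_neg_posNZ hf hm hi,
      (hg.mono hnm).half_colorAct]

end ColorAct

/-! ### The cocycle -/

section Cocycle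

variable {f f' : Coloring} {i n : ℕ} {x y : NZ} {g h : G}

/-- The component of color `i` of the cocycle, as a permutation. -/
def cocPerm (g : G) (hf : f ∈ goodColorings) (i : ℕ) : Equiv.Perm NZ :=
  (labEquiv hf i).symm.trans
    ((g.1.subtypeEquiv fun x => by rw [colorAct_apply_apply]).trans
      (labEquiv (colorAct_mem_good g hf) i))

theorem cocPerm_lab (g : G) (hf : f ∈ goodColorings) (hx : f x = i) :
    cocPerm g hf i (lab f i x) = lab (colorAct g f) i (g.1 x) := by
  have : lab f i x = labEquiv hf i ⟨x, hx⟩ := rfl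
  rw [this, cocPerm, Equiv.trans_apply, Equiv.symm_apply_apply]
  rfl

theorem cocPerm_of_notMem (hf : f ∈ goodColorings) (hn : f ∈ symColorings n)
    (hg : SuppIn n g) (hy : y ∉ window (half f i n)) : cocPerm g hf i y = y := by
  obtain ⟨x, hx, rfl⟩ := exists_lab hf i y
  rw [lab_mem_window_iff hf hn hx] at hy
  rw [cocPerm_lab g hf hx, hg x hy, lab_colorAct_of_notMem hf hn hg hy hx]

theorem exists_suppIn_sym (g : G) (hf : f ∈ goodColorings) : ∃ n, SuppIn n g ∧ f ∈ symColorings n := by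
  obtain ⟨n, hn⟩ := hf.1
  obtain ⟨m, hm⟩ := exists_suppIn g
  exact ⟨max m n, hm.mono (le_max_left _ _), symColorings_mono (le_max_right _ _) hn⟩

theorem notMem_window_zero (x : NZ) : x ∉ window 0 := by
  rw [mem_window']
  have := x.2
  omega

theorem finite_half_ne_zero (f : Coloring) (n : ℕ) : {i | half f i n ≠ 0}.Finite := by
  refine ((window_finite n).image f).subset fun i hi => ?_
  have : (colorClass f i n).card ≠ 0 := by
    intro h
    exact hi (by rw [half, h])
  obtain ⟨x, hx⟩ := Finset.card_pos.1 (Nat.pos_of_ne_zero this)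
  rw [mem_colorClass] at hx
  exact ⟨x, hx.1, hx.2⟩

open Classical in
/-- The cocycle. -/
def coc (g : G) (f : Coloring) : GFamily :=
  if hf : f ∈ goodColorings then
    ⟨fun i => ⟨cocPerm g hf i, by
      obtain ⟨n, hg, hn⟩ := exists_suppIn_sym g hf
      refine (window_finite (half f i n)).subset fun y hy => ?_
      by_contra h
      exact hy (cocPerm_of_notMem hf hn hg h)⟩, by
      obtain ⟨n, hg, hn⟩ := exists_suppIn_sym g hf
      refine (finite_half_ne_zero f n).subset fun i hi h => hi ?_
      refine G.ext' fun y => cocPerm_of_notMem hf hn hg ?_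
      rw [h]
      exact notMem_window_zero y⟩
  else 1

variable (hf : f ∈ goodColorings)

include hf

theorem coc_apply (g : G) (i : ℕ) : ((coc g f).1 i).1 = cocPerm g hf i := by
  rw [coc, dif_pos hf]

theorem coc_lab (g : G) (hx : f x = i) :
    ((coc g f).1 i).1 (lab f i x) = lab (colorAct g f) i (g.1 x) := by
  rw [coc_apply hf, cocPerm_lab g hf hx]

theorem eq_coc {γ : GFamily}
    (h : ∀ i x, f x = i → (γ.1 i).1 (lab f i x) = lab (colorAct g f) i (g.1 x)) : γ = coc g f := by
  refine GFamily.ext' fun i => G.ext' fun y => ?_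
  obtain ⟨x, hx, rfl⟩ := exists_lab hf i y
  rw [h i x hx, coc_lab hf g hx]

theorem isCocycleValue_coc (g : G) : IsCocycleValue g f (coc g f) := fun i =>
  ⟨lab f i, lab (colorAct g f) i, isLabelling_lab hf i,
    isLabelling_lab (colorAct_mem_good g hf) i, fun _ hx => coc_lab hf g hx⟩

/-- Labellings of the color classes are unique and surjective, so the defining relation of the
cocycle has only one solution. -/
theorem IsCocycleValue.eq_coc {γ : GFamily} (h : IsCocycleValue g f γ) : γ = coc g f := by
  refine Mixture.eq_coc hf fun i x hx => ?_
  obtain ⟨η, η', h1, h2, h3⟩ := h i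
  have hgf := colorAct_mem_good g hf
  rw [(isLabelling_lab hf i).eqOn (hf.2 i).1 (eventually_neg_mem hf i) h1 hx, h3 x hx]
  exact (isLabelling_lab hgf i).eqOn (hgf.2 i).1 (eventually_neg_mem hgf i) h2
    ((colorAct_apply_apply g f x).trans hx) |>.symm

theorem coc_mul (g h : G) : coc (g * h) f = coc g (colorAct h f) * coc h f := by
  refine (eq_coc hf fun i x hx => ?_).symm
  rw [GFamily.mul_val, mul_apply', coc_lab hf h hx, coc_lab (colorAct_mem_good h hf) g
    (by rw [colorAct_apply_apply, hx]), ← colorAct_mul, mul_apply']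

theorem coc_one : coc 1 f = 1 :=
  (eq_coc hf fun i x hx => by rw [colorAct_one, GFamily.one_val, one_apply', one_apply']).symm

theorem suppIn_coc (hn : f ∈ symColorings n) (hg : SuppIn n g) (i : ℕ) :
    SuppIn (half f i n) ((coc g f).1 i) := fun y hy => by
  rw [coc_apply hf, cocPerm_of_notMem hf hn hg hy]

theorem coc_congr (hf' : f' ∈ goodColorings) (hn : f ∈ symColorings n)
    (hn' : f' ∈ symColorings n) (h : ∀ x ∈ window n, f x = f' x) (hg : SuppIn n g) :
    coc g f = coc g f' := by
  -- The cocycle moves only labels of points of the window, and these labels depend only on the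
  -- colors there.
  refine GFamily.ext' fun i => G.ext' fun y => ?_
  by_cases hy : y ∈ window (half f i n)
  · obtain ⟨x, hxn, hx, rfl⟩ := exists_lab_eq hf hn hy
    rw [coc_lab hf g hx, lab_congr hf hf' hn hn' h i hxn, coc_lab hf' g (by rw [← h x hxn, hx]),
      lab_congr (colorAct_mem_good g hf) (colorAct_mem_good g hf') (hg.colorAct_mem hn)
        (hg.colorAct_mem hn') (fun z hz => h _ (hg.inv.apply_mem.2 hz)) i (hg.apply_mem.2 hxn)]
  · rw [suppIn_coc hf hn hg i y hy, suppIn_coc hf' hn' hg i y (by rwa [← half_congr h])]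

theorem coc_mem_K (hn : f ∈ symColorings n) {k : G} (hk : k ∈ K n) (i : ℕ) :
    (coc k f).1 i ∈ K (half f i n) := by
  have hkf := colorAct_mem_good k hf
  have hkn := colorAct_mem_symColorings_K hk hn
  have h2 : ∀ y ∈ window (half f i n), ((coc k f).1 i).1 y = y := by
    intro y hy
    obtain ⟨x, hxn, hx, rfl⟩ := exists_lab_eq hf hn hy
    rw [coc_lab hf k hx, hk.2 x hxn,
      lab_congr hkf hf hkn hn (fun z hz => colorAct_K_apply hk hz) i hxn]
  refine ⟨fun y => ?_, h2⟩
  by_cases hy : y ∈ window (half f i n)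
  · rw [h2 y hy, h2 _ (neg_mem_window.2 hy)]
  · obtain ⟨x, hx, rfl⟩ := exists_lab hf i y
    rw [lab_mem_window_iff hf hn hx] at hy
    have hkx : k.1 x ∉ window n := fun h => hy (by
      have := k.1.injective (hk.2 _ h)
      rwa [this] at h)
    rw [← lab_neg hf hn hx hy, coc_lab hf k ((hn x hy).trans hx), coc_lab hf k hx, hk.1,
      lab_neg hkf hkn (by rw [colorAct_apply_apply, hx]) hkx]

/-- Every element of `G` that acts at the place `i` comes from an element of `G` that preserves the
coloring. -/
theorem exists_lift (i : ℕ) (γ : G) : ∃ k : G, colorAct k f = f ∧ coc k f = singleG i γ ∧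
    ∀ n, f ∈ symColorings n → γ ∈ K (half f i n) → k ∈ K n := by
  classical
  -- The labelling transports `γ` to the points of color `i`; all other points stay fixed.
  let τ : Equiv.Perm {x // f x = i} := (labEquiv hf i).symm.permCongr γ.1
  have hτ : ∀ x, lab f i (τ x).1 = γ.1 (lab f i x.1) := by
    intro x
    rw [← labEquiv_apply hf, ← labEquiv_apply hf]
    simp [τ, Equiv.permCongr_apply]
  have h1 : ∀ x (hx : f x = i), Equiv.Perm.ofSubtype τ x = (τ ⟨x, hx⟩).1 := fun x hx =>
    Equiv.Perm.ofSubtype_apply_of_mem τ hx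
  have h2 : ∀ x, f x ≠ i → Equiv.Perm.ofSubtype τ x = x := fun x hx =>
    Equiv.Perm.ofSubtype_apply_of_not_mem τ hx
  have hfin : {x | Equiv.Perm.ofSubtype τ x ≠ x}.Finite := by
    have hfin' : {y | γ.1 y ≠ y}.Finite := γ.2
    have hpre : ({x | f x = i} ∩ lab f i ⁻¹' {y | γ.1 y ≠ y}).Finite :=
      Set.Finite.of_finite_image (f := lab f i)
        (hfin'.subset (by rintro _ ⟨x, hx, rfl⟩; exact hx.2))
        ((lab_injOn hf).mono Set.inter_subset_left)
    refine hpre.subset fun x hx => ?_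
    have hxi : f x = i := by
      by_contra h
      exact hx (h2 x h)
    refine ⟨hxi, fun h => hx ?_⟩
    rw [h1 x hxi]
    exact lab_injOn hf (τ ⟨x, hxi⟩).2 hxi ((hτ ⟨x, hxi⟩).trans h)
  let k : G := ⟨Equiv.Perm.ofSubtype τ, hfin⟩
  have hkf : ∀ x, f (k.1 x) = f x := by
    intro x
    by_cases hx : f x = i
    · change f (Equiv.Perm.ofSubtype τ x) = f x
      rw [h1 x hx, (τ _).2, hx]
    · change f (Equiv.Perm.ofSubtype τ x) = f x
      rw [h2 x hx]
  have hk : colorAct k f = f := by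
    funext x
    rw [colorAct, ← hkf, apply_inv_self']
  refine ⟨k, hk, (eq_coc hf fun j x hx => ?_).symm, fun n hn hγ => ?_⟩
  · rw [hk]
    by_cases hj : j = i
    · subst hj
      rw [singleG_same]
      change _ = lab f j (Equiv.Perm.ofSubtype τ x)
      rw [h1 x hx, hτ]
    · rw [singleG_ne hj, one_apply']
      change _ = lab f j (Equiv.Perm.ofSubtype τ x)
      rw [h2 x (by rwa [hx])]
  · have hkn : ∀ x ∈ window n, k.1 x = x := by
      intro x hxn
      by_cases hx : f x = i
      · change Equiv.Perm.ofSubtype τ x = x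
        rw [h1 x hx]
        exact lab_injOn hf (τ ⟨x, hx⟩).2 hx
          ((hτ ⟨x, hx⟩).trans (hγ.2 _ (lab_mem_window hf hn hx hxn)))
      · exact h2 x hx
    refine ⟨fun x => ?_, hkn⟩
    by_cases hxn : x ∈ window n
    · rw [hkn x hxn, hkn _ (neg_mem_window.2 hxn)]
    by_cases hx : f x = i
    · have hnx : f (-x) = i := (hn x hxn).trans hx
      change Equiv.Perm.ofSubtype τ (-x) = -Equiv.Perm.ofSubtype τ x
      rw [h1 x hx, h1 _ hnx]
      have hτn : (τ ⟨x, hx⟩).1 ∉ window n := by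
        rw [← lab_mem_window_iff hf hn (τ ⟨x, hx⟩).2, hτ]
        intro h
        have := hγ.2 _ h
        have := γ.1.injective this
        rw [this, lab_mem_window_iff hf hn hx] at h
        exact hxn h
      refine lab_injOn hf (τ ⟨-x, hnx⟩).2 ((hn _ hτn).trans (τ ⟨x, hx⟩).2) ?_
      rw [hτ, lab_neg hf hn (τ ⟨x, hx⟩).2 hτn, hτ, lab_neg hf hn hx hxn, hγ.1]
    · have hnx : f (-x) ≠ i := by rwa [hn x hxn]
      change Equiv.Perm.ofSubtype τ (-x) = -Equiv.Perm.ofSubtype τ x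
      rw [h2 x hx, h2 _ hnx]

omit hf in
theorem colorAct_transposition_of_eq {a b : NZ} (h : f a = f b) :
    colorAct (transposition a b) f = f := by
  funext x
  rw [colorAct, transposition_inv, transposition_apply]
  split_ifs with h1 h2
  · rw [h1, h]
  · rw [h2, h]
  · rfl

theorem coc_transposition {a b : NZ} (ha : f a = i) (hb : f b = i) :
    coc (transposition a b) f = singleG i (transposition (lab f i a) (lab f i b)) := by
  refine (eq_coc hf fun j x hx => ?_).symm
  rw [colorAct_transposition_of_eq (ha.trans hb.symm)]
  by_cases hj : j = i
  · subst hj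
    rw [singleG_same]
    by_cases h1 : x = a
    · rw [h1, transposition_left, transposition_left]
    by_cases h2 : x = b
    · rw [h2, transposition_right, transposition_right]
    rw [transposition_of_ne h1 h2, transposition_of_ne]
    · exact fun h => h1 (lab_injOn hf hx ha h)
    · exact fun h => h2 (lab_injOn hf hx hb h)
  · rw [singleG_ne hj, one_apply', transposition_of_ne]
    · rintro rfl
      exact hj (hx.symm.trans ha)
    · rintro rfl
      exact hj (hx.symm.trans hb)

/-- Every transposition exchanges points of the same color, and the outer points receive consecutive
labels beyond those of the window. -/
theorem coc_starProd (hn : f ∈ symColorings n) (hx : f x = i) (m : ℕ)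
    (hm : ∀ j < m, f (posNZ (n + j)) = i) :
    colorAct (starProd x n m) f = f ∧ half f i (n + m) = half f i n + m ∧
    coc (starProd x n m) f = singleG i (starProd (lab f i x) (half f i n) m) := by
  induction m with
  | zero => exact ⟨colorAct_one f, rfl, by rw [starProd, starProd, coc_one hf, map_one]⟩
  | succ m ih =>
    obtain ⟨h1, h2, h3⟩ := ih fun j hj => hm j (by omega)
    have hy := hm m (by omega)
    have hnm := symColorings_mono (Nat.le_add_right n m) hn
    have ht := colorAct_transposition_of_eq (hx.trans hy.symm)
    refine ⟨?_, ?_, ?_⟩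
    · rw [starProd, colorAct_mul, ht, h1]
    · rw [← add_assoc, half_succ (balanced_of_good hf hnm), h2, if_pos hy, add_assoc]
    · rw [starProd, coc_mul hf, ht, h3, coc_transposition hf hx hy, lab_posNZ hf hnm hy, h2,
        ← map_mul, starProd]

omit hf in
/-- If a coloring and its image under a star product are symmetric, then the star product moves
only points of one color. -/
theorem eq_of_colorAct_starProd (hn : f ∈ symColorings n) (hx : x ≠ posNZ n)
    (hxw : ∀ j, x ≠ posNZ (n + j)) (hxw' : ∀ j, x ≠ -posNZ (n + j)) (m : ℕ)
    (hm : colorAct (starProd x n m)⁻¹ f ∈ symColorings n) :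
    ∀ j < m, f (posNZ (n + j)) = f x := by
  have hneg : ∀ m j, (starProd x n m).1 (-posNZ (n + j)) = -posNZ (n + j) := by
    intro m
    induction m with
    | zero => exact fun _ => rfl
    | succ m ih =>
      intro j
      rw [starProd, mul_apply', transposition_of_ne (hxw' j).symm (neg_posNZ_ne _ _), ih]
  have hfix : ∀ m j, m ≤ j → (starProd x n m).1 (posNZ (n + j)) = posNZ (n + j) := by
    intro m
    induction m with
    | zero => exact fun _ _ => rfl
    | succ m ih =>
      intro j hj
      rw [starProd, mul_apply', transposition_of_ne (hxw j).symm
        (by rw [Ne, posNZ_inj]; omega), ih j (by omega)]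
  have hval : ∀ m j, j + 1 < m → (starProd x n m).1 (posNZ (n + (j + 1))) = posNZ (n + j) := by
    intro m
    induction m with
    | zero => intro j hj; omega
    | succ m ih =>
      intro j hj
      rw [starProd, mul_apply']
      rcases Nat.lt_succ_iff_lt_or_eq.1 hj with h | h
      · rw [transposition_of_ne (hxw _).symm (by rw [Ne, posNZ_inj]; omega), ih j h]
      · obtain rfl : m = j + 1 := h.symm
        rw [transposition_right]
        rw [starProd, mul_apply', transposition_left, hfix j j le_rfl]
  have hval0 : ∀ m, 0 < m → (starProd x n m).1 (posNZ n) = x := by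
    intro m hm
    induction m with
    | zero => omega
    | succ m ih =>
      rw [starProd, mul_apply']
      rcases Nat.eq_zero_or_pos m with rfl | h
      · rw [add_zero, transposition_right]
        rfl
      · rw [transposition_of_ne hx.symm (by rw [Ne, posNZ_inj]; omega), ih h]
  -- The star product fixes the points `-posNZ (n + j)`. Symmetry of `f` and of its image therefore
  -- shows that `f` takes the same value at a point `posNZ (n + j)` and at its image under the star
  -- product.
  have key : ∀ j, f ((starProd x n m).1 (posNZ (n + j))) = f (posNZ (n + j)) := by
    intro j
    have h := hm (posNZ (n + j)) (by simp)
    rw [colorAct, colorAct, inv_inv, hneg] at h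
    rw [← h, hn _ (by simp)]
  intro j hj
  induction j with
  | zero =>
    have := key 0
    rw [add_zero, hval0 m hj] at this
    rw [add_zero, this]
  | succ j ih =>
    have := key (j + 1)
    rw [hval m j hj] at this
    rw [← this, ih (by omega)]

end Cocycle

/-! ### The Hewitt–Savage zero-one law -/

section HewittSavage

variable {X : Type*} [MeasurableSpace X] (κ : Measure X) [IsProbabilityMeasure κ]

/-- The law of an independent sequence. -/
abbrev seqLaw : Measure (ℕ → X) := Measure.infinitePi fun _ => κ

theorem measurePreserving_comp_injective {τ : ℕ → ℕ} (hτ : Function.Injective τ) :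
    MeasurePreserving (fun s : ℕ → X => s ∘ τ) (seqLaw κ) (seqLaw κ) := by
  have hm : Measurable fun s : ℕ → X => s ∘ τ :=
    measurable_pi_lambda _ fun i => measurable_pi_apply _
  refine ⟨hm, Measure.eq_infinitePi _ fun I t ht => ?_⟩
  classical
  rw [Measure.map_apply hm (MeasurableSet.pi I.countable_toSet fun i _ => ht i)]
  have : (fun s : ℕ → X => s ∘ τ) ⁻¹' Set.pi I t =
      Set.pi (I.image τ) fun j => t (Function.invFun τ j) := by
    ext s
    simp only [Set.mem_preimage, Set.mem_pi, Finset.mem_coe, Finset.mem_image, Function.comp,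
      forall_exists_index, and_imp, forall_apply_eq_imp_iff₂, Function.leftInverse_invFun hτ _]
  rw [this, Measure.infinitePi_pi _ (fun i _ => ht _), Finset.prod_image hτ.injOn]
  exact Finset.prod_congr rfl fun i _ => by rw [Function.leftInverse_invFun hτ i]

theorem isSetAlgebra_measurableCylinders :
    IsSetAlgebra (measurableCylinders fun _ : ℕ => X) where
  empty_mem := empty_mem_measurableCylinders _
  compl_mem _ h := compl_mem_measurableCylinders h
  union_mem _ _ h h' := union_mem_measurableCylinders h h'

/-- The involution that exchanges `j` and `N + j` for `j < k`. -/
def blockSwap (N : ℕ) : ℕ → Equiv.Perm ℕ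
  | 0 => 1
  | k + 1 => blockSwap N k * Equiv.swap k (N + k)

theorem blockSwap_apply (N : ℕ) {k j : ℕ} (hk : k ≤ N) :
    (j < k → blockSwap N k j = N + j) ∧ (k ≤ j → j < N → blockSwap N k j = j) ∧
      (N + k ≤ j → blockSwap N k j = j) := by
  induction k with
  | zero => exact ⟨fun h => absurd h (by omega), fun _ _ => rfl, fun _ => rfl⟩
  | succ k ih =>
    obtain ⟨h1, h2, h3⟩ := ih (by omega)
    refine ⟨fun h => ?_, fun h h' => ?_, fun h => ?_⟩
    · rw [blockSwap, Equiv.Perm.mul_apply]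
      rcases Nat.lt_succ_iff_lt_or_eq.1 h with h | rfl
      · rw [Equiv.swap_apply_of_ne_of_ne (by omega) (by omega), h1 h]
      · rw [Equiv.swap_apply_left]
        have h4 : ∀ k' ≤ j, ∀ i, N + k' ≤ i → blockSwap N k' i = i := by
          intro k' hk'
          induction k' with
          | zero => exact fun _ _ => rfl
          | succ k' ih' =>
            intro i hi
            rw [blockSwap, Equiv.Perm.mul_apply,
              Equiv.swap_apply_of_ne_of_ne (by omega) (by omega), ih' (by omega) i (by omega)]
        exact h4 j le_rfl _ le_rfl
    · rw [blockSwap, Equiv.Perm.mul_apply, Equiv.swap_apply_of_ne_of_ne (by omega) (by omega),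
        h2 (by omega) h']
    · rw [blockSwap, Equiv.Perm.mul_apply, Equiv.swap_apply_of_ne_of_ne (by omega) (by omega),
        h3 (by omega)]

variable {κ}

theorem ae_comp_blockSwap {A : Set (ℕ → X)}
    (hinv : ∀ a b, (fun s : ℕ → X => s ∘ Equiv.swap a b) ⁻¹' A =ᵐ[seqLaw κ] A) (N k : ℕ) :
    (fun s : ℕ → X => s ∘ blockSwap N k) ⁻¹' A =ᵐ[seqLaw κ] A := by
  induction k with
  | zero => exact EventuallyEq.rfl
  | succ k ih =>
    have h := (measurePreserving_comp_injective κ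
      (blockSwap N k).injective).quasiMeasurePreserving.preimage_ae_eq (hinv k (N + k))
    exact h.trans ih

/-- `B` and `C` play the role of independent events of equal probability that are both within `ε` of
`A`; so `A` is almost independent of itself. -/
theorem symmDiff_measure_bound {Ω : Type*} [MeasurableSpace Ω] {P : Measure Ω}
    [IsProbabilityMeasure P] {A B C : Set Ω} {ε : ℝ} (hA : NullMeasurableSet A P)
    (hB : NullMeasurableSet B P) (hC : NullMeasurableSet C P)
    (h1 : P.real (symmDiff A B) ≤ ε) (h2 : P.real (symmDiff A C) ≤ ε)
    (h3 : P.real C = P.real B)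
    (h4 : P.real (B ∩ C) = P.real B * P.real B) : P.real A - P.real A * P.real A ≤ 4 * ε := by
  have hAB : P.real A ≤ P.real (B ∩ C) + 2 * ε := by
    have hsub : A ⊆ (B ∩ C) ∪ (symmDiff A B ∪ symmDiff A C) := by
      intro x hx
      by_cases hb : x ∈ B
      · by_cases hc : x ∈ C
        · exact Or.inl ⟨hb, hc⟩
        · exact Or.inr (Or.inr (Or.inl ⟨hx, hc⟩))
      · exact Or.inr (Or.inl (Or.inl ⟨hx, hb⟩))
    have := measureReal_mono (μ := P) hsub
    have h5 := measureReal_union_le (μ := P) (B ∩ C) (symmDiff A B ∪ symmDiff A C)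
    have h6 := measureReal_union_le (μ := P) (symmDiff A B) (symmDiff A C)
    linarith
  have hBA : P.real B ≤ P.real A + ε := by
    have hsub : B ⊆ A ∪ symmDiff A B := by
      intro x hx
      by_cases ha : x ∈ A
      · exact Or.inl ha
      · exact Or.inr (Or.inr ⟨hx, ha⟩)
    have := measureReal_mono (μ := P) hsub
    have h5 := measureReal_union_le (μ := P) A (symmDiff A B)
    linarith
  have h7 : P.real A ≤ 1 := measureReal_le_one
  have h8 : P.real B ≤ 1 := measureReal_le_one
  have h9 : 0 ≤ P.real A := measureReal_nonneg
  have h10 : 0 ≤ P.real B := measureReal_nonneg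
  have hε : 0 ≤ ε := measureReal_nonneg.trans h1
  have h11 : P.real B * P.real B ≤ P.real B * (P.real A + ε) := mul_le_mul_of_nonneg_left hBA h10
  have h12 : P.real B * P.real A ≤ (P.real A + ε) * P.real A := mul_le_mul_of_nonneg_right hBA h9
  have h13 : P.real B * ε ≤ ε := mul_le_of_le_one_left hε h8
  have h14 : ε * P.real A ≤ ε := mul_le_of_le_one_right hε h7
  linarith

/-- The Hewitt–Savage zero-one law. -/
theorem measure_zero_or_one_of_swap {A : Set (ℕ → X)} (hA : NullMeasurableSet A (seqLaw κ))
    (hinv : ∀ a b, (fun s : ℕ → X => s ∘ Equiv.swap a b) ⁻¹' A =ᵐ[seqLaw κ] A) :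
    (∀ᵐ s ∂seqLaw κ, s ∈ A) ∨ ∀ᵐ s ∂seqLaw κ, s ∉ A := by
  have hdense := Measure.MeasureDense.of_generateFrom_isSetAlgebra_finite (seqLaw κ)
    (isSetAlgebra_measurableCylinders (X := X)) generateFrom_measurableCylinders.symm
  have key : ∀ ε : ℝ, 0 < ε →
      (seqLaw κ).real A - (seqLaw κ).real A * (seqLaw κ).real A ≤ 4 * ε := by
    intro ε hε
    obtain ⟨A', -, hA', hAA'⟩ := hA.exists_measurable_superset_ae_eq
    obtain ⟨B, hB, hAB⟩ := hdense.approx A' hA' (measure_ne_top _ _) ε hε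
    have hBm := hdense.measurable B hB
    have hAB' : (seqLaw κ) (symmDiff A B) < ENNReal.ofReal ε := by
      rwa [measure_congr (hAA'.symm.symmDiff (EventuallyEq.refl _ B))]
    obtain ⟨I, S, hS, rfl⟩ := (mem_measurableCylinders B).1 hB
    obtain ⟨N, hN⟩ : ∃ N, ∀ i ∈ I, i < N := ⟨I.sup id + 1, fun i hi =>
      Nat.lt_succ_of_le (Finset.le_sup (f := id) hi)⟩
    -- The block swap moves the finitely many coordinates that determine the cylinder to disjoint
    -- ones, so the cylinder and its preimage are independent.
    let σ := blockSwap N N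
    have hσ : ∀ i ∈ I, σ i = N + i := fun i hi => (blockSwap_apply N le_rfl).1 (hN i hi)
    have hmp := measurePreserving_comp_injective κ σ.injective
    let C := (fun s : ℕ → X => s ∘ σ) ⁻¹' cylinder I S
    have hCm : MeasurableSet C := hmp.measurable hBm
    have hAC : (seqLaw κ) (symmDiff A C) = (seqLaw κ) (symmDiff A (cylinder I S)) := by
      rw [← hmp.measure_preimage (hA.symmDiff hBm.nullMeasurableSet)]
      exact measure_congr ((ae_comp_blockSwap hinv N N).symm.symmDiff (EventuallyEq.refl _ C))
    have hBC : (seqLaw κ) (cylinder I S ∩ C) = (seqLaw κ) (cylinder I S) * (seqLaw κ) C := by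
      have hind := (ProbabilityTheory.iIndepFun_infinitePi (P := fun _ : ℕ => κ)
        (X := fun _ x => x) (fun _ => measurable_id)).indepFun_finset I (I.image σ) (by
          rw [Finset.disjoint_left]
          rintro i hi hi'
          obtain ⟨j, hj, rfl⟩ := Finset.mem_image.1 hi'
          have := hN _ hi
          rw [hσ j hj] at this
          omega) (fun _ => measurable_pi_apply _)
      let r : (∀ i : (I.image σ : Finset ℕ), X) → (∀ i : I, X) :=
        fun t i => t ⟨σ i, Finset.mem_image_of_mem _ i.2⟩
      have hr : Measurable r := measurable_pi_lambda _ fun i => measurable_pi_apply _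
      exact hind.measure_inter_preimage_eq_mul S (r ⁻¹' S) hS (hr hS)
    refine symmDiff_measure_bound hA hBm.nullMeasurableSet hCm.nullMeasurableSet
      (ENNReal.toReal_le_of_le_ofReal hε.le hAB'.le)
      (ENNReal.toReal_le_of_le_ofReal hε.le (hAC.trans_le hAB'.le)) ?_ ?_
    · exact congrArg ENNReal.toReal (hmp.measure_preimage hBm.nullMeasurableSet)
    · rw [Measure.real, hBC, ENNReal.toReal_mul, hmp.measure_preimage hBm.nullMeasurableSet]
      rfl
  have h0 : (seqLaw κ).real A - (seqLaw κ).real A * (seqLaw κ).real A ≤ 0 := by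
    refine le_of_forall_pos_le_add fun ε hε => ?_
    have := key (ε / 4) (by positivity)
    linarith
  have h1 : (seqLaw κ).real A ≤ 1 := measureReal_le_one
  have h2 : 0 ≤ (seqLaw κ).real A := measureReal_nonneg
  have h3 : (seqLaw κ).real A = 0 ∨ (seqLaw κ).real A = 1 := by
    rcases h2.eq_or_lt with h | h
    · exact Or.inl h.symm
    · right
      nlinarith
  rcases h3 with h | h
  · right
    rw [← measure_eq_zero_iff_ae_notMem]
    exact (measureReal_eq_zero_iff).1 h
  · left
    have h4 : (seqLaw κ) A = 1 := by
      rw [Measure.real] at h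
      rw [← ENNReal.ofReal_toReal (measure_ne_top (seqLaw κ) A), h, ENNReal.ofReal_one]
    exact (prob_compl_eq_zero_iff₀ hA).2 h4

/-- A function of an independent sequence that is invariant under all transpositions of the index
set is constant. -/
theorem exists_ae_eq_const_of_swap {Y : Type*} [TopologicalSpace Y]
    [TopologicalSpace.MetrizableSpace Y] [Nonempty Y] {Φ : (ℕ → X) → Y}
    (hΦ : AEStronglyMeasurable Φ (seqLaw κ))
    (hinv : ∀ a b, ∀ᵐ s ∂seqLaw κ, Φ (s ∘ Equiv.swap a b) = Φ s) :
    ∃ c, Φ =ᵐ[seqLaw κ] fun _ => c := by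
  borelize Y
  rcases hΦ.isSeparable_ae_range with ⟨t, ht, hgt⟩
  have := ht.secondCountableTopology
  refine exists_eventuallyEq_const_of_eventually_mem_of_forall_separating MeasurableSet hgt ?_
  refine fun U hU => measure_zero_or_one_of_swap (hΦ.aemeasurable.nullMeasurable hU) fun a b => ?_
  refine ((hinv a b).mono fun s hs => ?_).set_eq
  change Φ (s ∘ Equiv.swap a b) ∈ U ↔ Φ s ∈ U
  rw [hs]

end HewittSavage

/-! ### Colorings with prescribed colors in a window -/

section TailGlue

variable {n : ℕ} {w : window n → ℕ} {s : ℕ → ℕ} {x : NZ} {f : Coloring}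

open Classical in
/-- The coloring from `X_n` with given colors at `±1, …, ±n` and with color `s j` at
`±(n + 1 + j)`. -/
def tailGlue (n : ℕ) (w : window n → ℕ) (s : ℕ → ℕ) : Coloring :=
  fun x => if h : x ∈ window n then w ⟨x, h⟩ else s (x.1.natAbs - n - 1)

theorem glue_eq_tailGlue (n : ℕ) (w : window n → ℕ) (t : ℕ → ℕ) :
    glue n w t = tailGlue n w (t ∘ fun j => n + 1 + j) := by
  funext x
  rw [glue, tailGlue]
  split_ifs with h
  · rfl
  · rw [mem_window'] at h
    rw [Function.comp]
    congr 1
    omega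

theorem tailGlue_window (x : window n) : tailGlue n w s x = w x := dif_pos x.2

theorem tailGlue_of_mem (h : x ∈ window n) : tailGlue n w s x = w ⟨x, h⟩ := dif_pos h

theorem tailGlue_posNZ (j : ℕ) : tailGlue n w s (posNZ (n + j)) = s j := by
  rw [tailGlue, dif_neg (by simp)]
  congr 1
  simp only [posNZ_val]
  omega

theorem tailGlue_posNZ_self : tailGlue n w s (posNZ n) = s 0 := tailGlue_posNZ 0

theorem tailGlue_mem : tailGlue n w s ∈ symColorings n := fun x hx => by
  rw [tailGlue, tailGlue, dif_neg hx, dif_neg (mt neg_mem_window.1 hx), NZ.neg_val, Int.natAbs_neg]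

theorem eq_of_symColorings {f' : Coloring} (hf : f ∈ symColorings n) (hf' : f' ∈ symColorings n)
    (h1 : ∀ x ∈ window n, f x = f' x) (h2 : ∀ j, f (posNZ (n + j)) = f' (posNZ (n + j))) :
    f = f' := by
  funext x
  by_cases hx : x ∈ window n
  · exact h1 x hx
  · obtain ⟨m, rfl | rfl⟩ := posNZ_cases x
    · have hm : n ≤ m := by simpa using hx
      have := h2 (m - n)
      rwa [Nat.add_sub_cancel' hm] at this
    · have hm : n ≤ m := by simpa using hx
      have := h2 (m - n)
      rw [Nat.add_sub_cancel' hm] at this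
      rw [hf _ (by simpa using hm), hf' _ (by simpa using hm), this]

theorem eq_tailGlue (hf : f ∈ symColorings n) (h1 : ∀ x : window n, f x = w x)
    (h2 : ∀ j, f (posNZ (n + j)) = s j) : f = tailGlue n w s :=
  eq_of_symColorings hf tailGlue_mem (fun x hx => by rw [tailGlue_of_mem hx, ← h1])
    fun j => by rw [tailGlue_posNZ, h2]

theorem measurable_tailGlue (n : ℕ) (w : window n → ℕ) : Measurable (tailGlue n w) := by
  refine measurable_pi_lambda _ fun x => ?_
  unfold tailGlue
  split_ifs
  · exact measurable_const
  · exact measurable_pi_apply _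

theorem measurableSet_symColorings (n : ℕ) : MeasurableSet (symColorings n) := by
  have : symColorings n = ⋂ x : NZ, ⋂ _ : x ∉ window n, {f : Coloring | f (-x) = f x} := by
    ext f
    simp [symColorings]
  rw [this]
  exact MeasurableSet.iInter fun x => MeasurableSet.iInter fun _ =>
    measurableSet_eq_fun (measurable_pi_apply _) (measurable_pi_apply _)

theorem measurableSet_colors (n : ℕ) (w : window n → ℕ) :
    MeasurableSet {f : Coloring | ∀ x : window n, f x = w x} := by
  rw [Set.ofPred_forall]
  exact MeasurableSet.iInter fun x => measurableSet_eq_fun (measurable_pi_apply _) measurable_const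

theorem measurableEmbedding_tailGlue (n : ℕ) (w : window n → ℕ) :
    MeasurableEmbedding (tailGlue n w) := by
  refine MeasurableEmbedding.of_measurable_inverse
    (g := fun f : Coloring => fun j => f (posNZ (n + j))) (measurable_tailGlue n w) ?_
    (measurable_pi_lambda _ fun j => measurable_pi_apply _)
    (fun s => funext fun j => tailGlue_posNZ j)
  have : Set.range (tailGlue n w) = symColorings n ∩ {f | ∀ x : window n, f x = w x} := by
    ext f
    constructor
    · rintro ⟨s, rfl⟩
      exact ⟨tailGlue_mem, tailGlue_window⟩
    · rintro ⟨h1, h2⟩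
      exact ⟨_, (eq_tailGlue h1 h2 fun j => rfl).symm⟩
  rw [this]
  exact (measurableSet_symColorings n).inter (measurableSet_colors n w)

theorem colorAct_ofWindow_tailGlue (τ : Equiv.Perm (window n)) :
    colorAct (ofWindow n τ) (tailGlue n w s) = tailGlue n (w ∘ τ.symm) s := by
  refine eq_tailGlue ((suppIn_ofWindow n τ).colorAct_mem tailGlue_mem) (fun x => ?_) fun j => ?_
  · have := ofWindow_apply n τ (τ.symm x)
    rw [Equiv.apply_symm_apply] at this
    rw [← this, colorAct_apply_apply, tailGlue_window]
    rfl
  · have := suppIn_ofWindow n τ (posNZ (n + j)) (by simp)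
    conv_lhs => rw [← this]
    rw [colorAct_apply_apply, tailGlue_posNZ]

theorem colorAct_signedSwap_tailGlue (a b : ℕ) :
    colorAct (signedSwap (posNZ (n + a)) (posNZ (n + b))) (tailGlue n w s) =
      tailGlue n w (s ∘ Equiv.swap a b) := by
  have hk : signedSwap (posNZ (n + a)) (posNZ (n + b)) ∈ K n :=
    signedSwap_mem_K (by simp) (by simp)
  have hne : posNZ (n + a) ≠ -posNZ (n + b) := (neg_posNZ_ne _ _).symm
  refine eq_tailGlue (colorAct_mem_symColorings_K hk tailGlue_mem) (fun x => ?_) fun j => ?_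
  · rw [colorAct_K_apply hk x.2, tailGlue_window]
  · rw [Function.comp]
    by_cases h1 : j = a
    · subst h1
      have := colorAct_apply_apply (signedSwap (posNZ (n + j)) (posNZ (n + b)))
        (tailGlue n w s) (posNZ (n + b))
      rw [signedSwap_right hne, tailGlue_posNZ] at this
      rw [this, Equiv.swap_apply_left]
    by_cases h2 : j = b
    · subst h2
      have := colorAct_apply_apply (signedSwap (posNZ (n + a)) (posNZ (n + j)))
        (tailGlue n w s) (posNZ (n + a))
      rw [signedSwap_left hne, tailGlue_posNZ] at this
      rw [this, Equiv.swap_apply_right]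
    · rw [Equiv.swap_apply_of_ne_of_ne h1 h2]
      have : (signedSwap (posNZ (n + a)) (posNZ (n + b))).1 (posNZ (n + j)) = posNZ (n + j) :=
        signedSwap_of_ne (by rw [Ne, posNZ_inj]; omega) (by rw [Ne, posNZ_inj]; omega)
          (neg_posNZ_ne _ _).symm (neg_posNZ_ne _ _).symm
      conv_lhs => rw [← this]
      rw [colorAct_apply_apply, tailGlue_posNZ]

end TailGlue

/-! ### Independent sequences of colors -/

section Law

variable (p : Weights)

theorem law_singleton (i : ℕ) : p.law {i} = ENNReal.ofReal (p i) := by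
  rw [Weights.law, Measure.sum_apply _ (measurableSet_singleton i), tsum_eq_single i]
  · simp
  · intro j hj
    simp [hj]

theorem lintegral_law (φ : ℕ → ℝ≥0∞) : ∫⁻ i, φ i ∂p.law = ∑' i, ENNReal.ofReal (p i) * φ i := by
  rw [lintegral_countable']
  exact tsum_congr fun i => by rw [law_singleton, mul_comm]

/-- The sequence `i, s 0, s 1, …`. -/
def consSeq (i : ℕ) (s : ℕ → ℕ) : ℕ → ℕ
  | 0 => i
  | j + 1 => s j

theorem measurable_consSeq (i : ℕ) : Measurable (consSeq i) := by
  refine measurable_pi_lambda _ fun j => ?_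
  cases j with
  | zero => exact measurable_const
  | succ j => exact measurable_pi_apply j

theorem measurable_consSeq_uncurry : Measurable fun q : ℕ × (ℕ → ℕ) => consSeq q.1 q.2 :=
  measurable_from_prod_countable_right measurable_consSeq

/-- Prepending an independent term to an independent sequence does not change its law. This
underlies the compatibility of the measures on `X_n` and `X_{n+1}`. -/
theorem map_consSeq {κ : Measure ℕ} [IsProbabilityMeasure κ] :
    (κ.prod (seqLaw κ)).map (fun q => consSeq q.1 q.2) = seqLaw κ := by
  classical
  refine Measure.eq_infinitePi _ fun I t ht => ?_
  rw [Measure.map_apply measurable_consSeq_uncurry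
    (MeasurableSet.pi I.countable_toSet fun i _ => ht i)]
  let t' : ℕ → Set ℕ := fun i => if i ∈ I then t i else Set.univ
  obtain ⟨N, hN⟩ : ∃ N, ∀ i ∈ I, i < N + 1 := ⟨I.sup id, fun i hi =>
    Nat.lt_succ_of_le (Finset.le_sup (f := id) hi)⟩
  have h1 : (fun q : ℕ × (ℕ → ℕ) => consSeq q.1 q.2) ⁻¹' Set.pi I t =
      t' 0 ×ˢ Set.pi (Finset.range N) fun j => t' (j + 1) := by
    ext ⟨i, s⟩
    simp only [Set.mem_preimage, Set.mem_pi, Finset.mem_coe, Set.mem_prod, Finset.mem_range, t']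
    constructor
    · intro h
      refine ⟨?_, fun j hj => ?_⟩
      · split_ifs with h0
        · exact h 0 h0
        · trivial
      · split_ifs with h0
        · exact h (j + 1) h0
        · trivial
    · rintro ⟨h0, h⟩ j hj
      cases j with
      | zero => rwa [if_pos hj] at h0
      | succ j =>
        have := h j (by have := hN _ hj; omega)
        rwa [if_pos hj] at this
  have h2 : ∏ i ∈ I, κ (t i) = ∏ i ∈ Finset.range (N + 1), κ (t' i) := by
    refine Finset.prod_subset_one_on_sdiff (fun i hi => Finset.mem_range.2 (hN i hi))
      (fun i hi => ?_) (fun i hi => ?_)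
    · simp [t', (Finset.mem_sdiff.1 hi).2]
    · simp [t', hi]
  rw [h1, Measure.prod_prod, h2, Finset.prod_range_succ',
    Measure.infinitePi_pi _ (fun i _ => MeasurableSet.of_discrete), mul_comm]

theorem seqLaw_law_apply {A : Set (ℕ → ℕ)} (hA : MeasurableSet A) :
    seqLaw p.law A = ∑' i, ENNReal.ofReal (p i) * seqLaw p.law (consSeq i ⁻¹' A) := by
  conv_lhs => rw [← map_consSeq]
  rw [Measure.map_apply measurable_consSeq_uncurry hA,
    Measure.prod_apply (measurable_consSeq_uncurry hA), lintegral_law]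
  rfl

theorem ae_infinite_color : ∀ᵐ s ∂seqLaw p.law, ∀ i, {j | s j = i}.Infinite := by
  rw [ae_all_iff]
  intro i
  have h1 : ∀ N, ∀ᵐ s ∂seqLaw p.law, ∃ j ≥ N, s j = i := by
    intro N
    have hq : p.law {i}ᶜ < 1 := by
      rw [prob_compl_eq_one_sub (measurableSet_singleton i), law_singleton]
      exact ENNReal.sub_lt_self ENNReal.one_ne_top one_ne_zero
        (ENNReal.ofReal_pos.2 (p.pos i)).ne'
    have hle : ∀ M, seqLaw p.law {s | ¬ ∃ j ≥ N, s j = i} ≤ p.law {i}ᶜ ^ M := by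
      intro M
      have := Measure.infinitePi_pi (μ := fun _ : ℕ => p.law) (s := Finset.Ico N (N + M))
        (t := fun _ => {i}ᶜ) (fun _ _ => MeasurableSet.of_discrete)
      rw [Finset.prod_const, Nat.card_Ico, Nat.add_sub_cancel_left] at this
      rw [← this]
      refine measure_mono fun s hs j hj => ?_
      intro h
      exact hs ⟨j, (Finset.mem_Ico.1 hj).1, h⟩
    rw [ae_iff]
    exact le_antisymm (ge_of_tendsto' (ENNReal.tendsto_pow_atTop_nhds_zero_of_lt_one hq) hle)
      (zero_le)
  filter_upwards [ae_all_iff.2 h1] with s hs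
  rw [Set.infinite_iff_exists_gt]
  intro N
  obtain ⟨j, hj, h⟩ := hs (N + 1)
  exact ⟨j, h, hj⟩

end Law

/-! ### The measure `ω` -/

section Omega

variable (p : Weights) {n : ℕ}

/-- The measure of the set of colorings from `X_n` with given colors at `±1, …, ±n`. -/
def weight (n : ℕ) (w : window n → ℕ) : ℝ := ∏ x, √(p (w x))

theorem weight_pos (w : window n → ℕ) : 0 < weight p n w :=
  Finset.prod_pos fun x _ => Real.sqrt_pos.2 (p.pos _)

theorem map_glue (w : window n → ℕ) :
    (seqLaw p.law).map (glue n w) = (seqLaw p.law).map (tailGlue n w) := by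
  have h := measurePreserving_comp_injective p.law (τ := fun j => n + 1 + j)
    (fun a b h => by simpa using h)
  have h2 : glue n w = tailGlue n w ∘ fun s => s ∘ fun j => n + 1 + j :=
    funext fun t => glue_eq_tailGlue n w t
  rw [h2, ← Measure.map_map (measurable_tailGlue n w) h.measurable, h.map_eq]

theorem omegaOn_eq (n : ℕ) : omegaOn p n = Measure.sum fun w : window n → ℕ =>
    ENNReal.ofReal (weight p n w) • (seqLaw p.law).map (tailGlue n w) := by
  simp only [omegaOn, ← map_glue]
  rfl

theorem omegaOn_apply {A : Set Coloring} (hA : MeasurableSet A) : omegaOn p n A =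
    ∑' w : window n → ℕ, ENNReal.ofReal (weight p n w) * seqLaw p.law (tailGlue n w ⁻¹' A) := by
  rw [omegaOn_eq, Measure.sum_apply _ hA]
  refine tsum_congr fun w => ?_
  rw [Measure.smul_apply, smul_eq_mul, Measure.map_apply (measurable_tailGlue n w) hA]

/-- The extension of colors by a color for `±(n + 1)`. -/
def extendColors (w : window n → ℕ) (i : ℕ) : window (n + 1) → ℕ :=
  fun x => tailGlue n w (fun _ => i) x

theorem tailGlue_extendColors (w : window n → ℕ) (i : ℕ) (s : ℕ → ℕ) :
    tailGlue (n + 1) (extendColors w i) s = tailGlue n w (consSeq i s) := by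
  symm
  refine eq_tailGlue (symColorings_mono (Nat.le_succ n) tailGlue_mem) (fun x => ?_) fun j => ?_
  · rw [extendColors]
    rcases mem_window_succ.1 x.2 with h | h | h
    · rw [tailGlue_of_mem h, tailGlue_of_mem h]
    · rw [h, tailGlue_posNZ_self, tailGlue_posNZ_self]
      rfl
    · rw [h, tailGlue_mem _ (by simp), tailGlue_mem _ (by simp), tailGlue_posNZ_self,
        tailGlue_posNZ_self]
      rfl
  · rw [add_assoc, tailGlue_posNZ, add_comm]
    rfl

theorem extendColors_injective :
    Function.Injective fun q : (window n → ℕ) × ℕ => extendColors q.1 q.2 := by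
  rintro ⟨w, i⟩ ⟨w', i'⟩ h
  have h' : ∀ x ∈ window (n + 1), tailGlue n w (fun _ => i) x = tailGlue n w' (fun _ => i') x :=
    fun x hx => congrFun h ⟨x, hx⟩
  refine Prod.ext (funext fun x => ?_) ?_
  · have := h' x (mem_window_succ.2 (Or.inl x.2))
    rwa [tailGlue_window, tailGlue_window] at this
  · have := h' (posNZ (n + 0)) (by simp)
    rwa [tailGlue_posNZ, tailGlue_posNZ] at this

theorem prod_window_succ (n : ℕ) (φ : NZ → ℝ) :
    ∏ x : window (n + 1), φ x = (∏ x : window n, φ x) * (φ (posNZ n) * φ (-posNZ n)) := by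
  classical
  have h : ∀ m, ∏ x : window m, φ x = ∏ x ∈ (window_finite m).toFinset, φ x := fun m =>
    (Finset.prod_subtype _ (fun x => by simp) φ).symm
  rw [h, h]
  have h1 : (window_finite (n + 1)).toFinset =
      (window_finite n).toFinset ∪ {posNZ n, -posNZ n} := by
    ext x
    simp only [Set.Finite.mem_toFinset, mem_window_succ, Finset.mem_union, Finset.mem_insert,
      Finset.mem_singleton]
  rw [h1, Finset.prod_union, Finset.prod_pair (NZ.neg_ne _).symm]
  rw [Finset.disjoint_left]
  intro x hx hx'
  simp only [Set.Finite.mem_toFinset, Finset.mem_insert, Finset.mem_singleton] at hx hx'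
  rcases hx' with rfl | rfl <;> simp at hx

theorem weight_extendColors (w : window n → ℕ) (i : ℕ) :
    weight p (n + 1) (extendColors w i) = weight p n w * p i := by
  have h := prod_window_succ n fun x => √(p (tailGlue n w (fun _ => i) x))
  rw [weight, weight]
  refine h.trans ?_
  have h1 := tailGlue_posNZ (n := n) (w := w) (s := fun _ => i) 0
  rw [add_zero] at h1
  rw [tailGlue_mem _ (by simp), h1, Real.mul_self_sqrt (p.pos i).le]
  congr 1
  exact Finset.prod_congr rfl fun x _ => by rw [tailGlue_window]

/-- A coloring in `X_n` has equal colors at `±(n + 1)`. The weight on `X_{n+1}` gives this pair the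
factor `√p_i · √p_i = p_i`, which is the probability of its color under the law on `X_n`. This is
the reason for the square roots. -/
theorem omegaOn_succ_restrict (n : ℕ) :
    (omegaOn p (n + 1)).restrict (symColorings n) = omegaOn p n := by
  ext A hA
  rw [Measure.restrict_apply hA, omegaOn_apply p (hA.inter (measurableSet_symColorings n)),
    omegaOn_apply p hA]
  have hsupp : Function.support (fun w : window (n + 1) → ℕ => ENNReal.ofReal (weight p (n + 1) w) *
      seqLaw p.law (tailGlue (n + 1) w ⁻¹' (A ∩ symColorings n))) ⊆
      Set.range fun q : (window n → ℕ) × ℕ => extendColors q.1 q.2 := by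
    intro w hw
    have hne : (tailGlue (n + 1) w ⁻¹' (A ∩ symColorings n)).Nonempty := by
      by_contra h
      rw [Set.not_nonempty_iff_eq_empty] at h
      exact hw (by simp [h])
    obtain ⟨s, -, hs⟩ := hne
    refine ⟨(fun x => w ⟨x, mem_window_succ.2 (Or.inl x.2)⟩, w ⟨posNZ n, by simp⟩), ?_⟩
    funext x
    change tailGlue n _ _ x.1 = _
    rcases mem_window_succ.1 x.2 with h | h | h
    · rw [tailGlue_of_mem h]
    · have : x = ⟨posNZ n, by simp⟩ := Subtype.ext h
      rw [this]
      exact tailGlue_posNZ (s := fun _ => w ⟨posNZ n, by simp⟩) 0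
    · have : x = ⟨-posNZ n, by simp⟩ := Subtype.ext h
      rw [this]
      have h3 := hs (posNZ n) (by simp)
      rw [tailGlue_of_mem (by simp), tailGlue_of_mem (by simp)] at h3
      rw [h3]
      dsimp only
      rw [tailGlue_mem _ (by simp)]
      exact tailGlue_posNZ (s := fun _ => w ⟨posNZ n, by simp⟩) 0
  rw [← extendColors_injective.tsum_eq hsupp, ENNReal.tsum_prod']
  refine tsum_congr fun w => ?_
  rw [seqLaw_law_apply p (measurable_tailGlue n w hA), ← ENNReal.tsum_mul_left]
  refine tsum_congr fun i => ?_
  dsimp only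
  rw [weight_extendColors, ENNReal.ofReal_mul (weight_pos p w).le, mul_assoc]
  congr 3
  ext s
  simp only [Set.mem_preimage, tailGlue_extendColors, Set.mem_inter_iff, tailGlue_mem, and_true]

theorem omegaOn_compl (n : ℕ) : omegaOn p n (symColorings n)ᶜ = 0 := by
  rw [omegaOn_apply p (measurableSet_symColorings n).compl, ENNReal.tsum_eq_zero]
  intro w
  have : tailGlue n w ⁻¹' (symColorings n)ᶜ = ∅ := by
    ext s
    simp [tailGlue_mem]
  rw [this, measure_empty, mul_zero]

theorem omegaOn_restrict_self (n : ℕ) : (omegaOn p n).restrict (symColorings n) = omegaOn p n :=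
  Measure.restrict_eq_self_of_ae_mem (by
    rw [ae_iff]
    exact omegaOn_compl p n)

theorem omegaOn_restrict {k n : ℕ} (h : k ≤ n) :
    (omegaOn p n).restrict (symColorings k) = omegaOn p k := by
  induction n, h using Nat.le_induction with
  | base => exact omegaOn_restrict_self p k
  | succ n hn ih =>
    rw [← ih, ← omegaOn_succ_restrict p n,
      Measure.restrict_restrict (measurableSet_symColorings k),
      Set.inter_eq_left.2 (symColorings_mono hn)]

theorem measurableSet_symColorings_lt (n : ℕ) : MeasurableSet (⋃ m < n, symColorings m) :=
  MeasurableSet.iUnion fun m => MeasurableSet.iUnion fun _ => measurableSet_symColorings m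

/-- The shells with index `k > n` do not meet `X_n`, and on the other shells compatibility allows
`omegaOn p k` to be replaced by `omegaOn p n`. -/
theorem omega_restrict (n : ℕ) : (omega p).restrict (symColorings n) = omegaOn p n := by
  ext A hA
  let D : ℕ → Set Coloring := fun k => symColorings k \ ⋃ m < k, symColorings m
  have hD : ∀ k, MeasurableSet (D k) := fun k =>
    (measurableSet_symColorings k).diff (measurableSet_symColorings_lt k)
  have hAn := hA.inter (measurableSet_symColorings n)
  have hDn : ∀ k, n < k → A ∩ symColorings n ∩ D k = ∅ := by
    intro k hk
    rw [Set.eq_empty_iff_forall_notMem]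
    rintro f ⟨⟨-, h1⟩, -, h2⟩
    exact h2 (Set.mem_iUnion₂.2 ⟨n, hk, h1⟩)
  have hcongr : ∀ k, omegaOn p k (A ∩ symColorings n ∩ D k) =
      omegaOn p n (A ∩ symColorings n ∩ D k) := by
    intro k
    rcases lt_or_ge n k with hk | hk
    · rw [hDn k hk, measure_empty, measure_empty]
    · rw [← omegaOn_restrict p hk, Measure.restrict_apply (hAn.inter (hD k))]
      congr 1
      refine Set.inter_eq_left.2 fun f hf => hf.2.1
  rw [Measure.restrict_apply hA, omega, Measure.sum_apply _ hAn]
  have h1 : ∀ k, ((omegaOn p k).restrict (D k)) (A ∩ symColorings n) =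
      omegaOn p n (A ∩ symColorings n ∩ D k) := fun k => by
    rw [Measure.restrict_apply hAn, hcongr]
  change ∑' k, ((omegaOn p k).restrict (D k)) (A ∩ symColorings n) = _
  simp only [h1]
  rw [← measure_iUnion _ fun k => hAn.inter (hD k), ← Set.inter_iUnion]
  · have h2 : A ∩ symColorings n ∩ ⋃ k, D k = A ∩ symColorings n := by
      refine Set.inter_eq_left.2 fun f hf => ?_
      classical
      have hex : ∃ k, f ∈ symColorings k := ⟨n, hf.2⟩
      refine Set.mem_iUnion.2 ⟨Nat.find hex, Nat.find_spec hex, ?_⟩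
      rw [Set.mem_iUnion₂]
      rintro ⟨m, hm, h⟩
      exact Nat.find_min hex hm h
    rw [h2, ← Measure.restrict_apply hA, omegaOn_restrict_self]
  · have hlt : ∀ a b, a < b → Disjoint (D a) (D b) := fun a b hab =>
      Set.disjoint_left.2 fun f h1 h2 => h2.2 (Set.mem_iUnion₂.2 ⟨a, hab, h1.1⟩)
    intro a b hab
    refine Disjoint.mono Set.inter_subset_right Set.inter_subset_right ?_
    rcases lt_or_gt_of_ne hab with h | h
    · exact hlt a b h
    · exact (hlt b a h).symm

theorem ae_exists_symColorings : ∀ᵐ f ∂omega p, ∃ n, f ∈ symColorings n := by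
  rw [omega, Measure.ae_sum_iff' (by
    simp only [Set.ofPred_exists]
    exact MeasurableSet.iUnion measurableSet_symColorings)]
  intro n
  filter_upwards [ae_restrict_mem ((measurableSet_symColorings n).diff
    (measurableSet_symColorings_lt n))] with f hf
  exact ⟨n, hf.1⟩

theorem omega_apply {A : Set Coloring} (hA : MeasurableSet A) (N : ℕ) :
    omega p A = ⨆ n, omegaOn p (N + n) A := by
  have hmono : Monotone fun n => A ∩ symColorings (N + n) := fun a b hab =>
    Set.inter_subset_inter_right _ (symColorings_mono (by omega))
  have h1 : omega p A = omega p (⋃ n, A ∩ symColorings (N + n)) := by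
    refine measure_congr ?_
    filter_upwards [ae_exists_symColorings p] with f hf
    refine propext ?_
    change f ∈ A ↔ f ∈ ⋃ n, A ∩ symColorings (N + n)
    simp only [Set.mem_iUnion, Set.mem_inter_iff]
    obtain ⟨n, hn⟩ := hf
    exact ⟨fun h => ⟨n, h, symColorings_mono (by omega) hn⟩, fun h => h.choose_spec.1⟩
  rw [h1, hmono.measure_iUnion]
  exact iSup_congr fun n => by rw [← omega_restrict, Measure.restrict_apply hA]

theorem measurable_colorAct (g : G) : Measurable (colorAct g) :=
  measurable_pi_lambda _ fun _ => measurable_pi_apply _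

/-- A permutation of the window permutes the words, and the weight of a word is a product over the
points of the window. -/
theorem omegaOn_colorAct {g : G} (hg : SuppIn n g) {A : Set Coloring} (hA : MeasurableSet A) :
    omegaOn p n (colorAct g ⁻¹' A) = omegaOn p n A := by
  obtain ⟨τ, rfl⟩ := hg.exists_ofWindow
  rw [omegaOn_apply p (measurable_colorAct _ hA), omegaOn_apply p hA]
  refine Eq.trans ?_ (Equiv.tsum_eq (Equiv.arrowCongr τ (Equiv.refl ℕ)) _)
  refine tsum_congr fun w => ?_
  refine congrArg₂ _ (congrArg _ ?_) (congrArg _ ?_)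
  · exact (Equiv.prod_comp τ.symm fun x => √(p (w x))).symm
  · ext s
    simp only [Set.mem_preimage, colorAct_ofWindow_tailGlue]
    rfl

theorem measurePreserving_colorAct_omega (g : G) :
    MeasurePreserving (colorAct g) (omega p) (omega p) := by
  refine ⟨measurable_colorAct g, ?_⟩
  ext A hA
  obtain ⟨N, hN⟩ := exists_suppIn g
  rw [Measure.map_apply (measurable_colorAct g) hA, omega_apply p (measurable_colorAct g hA) N,
    omega_apply p hA N]
  exact iSup_congr fun n => omegaOn_colorAct p (hN.mono (by omega)) hA

end Omega

/-! ### The set `Y` -/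

section Good

variable {n : ℕ} {w : window n → ℕ} {s : ℕ → ℕ} {x : NZ} {f : Coloring}

theorem measurable_card_colorClass (i n : ℕ) :
    Measurable fun f : Coloring => (colorClass f i n).card := by
  classical
  have : (fun f : Coloring => (colorClass f i n).card) =
      fun f => ∑ x ∈ (window_finite n).toFinset, if f x = i then 1 else 0 := by
    funext f
    rw [colorClass, Finset.card_filter]
  rw [this]
  exact Finset.measurable_sum _ fun x _ => Measurable.ite
    (measurableSet_eq_fun (measurable_pi_apply _) measurable_const) measurable_const
    measurable_const

theorem infinite_color_iff (i : ℕ) :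
    {x | f x = i}.Infinite ↔ ∀ n, ∃ x ∉ window n, f x = i := by
  constructor
  · intro h n
    by_contra hcon
    push Not at hcon
    exact h ((window_finite n).subset fun x hx => by
      by_contra hxn
      exact hcon x hxn hx)
  · intro h hfin
    obtain ⟨n, hn⟩ : ∃ n, {x | f x = i} ⊆ window n := by
      refine ⟨hfin.toFinset.sup fun x => x.1.natAbs, fun x hx => ?_⟩
      rw [mem_window']
      exact Finset.le_sup (f := fun x : NZ => x.1.natAbs) (hfin.mem_toFinset.2 hx)
    obtain ⟨x, hx, hxi⟩ := h n
    exact hx (hn hxi)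

theorem measurableSet_goodColorings : MeasurableSet goodColorings := by
  have h : goodColorings = (⋃ n, symColorings n) ∩ ⋂ i : ℕ,
      ((⋂ n : ℕ, ⋃ x : NZ, ⋃ _ : x ∉ window n, {f : Coloring | f x = i}) ∩
        ⋃ M : ℕ, ⋂ N : ℕ, ⋂ _ : M ≤ N, {f : Coloring | Even (colorClass f i N).card}) := by
    ext f
    simp only [goodColorings, infinite_color_iff, ncard_eq_card_colorClass, eventually_atTop,
      Set.mem_ofPred_eq, Set.mem_inter_iff, Set.mem_iUnion, Set.mem_iInter, exists_prop]
  rw [h]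
  refine (MeasurableSet.iUnion measurableSet_symColorings).inter (MeasurableSet.iInter fun i =>
    MeasurableSet.inter ?_ ?_)
  · exact MeasurableSet.iInter fun n => MeasurableSet.iUnion fun x => MeasurableSet.iUnion fun _ =>
      measurableSet_eq_fun (measurable_pi_apply _) measurable_const
  · exact MeasurableSet.iUnion fun n => MeasurableSet.iInter fun x => MeasurableSet.iInter fun _ =>
      measurable_card_colorClass i x (MeasurableSet.of_discrete (s := {m | Even m}))

theorem good_of_balanced (h : Balanced f n) (hinf : ∀ i, {x | f x = i}.Infinite) :
    f ∈ goodColorings := by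
  refine ⟨⟨n, h.1⟩, fun i => ⟨hinf i, ?_⟩⟩
  filter_upwards [eventually_ge_atTop n] with N hN
  rw [ncard_eq_card_colorClass]
  exact (h.mono hN).2 i

/-- Every color occurs an even number of times. -/
def EvenColors (w : window n → ℕ) : Prop := Balanced (tailGlue n w fun _ => 0) n

theorem balanced_tailGlue : Balanced (tailGlue n w s) n ↔ EvenColors w := by
  refine and_congr ⟨fun _ => tailGlue_mem, fun _ => tailGlue_mem⟩ (forall_congr' fun i => ?_)
  rw [colorClass_congr (f := tailGlue n w s) (f' := tailGlue n w fun _ => 0)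
    fun x hx => by rw [tailGlue_of_mem hx, tailGlue_of_mem hx]]

theorem evenColors_of_good (hf : f ∈ goodColorings) (hn : f ∈ symColorings n) :
    EvenColors fun x : window n => f x := by
  have h := eq_tailGlue hn (fun _ => rfl) (fun _ => rfl)
  rw [← balanced_tailGlue, ← h]
  exact balanced_of_good hf hn

theorem tailGlue_good (hs : ∀ i, {j | s j = i}.Infinite) :
    tailGlue n w s ∈ goodColorings ↔ EvenColors w := by
  refine ⟨fun h => balanced_tailGlue.1 (balanced_of_good h tailGlue_mem), fun h =>
    good_of_balanced (balanced_tailGlue.2 h) fun i => ?_⟩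
  refine ((hs i).image (f := fun j => posNZ (n + j)) fun a _ b _ h => ?_).mono ?_
  · have := posNZ_inj.1 h
    omega
  · rintro _ ⟨j, hj, rfl⟩
    exact tailGlue_posNZ j |>.trans hj

end Good

/-! ### The measure on `Y` and functions invariant under `K_n` -/

section MixLaw

variable (p : Weights) {n : ℕ}

/-- The measure `ω` on `Y`. -/
abbrev mixLaw : Measure Coloring := (omega p).restrict goodColorings

theorem mixLaw_apply_inter {A : Set Coloring} (hA : MeasurableSet A) :
    mixLaw p (A ∩ symColorings n) = ∑' w : {w : window n → ℕ // EvenColors w},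
      ENNReal.ofReal (weight p n w.1) * seqLaw p.law (tailGlue n w.1 ⁻¹' A) := by
  have hX := measurableSet_symColorings n
  have hY := measurableSet_goodColorings
  rw [mixLaw, Measure.restrict_apply (hA.inter hX), Set.inter_right_comm,
    ← Measure.restrict_apply (hA.inter hY), omega_restrict, omegaOn_apply p (hA.inter hY)]
  refine Eq.trans ?_ (tsum_subtype {w : window n → ℕ | EvenColors w} fun w =>
    ENNReal.ofReal (weight p n w) * seqLaw p.law (tailGlue n w ⁻¹' A)).symm
  refine tsum_congr fun w => ?_
  by_cases hw : EvenColors w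
  · rw [Set.indicator_of_mem (show w ∈ {w | EvenColors w} from hw)]
    congr 1
    refine measure_congr ?_
    filter_upwards [ae_infinite_color p] with s hs
    exact propext (and_iff_left ((tailGlue_good hs).2 hw))
  · rw [Set.indicator_of_notMem (show w ∉ {w | EvenColors w} from hw)]
    have : seqLaw p.law (tailGlue n w ⁻¹' (A ∩ goodColorings)) = 0 := by
      rw [measure_eq_zero_iff_ae_notMem]
      filter_upwards [ae_infinite_color p] with s hs h
      exact hw ((tailGlue_good hs).1 h.2)
    rw [this, mul_zero]

theorem mixLaw_restrict (n : ℕ) : (mixLaw p).restrict (symColorings n) =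
    Measure.sum fun w : {w : window n → ℕ // EvenColors w} =>
      ENNReal.ofReal (weight p n w.1) • (seqLaw p.law).map (tailGlue n w.1) := by
  ext A hA
  rw [Measure.restrict_apply hA, mixLaw_apply_inter p hA, Measure.sum_apply _ hA]
  refine tsum_congr fun w => ?_
  rw [Measure.smul_apply, smul_eq_mul, Measure.map_apply (measurable_tailGlue n w.1) hA]

theorem ae_mixLaw_iff {Q : Coloring → Prop} : (∀ᵐ f ∂mixLaw p, f ∈ symColorings n → Q f) ↔
    ∀ w : window n → ℕ, EvenColors w → ∀ᵐ s ∂seqLaw p.law, Q (tailGlue n w s) := by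
  rw [← ae_restrict_iff' (measurableSet_symColorings n), mixLaw_restrict, Measure.ae_sum_iff,
    Subtype.forall]
  refine forall_congr' fun w => forall_congr' fun _ => ?_
  rw [Measure.ae_ennreal_smul_measure_iff (ENNReal.ofReal_pos.2 (weight_pos p w)).ne',
    (measurableEmbedding_tailGlue n w).ae_map_iff]

theorem ae_mem_good : ∀ᵐ f ∂mixLaw p, f ∈ goodColorings :=
  ae_restrict_mem measurableSet_goodColorings

theorem map_tailGlue_absolutelyContinuous {w : window n → ℕ} (hw : EvenColors w) :
    (seqLaw p.law).map (tailGlue n w) ≪ mixLaw p := by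
  refine Measure.AbsolutelyContinuous.mk fun A hA h => ?_
  rw [Measure.map_apply (measurable_tailGlue n w) hA, measure_eq_zero_iff_ae_notMem]
  rw [measure_eq_zero_iff_ae_notMem] at h
  exact (ae_mixLaw_iff p).1 (h.mono fun f hf _ => hf) w hw

theorem colorAct_measurableEmbedding (g : G) : MeasurableEmbedding (colorAct g) :=
  MeasurableEmbedding.of_measurable_inverse (measurable_colorAct g)
    (by
      have : Set.range (colorAct g) = Set.univ :=
        Set.range_eq_univ.2 fun f => ⟨colorAct g⁻¹ f, colorAct_colorAct_inv g f⟩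
      rw [this]
      exact MeasurableSet.univ) (measurable_colorAct g⁻¹) (colorAct_inv_colorAct g)

theorem measurePreserving_colorAct (g : G) :
    MeasurePreserving (colorAct g) (mixLaw p) (mixLaw p) := by
  have h := (measurePreserving_colorAct_omega p g).restrict_preimage measurableSet_goodColorings
  have h2 : colorAct g ⁻¹' goodColorings = goodColorings := by
    ext f
    exact colorAct_mem_good_iff g
  rwa [h2] at h

/-- The set of all colorings in `Y ∩ X_n` with given colors at `±1, …, ±n`. -/
def colorCylinder (n : ℕ) (w : window n → ℕ) : Set Coloring :=
  {f | f ∈ goodColorings ∧ f ∈ symColorings n ∧ ∀ x : window n, f x = w x}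

theorem measurableSet_colorCylinder (w : window n → ℕ) : MeasurableSet (colorCylinder n w) :=
  measurableSet_goodColorings.inter ((measurableSet_symColorings n).inter (measurableSet_colors n w))

theorem measurableSet_tail (n m i : ℕ) :
    MeasurableSet {f : Coloring | ∀ j < m, f (posNZ (n + j)) = i} := by
  simp only [Set.ofPred_forall]
  exact MeasurableSet.iInter fun j => MeasurableSet.iInter fun _ =>
    measurableSet_eq_fun (measurable_pi_apply _) measurable_const

/-- The colors beyond the window are independent with law `p`, and almost surely every color occurs
infinitely often, so the restriction to `Y` costs nothing. The factor `p i ^ m` is the source of the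
rescaling by `p_i`. -/
theorem mixLaw_colorCylinder {w : window n → ℕ} (hw : EvenColors w) (i m : ℕ) :
    mixLaw p (colorCylinder n w ∩ {f | ∀ j < m, f (posNZ (n + j)) = i}) =
      ENNReal.ofReal (weight p n w * p i ^ m) := by
  have h1 : colorCylinder n w ∩ {f | ∀ j < m, f (posNZ (n + j)) = i} =
      (goodColorings ∩ ({f : Coloring | ∀ x : window n, f x = w x} ∩
        {f | ∀ j < m, f (posNZ (n + j)) = i})) ∩ symColorings n := by
    ext f
    simp only [colorCylinder, Set.mem_inter_iff, Set.mem_ofPred_eq]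
    tauto
  rw [h1, mixLaw_apply_inter p (measurableSet_goodColorings.inter
    ((measurableSet_colors n w).inter (measurableSet_tail n m i))), tsum_eq_single ⟨w, hw⟩]
  · rw [ENNReal.ofReal_mul (weight_pos p w).le]
    congr 1
    have h2 := Measure.infinitePi_pi (μ := fun _ : ℕ => p.law) (s := Finset.range m)
      (t := fun _ => {i}) (fun _ _ => MeasurableSet.of_discrete)
    rw [Finset.prod_const, Finset.card_range, law_singleton] at h2
    rw [ENNReal.ofReal_pow (p.pos i).le, ← h2]
    refine measure_congr ?_
    filter_upwards [ae_infinite_color p] with s hs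
    refine propext ?_
    change (tailGlue n w s ∈ goodColorings ∧ (∀ x : window n, tailGlue n w s x = w x) ∧
      ∀ j < m, tailGlue n w s (posNZ (n + j)) = i) ↔ ∀ j ∈ (Finset.range m : Set ℕ), s j = i
    simp only [tailGlue_good hs, hw, true_and, tailGlue_window, tailGlue_posNZ, implies_true,
      Finset.coe_range, Set.mem_Iio]
  · intro w' hw'
    have : tailGlue n w'.1 ⁻¹' (goodColorings ∩ ({f : Coloring | ∀ x : window n, f x = w x} ∩
        {f | ∀ j < m, f (posNZ (n + j)) = i})) = ∅ := by
      rw [Set.eq_empty_iff_forall_notMem]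
      rintro s ⟨-, h, -⟩
      refine hw' (Subtype.ext (funext fun x => ?_))
      exact (tailGlue_window x).symm.trans (h x)
    rw [this, measure_empty, mul_zero]

/-- A function on `Y ∩ X_n` that is invariant under `K_n` depends only on the colors of
`±1, …, ±n`. -/
theorem exists_ae_eq_window {E : Type*} [TopologicalSpace E] [TopologicalSpace.MetrizableSpace E]
    [Nonempty E] {F : Coloring → E} (hF : AEStronglyMeasurable F (mixLaw p))
    (hinv : ∀ k ∈ K n, ∀ᵐ f ∂mixLaw p, f ∈ symColorings n → F (colorAct k f) = F f) :
    ∃ u : (window n → ℕ) → E, ∀ᵐ f ∂mixLaw p, f ∈ symColorings n → F f = u fun x => f x := by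
  have h : ∀ w : window n → ℕ, ∃ c, EvenColors w → ∀ᵐ s ∂seqLaw p.law, F (tailGlue n w s) = c := by
    intro w
    by_cases hw : EvenColors w
    · have hm : AEStronglyMeasurable (F ∘ tailGlue n w) (seqLaw p.law) :=
        (hF.mono_ac (map_tailGlue_absolutelyContinuous p hw)).comp_measurable
          (measurable_tailGlue n w)
      -- On a cylinder, the elements of `K_n` that exchange two outer pairs act on the sequence of
      -- outer colors as transpositions of the index set.
      obtain ⟨c, hc⟩ := exists_ae_eq_const_of_swap hm fun a b => by
        have := (ae_mixLaw_iff p).1 (hinv _ (signedSwap_mem_K (x := posNZ (n + a))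
          (y := posNZ (n + b)) (by simp) (by simp))) w hw
        filter_upwards [this] with s hs
        rw [colorAct_signedSwap_tailGlue] at hs
        exact hs
      exact ⟨c, fun _ => hc⟩
    · exact ⟨Classical.arbitrary E, fun h => absurd h hw⟩
  choose u hu using h
  refine ⟨u, (ae_mixLaw_iff p).2 fun w hw => ?_⟩
  filter_upwards [hu w hw] with s hs
  rw [hs]
  congr 1
  exact funext fun x => (tailGlue_window x).symm

/-- An integrable function on `Y` that is invariant under `K_n` vanishes outside of `X_n`. -/
theorem ae_eq_zero_of_notMem {Φ : Coloring → ℝ≥0∞} (hΦ : AEMeasurable Φ (mixLaw p))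
    (hfin : ∫⁻ f, Φ f ∂mixLaw p ≠ ∞)
    (hinv : ∀ k ∈ K n, ∀ᵐ f ∂mixLaw p, Φ (colorAct k f) = Φ f) :
    ∀ᵐ f ∂mixLaw p, f ∉ symColorings n → Φ f = 0 := by
  let T : ℕ → ℕ → Set Coloring := fun c N =>
    {f | f ∈ symColorings N ∧ f (-posNZ c) ≠ f (posNZ c)}
  have hne : ∀ c, MeasurableSet {f : Coloring | f (-posNZ c) ≠ f (posNZ c)} := fun c =>
    (measurableSet_eq_fun (measurable_pi_apply (-posNZ c)) (measurable_pi_apply (posNZ c))).compl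
  have hTm : ∀ c N, MeasurableSet (T c N) := fun c N =>
    (measurableSet_symColorings N).inter (hne c)
  have hT : ∀ c N, n ≤ c → c < N → ∫⁻ f in T c N, Φ f ∂mixLaw p = 0 := by
    intro c N hnc hcN
    -- In `S m` the only asymmetric pair from the index `N` on is the one with index `N + m`, so
    -- these sets are disjoint. The swap of the pairs with indices `c` and `N + m` belongs to `K_n`
    -- and maps `T c N` into `S m`. An integrable function would have infinitely many equal
    -- contributions, so its integral over `T c N` vanishes.
    let S : ℕ → Set Coloring := fun m => {f | f (-posNZ (N + m)) ≠ f (posNZ (N + m)) ∧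
      ∀ j, N ≤ j → j ≠ N + m → f (-posNZ j) = f (posNZ j)}
    have hSm : ∀ m, MeasurableSet (S m) := fun m => (hne _).inter (by
      change MeasurableSet {f : Coloring | ∀ j, N ≤ j → j ≠ N + m → f (-posNZ j) = f (posNZ j)}
      simp only [Set.ofPred_forall]
      exact MeasurableSet.iInter fun j => MeasurableSet.iInter fun _ => MeasurableSet.iInter
        fun _ => measurableSet_eq_fun (measurable_pi_apply _) (measurable_pi_apply _))
    have hSd : Pairwise (Function.onFun Disjoint S) := by
      intro a b hab
      refine Set.disjoint_left.2 fun f ha hb => ha.1 (hb.2 _ (by omega) (by omega))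
    have hle : ∀ m, ∫⁻ f in T c N, Φ f ∂mixLaw p ≤ ∫⁻ f in S m, Φ f ∂mixLaw p := by
      intro m
      let k := signedSwap (posNZ c) (posNZ (N + m))
      have hk : k ∈ K n := signedSwap_mem_K (by simpa using hnc) (by simp; omega)
      have hne' : posNZ c ≠ -posNZ (N + m) := (neg_posNZ_ne _ _).symm
      have h1 : ∫⁻ f in T c N, Φ f ∂mixLaw p = ∫⁻ f in T c N, Φ (colorAct k f) ∂mixLaw p :=
        setLIntegral_congr_fun_ae (hTm c N) ((hinv k hk).mono fun f hf _ => hf.symm)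
      rw [h1, ← (measurePreserving_colorAct p k).setLIntegral_comp_preimage_emb
        (colorAct_measurableEmbedding k) Φ (S m)]
      refine lintegral_mono_set fun f hf => ⟨?_, fun j hj hjm => ?_⟩
      · have h2 : k.1 (posNZ c) = posNZ (N + m) := signedSwap_left hne'
        rw [← h2, ← hk.1, colorAct_apply_apply, colorAct_apply_apply]
        exact hf.2
      · have h2 : k.1 (posNZ j) = posNZ j :=
          signedSwap_of_ne (by rw [Ne, posNZ_inj]; omega) (by rw [Ne, posNZ_inj]; omega)
            (neg_posNZ_ne _ _).symm (neg_posNZ_ne _ _).symm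
        rw [← h2, ← hk.1, colorAct_apply_apply, colorAct_apply_apply]
        exact hf.1 _ (by simpa using hj)
    by_contra h0
    have h1 : ∑' _ : ℕ, ∫⁻ f in T c N, Φ f ∂mixLaw p = ∞ := ENNReal.tsum_const_eq_top_of_ne_zero h0
    have h2 := ENNReal.tsum_le_tsum hle
    rw [h1, ← lintegral_iUnion hSm hSd] at h2
    exact hfin (top_le_iff.1 (h2.trans (setLIntegral_le_lintegral _ _)))
  have h2 : ∀ c N, ∀ᵐ f ∂mixLaw p, n ≤ c → c < N → f ∈ T c N → Φ f = 0 := by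
    intro c N
    by_cases h : n ≤ c ∧ c < N
    · have := (lintegral_eq_zero_iff' hΦ.restrict).1 (hT c N h.1 h.2)
      filter_upwards [(ae_restrict_iff' (hTm c N)).1 this] with f hf _ _ hT
      exact hf hT
    · exact Eventually.of_forall fun f h1 h2 => absurd ⟨h1, h2⟩ h
  filter_upwards [ae_all_iff.2 fun c => ae_all_iff.2 (h2 c), ae_mem_good p] with f hf hgood hn
  obtain ⟨N, hN⟩ := hgood.1
  obtain ⟨c, hc, hne⟩ : ∃ c, n ≤ c ∧ f (-posNZ c) ≠ f (posNZ c) := by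
    by_contra hcon
    push Not at hcon
    refine hn fun x hx => ?_
    obtain ⟨m, rfl | rfl⟩ := posNZ_cases x
    · exact hcon m (by simpa using hx)
    · rw [NZ.neg_neg', hcon m (by simpa using hx)]
  exact hf c (max N (c + 1)) hc (by omega) ⟨symColorings_mono (le_max_left _ _) hN, hne⟩

end MixLaw

/-! ### The representation in `L²(Y, E)` -/

section Action

variable {H : ℕ → Type*} [∀ i, NormedAddCommGroup (H i)] [∀ i, InnerProductSpace ℂ (H i)]
  {ξ : ∀ i, Metric.sphere (0 : H i) 1} (π : ∀ i, URep (H i)) {p : Weights}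

/-- The action of `G` on functions on `Y`. -/
def mixFun (g : G) (F : Coloring → InfTensor ξ) : Coloring → InfTensor ξ := fun f =>
  tensorAct π (coc g (colorAct g⁻¹ f)) (F (colorAct g⁻¹ f))

theorem good_iff_exists_cylinder (N : ℕ) {f : Coloring} :
    f ∈ goodColorings ↔ f ∈ ⋃ q : Σ n : ℕ, (window (N + n) → ℕ), colorCylinder (N + q.1) q.2 := by
  rw [Set.mem_iUnion]
  constructor
  · intro hf
    obtain ⟨n, hn⟩ := hf.1
    exact ⟨⟨n, fun x => f x⟩, hf, symColorings_mono (Nat.le_add_left n N) hn, fun _ => rfl⟩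
  · rintro ⟨q, hq⟩
    exact hq.1

theorem aestronglyMeasurable_comp_colorAct {E : Type*} [TopologicalSpace E] (g : G)
    {F : Coloring → E} (hF : AEStronglyMeasurable F (mixLaw p)) :
    AEStronglyMeasurable (fun f => F (colorAct g f)) (mixLaw p) :=
  hF.comp_quasiMeasurePreserving (measurePreserving_colorAct p g).quasiMeasurePreserving

/-- The cocycle is constant on every color cylinder of a window that contains the support of `g`,
and countably many such cylinders cover `Y`. -/
theorem aestronglyMeasurable_mixFun (g : G) {F : Coloring → InfTensor ξ}
    (hF : AEStronglyMeasurable F (mixLaw p)) : AEStronglyMeasurable (mixFun π g F) (mixLaw p) := by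
  obtain ⟨N, hN⟩ := exists_suppIn g
  have hset : goodColorings = ⋃ q : Σ n : ℕ, (window (N + n) → ℕ), colorCylinder (N + q.1) q.2 := by
    ext f
    exact good_iff_exists_cylinder N
  have hF' := aestronglyMeasurable_comp_colorAct g⁻¹ hF
  have key : AEStronglyMeasurable (mixFun π g F) ((omega p).restrict
      (⋃ q : Σ n : ℕ, (window (N + n) → ℕ), colorCylinder (N + q.1) q.2)) := by
    rw [aestronglyMeasurable_iUnion_iff]
    rintro ⟨n, w⟩
    rcases (colorCylinder (N + n) w).eq_empty_or_nonempty with h | ⟨f₀, hf₀⟩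
    · dsimp only
      rw [h, Measure.restrict_empty]
      exact aestronglyMeasurable_zero_measure _
    have hle : (omega p).restrict (colorCylinder (N + n) w) ≤ mixLaw p :=
      Measure.restrict_mono (fun f hf => hf.1) le_rfl
    have hg' : SuppIn (N + n) g := hN.mono (by omega)
    have hc : ∀ f ∈ colorCylinder (N + n) w,
        coc g (colorAct g⁻¹ f) = coc g (colorAct g⁻¹ f₀) := by
      intro f hf
      refine coc_congr (colorAct_mem_good _ hf.1) (colorAct_mem_good _ hf₀.1)
        (hg'.inv.colorAct_mem hf.2.1) (hg'.inv.colorAct_mem hf₀.2.1) (fun x hx => ?_) hg'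
      have hx' : ((g⁻¹)⁻¹).1 x ∈ window (N + n) := hg'.inv.inv.apply_mem.2 hx
      exact (hf.2.2 ⟨_, hx'⟩).trans (hf₀.2.2 ⟨_, hx'⟩).symm
    have h1 : AEStronglyMeasurable (fun f => tensorAct π (coc g (colorAct g⁻¹ f₀))
        (F (colorAct g⁻¹ f))) ((omega p).restrict (colorCylinder (N + n) w)) :=
      (continuous_tensorAct π _).comp_aestronglyMeasurable (hF'.mono_measure hle)
    refine h1.congr ?_
    filter_upwards [ae_restrict_mem (measurableSet_colorCylinder w)] with f hf
    rw [mixFun, hc f hf]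
  rwa [← hset] at key

theorem norm_mixFun (g : G) (F : Coloring → InfTensor ξ) (f : Coloring) :
    ‖mixFun π g F f‖ = ‖F (colorAct g⁻¹ f)‖ := norm_tensorAct π _ _

theorem eLpNorm_mixFun (g : G) {F : Coloring → InfTensor ξ}
    (hF : AEStronglyMeasurable F (mixLaw p)) :
    eLpNorm (mixFun π g F) 2 (mixLaw p) = eLpNorm F 2 (mixLaw p) := by
  rw [← eLpNorm_comp_measurePreserving hF (measurePreserving_colorAct p g⁻¹)]
  exact eLpNorm_congr_norm_ae (Eventually.of_forall fun f => norm_mixFun π g F f)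

theorem memLp_mixFun (g : G) {F : Coloring → InfTensor ξ} (hF : MemLp F 2 (mixLaw p)) :
    MemLp (mixFun π g F) 2 (mixLaw p) :=
  ⟨aestronglyMeasurable_mixFun π g hF.1, by
    rw [eLpNorm_mixFun π g hF.1]
    exact hF.2⟩

theorem ae_comp_colorAct (g : G) {Q : Coloring → Prop} (h : ∀ᵐ f ∂mixLaw p, Q f) :
    ∀ᵐ f ∂mixLaw p, Q (colorAct g f) :=
  (measurePreserving_colorAct p g).quasiMeasurePreserving.ae h

theorem mixFun_congr (g : G) {F F' : Coloring → InfTensor ξ} (h : F =ᵐ[mixLaw p] F') :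
    mixFun π g F =ᵐ[mixLaw p] mixFun π g F' := by
  filter_upwards [ae_comp_colorAct g⁻¹ h] with f hf
  rw [mixFun, mixFun, hf]

theorem mixFun_mul (g h : G) (F : Coloring → InfTensor ξ) :
    mixFun π (g * h) F =ᵐ[mixLaw p] mixFun π g (mixFun π h F) := by
  filter_upwards [ae_mem_good p] with f hf
  rw [mixFun, mixFun, mixFun, mul_inv_rev, colorAct_mul,
    coc_mul (colorAct_mem_good _ (colorAct_mem_good _ hf)), tensorAct_mul,
    colorAct_colorAct_inv]

theorem mixFun_one (F : Coloring → InfTensor ξ) : mixFun π 1 F =ᵐ[mixLaw p] F := by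
  filter_upwards [ae_mem_good p] with f hf
  rw [mixFun, inv_one, colorAct_one, coc_one hf, tensorAct_one]

/-- The action of an element of `G` on `L²`. -/
def mixMap (g : G) (F : MixSpace ξ p) : MixSpace ξ p :=
  (memLp_mixFun π g (Lp.memLp F)).toLp _

theorem coeFn_mixMap (g : G) (F : MixSpace ξ p) :
    (mixMap π g F : Coloring → InfTensor ξ) =ᵐ[mixLaw p] mixFun π g F := MemLp.coeFn_toLp _

theorem mixMap_mul (g h : G) (F : MixSpace ξ p) :
    mixMap π (g * h) F = mixMap π g (mixMap π h F) := by
  refine Lp.ext ?_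
  exact (coeFn_mixMap π _ F).trans ((mixFun_mul π g h F).trans
    ((mixFun_congr π g (coeFn_mixMap π h F).symm).trans (coeFn_mixMap π g _).symm))

theorem mixMap_one (F : MixSpace ξ p) : mixMap π 1 F = F :=
  Lp.ext ((coeFn_mixMap π 1 F).trans (mixFun_one π F))

theorem norm_mixMap (g : G) (F : MixSpace ξ p) : ‖mixMap π g F‖ = ‖F‖ := by
  rw [Lp.norm_def, Lp.norm_def, eLpNorm_congr_ae (coeFn_mixMap π g F),
    eLpNorm_mixFun π g (Lp.aestronglyMeasurable F)]

theorem mixMap_add (g : G) (F F' : MixSpace ξ p) :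
    mixMap π g (F + F') = mixMap π g F + mixMap π g F' := by
  refine Lp.ext ?_
  filter_upwards [coeFn_mixMap π g (F + F'), coeFn_mixMap π g F, coeFn_mixMap π g F',
    Lp.coeFn_add (mixMap π g F) (mixMap π g F'),
    ae_comp_colorAct g⁻¹ (Lp.coeFn_add F F')] with f h1 h2 h3 h4 h5
  rw [h1, h4, Pi.add_apply, h2, h3, mixFun, h5, Pi.add_apply, (isLinearMap_tensorAct π _).map_add]
  rfl

theorem mixMap_smul (g : G) (c : ℂ) (F : MixSpace ξ p) :
    mixMap π g (c • F) = c • mixMap π g F := by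
  refine Lp.ext ?_
  filter_upwards [coeFn_mixMap π g (c • F), coeFn_mixMap π g F,
    Lp.coeFn_smul c (mixMap π g F), ae_comp_colorAct g⁻¹ (Lp.coeFn_smul c F)] with f h1 h2 h4 h5
  rw [h1, h4, Pi.smul_apply, h2, mixFun, h5, Pi.smul_apply, (isLinearMap_tensorAct π _).map_smul]
  rfl

/-- The representation of `G` in `L²(Y, E)`. -/
def mixAction (ξ : ∀ i, Metric.sphere (0 : H i) 1) (p : Weights) : URep (MixSpace ξ p) where
  toFun g :=
    { toFun := mixMap π g
      invFun := mixMap π g⁻¹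
      map_add' := mixMap_add π g
      map_smul' := mixMap_smul π g
      left_inv := fun F => by rw [← mixMap_mul, inv_mul_cancel, mixMap_one]
      right_inv := fun F => by rw [← mixMap_mul, mul_inv_cancel, mixMap_one]
      norm_map' := norm_mixMap π g }
  map_one' := by
    ext1 F
    exact mixMap_one π F
  map_mul' g h := by
    ext1 F
    exact mixMap_mul π g h F

theorem isMixAction_mixAction : IsMixAction π ξ p (mixAction π ξ p) := by
  intro g F
  filter_upwards [coeFn_mixMap π g F, ae_mem_good p] with f h hf
  exact ⟨_, isCocycleValue_coc (colorAct_mem_good _ hf) g, h⟩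

variable {π} {ρ : URep (MixSpace ξ p)}

theorem IsMixAction.coeFn (h : IsMixAction π ξ p ρ) (g : G) (F : MixSpace ξ p) :
    (ρ g F : Coloring → InfTensor ξ) =ᵐ[mixLaw p] mixFun π g F := by
  filter_upwards [h g F, ae_mem_good p] with f hf hgood
  obtain ⟨γ, h1, h2⟩ := hf
  rw [h2, h1.eq_coc (colorAct_mem_good _ hgood)]
  rfl

theorem IsMixAction.apply_of_fixed (h : IsMixAction π ξ p ρ) {n : ℕ} {F : MixSpace ξ p}
    (hF : F ∈ fixed ρ n) {k : G} (hk : k ∈ K n) : ∀ᵐ f ∂mixLaw p,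
      (F : Coloring → InfTensor ξ) (colorAct k f) =
        tensorAct π (coc k f) ((F : Coloring → InfTensor ξ) f) := by
  have h1 := ae_comp_colorAct k (h.coeFn k F)
  rw [hF k hk] at h1
  filter_upwards [h1] with f hf
  rw [hf, mixFun, colorAct_inv_colorAct]

end Action

/-! ### Invariant vectors of the representation in `L²(Y, E)` -/

section Fixed

variable {H : ℕ → Type*} [∀ i, NormedAddCommGroup (H i)] [∀ i, InnerProductSpace ℂ (H i)]
  {ξ : ∀ i, Metric.sphere (0 : H i) 1} {π : ∀ i, URep (H i)} {p : Weights}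
  {ρ : URep (MixSpace ξ p)}

/-- The operators given by the cocycle are isometric, so the squared norm of `F` is an integrable
function invariant under `K_n`. -/
theorem IsMixAction.ae_eq_zero (h : IsMixAction π ξ p ρ) {n : ℕ} {F : MixSpace ξ p}
    (hF : F ∈ fixed ρ n) :
    ∀ᵐ f ∂mixLaw p, f ∉ symColorings n → (F : Coloring → InfTensor ξ) f = 0 := by
  have hm := Lp.memLp F
  have h2 := lintegral_rpow_enorm_lt_top_of_eLpNorm_lt_top two_ne_zero ENNReal.ofNat_ne_top hm.2
  have := ae_eq_zero_of_notMem (n := n) p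
    (Φ := fun f => ‖(F : Coloring → InfTensor ξ) f‖ₑ ^ (2 : ℝ≥0∞).toReal)
    (hm.1.enorm.pow_const _) h2.ne fun k hk => by
      filter_upwards [h.apply_of_fixed hF hk] with f hf
      rw [hf, ← ofReal_norm, norm_tensorAct, ofReal_norm]
  filter_upwards [this] with f hf hn
  simpa using hf hn

/-- For almost every `f` the invariance holds for all elements of `K_n` at once. Among them are
elements that preserve `f` and act at a single place `i` by an arbitrary element of `K (half f i
n)`. -/
theorem IsMixAction.ae_mem_fixedTensor [∀ i, CompleteSpace (H i)] (h : IsMixAction π ξ p ρ) {n : ℕ} {F : MixSpace ξ p}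
    (hF : F ∈ fixed ρ n) (hξ : {i | (ξ i : H i) ∉ fixed (π i) 0}.Finite) :
    ∀ᵐ f ∂mixLaw p, f ∈ symColorings n →
      (F : Coloring → InfTensor ξ) f ∈ fixedTensor π ξ fun i => half f i n := by
  have h1 : ∀ᵐ f ∂mixLaw p, ∀ k : G, k ∈ K n → (F : Coloring → InfTensor ξ) (colorAct k f) =
        tensorAct π (coc k f) ((F : Coloring → InfTensor ξ) f) := by
    rw [ae_all_iff]
    intro k
    by_cases hk : k ∈ K n
    · filter_upwards [h.apply_of_fixed hF hk] with f hf _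
      exact hf
    · exact Eventually.of_forall fun f hk' => absurd hk' hk
  filter_upwards [h1, ae_mem_good p] with f hf hgood hn
  refine mem_fixedTensor (hξ.subset fun i hi hi' => hi (fixed_mono _ (Nat.zero_le _) hi')) fun i γ hγ => ?_
  obtain ⟨k, hk1, hk2, hk3⟩ := exists_lift hgood i γ
  have := hf k (hk3 n hn hγ)
  rw [hk1, hk2] at this
  exact this.symm

theorem card_window (n : ℕ) : Fintype.card (window n) = 2 * n := by
  have h : ∀ m, Fintype.card (window m) = (window_finite m).toFinset.card := fun m => by
    rw [← Set.ncard_eq_toFinset_card _ (window_finite m), ← Nat.card_eq_fintype_card,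
      Nat.card_coe_set_eq]
  induction n with
  | zero =>
    rw [Fintype.card_eq_zero_iff]
    exact ⟨fun x => notMem_window_zero x.1 x.2⟩
  | succ n ih =>
    classical
    rw [h] at ih ⊢
    have h1 : (window_finite (n + 1)).toFinset =
        (window_finite n).toFinset ∪ {posNZ n, -posNZ n} := by
      ext x
      simp only [Set.Finite.mem_toFinset, mem_window_succ, Finset.mem_union, Finset.mem_insert,
        Finset.mem_singleton]
    rw [h1, Finset.card_union_of_disjoint, ih, Finset.card_pair (NZ.neg_ne _).symm]
    · omega
    · rw [Finset.disjoint_left]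
      intro x hx hx'
      simp only [Set.Finite.mem_toFinset, Finset.mem_insert, Finset.mem_singleton] at hx hx'
      rcases hx' with rfl | rfl <;> simp at hx

theorem finsum_half {f : Coloring} {n : ℕ} (hf : Balanced f n) : ∑ᶠ i, half f i n = n := by
  classical
  have hW : (window_finite n).toFinset.card = 2 * n := by
    rw [← card_window n, ← Set.ncard_eq_toFinset_card _ (window_finite n),
      ← Nat.card_eq_fintype_card, Nat.card_coe_set_eq]
  have h1 : (window_finite n).toFinset.card =
      ∑ i ∈ (window_finite n).toFinset.image f, (colorClass f i n).card :=
    Finset.card_eq_sum_card_image f _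
  have h2 : ∑ᶠ i, half f i n = ∑ i ∈ (window_finite n).toFinset.image f, half f i n := by
    refine finsum_eq_sum_of_support_subset _ fun i hi => ?_
    have : (colorClass f i n).card ≠ 0 := by
      intro h
      exact hi (by simp [half, h])
    obtain ⟨x, hx⟩ := Finset.card_pos.1 (Nat.pos_of_ne_zero this)
    rw [mem_colorClass] at hx
    rw [Finset.mem_coe, Finset.mem_image]
    exact ⟨x, by simpa using hx.1, hx.2⟩
  rw [hW, Finset.sum_congr rfl fun i _ => hf.two_mul_half i, ← Finset.mul_sum] at h1
  omega

theorem eq_of_le_of_finsum_le {a b : ℕ → ℕ} (ha : (Function.support a).Finite)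
    (hb : (Function.support b).Finite) (hab : ∀ i, a i ≤ b i) :
    ∑ᶠ i, a i ≤ ∑ᶠ i, b i ∧ (∑ᶠ i, b i ≤ ∑ᶠ i, a i → a = b) := by
  classical
  have h1 := finsum_eq_sum_of_support_subset a (s := ha.toFinset ∪ hb.toFinset) (by simp)
  have h2 := finsum_eq_sum_of_support_subset b (s := ha.toFinset ∪ hb.toFinset) (by simp)
  rw [h1, h2]
  refine ⟨Finset.sum_le_sum fun i _ => hab i, fun hle => funext fun i => ?_⟩
  by_cases hi : i ∈ ha.toFinset ∪ hb.toFinset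
  · have heq := le_antisymm (Finset.sum_le_sum fun i _ => hab i) hle
    exact (Finset.sum_eq_sum_iff_of_le fun i _ => hab i).1 heq i hi
  · simp only [Finset.mem_union, Set.Finite.mem_toFinset, Function.mem_support, not_or,
      not_not] at hi
    rw [hi.1, hi.2]

variable (hdepth : {i | depth (π i) ≠ 0}.Finite)
include hdepth

/-- The place `i` needs at least `2 d_i` points of color `i`, and the window has `2 n` points.
Equality of the totals forces equality at every place. -/
theorem le_half_of_ne_bot {f : Coloring} {n : ℕ} (hf : Balanced f n)
    (hne : ∀ i, fixed (π i) (half f i n) ≠ ⊥) : totalDepth π ≤ n ∧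
      (n ≤ totalDepth π → ∀ i, half f i n = depth (π i)) := by
  have hle : ∀ i, depth (π i) ≤ half f i n := fun i => by
    by_contra h
    exact hne i (fixed_eq_bot_of_lt_depth (by omega))
  have h := eq_of_le_of_finsum_le (a := fun i => depth (π i)) (b := fun i => half f i n) hdepth
    (finite_half_ne_zero f n) hle
  rw [finsum_half hf] at h
  exact ⟨h.1, fun hn i => (congrFun (h.2 hn) i).symm⟩

omit hdepth in
theorem mem_rootColorings_iff {f : Coloring} : f ∈ rootColorings π ↔
    f ∈ goodColorings ∧ f ∈ symColorings (totalDepth π) ∧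
      ∀ i, half f i (totalDepth π) = depth (π i) := by
  refine and_congr_right fun h1 => and_congr_right fun h2 => forall_congr' fun i => ?_
  have := (balanced_of_good h1 h2).two_mul_half i
  rw [ncard_eq_card_colorClass]
  omega

variable [∀ i, CompleteSpace (H i)] (hξ : {i | (ξ i : H i) ∉ fixed (π i) 0}.Finite)
include hξ

theorem IsMixAction.fixed_eq_bot (h : IsMixAction π ξ p ρ) {n : ℕ} (hn : n < totalDepth π) :
    fixed ρ n = ⊥ := by
  rw [Submodule.eq_bot_iff]
  intro F hF
  refine (Lp.eq_zero_iff_ae_eq_zero).2 ?_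
  filter_upwards [h.ae_eq_zero hF, h.ae_mem_fixedTensor hF hξ, ae_mem_good p] with f h1 h2 hf
  by_cases hfn : f ∈ symColorings n
  · by_contra h0
    have := le_half_of_ne_bot hdepth (balanced_of_good hf hfn) fun i hi => by
      have := h2 hfn
      rw [fixedTensor_eq_bot (i := i) hi, Submodule.mem_bot] at this
      exact h0 this
    omega
  · exact h1 hfn

/-- On colorings of `X_d` the values are tensors of invariant vectors, and these are zero unless the
color `i` occurs exactly `2 d_i` times in the window for all `i`. The cocycle of an element of `K_d`
acts trivially on such tensors, so `F` is an invariant function there and depends only on the colors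
in the window. -/
theorem IsMixAction.mem_mixRoot (h : IsMixAction π ξ p ρ) {F : MixSpace ξ p}
    (hF : F ∈ fixed ρ (totalDepth π)) : F ∈ mixRoot π ξ p := by
  classical
  have h3 := h.ae_mem_fixedTensor hF hξ
  obtain ⟨u, hu⟩ := exists_ae_eq_window (n := totalDepth π) p (Lp.aestronglyMeasurable F)
    fun k hk => by
      filter_upwards [h.apply_of_fixed hF hk, h3, ae_mem_good p] with f h1 h2 hf hn
      rw [h1]
      exact tensorAct_eq_self (fun i => coc_mem_K hf hn hk i) (h2 hn)
  -- The function `u` is controlled only almost everywhere, while membership is required for every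
  -- word; the remaining values are set to zero.
  refine ⟨fun w => if u w ∈ tensorRoot π ξ then u w else 0, fun w => ?_, ?_⟩
  · dsimp only
    split_ifs with hw
    · exact hw
    · exact Submodule.zero_mem _
  filter_upwards [h.ae_eq_zero hF, h3, ae_mem_good p, hu] with f h1 h2 hf h4
  split_ifs with hr hw
  · rw [h4 hr.2.1]
  · refine absurd ?_ hw
    rw [← h4 hr.2.1]
    have := h2 hr.2.1
    rw [mem_rootColorings_iff] at hr
    simp only [hr.2.2] at this
    exact this
  · by_cases hfn : f ∈ symColorings (totalDepth π)
    · by_contra h0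
      have := (le_half_of_ne_bot hdepth (balanced_of_good hf hfn) fun i hi => by
        have := h2 hfn
        rw [fixedTensor_eq_bot (i := i) hi, Submodule.mem_bot] at this
        exact h0 this).2 le_rfl
      exact hr (mem_rootColorings_iff.2 ⟨hf, hfn, this⟩)
    · exact h1 hfn

omit hdepth hξ [∀ i, CompleteSpace (H i)] in
theorem colorAct_K_mem_rootColorings {f : Coloring} {k : G} (hk : k ∈ K (totalDepth π))
    (hf : f ∈ rootColorings π) : colorAct k f ∈ rootColorings π := by
  rw [mem_rootColorings_iff] at hf ⊢
  refine ⟨colorAct_mem_good k hf.1, colorAct_mem_symColorings_K hk hf.2.1, fun i => ?_⟩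
  rw [← hf.2.2 i]
  exact half_congr (fun x hx => colorAct_K_apply hk hx) i

omit hdepth hξ in
theorem IsMixAction.mem_fixed (h : IsMixAction π ξ p ρ) {F : MixSpace ξ p}
    (hF : F ∈ mixRoot π ξ p) : F ∈ fixed ρ (totalDepth π) := by
  obtain ⟨u, hu, hFu⟩ := hF
  intro k hk
  refine Lp.ext ?_
  filter_upwards [h.coeFn k F, hFu, ae_comp_colorAct k⁻¹ hFu, ae_mem_good p] with f h1 h2 h3 hf
  rw [h1, mixFun, h3, h2]
  have hk' := inv_mem hk
  by_cases hr : f ∈ rootColorings π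
  · have hr' := colorAct_K_mem_rootColorings hk' hr
    rw [if_pos hr, if_pos hr']
    have hw : (fun x : window (totalDepth π) => colorAct k⁻¹ f x.1) = fun x => f x.1 :=
      funext fun x => colorAct_K_apply hk' x.2
    rw [hw]
    refine tensorAct_eq_self (e := fun i => depth (π i)) (fun i => ?_) (hu _)
    rw [mem_rootColorings_iff] at hr'
    rw [← hr'.2.2 i]
    exact coc_mem_K hr'.1 hr'.2.1 hk i
  · have hr' : colorAct k⁻¹ f ∉ rootColorings π := fun h' => hr (by
      have := colorAct_K_mem_rootColorings hk h'
      rwa [colorAct_colorAct_inv] at this)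
    rw [if_neg hr, if_neg hr', (isLinearMap_tensorAct π _).map_zero]

end Fixed

/-! ### Representative colorings of words -/

section WordExt

variable {n : ℕ} {w : window n → ℕ} {f : Coloring}

/-- A sequence of colors in which every color occurs infinitely often. -/
def baseSeq : ℕ → ℕ := fun j => (Nat.unpair j).1

theorem infinite_baseSeq (i : ℕ) : {j | baseSeq j = i}.Infinite := by
  refine (Set.infinite_range_of_injective (f := fun j => Nat.pair i j) fun a b h => ?_).mono ?_
  · exact (Nat.pair_eq_pair.1 h).2
  · rintro _ ⟨j, rfl⟩
    simp [baseSeq]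

/-- A coloring from `Y ∩ X_n` with given colors at `±1, …, ±n`. -/
def wordExt (w : window n → ℕ) : Coloring := tailGlue n w baseSeq

theorem wordExt_mem_symColorings : wordExt w ∈ symColorings n := tailGlue_mem

theorem wordExt_apply (x : window n) : wordExt w x = w x := tailGlue_window x

theorem wordExt_of_mem {x : NZ} (hx : x ∈ window n) : wordExt w x = w ⟨x, hx⟩ := tailGlue_of_mem hx

theorem wordExt_mem_good : wordExt w ∈ goodColorings ↔ EvenColors w :=
  tailGlue_good infinite_baseSeq

theorem eq_wordExt (h : f ∈ colorCylinder n w) : ∀ x ∈ window n, f x = wordExt w x := fun x hx => by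
  rw [wordExt_of_mem hx]
  exact h.2.2 ⟨x, hx⟩

theorem colorAct_wordExt (τ : Equiv.Perm (window n)) :
    colorAct (ofWindow n τ) (wordExt w) = wordExt (w ∘ τ.symm) := colorAct_ofWindow_tailGlue τ

end WordExt

/-! ### Root words -/

section Words

variable {H : ℕ → Type*} [∀ i, NormedAddCommGroup (H i)] [∀ i, InnerProductSpace ℂ (H i)]
  {ξ : ∀ i, Metric.sphere (0 : H i) 1} {π : ∀ i, URep (H i)} {p : Weights}

/-- The colors of `±1, …, ±d` of a coloring from `Y_{d_1, d_2, …}`. -/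
def RootWord (π : ∀ i, URep (H i)) : Type :=
  {w : window (totalDepth π) → ℕ // wordExt w ∈ rootColorings π}

variable (w : RootWord π)

theorem RootWord.evenColors : EvenColors w.1 := wordExt_mem_good.1 w.2.1

theorem RootWord.good : wordExt w.1 ∈ goodColorings := w.2.1

theorem RootWord.half_eq (i : ℕ) : half (wordExt w.1) i (totalDepth π) = depth (π i) :=
  (mem_rootColorings_iff.1 w.2).2.2 i

theorem mem_rootColorings_of_eq {f f' : Coloring} (hf : f ∈ goodColorings)
    (hn : f ∈ symColorings (totalDepth π)) (h : ∀ x ∈ window (totalDepth π), f x = f' x)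
    (hf' : f' ∈ rootColorings π) : f ∈ rootColorings π := by
  rw [mem_rootColorings_iff] at hf' ⊢
  exact ⟨hf, hn, fun i => by rw [half_congr h, hf'.2.2 i]⟩

/-- The word of a coloring. -/
def RootWord.ofColoring {f : Coloring} (h : f ∈ rootColorings π) : RootWord π :=
  ⟨fun x => f x, mem_rootColorings_of_eq (wordExt_mem_good.2 (evenColors_of_good h.1 h.2.1))
    wordExt_mem_symColorings (fun _ hx => wordExt_of_mem hx) h⟩

theorem mem_colorCylinder_iff {f : Coloring} : f ∈ colorCylinder (totalDepth π) w.1 ↔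
    ∃ h : f ∈ rootColorings π, RootWord.ofColoring h = w := by
  constructor
  · intro h
    exact ⟨mem_rootColorings_of_eq h.1 h.2.1 (eq_wordExt h) w.2,
      Subtype.ext (funext fun x => h.2.2 x)⟩
  · rintro ⟨h, rfl⟩
    exact ⟨h.1, h.2.1, fun x => rfl⟩

theorem mixLaw_colorCylinder_self {n : ℕ} {w : window n → ℕ} (hw : EvenColors w) :
    mixLaw p (colorCylinder n w) = ENNReal.ofReal (weight p n w) := by
  have := mixLaw_colorCylinder p hw 0 0
  rw [pow_zero, mul_one] at this
  rw [← this]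
  congr 1
  ext f
  simp

theorem mixLaw_colorCylinder_ne_top {n : ℕ} {w : window n → ℕ} (hw : EvenColors w) :
    mixLaw p (colorCylinder n w) ≠ ∞ := by
  rw [mixLaw_colorCylinder_self hw]
  exact ENNReal.ofReal_ne_top

theorem RootWord.ncard (i : ℕ) : Nat.card {x : window (totalDepth π) // w.1 x = i} =
    2 * depth (π i) := by
  rw [← w.2.2.2 i, ← Nat.card_coe_set_eq]
  refine Nat.card_congr ⟨fun x => ⟨x.1, x.1.2, (wordExt_apply x.1).trans x.2⟩,
    fun x => ⟨⟨x.1, x.2.1⟩, (wordExt_of_mem x.2.1).symm.trans x.2.2⟩, fun _ => rfl, fun _ => rfl⟩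

theorem RootWord.depth_ne_zero (x : window (totalDepth π)) : depth (π (w.1 x)) ≠ 0 := by
  intro h
  have h1 := w.ncard (w.1 x)
  rw [h, mul_zero] at h1
  have : Nonempty {y : window (totalDepth π) // w.1 y = w.1 x} := ⟨⟨x, rfl⟩⟩
  exact Nat.card_pos.ne' h1

theorem isRootWord_iff {w : window (totalDepth π) → ℕ} : wordExt w ∈ rootColorings π ↔
    ∀ i, Nat.card {x : window (totalDepth π) // w x = i} = 2 * depth (π i) := by
  refine ⟨fun h => RootWord.ncard ⟨w, h⟩, fun h => ?_⟩
  have hcard : ∀ i, (colorClass (wordExt w) i (totalDepth π)).card = 2 * depth (π i) := by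
    intro i
    rw [← h i, ← ncard_eq_card_colorClass, ← Nat.card_coe_set_eq]
    refine Nat.card_congr ⟨fun x => ⟨⟨x.1, x.2.1⟩, (wordExt_of_mem x.2.1).symm.trans x.2.2⟩,
      fun x => ⟨x.1, x.1.2, (wordExt_apply x.1).trans x.2⟩, fun _ => rfl, fun _ => rfl⟩
  rw [mem_rootColorings_iff]
  refine ⟨wordExt_mem_good.2 ((balanced_tailGlue (s := baseSeq)).1
    ⟨tailGlue_mem, fun i => ?_⟩), wordExt_mem_symColorings, fun i => ?_⟩
  · change Even (colorClass (wordExt w) i (totalDepth π)).card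
    rw [hcard i]
    exact even_two_mul _
  · rw [half, hcard i, Nat.mul_div_cancel_left _ two_pos]

theorem exists_rootWord (hdepth : {i | depth (π i) ≠ 0}.Finite) : Nonempty (RootWord π) := by
  classical
  let I := hdepth.toFinset
  have hd : totalDepth π = ∑ i ∈ I, depth (π i) :=
    finsum_eq_sum_of_support_subset _ (by
      intro i hi
      simpa [I] using hi)
  have hcard : Fintype.card (window (totalDepth π)) =
      Fintype.card (Σ i : I, Fin (2 * depth (π i))) := by
    rw [card_window, Fintype.card_sigma, hd, Finset.mul_sum, ← Finset.sum_coe_sort]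
    exact Finset.sum_congr rfl fun i _ => by rw [Fintype.card_fin]
  let e := Fintype.equivOfCardEq hcard
  refine ⟨⟨fun x => (e x).1.1, isRootWord_iff.2 fun i => ?_⟩⟩
  have h1 : Nat.card {x : window (totalDepth π) // ((e x).1 : ℕ) = i} =
      Nat.card {q : Σ i : I, Fin (2 * depth (π i)) // (q.1 : ℕ) = i} :=
    Nat.card_congr (e.subtypeEquiv fun x => Iff.rfl)
  rw [h1]
  by_cases hi : i ∈ I
  · have e2 : {q : Σ i : I, Fin (2 * depth (π i)) // (q.1 : ℕ) = i} ≃ Fin (2 * depth (π i)) :=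
      ⟨fun q => Fin.cast (by rw [q.2]) q.1.2, fun k => ⟨⟨⟨i, hi⟩, k⟩, rfl⟩, by
        rintro ⟨⟨⟨j, hj⟩, k⟩, h⟩
        dsimp only at h
        subst h
        rfl, fun k => rfl⟩
    rw [Nat.card_congr e2, Nat.card_eq_fintype_card, Fintype.card_fin]
  · have : IsEmpty {q : Σ i : I, Fin (2 * depth (π i)) // (q.1 : ℕ) = i} :=
      ⟨fun q => hi (q.2 ▸ q.1.1.2)⟩
    have h0 : depth (π i) = 0 := by
      by_contra h
      exact hi (hdepth.mem_toFinset.2 h)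
    rw [Nat.card_of_isEmpty, h0]

theorem finite_rootWord (hdepth : {i | depth (π i) ≠ 0}.Finite) : Finite (RootWord π) := by
  have : Finite {i | depth (π i) ≠ 0} := hdepth
  refine Finite.of_injective (β := window (totalDepth π) → {i | depth (π i) ≠ 0})
    (fun w x => ⟨w.1 x, w.depth_ne_zero x⟩) fun w w' h => Subtype.ext (funext fun x => ?_)
  exact congrArg Subtype.val (congrFun h x)

/-- The action of permutations of `{±1, …, ±d}` on words. -/
def RootWord.perm (τ : Equiv.Perm (window (totalDepth π))) (w : RootWord π) : RootWord π :=
  ⟨w.1 ∘ τ.symm, isRootWord_iff.2 fun i => by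
    rw [← w.ncard i]
    exact Nat.card_congr (τ.symm.subtypeEquiv fun x => Iff.rfl)⟩

theorem RootWord.wordExt_perm (τ : Equiv.Perm (window (totalDepth π))) :
    wordExt (w.perm τ).1 = colorAct (ofWindow _ τ) (wordExt w.1) := (colorAct_wordExt τ).symm

@[simp] theorem RootWord.perm_apply (τ : Equiv.Perm (window (totalDepth π)))
    (x : window (totalDepth π)) : (w.perm τ).1 x = w.1 (τ.symm x) := rfl

@[simp] theorem RootWord.perm_symm_perm (τ : Equiv.Perm (window (totalDepth π))) :
    (w.perm τ).perm τ.symm = w := Subtype.ext (funext fun x => by simp)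

@[simp] theorem RootWord.perm_perm_symm (τ : Equiv.Perm (window (totalDepth π))) :
    (w.perm τ.symm).perm τ = w := Subtype.ext (funext fun x => by simp)

theorem RootWord.exists_perm (w w' : RootWord π) : ∃ τ, w.perm τ = w' := by
  have hc : ∀ i, Nonempty ({x : window (totalDepth π) // w.1 x = i} ≃
      {x : window (totalDepth π) // w'.1 x = i}) := fun i =>
    ⟨(Finite.equivFinOfCardEq (w.ncard i)).trans (Finite.equivFinOfCardEq (w'.ncard i)).symm⟩
  refine ⟨Equiv.ofFiberEquiv fun i => (hc i).some, Subtype.ext (funext fun x => ?_)⟩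
  rw [RootWord.perm_apply]
  have h := Equiv.ofFiberEquiv_map (f := w.1) (g := w'.1) (fun i => (hc i).some)
    ((Equiv.ofFiberEquiv fun i => (hc i).some).symm x)
  rw [Equiv.apply_symm_apply] at h
  exact h.symm

theorem RootWord.weight_eq (w w' : RootWord π) :
    weight p (totalDepth π) w.1 = weight p (totalDepth π) w'.1 := by
  obtain ⟨τ, rfl⟩ := w.exists_perm w'
  exact (Equiv.prod_comp τ.symm fun x => √(p (w.1 x))).symm

end Words

/-! ### Vectors of the mixture as functions on root words -/

section MixVec

variable {H : ℕ → Type*} [∀ i, NormedAddCommGroup (H i)] [∀ i, InnerProductSpace ℂ (H i)]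
  {ξ : ∀ i, Metric.sphere (0 : H i) 1} {π : ∀ i, URep (H i)} {p : Weights}
  {ρ : URep (MixSpace ξ p)}

open Classical in
/-- The function on `Y` with given values on the sets of colorings with a given root word. -/
def rootFun (u : RootWord π → InfTensor ξ) : Coloring → InfTensor ξ := fun f =>
  if h : f ∈ rootColorings π then u (RootWord.ofColoring h) else 0

theorem rootFun_of_notMem {u : RootWord π → InfTensor ξ} {f : Coloring}
    (h : f ∉ rootColorings π) : rootFun u f = 0 := dif_neg h

theorem rootFun_of_mem {u : RootWord π → InfTensor ξ} {f : Coloring} {w : RootWord π}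
    (h : f ∈ colorCylinder (totalDepth π) w.1) : rootFun u f = u w := by
  obtain ⟨h1, h2⟩ := (mem_colorCylinder_iff w).1 h
  rw [rootFun, dif_pos h1, h2]

variable [Fintype (RootWord π)]

theorem rootFun_eq_sum (u : RootWord π → InfTensor ξ) : rootFun u =
    fun f => ∑ w, (colorCylinder (totalDepth π) w.1).indicator (fun _ => u w) f := by
  classical
  funext f
  by_cases h : f ∈ rootColorings π
  · have hw : f ∈ colorCylinder (totalDepth π) (RootWord.ofColoring h).1 :=
      (mem_colorCylinder_iff _).2 ⟨h, rfl⟩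
    rw [rootFun_of_mem hw, Finset.sum_eq_single (RootWord.ofColoring h), Set.indicator_of_mem hw]
    · intro w _ hne
      refine Set.indicator_of_notMem (fun h' => hne ?_) _
      obtain ⟨h1, h2⟩ := (mem_colorCylinder_iff w).1 h'
      exact h2.symm
    · exact fun h' => absurd (Finset.mem_univ _) h'
  · rw [rootFun_of_notMem h, Finset.sum_eq_zero]
    intro w _
    exact Set.indicator_of_notMem (fun h' => h ((mem_colorCylinder_iff w).1 h').1) _

theorem memLp_rootFun (u : RootWord π → InfTensor ξ) : MemLp (rootFun u) 2 (mixLaw p) := by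
  rw [rootFun_eq_sum]
  exact memLp_finsetSum _ fun w _ => memLp_indicator_const 2 (measurableSet_colorCylinder w.1) _
    (Or.inr (mixLaw_colorCylinder_ne_top w.evenColors))

/-- The element of `L²(Y, E)` with given values on the sets of colorings with a given root word. -/
def mixVec (p : Weights) : (RootWord π → InfTensor ξ) →ₗ[ℂ] MixSpace ξ p where
  toFun u := (memLp_rootFun u).toLp _
  map_add' u v := by
    rw [← MemLp.toLp_add]
    refine MemLp.toLp_congr _ _ (Eventually.of_forall fun f => ?_)
    simp only [Pi.add_apply, rootFun]
    split_ifs <;> simp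
  map_smul' c u := by
    rw [RingHom.id_apply, ← MemLp.toLp_const_smul]
    refine MemLp.toLp_congr _ _ (Eventually.of_forall fun f => ?_)
    simp only [Pi.smul_apply, rootFun]
    split_ifs <;> simp

theorem coeFn_mixVec (u : RootWord π → InfTensor ξ) :
    (mixVec p u : Coloring → InfTensor ξ) =ᵐ[mixLaw p] rootFun u :=
  (memLp_rootFun u).coeFn_toLp

open Classical in
theorem mixVec_single (w : RootWord π) (c : InfTensor ξ) :
    mixVec p (Pi.single w c) = indicatorConstLp 2 (measurableSet_colorCylinder w.1)
      (mixLaw_colorCylinder_ne_top (p := p) w.evenColors) c := by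
  classical
  refine Lp.ext ((coeFn_mixVec _).trans ?_)
  refine EventuallyEq.trans (Eventually.of_forall fun f => ?_) indicatorConstLp_coeFn.symm
  by_cases h : f ∈ colorCylinder (totalDepth π) w.1
  · rw [rootFun_of_mem h, Pi.single_eq_same, Set.indicator_of_mem h]
  · rw [Set.indicator_of_notMem h]
    by_cases h' : f ∈ rootColorings π
    · have h2 : f ∈ colorCylinder (totalDepth π) (RootWord.ofColoring h').1 :=
        (mem_colorCylinder_iff _).2 ⟨h', rfl⟩
      rw [rootFun_of_mem h2, Pi.single_eq_of_ne]
      rintro rfl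
      exact h h2
    · exact rootFun_of_notMem h'

theorem inner_mixVec (u : RootWord π → InfTensor ξ) (F : MixSpace ξ p) :
    ⟪mixVec p u, F⟫_ℂ = ∑ w, ∫ f in colorCylinder (totalDepth π) w.1,
      ⟪u w, (F : Coloring → InfTensor ξ) f⟫_ℂ ∂mixLaw p := by
  classical
  conv_lhs => rw [← Finset.univ_sum_single u, map_sum, sum_inner]
  refine Finset.sum_congr rfl fun w _ => ?_
  rw [mixVec_single, L2.inner_indicatorConstLp_eq_setIntegral_inner]

theorem mixLaw_real_tail (w : RootWord π) (i m : ℕ) :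
    (mixLaw p).real (colorCylinder (totalDepth π) w.1 ∩
      {f | ∀ j < m, f (posNZ (totalDepth π + j)) = i}) =
        weight p (totalDepth π) w.1 * p i ^ m := by
  rw [Measure.real, mixLaw_colorCylinder p w.evenColors, ENNReal.toReal_ofReal]
  exact mul_nonneg (weight_pos p _).le (pow_nonneg (p.pos i).le m)

theorem inner_mixVec_mixVec (u v : RootWord π → InfTensor ξ) :
    ⟪mixVec p u, mixVec p v⟫_ℂ =
      ∑ w : RootWord π, (weight p (totalDepth π) w.1 : ℂ) * ⟪u w, v w⟫_ℂ := by
  rw [inner_mixVec]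
  refine Finset.sum_congr rfl fun w _ => ?_
  have h1 : ∫ f in colorCylinder (totalDepth π) w.1,
      ⟪u w, (mixVec p v : Coloring → InfTensor ξ) f⟫_ℂ ∂mixLaw p =
      ∫ f in colorCylinder (totalDepth π) w.1, ⟪u w, v w⟫_ℂ ∂mixLaw p := by
    refine setIntegral_congr_ae (measurableSet_colorCylinder w.1) ?_
    filter_upwards [coeFn_mixVec (p := p) v] with f hf hw
    rw [hf, rootFun_of_mem hw]
  rw [h1, setIntegral_const, Measure.real, mixLaw_colorCylinder_self w.evenColors,
    ENNReal.toReal_ofReal (weight_pos p _).le, Complex.real_smul]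

theorem mem_mixRoot_iff {F : MixSpace ξ p} : F ∈ mixRoot π ξ p ↔
    ∃ u : RootWord π → InfTensor ξ, (∀ w, u w ∈ tensorRoot π ξ) ∧ mixVec p u = F := by
  classical
  constructor
  · rintro ⟨u, hu, h⟩
    refine ⟨fun w => u w.1, fun w => hu _, Lp.ext ?_⟩
    filter_upwards [h, coeFn_mixVec (p := p) fun w : RootWord π => u w.1] with f h1 h2
    rw [h2, h1, rootFun]
    split_ifs <;> rfl
  · rintro ⟨u, hu, rfl⟩
    refine ⟨fun w => if h : wordExt w ∈ rootColorings π then u ⟨w, h⟩ else 0, fun w => ?_, ?_⟩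
    · dsimp only
      split_ifs
      · exact hu _
      · exact Submodule.zero_mem _
    · filter_upwards [coeFn_mixVec (p := p) u] with f h2
      rw [h2]
      by_cases h : f ∈ rootColorings π
      · rw [rootFun, dif_pos h, if_pos h]
        have h' : wordExt (fun x : window (totalDepth π) => f x) ∈ rootColorings π :=
          (RootWord.ofColoring h).2
        rw [dif_pos h']
        rfl
      · rw [rootFun_of_notMem h, if_neg h]

theorem coc_eq_wordExt {f : Coloring} {w : RootWord π}
    (h : f ∈ colorCylinder (totalDepth π) w.1) {g : G} (hg : SuppIn (totalDepth π) g) :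
    coc g f = coc g (wordExt w.1) :=
  coc_congr h.1 w.good h.2.1 wordExt_mem_symColorings (eq_wordExt h) hg

/-- The label of a point of `{±1, …, ±d}`, for the colors given by a root word. -/
def RootWord.label (w : RootWord π) (x : window (totalDepth π)) : NZ :=
  lab (wordExt w.1) (w.1 x) x

theorem RootWord.label_mem (w : RootWord π) (x : window (totalDepth π)) :
    w.label x ∈ window (depth (π (w.1 x))) := by
  rw [← w.half_eq]
  exact lab_mem_window w.good wordExt_mem_symColorings (wordExt_apply x) x.2

theorem RootWord.lab_eq {w : RootWord π} {f : Coloring}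
    (h : f ∈ colorCylinder (totalDepth π) w.1) (x : window (totalDepth π)) :
    lab f (w.1 x) x = w.label x :=
  lab_congr h.1 w.good h.2.1 wordExt_mem_symColorings (eq_wordExt h) _ x.2

/-- The action of permutations of `{±1, …, ±d}` on the values. -/
def permVec (τ : Equiv.Perm (window (totalDepth π))) (v : RootWord π → InfTensor ξ) :
    RootWord π → InfTensor ξ := fun w =>
  tensorAct π (coc (ofWindow _ τ) (wordExt (w.perm τ.symm).1)) (v (w.perm τ.symm))

theorem IsMixAction.ofWindow_mixVec (h : IsMixAction π ξ p ρ)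
    (τ : Equiv.Perm (window (totalDepth π))) (v : RootWord π → InfTensor ξ) :
    ρ (ofWindow _ τ) (mixVec p v) = mixVec p (permVec τ v) := by
  refine Lp.ext ?_
  have hτ := suppIn_ofWindow (totalDepth π) τ
  filter_upwards [h.coeFn (ofWindow _ τ) (mixVec p v),
    ae_comp_colorAct (ofWindow _ τ)⁻¹ (coeFn_mixVec (p := p) v),
    coeFn_mixVec (p := p) (permVec τ v), ae_mem_good p] with f h1 h2 h3 hf
  rw [h1, h3, mixFun, h2]
  have key : ∀ (w : RootWord π) (f : Coloring), f ∈ colorCylinder (totalDepth π) w.1 →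
      colorAct (ofWindow _ τ) f ∈ colorCylinder (totalDepth π) (w.perm τ).1 := by
    intro w f hw
    refine ⟨colorAct_mem_good _ hw.1, hτ.colorAct_mem hw.2.1, fun x => ?_⟩
    rw [RootWord.perm_apply, ← hw.2.2]
    have := colorAct_apply_apply (ofWindow _ τ) f (τ.symm x)
    rwa [ofWindow_apply, Equiv.apply_symm_apply] at this
  by_cases hr : colorAct (ofWindow _ τ)⁻¹ f ∈ rootColorings π
  · have hw : colorAct (ofWindow _ τ)⁻¹ f ∈ colorCylinder (totalDepth π)
      (RootWord.ofColoring hr).1 := (mem_colorCylinder_iff _).2 ⟨hr, rfl⟩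
    have hw' := key _ _ hw
    rw [colorAct_colorAct_inv] at hw'
    rw [rootFun_of_mem hw, rootFun_of_mem hw', permVec, RootWord.perm_symm_perm,
      coc_eq_wordExt hw hτ]
  · have hr' : f ∉ rootColorings π := by
      intro hf'
      have hw : f ∈ colorCylinder (totalDepth π) ((RootWord.ofColoring hf').perm τ.symm |>.perm τ).1 :=
        (mem_colorCylinder_iff _).2 ⟨hf', by rw [RootWord.perm_perm_symm]⟩
      have hw2 : colorAct (ofWindow _ τ)⁻¹ f ∈ colorCylinder (totalDepth π)
          ((RootWord.ofColoring hf').perm τ.symm).1 := by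
        refine ⟨colorAct_mem_good _ hf, hτ.inv.colorAct_mem hw.2.1, fun x => ?_⟩
        have := colorAct_apply_apply (ofWindow _ τ) (colorAct (ofWindow _ τ)⁻¹ f) x
        rw [ofWindow_apply, colorAct_colorAct_inv, hw.2.2, RootWord.perm_apply,
          Equiv.symm_apply_apply] at this
        exact this.symm
      exact hr ((mem_colorCylinder_iff _).1 hw2).1
    rw [rootFun_of_notMem hr, rootFun_of_notMem hr', (isLinearMap_tensorAct π _).map_zero]

/-- Matrix coefficients of star products with center in `{±1, …, ±d}`. -/
theorem IsMixAction.inner_starProd_window (h : IsMixAction π ξ p ρ)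
    (u v : RootWord π → InfTensor ξ) (x : window (totalDepth π)) (m : ℕ) :
    ⟪mixVec p u, ρ (starProd x (totalDepth π) m) (mixVec p v)⟫_ℂ =
      ∑ w : RootWord π, ((weight p (totalDepth π) w.1 * p (w.1 x) ^ m : ℝ) : ℂ) *
        ⟪u w, placeRep π ξ (w.1 x) (starProd (w.label x) (depth (π (w.1 x))) m) (v w)⟫_ℂ := by
  rw [inner_mixVec]
  refine Finset.sum_congr rfl fun w _ => ?_
  set z := starProd x (totalDepth π) m with hz
  set T : Set Coloring := {f | ∀ j < m, f (posNZ (totalDepth π + j)) = w.1 x}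
  set c := ⟪u w, placeRep π ξ (w.1 x) (starProd (w.label x) (depth (π (w.1 x))) m) (v w)⟫_ℂ
  have h1 : ∫ f in colorCylinder (totalDepth π) w.1,
      ⟪u w, (ρ z (mixVec p v) : Coloring → InfTensor ξ) f⟫_ℂ ∂mixLaw p =
      ∫ f in colorCylinder (totalDepth π) w.1, T.indicator (fun _ => c) f ∂mixLaw p := by
    refine setIntegral_congr_ae (measurableSet_colorCylinder w.1) ?_
    filter_upwards [h.coeFn z (mixVec p v), ae_comp_colorAct z⁻¹ (coeFn_mixVec (p := p) v)]
      with f h1 h2 hw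
    rw [h1, mixFun, h2]
    -- If all outer points have the color of `x`, the star product preserves `f` and acts at one
    -- place by a star product. Otherwise the preimage of `f` is not a root coloring and the
    -- integrand is zero.
    by_cases hT : f ∈ T
    · have hfx : f x = w.1 x := hw.2.2 x
      obtain ⟨h3, -, h4⟩ := coc_starProd hw.1 hw.2.1 hfx m hT
      have h5 : colorAct z⁻¹ f = f := by
        conv_lhs => rw [← h3, hz, colorAct_inv_colorAct]
      have h6 : half f (w.1 x) (totalDepth π) = depth (π (w.1 x)) := by
        rw [half_congr (eq_wordExt hw), w.half_eq]
      rw [Set.indicator_of_mem hT, h5, hz, h4, rootFun_of_mem hw, RootWord.lab_eq hw, h6]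
      rfl
    · rw [Set.indicator_of_notMem hT, rootFun_of_notMem, (isLinearMap_tensorAct π _).map_zero,
        inner_zero_right]
      intro hr
      refine hT fun j hj => ?_
      have hne : ∀ j, x.1 ≠ posNZ (totalDepth π + j) := fun j hx => by
        have := x.2
        rw [hx] at this
        simp at this
      have hne' : ∀ j, x.1 ≠ -posNZ (totalDepth π + j) := fun j hx => by
        have := x.2
        rw [hx] at this
        simp at this
      rw [eq_of_colorAct_starProd hw.2.1 (hne 0) hne hne' m hr.2.1 j hj]
      exact hw.2.2 x
  have hTm : MeasurableSet T := measurableSet_tail _ _ _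
  rw [h1, setIntegral_indicator hTm, setIntegral_const, mixLaw_real_tail, Complex.real_smul]

end MixVec

/-! ### Polarization -/

section Polarization

variable {V : Type*} [NormedAddCommGroup V] [InnerProductSpace ℂ V]

/-- The quadratic form is evaluated at `u + v` and `u + i v`. In this way the condition on unit
vectors in the definition of the Thoma measure becomes a statement about all pairs of vectors of the
root. -/
theorem inner_eq_of_unit {S : Submodule ℂ V} {T : V →L[ℂ] V} {c : ℂ}
    (h : ∀ ζ ∈ S, ‖ζ‖ = 1 → ⟪ζ, T ζ⟫_ℂ = c) {u v : V} (hu : u ∈ S) (hv : v ∈ S) :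
    ⟪u, T v⟫_ℂ = c * ⟪u, v⟫_ℂ := by
  have h1 : ∀ ζ ∈ S, ⟪ζ, T ζ⟫_ℂ - c * ⟪ζ, ζ⟫_ℂ = 0 := by
    intro ζ hζ
    by_cases h0 : ζ = 0
    · simp [h0]
    have hn : (‖ζ‖ : ℂ) ≠ 0 := by simpa using h0
    have h2 := h ((‖ζ‖ : ℂ)⁻¹ • ζ) (S.smul_mem _ hζ) (by
      rw [norm_smul, norm_inv, Complex.norm_real, norm_norm, inv_mul_cancel₀ (norm_ne_zero_iff.2 h0)])
    rw [map_smul, inner_smul_left, inner_smul_right, map_inv₀, Complex.conj_ofReal] at h2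
    rw [inner_self_eq_norm_sq_to_K, ← h2]
    simp only [Complex.coe_algebraMap]
    field_simp
    ring
  let B : V → V → ℂ := fun u v => ⟪u, T v⟫_ℂ - c * ⟪u, v⟫_ℂ
  have e1 : B u v + B v u = 0 := by
    have h2 := h1 (u + v) (S.add_mem hu hv)
    have h3 := h1 u hu
    have h4 := h1 v hv
    simp only [map_add, inner_add_left, inner_add_right] at h2
    simp only [B]
    linear_combination h2 - h3 - h4
  have e2 : B u v - B v u = 0 := by
    have h2 := h1 (u + Complex.I • v) (S.add_mem hu (S.smul_mem _ hv))
    have h3 := h1 u hu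
    have h4 := h1 v hv
    simp only [map_add, map_smul, inner_add_left, inner_add_right, inner_smul_left,
      inner_smul_right, Complex.conj_I] at h2
    have h5 : Complex.I * (B u v - B v u) = 0 := by
      simp only [B]
      linear_combination h2 - h3 - h4 - (⟪v, T v⟫_ℂ - c * ⟪v, v⟫_ℂ) * (-Complex.I_sq) + 2 * h4 * 0
    exact (mul_eq_zero.1 h5).resolve_left Complex.I_ne_zero
  have h6 : B u v = 0 := by linear_combination (e1 + e2) / 2
  exact sub_eq_zero.1 h6

end Polarization

/-! ### Moments of measures on `[-1, 1]` -/

section Moments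

variable {μ : Measure ℝ} [IsProbabilityMeasure μ]

theorem ae_abs_le_one (h : μ (Set.Icc (-1) 1)ᶜ = 0) : ∀ᵐ t ∂μ, |t| ≤ 1 := by
  filter_upwards [(measure_eq_zero_iff_ae_notMem).1 h] with t ht
  rw [Set.notMem_compl_iff] at ht
  exact abs_le.2 ht

theorem integrable_pow_of_abs_le (h : μ (Set.Icc (-1) 1)ᶜ = 0) (m : ℕ) :
    Integrable (fun t : ℝ => t ^ m) μ := by
  refine Integrable.of_bound (by fun_prop) 1 ?_
  filter_upwards [ae_abs_le_one h] with t ht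
  rw [norm_pow, Real.norm_eq_abs]
  exact pow_le_one₀ (abs_nonneg t) ht

theorem abs_moment_le_one (h : μ (Set.Icc (-1) 1)ᶜ = 0) (m : ℕ) : |∫ t, t ^ m ∂μ| ≤ 1 := by
  rw [← Real.norm_eq_abs]
  refine (norm_integral_le_of_norm_le_const (C := 1) ?_).trans (by simp)
  filter_upwards [ae_abs_le_one h] with t ht
  rw [norm_pow, Real.norm_eq_abs]
  exact pow_le_one₀ (abs_nonneg t) ht

end Moments

/-! ### The mixed measure -/

section MixMeasure

variable {p : Weights} {μ : ℕ → Measure ℝ}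

theorem Weights.le_one (p : Weights) (i : ℕ) : p i ≤ 1 :=
  le_hasSum p.hasSum i fun j _ => (p.pos j).le

theorem isProbabilityMeasure_mixMeasure (hμ : ∀ i, IsProbabilityMeasure (μ i)) :
    IsProbabilityMeasure (mixMeasure p μ) := by
  constructor
  rw [mixMeasure, Measure.sum_apply _ MeasurableSet.univ]
  have : ∀ i, (ENNReal.ofReal (p i) • (μ i).map fun t => p i * t) Set.univ =
      ENNReal.ofReal (p i) := fun i => by
    rw [Measure.smul_apply, Measure.map_apply (by fun_prop) MeasurableSet.univ, Set.preimage_univ,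
      measure_univ, smul_eq_mul, mul_one]
  simp only [this]
  rw [← ENNReal.ofReal_tsum_of_nonneg (fun i => (p.pos i).le) p.hasSum.summable,
    p.hasSum.tsum_eq, ENNReal.ofReal_one]

theorem mixMeasure_compl (hμ : ∀ i, μ i (Set.Icc (-1) 1)ᶜ = 0) :
    mixMeasure p μ (Set.Icc (-1) 1)ᶜ = 0 := by
  rw [mixMeasure, Measure.sum_apply _ measurableSet_Icc.compl, ENNReal.tsum_eq_zero]
  intro i
  rw [Measure.smul_apply, Measure.map_apply (by fun_prop) measurableSet_Icc.compl, smul_eq_mul]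
  refine mul_eq_zero_of_right _ (measure_mono_null (t := (Set.Icc (-1) 1)ᶜ) ?_ (hμ i))
  intro t ht h
  refine ht (abs_le.1 ?_)
  have h1 := abs_le.2 h
  rw [abs_mul, abs_of_pos (p.pos i)]
  exact mul_le_one₀ (p.le_one i) (abs_nonneg t) h1

/-- One factor `p i` is the weight of the summand; the other `m` factors come from the substitution
`t ↦ p i * t`. -/
theorem moment_mixMeasure (hp : ∀ i, IsProbabilityMeasure (μ i))
    (hμ : ∀ i, μ i (Set.Icc (-1) 1)ᶜ = 0) (m : ℕ) :
    ∫ t, t ^ m ∂mixMeasure p μ = ∑' i, p i ^ (m + 1) * ∫ t, t ^ m ∂μ i := by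
  have := isProbabilityMeasure_mixMeasure (p := p) hp
  have hint := integrable_pow_of_abs_le (mixMeasure_compl (p := p) hμ) m
  rw [mixMeasure] at hint ⊢
  rw [integral_sum_measure hint]
  refine tsum_congr fun i => ?_
  rw [integral_smul_measure, integral_map (by fun_prop) (by fun_prop),
    ENNReal.toReal_ofReal (p.pos i).le]
  simp only [mul_pow]
  rw [integral_const_mul, smul_eq_mul, pow_succ]
  ring

end MixMeasure

/-! ### The moments of the operator at `d + 1` -/

section Central

variable {H : ℕ → Type*} [∀ i, NormedAddCommGroup (H i)] [∀ i, InnerProductSpace ℂ (H i)]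
  {ξ : ∀ i, Metric.sphere (0 : H i) 1} {π : ∀ i, URep (H i)} {p : Weights}
  {ρ : URep (MixSpace ξ p)} [∀ i, CompleteSpace (H i)]

theorem opA_pow_placeRep_tprodAt {i : ℕ} (h : IsAdmissible (π i)) (v : Family ξ) (x : NZ) (m : ℕ)
    (a : H i) : (opA (placeRep π ξ i) x ^ m) (tprodAt v i a) = tprodAt v i ((opA (π i) x ^ m) a) := by
  induction m generalizing a with
  | zero => rfl
  | succ m ih =>
    rw [pow_succ, pow_succ]
    change (opA (placeRep π ξ i) x ^ m) (opA (placeRep π ξ i) x (tprodAt v i a)) = _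
    rw [opA_placeRep_tprodAt h, ih]
    rfl

theorem tensorRoot_induction {Q : InfTensor ξ → Prop}
    (hpure : ∀ v : Family ξ, (∀ i, v.1 i ∈ root (π i)) → Q (tprod v))
    (hzero : Q 0) (hadd : ∀ a b, Q a → Q b → Q (a + b)) (hsmul : ∀ (c : ℂ) a, Q a → Q (c • a))
    (hclosed : IsClosed {a | Q a}) {a : InfTensor ξ} (ha : a ∈ tensorRoot π ξ) : Q a := by
  let S : Submodule ℂ (InfTensor ξ) :=
    { carrier := {a | Q a}, add_mem' := fun h h' => hadd _ _ h h', zero_mem' := hzero,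
      smul_mem' := fun c a h => hsmul c a h }
  have hle : tensorRoot π ξ ≤ S := by
    refine Submodule.topologicalClosure_minimal _ ?_ hclosed
    rw [Submodule.span_le]
    rintro _ ⟨v, hv, rfl⟩
    exact hpure v hv
  exact hle ha

theorem inner_opA_pow_placeRep {i : ℕ} (h : IsAdmissible (π i)) {c : ℂ} {x : NZ} {m : ℕ}
    (hc : ∀ u ∈ root (π i), ∀ v ∈ root (π i), ⟪u, (opA (π i) x ^ m) v⟫_ℂ = c * ⟪u, v⟫_ℂ)
    {u v : InfTensor ξ} (hu : u ∈ tensorRoot π ξ) (hv : v ∈ tensorRoot π ξ) :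
    ⟪u, (opA (placeRep π ξ i) x ^ m) v⟫_ℂ = c * ⟪u, v⟫_ℂ := by
  refine tensorRoot_induction (Q := fun u => ⟪u, (opA (placeRep π ξ i) x ^ m) v⟫_ℂ = c * ⟪u, v⟫_ℂ)
    (fun a ha => ?_) (by simp) (fun a b h1 h2 => by
      rw [inner_add_left, inner_add_left, h1, h2, mul_add]) (fun r a h1 => by
      rw [inner_smul_left, inner_smul_left, h1]; ring) (isClosed_eq (by fun_prop) (by fun_prop)) hu
  refine tensorRoot_induction (Q := fun v =>
      ⟪tprod a, (opA (placeRep π ξ i) x ^ m) v⟫_ℂ = c * ⟪tprod a, v⟫_ℂ)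
    (fun b hb => ?_) (by simp) (fun a b h1 h2 => by
      rw [map_add, inner_add_right, inner_add_right, h1, h2, mul_add]) (fun r a h1 => by
      rw [map_smul, inner_smul_right, inner_smul_right, h1]; ring)
      (isClosed_eq (by fun_prop) (by fun_prop)) hv
  rw [← tprodAt_self b i, opA_pow_placeRep_tprodAt h, tprodAt_apply, tprodAt_self,
    inner_tprod_update, inner_tprod_eq a b i, hc _ (ha i) _ (hb i), mul_assoc]

theorem tensorRoot_le_fixed (i : ℕ) :
    tensorRoot π ξ ≤ fixed (placeRep π ξ i) (depth (π i)) :=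
  fixedTensor_le_fixed (fun i => depth (π i)) i

variable [Fintype (RootWord π)]

-- The star product has its center at `d + 1` and `m` further points. It contributes only where
-- these `m + 1` points have a common color `i`, which has the conditional probability `p i ^ (m +
-- 1)`. There it acts as a star product at the place `i` whose center is the first point beyond the
-- depth of `π i`, and this yields `β i`.
open Classical in
theorem IsMixAction.inner_starProd_central (h : IsMixAction π ξ p ρ)
    (hadm : ∀ i, IsAdmissible (π i)) {m : ℕ} {β : ℕ → ℝ} (hβ1 : ∀ i, |β i| ≤ 1)
    (hβ : ∀ i, ∀ u ∈ root (π i), ∀ v ∈ root (π i),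
      ⟪u, (opA (π i) (posNZ (depth (π i))) ^ m) v⟫_ℂ = β i * ⟪u, v⟫_ℂ)
    {u v : RootWord π → InfTensor ξ} (hu : ∀ w, u w ∈ tensorRoot π ξ)
    (hv : ∀ w, v w ∈ tensorRoot π ξ) :
    ⟪mixVec p u, ρ (starProd (posNZ (totalDepth π)) (totalDepth π + 1) m) (mixVec p v)⟫_ℂ =
      ((∑' i, p i ^ (m + 1) * β i : ℝ) : ℂ) * ⟪mixVec p u, mixVec p v⟫_ℂ := by
  rw [inner_mixVec, inner_mixVec_mixVec, Finset.mul_sum]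
  refine Finset.sum_congr rfl fun w _ => ?_
  set d := totalDepth π with hd
  set z := starProd (posNZ d) (d + 1) m with hz
  let S : ℕ → Set Coloring := fun i => colorCylinder d w.1 ∩ {f | ∀ j < m + 1, f (posNZ (d + j)) = i}
  let T : Set Coloring := {f | ∀ j < m, f (posNZ (d + 1 + j)) = f (posNZ d)}
  let ψ : Coloring → ℝ := T.indicator fun f => β (f (posNZ d))
  have hTm : MeasurableSet T := by
    simp only [T, Set.ofPred_forall]
    exact MeasurableSet.iInter fun j => MeasurableSet.iInter fun _ =>
      measurableSet_eq_fun (measurable_pi_apply _) (measurable_pi_apply _)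
  have hψm : Measurable ψ :=
    ((measurable_of_countable β).comp (measurable_pi_apply (posNZ d))).indicator hTm
  have hcyl := measurableSet_colorCylinder w.1
  have hSm : ∀ i, MeasurableSet (S i) := fun i => hcyl.inter (measurableSet_tail _ _ _)
  have hST : ∀ i, ∀ f ∈ S i, f ∈ T ∧ f (posNZ d) = i := by
    intro i f hf
    have h0 : f (posNZ d) = i := hf.2 0 (by omega)
    refine ⟨fun j hj => ?_, h0⟩
    rw [h0, add_assoc, add_comm 1 j]
    exact hf.2 (j + 1) (by omega)
  have hSd : Pairwise (Function.onFun Disjoint S) := fun i j hij =>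
    Set.disjoint_left.2 fun f hi hj => hij ((hST i f hi).2.symm.trans (hST j f hj).2)
  have hfin : mixLaw p (colorCylinder d w.1) < ∞ :=
    (mixLaw_colorCylinder_ne_top w.evenColors).lt_top
  have hψint : IntegrableOn ψ (colorCylinder d w.1) (mixLaw p) := by
    refine IntegrableOn.of_bound hfin hψm.aestronglyMeasurable 1 (Eventually.of_forall fun f => ?_)
    by_cases hf : f ∈ T
    · rw [show ψ f = β (f (posNZ d)) from Set.indicator_of_mem hf _]
      exact hβ1 _
    · rw [show ψ f = 0 from Set.indicator_of_notMem hf _]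
      simp
  have hsub : (⋃ i, S i) ⊆ colorCylinder d w.1 := Set.iUnion_subset fun i => Set.inter_subset_left
  have hψ : ∫ f in colorCylinder d w.1, ψ f ∂mixLaw p =
      weight p d w.1 * ∑' i, p i ^ (m + 1) * β i := by
    have h1 : ∫ f in colorCylinder d w.1, ψ f ∂mixLaw p = ∫ f in ⋃ i, S i, ψ f ∂mixLaw p := by
      refine setIntegral_eq_of_subset_of_forall_sdiff_eq_zero hcyl hsub fun f hf => ?_
      refine Set.indicator_of_notMem (fun hT => hf.2 ?_) _
      refine Set.mem_iUnion.2 ⟨f (posNZ d), hf.1, fun j hj => ?_⟩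
      cases j with
      | zero => rfl
      | succ j =>
        have := hT j (by omega)
        rwa [add_assoc, add_comm 1 j] at this
    have h2 := integral_iUnion hSm hSd (hψint.mono_set hsub)
    rw [h1, h2, ← tsum_mul_left]
    refine tsum_congr fun i => ?_
    have h3 : ∫ f in S i, ψ f ∂mixLaw p = ∫ f in S i, β i ∂mixLaw p :=
      setIntegral_congr_fun (hSm i) fun f hf => by
        obtain ⟨h4, h5⟩ := hST i f hf
        rw [show ψ f = β (f (posNZ d)) from Set.indicator_of_mem h4 _, h5]
    rw [h3, setIntegral_const, mixLaw_real_tail, smul_eq_mul, mul_assoc]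
  have h1 : ∫ f in colorCylinder d w.1,
      ⟪u w, (ρ z (mixVec p v) : Coloring → InfTensor ξ) f⟫_ℂ ∂mixLaw p =
      ∫ f in colorCylinder d w.1, (ψ f : ℂ) * ⟪u w, v w⟫_ℂ ∂mixLaw p := by
    refine setIntegral_congr_ae hcyl ?_
    filter_upwards [h.coeFn z (mixVec p v), ae_comp_colorAct z⁻¹ (coeFn_mixVec (p := p) v)]
      with f h1 h2 hw
    rw [h1, mixFun, h2]
    have hsucc : f ∈ symColorings (d + 1) := symColorings_mono (Nat.le_succ d) hw.2.1
    by_cases hT : f ∈ T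
    · obtain ⟨h3, -, h4⟩ := coc_starProd hw.1 hsucc (x := posNZ d) rfl m hT
      have h5 : colorAct z⁻¹ f = f := by
        conv_lhs => rw [← h3, hz, colorAct_inv_colorAct]
      set i := f (posNZ d) with hi
      have h6 : half f i d = depth (π i) := by
        rw [half_congr (eq_wordExt hw), w.half_eq]
      have h7 : half f i (d + 1) = depth (π i) + 1 := by
        rw [half_succ (balanced_of_good hw.1 hw.2.1), h6, if_pos hi.symm]
      have h8 : lab f i (posNZ d) = posNZ (depth (π i)) := by
        rw [lab_posNZ hw.1 hw.2.1 hi.symm, h6]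
      rw [show ψ f = β i from Set.indicator_of_mem hT _, h5, hz, h4, rootFun_of_mem hw, h7, h8,
        ← inner_opA_pow_placeRep (hadm i) (hβ i) (hu w) (hv w)]
      exact inner_starProd (isAdmissible_placeRep (hadm i)) (by simp) m
        (fixed_mono _ (Nat.le_succ _) (tensorRoot_le_fixed i (hu w)))
        (fixed_mono _ (Nat.le_succ _) (tensorRoot_le_fixed i (hv w)))
    · rw [show ψ f = 0 from Set.indicator_of_notMem hT _, rootFun_of_notMem,
        (isLinearMap_tensorAct π _).map_zero, inner_zero_right, Complex.ofReal_zero, zero_mul]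
      intro hr
      refine hT fun j hj => ?_
      exact eq_of_colorAct_starProd hsucc (by rw [Ne, posNZ_inj]; omega)
        (fun j => by rw [Ne, posNZ_inj]; omega) (fun j => (neg_posNZ_ne _ _).symm) m
        (symColorings_mono (Nat.le_succ d) hr.2.1) j hj
  have h2 : ∫ f in colorCylinder d w.1, (ψ f : ℂ) ∂mixLaw p =
      ((∫ f in colorCylinder d w.1, ψ f ∂mixLaw p : ℝ) : ℂ) := integral_ofReal
  rw [h1, integral_mul_const, h2, hψ, Complex.ofReal_mul]
  ring

end Central

/-! ### Finiteness of the root from a Young distribution -/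

section Young

variable {V : Type*} [NormedAddCommGroup V] [InnerProductSpace ℂ V] {ρ : URep V}
  {L : YoungDistribution}

theorem HasYoungDistribution.finiteDimensional_root (h : HasYoungDistribution ρ L) :
    FiniteDimensional ℂ (root ρ) := by
  obtain ⟨e, φ, -, h2, -⟩ := h
  rw [← h2]
  have : FiniteDimensional ℂ L.youngModule := FiniteDimensional.span_of_finite ℂ (Set.finite_range _)
  infer_instance

theorem HasYoungDistribution.size_eq (h : HasYoungDistribution ρ L) : L.size = 2 * depth ρ := by
  obtain ⟨e, -⟩ := h
  rw [YoungDistribution.size, Fintype.card_congr e, card_window]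

end Young

/-! ### Cyclic spans of invariant vectors -/

section CyclicSpan

variable {V : Type*} [NormedAddCommGroup V] [InnerProductSpace ℂ V] {ρ : URep V} {S : Set V}
  {d : ℕ}

/-- The closure of the vectors invariant under some `K_n` is a closed subrepresentation that
contains `S`. -/
theorem isAdmissible_cyclicSpan (hS : S ⊆ fixed ρ d) : IsAdmissible (cyclicSpan ρ S).rep := by
  set C := cyclicSpan ρ S with hC
  have hdir : Directed (· ≤ ·) (fixed C.rep) := fun a b =>
    ⟨max a b, fixed_mono _ (le_max_left _ _), fixed_mono _ (le_max_right _ _)⟩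
  have hU : (⋃ n, (fixed C.rep n : Set C.carrier)) =
      ((⨆ n, fixed C.rep n : Submodule ℂ C.carrier) : Set C.carrier) :=
    (Submodule.coe_iSup_of_directed _ hdir).symm
  unfold IsAdmissible
  rw [hU, Submodule.dense_iff_topologicalClosure_eq_top]
  let U : Subrep C.rep :=
    { carrier := (⨆ n, fixed C.rep n).topologicalClosure
      isClosed := Submodule.isClosed_topologicalClosure _
      invariant := by
        intro g v hv
        have hg : ∀ u ∈ ((⨆ n, fixed C.rep n : Submodule ℂ C.carrier) : Set C.carrier),
            C.rep g u ∈ ((⨆ n, fixed C.rep n : Submodule ℂ C.carrier) : Set C.carrier) := by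
          intro u hu
          rw [← hU] at hu ⊢
          obtain ⟨n, hn⟩ := Set.mem_iUnion.1 hu
          obtain ⟨m, hm⟩ := exists_suppIn g
          exact Set.mem_iUnion.2 ⟨max n m, (hm.mono (le_max_right n m)).rho_mem_fixed
            (fixed_mono _ (le_max_left n m) hn)⟩
        exact map_mem_closure (C.rep g).continuous hv hg }
  have hle : C.carrier ≤ (C.map U).carrier := cyclicSpan_le fun v hv => by
    refine ⟨⟨v, subset_cyclicSpan ρ S hv⟩, ?_, rfl⟩
    refine Submodule.le_topologicalClosure _ (Submodule.mem_iSup_of_mem d ?_)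
    exact C.mem_fixed_rep.2 (hS hv)
  rw [eq_top_iff]
  intro v _
  obtain ⟨u, hu, huv⟩ := hle v.2
  rwa [← Subtype.ext huv]

theorem isCyclicFixed_cyclicSpan (hS : S ⊆ fixed ρ d) :
    IsCyclicFixed (cyclicSpan ρ S).rep d := fun U hU => by
  have hle : (cyclicSpan ρ S).carrier ≤ ((cyclicSpan ρ S).map U).carrier :=
    cyclicSpan_le fun v hv =>
      ⟨⟨v, subset_cyclicSpan ρ S hv⟩, hU ((cyclicSpan ρ S).mem_fixed_rep.2 (hS hv)), rfl⟩
  rw [eq_top_iff]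
  intro v _
  obtain ⟨u, hu, huv⟩ := hle v.2
  rwa [← Subtype.ext huv]

end CyclicSpan

/-! ### The tensor product of the roots -/

variable {H : ℕ → Type*} [∀ i, NormedAddCommGroup (H i)] [∀ i, InnerProductSpace ℂ (H i)]
  {ξ : ∀ i, Metric.sphere (0 : H i) 1} {π : ∀ i, URep (H i)} {p : Weights} {μ : ℕ → Measure ℝ}
  {ρ : URep (MixSpace ξ p)} [∀ i, CompleteSpace (H i)]

/-- The assumptions on the representations and on the unit vectors of a mixture. -/
structure IsMixable (π : ∀ i, URep (H i)) (ξ : ∀ i, Metric.sphere (0 : H i) 1)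
    (μ : ℕ → Measure ℝ) : Prop where
  irreducible : ∀ i, IsIrreducible (π i)
  admissible : ∀ i, IsAdmissible (π i)
  thoma : ∀ i, HasThomaMeasure (π i) (μ i)
  finiteDimensional_root : ∀ i, FiniteDimensional ℂ (root (π i))
  finite_depth : {i | depth (π i) ≠ 0}.Finite
  mem_root : ∀ i, depth (π i) = 0 → (ξ i : H i) ∈ root (π i)

namespace IsMixable

variable (hs : IsMixable π ξ μ)
include hs

theorem finite_notMem_fixed : {i | (ξ i : H i) ∉ fixed (π i) 0}.Finite :=
  hs.finite_depth.subset fun i hi h => hi (by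
    have := hs.mem_root i h
    rwa [root, h] at this)

theorem inner_opA_pow (i m : ℕ) {u v : H i} (hu : u ∈ root (π i)) (hv : v ∈ root (π i)) :
    ⟪u, (opA (π i) (posNZ (depth (π i))) ^ m) v⟫_ℂ = ((∫ t, t ^ m ∂μ i : ℝ) : ℂ) * ⟪u, v⟫_ℂ :=
  inner_eq_of_unit (fun ζ hζ h => (hs.thoma i).2.2 ζ hζ h m) hu hv

theorem root_ne_bot (i : ℕ) : root (π i) ≠ ⊥ :=
  haveI := (hs.irreducible i).1
  Mixture.root_ne_bot (hs.admissible i)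

theorem form_eq (i : ℕ) (B : H i →ₗ⋆[ℂ] H i →ₗ[ℂ] ℂ)
    (hS : ∀ g, SuppIn (depth (π i)) g → ∀ u ∈ root (π i), ∀ v ∈ root (π i),
      B u (π i g v) = B (π i g⁻¹ u) v)
    (hA : ∀ x ∈ window (depth (π i)), ∀ u ∈ root (π i), ∀ v ∈ root (π i),
      B u (opA (π i) x v) = B (opA (π i) x u) v) :
    ∃ c : ℂ, ∀ u ∈ root (π i), ∀ v ∈ root (π i), B u v = c * ⟪u, v⟫_ℂ :=
  have : FiniteDimensional ℂ (fixed (π i) (depth (π i))) := hs.finiteDimensional_root i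
  (hs.irreducible i).form_eq (hs.admissible i) (fun _ => fixed_eq_bot_of_lt_depth)
    (fun m u hu v hv => hs.inner_opA_pow i m hu hv) (hs.root_ne_bot i) B hS hA

/-- In depth zero the window is empty, so neither permutations nor operators `A_x` act and the line
through `ξ i` is invariant. The root has no proper invariant subspaces. -/
theorem root_eq_span {i : ℕ} (h : depth (π i) = 0) : root (π i) = ℂ ∙ (ξ i : H i) := by
  have : FiniteDimensional ℂ (fixed (π i) (depth (π i))) := hs.finiteDimensional_root i
  have hξ := hs.mem_root i h
  have hw : ∀ x, x ∉ window (depth (π i)) := by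
    rw [h]
    exact notMem_window_zero
  have := (hs.irreducible i).invariant_eq (hs.admissible i) (fun _ => fixed_eq_bot_of_lt_depth)
    (fun m u hu v hv => hs.inner_opA_pow i m hu hv) (R := ℂ ∙ (ξ i : H i))
    ((Submodule.span_singleton_le_iff_mem _ _).2 hξ) (fun g hg r hr => by
      have : g = 1 := G.ext' fun x => hg x (hw x)
      rwa [this, map_one]) (fun x hx => absurd hx (hw x))
  rcases this with h | h
  · have h1 := (Submodule.span_singleton_eq_bot).1 h
    exact absurd h1 (ne_zero_of_mem_unit_sphere (ξ i))
  · exact h.symm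

/-- Almost all roots are the lines through `ξ i`, so only finitely many places allow a choice of
factor. The span is finite-dimensional and therefore closed. -/
theorem exists_finite_span : ∃ T : Set (InfTensor ξ), T.Finite ∧
    (∀ u ∈ T, ∃ v : Family ξ, (∀ i, v.1 i ∈ root (π i)) ∧ u = tprod v) ∧
    tensorRoot π ξ = Submodule.span ℂ T := by
  classical
  have hfg : ∀ i, ∃ S : Set (H i), S.Finite ∧ Submodule.span ℂ S = root (π i) ∧
      (depth (π i) = 0 → S = {(ξ i : H i)}) := fun i => by
    by_cases h : depth (π i) = 0
    · exact ⟨_, Set.finite_singleton _, (hs.root_eq_span h).symm, fun _ => rfl⟩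
    · obtain ⟨S, hS⟩ := Module.Finite.iff_fg.1 (hs.finiteDimensional_root i)
      exact ⟨S, S.finite_toSet, hS, fun h' => absurd h' h⟩
  choose S hSf hSs hS0 using hfg
  let T : Set (InfTensor ξ) := {u | ∃ s : Family ξ, (∀ i, s.1 i ∈ S i) ∧ u = tprod s}
  have hT : T.Finite := by
    have : Finite {i | depth (π i) ≠ 0} := hs.finite_depth
    have : ∀ i, Finite (S i) := fun i => hSf i
    have hfin : Finite {s : Family ξ // ∀ i, s.1 i ∈ S i} := by
      refine Finite.of_injective (β := ∀ i : {i | depth (π i) ≠ 0}, S i)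
        (fun s i => ⟨s.1.1 i, s.2 i⟩) fun s s' h => Subtype.ext (Family.ext' fun i => ?_)
      by_cases hi : depth (π i) = 0
      · have h1 := s.2 i
        have h2 := s'.2 i
        rw [hS0 i hi] at h1 h2
        exact h1.trans h2.symm
      · exact congrArg Subtype.val (congrFun h ⟨i, hi⟩)
    refine (Set.finite_range fun s : {s : Family ξ // ∀ i, s.1 i ∈ S i} => tprod s.1).subset ?_
    rintro _ ⟨s, hs, rfl⟩
    exact ⟨⟨s, hs⟩, rfl⟩
  have hTr : ∀ u ∈ T, ∃ v : Family ξ, (∀ i, v.1 i ∈ root (π i)) ∧ u = tprod v := by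
    rintro _ ⟨s, hs, rfl⟩
    exact ⟨s, fun i => hSs i ▸ Submodule.subset_span (hs i), rfl⟩
  have : FiniteDimensional ℂ (Submodule.span ℂ T) := FiniteDimensional.span_of_finite ℂ hT
  refine ⟨T, hT, hTr, le_antisymm ?_ ?_⟩
  · refine Submodule.topologicalClosure_minimal _ ?_ (Submodule.closed_of_finiteDimensional _)
    rw [Submodule.span_le]
    rintro _ ⟨v, hv, rfl⟩
    refine tprod_mem_span S (hs.finite_depth.toFinset ∪ v.2.toFinset) v (fun i hi => ?_)
      (fun i _ => (hSs i).symm ▸ hv i)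
    simp only [Finset.mem_union, Set.Finite.mem_toFinset, Set.mem_ofPred_eq, not_or, not_not] at hi
    rw [hS0 i hi.1, hi.2]
    rfl
  · rw [Submodule.span_le]
    intro u hu
    exact Submodule.le_topologicalClosure _ (Submodule.subset_span (hTr u hu))

theorem finiteDimensional_tensorRoot : FiniteDimensional ℂ (tensorRoot π ξ) := by
  obtain ⟨T, hT, -, h⟩ := hs.exists_finite_span
  rw [h]
  exact FiniteDimensional.span_of_finite ℂ hT

/-- Pure tensors span the tensor product of the roots. -/
theorem pure_induction {Q : InfTensor ξ → Prop}
    (hpure : ∀ v : Family ξ, (∀ i, v.1 i ∈ root (π i)) → Q (tprod v))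
    (hzero : Q 0) (hadd : ∀ a b, Q a → Q b → Q (a + b)) (hsmul : ∀ (c : ℂ) a, Q a → Q (c • a))
    {a : InfTensor ξ} (ha : a ∈ tensorRoot π ξ) : Q a := by
  obtain ⟨T, -, hT, h⟩ := hs.exists_finite_span
  rw [h] at ha
  induction ha using Submodule.span_induction with
  | mem u hu =>
    obtain ⟨v, hv, rfl⟩ := hT u hu
    exact hpure v hv
  | zero => exact hzero
  | add a b _ _ h1 h2 => exact hadd a b h1 h2
  | smul c a _ h1 => exact hsmul c a h1

theorem exists_family : ∃ v : Family ξ, (∀ i, v.1 i ∈ root (π i)) ∧ tprod v ≠ 0 := by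
  classical
  choose r hr hr0 using fun i => Submodule.exists_mem_ne_zero_of_ne_bot (hs.root_ne_bot i)
  let v : Family ξ := ⟨fun i => if depth (π i) = 0 then ξ i else r i,
    hs.finite_depth.subset fun i hi h => hi (if_pos h)⟩
  have h0 : ∀ i, v.1 i ≠ 0 := fun i => by
    change (if depth (π i) = 0 then (ξ i : H i) else r i) ≠ 0
    split_ifs
    · exact ne_zero_of_mem_unit_sphere (ξ i)
    · exact hr0 i
  refine ⟨v, fun i => ?_, fun h => ?_⟩
  · change (if depth (π i) = 0 then (ξ i : H i) else r i) ∈ _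
    split_ifs with h
    · exact hs.mem_root i h
    · exact hr i
  · have h1 : ⟪tprod v, tprod v⟫_ℂ ≠ 0 := by
      rw [inner_tprod]
      exact finprod_induction (· ≠ 0) one_ne_zero (fun _ _ => mul_ne_zero)
        fun i => inner_self_ne_zero.2 (h0 i)
    exact h1 (by rw [h, inner_zero_left])

theorem tensorAct_mem {γ : GFamily} (hγ : ∀ i, SuppIn (depth (π i)) (γ.1 i)) {u : InfTensor ξ}
    (hu : u ∈ tensorRoot π ξ) : tensorAct π γ u ∈ tensorRoot π ξ := by
  have hl := isLinearMap_tensorAct (ξ := ξ) π γ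
  refine hs.pure_induction (Q := fun u => tensorAct π γ u ∈ tensorRoot π ξ) (fun v hv => ?_)
    (by rw [hl.map_zero]; exact zero_mem _) (fun a b h1 h2 => by
      rw [hl.map_add]; exact add_mem h1 h2) (fun c a h1 => by
      rw [hl.map_smul]; exact Submodule.smul_mem _ _ h1) hu
  rw [tensorAct_tprod]
  exact Submodule.le_topologicalClosure _ (Submodule.subset_span
    ⟨Family.act π γ v, fun i => (hγ i).rho_mem_fixed (hv i), rfl⟩)

theorem opA_placeRep_mem {i : ℕ} {x : NZ} (hx : x ∈ window (depth (π i))) {u : InfTensor ξ}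
    (hu : u ∈ tensorRoot π ξ) : opA (placeRep π ξ i) x u ∈ tensorRoot π ξ := by
  refine hs.pure_induction (Q := fun u => opA (placeRep π ξ i) x u ∈ tensorRoot π ξ)
    (fun v hv => ?_) (by rw [map_zero]; exact zero_mem _) (fun a b h1 h2 => by
      rw [map_add]; exact add_mem h1 h2) (fun c a h1 => by
      rw [map_smul]; exact Submodule.smul_mem _ _ h1) hu
  rw [← tprodAt_self v i, opA_placeRep_tprodAt (hs.admissible i), tprodAt_apply]
  refine Submodule.le_topologicalClosure _ (Submodule.subset_span ⟨_, fun j => ?_, rfl⟩)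
  by_cases h : j = i
  · subst h
    rw [Family.update_same]
    exact opA_mem_fixed (hs.admissible j) hx (hv j)
  · rw [Family.update_ne _ h]
    exact hv j

end IsMixable

/-! ### The root, the depth and the Thoma measure of the mixture -/

variable {H : ℕ → Type*} [∀ i, NormedAddCommGroup (H i)] [∀ i, InnerProductSpace ℂ (H i)]
  {ξ : ∀ i, Metric.sphere (0 : H i) 1} {π : ∀ i, URep (H i)} {p : Weights} {μ : ℕ → Measure ℝ}
  {ρ : URep (MixSpace ξ p)} [∀ i, CompleteSpace (H i)] [Fintype (RootWord π)]

/-- The invariant vector of the mixture with given values in the tensor product of the roots. -/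
def rootVec (ρ : URep (MixSpace ξ p)) :
    (RootWord π → tensorRoot π ξ) →ₗ[ℂ] (cyclicSpan ρ (mixRoot π ξ p)).carrier where
  toFun v := ⟨mixVec p fun w => v w,
    subset_cyclicSpan _ _ (mem_mixRoot_iff.2 ⟨fun w => v w, fun w => (v w).2, rfl⟩)⟩
  map_add' u v := Subtype.ext ((mixVec p).map_add (fun w => (u w : InfTensor ξ)) fun w => v w)
  map_smul' c v := Subtype.ext ((mixVec p).map_smul c fun w => (v w : InfTensor ξ))

theorem inner_rootVec (u v : RootWord π → tensorRoot π ξ) :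
    ⟪rootVec ρ u, rootVec ρ v⟫_ℂ =
      ∑ w : RootWord π, (weight p (totalDepth π) w.1 : ℂ) * ⟪u w, v w⟫_ℂ :=
  inner_mixVec_mixVec _ _

theorem weight_ne_zero (w : RootWord π) : (weight p (totalDepth π) w.1 : ℂ) ≠ 0 :=
  Complex.ofReal_ne_zero.2 (weight_pos p w.1).ne'

theorem rootVec_injective : Function.Injective (rootVec (π := π) ρ) := by
  classical
  rw [← LinearMap.ker_eq_bot, LinearMap.ker_eq_bot']
  intro v hv
  funext w
  have h := inner_rootVec (ρ := ρ) (Pi.single w (v w)) v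
  rw [hv, inner_zero_right, Finset.sum_eq_single w (fun w' _ hne => by
    rw [Pi.single_eq_of_ne hne, inner_zero_left, mul_zero]) (by simp), Pi.single_eq_same] at h
  exact inner_self_eq_zero.1 ((mul_eq_zero.1 h.symm).resolve_left (weight_ne_zero w))

namespace IsMixAction

variable (h : IsMixAction π ξ p ρ) (hs : IsMixable π ξ μ)
include h

theorem isAdmissible_mixture : IsAdmissible (mixture π ξ p ρ) :=
  isAdmissible_cyclicSpan fun _ => h.mem_fixed

theorem isCyclicFixed_mixture : IsCyclicFixed (mixture π ξ p ρ) (totalDepth π) :=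
  isCyclicFixed_cyclicSpan fun _ => h.mem_fixed

theorem rootVec_mem_fixed (v : RootWord π → tensorRoot π ξ) :
    rootVec ρ v ∈ fixed (mixture π ξ p ρ) (totalDepth π) :=
  (Subrep.mem_fixed_rep _).2 (h.mem_fixed (mem_mixRoot_iff.2 ⟨fun w => v w, fun w => (v w).2, rfl⟩))

include hs

theorem fixed_mixture_eq_bot {n : ℕ} (hn : n < totalDepth π) : fixed (mixture π ξ p ρ) n = ⊥ := by
  rw [Submodule.eq_bot_iff]
  intro v hv
  have := (Subrep.mem_fixed_rep _).1 hv
  rw [IsMixAction.fixed_eq_bot hs.finite_depth hs.finite_notMem_fixed h hn, Submodule.mem_bot]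
    at this
  exact Subtype.ext this

theorem range_rootVec :
    LinearMap.range (rootVec ρ) = fixed (mixture π ξ p ρ) (totalDepth π) := by
  refine le_antisymm ?_ fun v hv => ?_
  · rintro _ ⟨v, rfl⟩
    exact h.rootVec_mem_fixed v
  · have h1 := h.mem_mixRoot hs.finite_depth hs.finite_notMem_fixed ((Subrep.mem_fixed_rep _).1 hv)
    obtain ⟨u, hu, huv⟩ := mem_mixRoot_iff.1 h1
    exact ⟨fun w => ⟨u w, hu w⟩, Subtype.ext huv⟩

theorem finiteDimensional_fixed :
    FiniteDimensional ℂ (fixed (mixture π ξ p ρ) (totalDepth π)) := by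
  have := hs.finiteDimensional_tensorRoot
  rw [← h.range_rootVec hs]
  infer_instance

theorem fixed_mixture_ne_bot : fixed (mixture π ξ p ρ) (totalDepth π) ≠ ⊥ := by
  obtain ⟨v, hv, hv0⟩ := hs.exists_family
  obtain ⟨w⟩ := exists_rootWord hs.finite_depth
  rw [← h.range_rootVec hs]
  intro hb
  have h1 : rootVec ρ (fun _ : RootWord π => (⟨tprod v, Submodule.le_topologicalClosure _
      (Submodule.subset_span ⟨v, hv, rfl⟩)⟩ : tensorRoot π ξ)) = 0 := by
    rw [← Submodule.mem_bot ℂ, ← hb]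
    exact ⟨_, rfl⟩
  have h2 := congrFun (rootVec_injective (h1.trans (map_zero _).symm)) w
  exact hv0 (congrArg Subtype.val h2)

theorem depth_mixture : depth (mixture π ξ p ρ) = totalDepth π :=
  depth_eq (h.fixed_mixture_ne_bot hs) fun _ => h.fixed_mixture_eq_bot hs

theorem root_mixture : root (mixture π ξ p ρ) = LinearMap.range (rootVec ρ) := by
  rw [root, h.depth_mixture hs, h.range_rootVec hs]

theorem eq_rootVec {a : (cyclicSpan ρ (mixRoot π ξ p)).carrier}
    (ha : a ∈ fixed (mixture π ξ p ρ) (totalDepth π)) {v : RootWord π → tensorRoot π ξ}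
    (hv : ∀ u, ⟪rootVec ρ u, a⟫_ℂ = ⟪rootVec ρ u, rootVec ρ v⟫_ℂ) : a = rootVec ρ v := by
  have h1 : a - rootVec ρ v ∈ LinearMap.range (rootVec (π := π) ρ) := by
    rw [h.range_rootVec hs]
    exact sub_mem ha (h.rootVec_mem_fixed v)
  obtain ⟨u, hu⟩ := h1
  have h2 : ⟪rootVec ρ u, a - rootVec ρ v⟫_ℂ = 0 := by
    rw [inner_sub_right, hv, sub_self]
  rw [hu] at h2
  exact sub_eq_zero.1 (inner_self_eq_zero.1 h2)

theorem inner_opA_pow_central (m : ℕ) {u v : (cyclicSpan ρ (mixRoot π ξ p)).carrier}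
    (hu : u ∈ fixed (mixture π ξ p ρ) (totalDepth π))
    (hv : v ∈ fixed (mixture π ξ p ρ) (totalDepth π)) :
    ⟪u, (opA (mixture π ξ p ρ) (posNZ (totalDepth π)) ^ m) v⟫_ℂ =
      ((∫ t, t ^ m ∂mixMeasure p μ : ℝ) : ℂ) * ⟪u, v⟫_ℂ := by
  rw [← inner_starProd h.isAdmissible_mixture (n := totalDepth π + 1) (by simp) m
    (fixed_mono _ (Nat.le_succ _) hu) (fixed_mono _ (Nat.le_succ _) hv)]
  rw [← h.range_rootVec hs] at hu hv
  obtain ⟨u, rfl⟩ := hu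
  obtain ⟨v, rfl⟩ := hv
  have hprob := fun i => (hs.thoma i).1
  rw [moment_mixMeasure (fun i => (hs.thoma i).1) (fun i => (hs.thoma i).2.1)]
  exact h.inner_starProd_central hs.admissible (β := fun i => ∫ t, t ^ m ∂μ i)
    (fun i => abs_moment_le_one (hs.thoma i).2.1 m)
    (fun i u hu v hv => hs.inner_opA_pow i m hu hv) (fun w => (u w).2) fun w => (v w).2

end IsMixAction

theorem RootWord.suppIn_coc (w : RootWord π) (τ : Equiv.Perm (window (totalDepth π))) (i : ℕ) :
    SuppIn (depth (π i)) ((coc (ofWindow _ τ) (wordExt w.1)).1 i) := by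
  rw [← w.half_eq i]
  exact Mixture.suppIn_coc w.good wordExt_mem_symColorings (suppIn_ofWindow _ τ) i

/-- The operators `A_x` in terms of the values. -/
def rootOp (hs : IsMixable π ξ μ) (p : Weights) (x : window (totalDepth π))
    (v : RootWord π → tensorRoot π ξ) : RootWord π → tensorRoot π ξ := fun w =>
  (p (w.1 x) : ℂ) • ⟨opA (placeRep π ξ (w.1 x)) (w.label x) (v w),
    hs.opA_placeRep_mem (w.label_mem x) (v w).2⟩

/-- The action of permutations of `{±1, …, ±d}` in terms of the values. -/
def rootPerm (hs : IsMixable π ξ μ) (τ : Equiv.Perm (window (totalDepth π)))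
    (v : RootWord π → tensorRoot π ξ) : RootWord π → tensorRoot π ξ := fun w =>
  ⟨permVec τ (fun w => (v w : InfTensor ξ)) w, by
    exact hs.tensorAct_mem ((w.perm τ.symm).suppIn_coc τ) (v (w.perm τ.symm)).2⟩

namespace IsMixAction

variable (h : IsMixAction π ξ p ρ) (hs : IsMixable π ξ μ)
include h

theorem ofWindow_rootVec (τ : Equiv.Perm (window (totalDepth π)))
    (v : RootWord π → tensorRoot π ξ) :
    mixture π ξ p ρ (ofWindow _ τ) (rootVec ρ v) = rootVec ρ (rootPerm hs τ v) :=
  Subtype.ext (h.ofWindow_mixVec τ _)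

/-- This is the star product formula for `m = 1`: the outer point has the color of `x` with
probability `p (w.1 x)`, the factor in `rootOp`. -/
theorem opA_rootVec (x : window (totalDepth π)) (v : RootWord π → tensorRoot π ξ) :
    opA (mixture π ξ p ρ) x (rootVec ρ v) = rootVec ρ (rootOp hs p x v) := by
  refine h.eq_rootVec hs (opA_mem_fixed h.isAdmissible_mixture x.2 (h.rootVec_mem_fixed v))
    fun u => ?_
  have h1 := inner_starProd h.isAdmissible_mixture x.2 1 (h.rootVec_mem_fixed u)
    (h.rootVec_mem_fixed v)
  rw [pow_one] at h1
  rw [← h1, inner_rootVec]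
  refine (h.inner_starProd_window _ _ x 1).trans (Finset.sum_congr rfl fun w _ => ?_)
  rw [inner_starProd (isAdmissible_placeRep (hs.admissible _)) (w.label_mem x) 1
    (tensorRoot_le_fixed _ (u w).2) (tensorRoot_le_fixed _ (v w).2), pow_one, pow_one]
  have h2 : ⟪u w, rootOp hs p x v w⟫_ℂ =
      (p (w.1 x) : ℂ) * ⟪(u w : InfTensor ξ), opA (placeRep π ξ (w.1 x)) (w.label x) (v w)⟫_ℂ :=
    inner_smul_right (u w) (⟨opA (placeRep π ξ (w.1 x)) (w.label x) (v w),
      hs.opA_placeRep_mem (w.label_mem x) (v w).2⟩ : tensorRoot π ξ) _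
  rw [h2, Complex.ofReal_mul, mul_assoc]

include hs

theorem exists_decomposition_mixture :
    ∃ (ι : Type) (W : ι → Subrep (mixture π ξ p ρ)),
      Nonempty ι ∧
      (∀ j k, j ≠ k → (W j).carrier ⟂ (W k).carrier) ∧
      (⨆ j, (W j).carrier).topologicalClosure = ⊤ ∧
      ∀ j, IsIrreducible (W j).rep ∧ IsAdmissible (W j).rep ∧
        HasThomaMeasure (W j).rep (mixMeasure p μ) := by
  have hadm := h.isAdmissible_mixture
  have hfin := h.finiteDimensional_fixed hs
  obtain ⟨ι, W, h1, h2, h3⟩ := exists_decomposition h.isCyclicFixed_mixture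
    { carrier := ⊤, isClosed := isClosed_univ, invariant := fun _ _ _ => trivial }
  refine ⟨ι, W, ?_, h1, ?_, fun j => ⟨h3 j, (W j).isAdmissible_rep hadm,
    isProbabilityMeasure_mixMeasure fun i => (hs.thoma i).1,
    mixMeasure_compl fun i => (hs.thoma i).2.1, fun ζ hζ hn m => ?_⟩⟩
  · by_contra hne
    rw [not_nonempty_iff] at hne
    rw [iSup_of_empty] at h2
    refine h.fixed_mixture_ne_bot hs ?_
    rw [eq_bot_iff, h2]
    exact le_top
  · rw [h2, eq_top_iff]
    exact Submodule.le_topologicalClosure _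
  -- By cyclicity a nonzero summand contains `K_d`-invariant vectors, so it has the depth of the
  -- mixture and its root lies in the root of the mixture.
  · have hd : depth (W j).rep = totalDepth π := by
      refine (W j).depth_rep (fun _ => h.fixed_mixture_eq_bot hs) fun hb => ?_
      exact Submodule.nontrivial_iff_ne_bot.1 (h3 j).1 (h.isCyclicFixed_mixture.eq_bot _ hb)
    rw [root, hd] at hζ
    rw [hd]
    have h4 := h.inner_opA_pow_central hs m ((W j).mem_fixed_rep.1 hζ) ((W j).mem_fixed_rep.1 hζ)
    rw [← (W j).coe_opA_pow_rep hadm] at h4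
    refine h4.trans ?_
    have h5 : ⟪(ζ : (cyclicSpan ρ (mixRoot π ξ p)).carrier), ζ⟫_ℂ = 1 := by
      rw [inner_self_eq_norm_sq_to_K]
      have : ‖(ζ : (cyclicSpan ρ (mixRoot π ξ p)).carrier)‖ = 1 := hn
      rw [this]
      simp
    rw [h5, mul_one]

end IsMixAction

/-! ### Schur's lemma for the tensor product of the roots -/

variable {H : ℕ → Type*} [∀ i, NormedAddCommGroup (H i)] [∀ i, InnerProductSpace ℂ (H i)]
  {ξ : ∀ i, Metric.sphere (0 : H i) 1} {π : ∀ i, URep (H i)} {p : Weights} {μ : ℕ → Measure ℝ}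
  {ρ : URep (MixSpace ξ p)} [∀ i, CompleteSpace (H i)]

/-- A sesquilinear form composed with linear maps. -/
def sesqComp {E E' F F' : Type*} [AddCommGroup E] [Module ℂ E] [AddCommGroup E'] [Module ℂ E']
    [AddCommGroup F] [Module ℂ F] [AddCommGroup F'] [Module ℂ F'] (B : F →ₗ⋆[ℂ] F' →ₗ[ℂ] ℂ)
    (P : E →ₗ[ℂ] F) (Q : E' →ₗ[ℂ] F') : E →ₗ⋆[ℂ] E' →ₗ[ℂ] ℂ :=
  LinearMap.mk₂'ₛₗ (starRingEnd ℂ) (RingHom.id ℂ) (fun a b => B (P a) (Q b))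
    (fun a a' b => by rw [map_add, map_add, LinearMap.add_apply])
    (fun c a b => by rw [map_smul, LinearMap.map_smulₛₗ, LinearMap.smul_apply])
    (fun a b b' => by rw [map_add, map_add]) (fun c a b => by rw [map_smul, map_smul]; rfl)

namespace IsMixable

variable (hs : IsMixable π ξ μ)
include hs

/-- Schur's lemma for sesquilinear forms on the root. -/
theorem form_eq_root (i : ℕ) (B : root (π i) →ₗ⋆[ℂ] root (π i) →ₗ[ℂ] ℂ)
    (hS : ∀ g, SuppIn (depth (π i)) g → ∀ u v u' v' : root (π i), (u' : H i) = π i g⁻¹ u →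
      (v' : H i) = π i g v → B u v' = B u' v)
    (hA : ∀ x ∈ window (depth (π i)), ∀ u v u' v' : root (π i), (u' : H i) = opA (π i) x u →
      (v' : H i) = opA (π i) x v → B u v' = B u' v) :
    ∃ c : ℂ, ∀ u v, B u v = c * ⟪u, v⟫_ℂ := by
  have := hs.finiteDimensional_root i
  -- The projection to the root extends the form to all of `H i`.
  let P : H i →ₗ[ℂ] root (π i) := ((root (π i)).orthogonalProjectionOnto : H i →ₗ[ℂ] root (π i))
  have hP : ∀ u (hu : u ∈ root (π i)), P u = ⟨u, hu⟩ := fun u hu =>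
    Submodule.orthogonalProjectionOnto_mem_subspace_eq_self (K := root (π i)) ⟨u, hu⟩
  obtain ⟨c, hc⟩ := hs.form_eq i (sesqComp B P P) (fun g hg u hu v hv => by
      have h1 := hg.rho_mem_fixed hv
      have h2 := hg.inv.rho_mem_fixed hu
      change B (P u) (P (π i g v)) = B (P (π i g⁻¹ u)) (P v)
      rw [hP u hu, hP v hv, hP _ h1, hP _ h2]
      exact hS g hg _ _ _ _ rfl rfl) fun x hx u hu v hv => by
      have h1 := opA_mem_fixed (hs.admissible i) hx hv
      have h2 := opA_mem_fixed (hs.admissible i) hx hu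
      change B (P u) (P (opA (π i) x v)) = B (P (opA (π i) x u)) (P v)
      rw [hP u hu, hP v hv, hP _ h1, hP _ h2]
      exact hA x hx _ _ _ _ rfl rfl
  refine ⟨c, fun u v => ?_⟩
  have := hc u u.2 v v.2
  change B (P u) (P v) = _ at this
  rwa [hP u u.2, hP v v.2] at this

end IsMixable

theorem update_mem_root {v : Family ξ} (hv : ∀ i, v.1 i ∈ root (π i)) {i : ℕ} {a : H i}
    (ha : a ∈ root (π i)) (j : ℕ) : (v.update i a).1 j ∈ root (π j) := by
  by_cases h : j = i
  · subst h
    rwa [Family.update_same]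
  · rw [Family.update_ne _ h]
    exact hv j

theorem tprod_mem_tensorRoot {v : Family ξ} (hv : ∀ i, v.1 i ∈ root (π i)) :
    tprod v ∈ tensorRoot π ξ :=
  Submodule.le_topologicalClosure _ (Submodule.subset_span ⟨v, hv, rfl⟩)

theorem IsMixable.root_induction (hs : IsMixable π ξ μ) {Q : tensorRoot π ξ → Prop}
    (hpure : ∀ (v : Family ξ) (hv : ∀ i, v.1 i ∈ root (π i)), Q ⟨tprod v, tprod_mem_tensorRoot hv⟩)
    (hzero : Q 0) (hadd : ∀ a b, Q a → Q b → Q (a + b)) (hsmul : ∀ (c : ℂ) a, Q a → Q (c • a))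
    (a : tensorRoot π ξ) : Q a := by
  obtain ⟨b, hba, hb⟩ : ∃ b : tensorRoot π ξ, (b : InfTensor ξ) = a ∧ Q b := by
    refine hs.pure_induction (Q := fun a => ∃ b : tensorRoot π ξ, (b : InfTensor ξ) = a ∧ Q b)
      (fun v hv => ⟨_, rfl, hpure v hv⟩) ⟨0, rfl, hzero⟩ ?_ ?_ a.2
    · rintro _ _ ⟨b, rfl, hb⟩ ⟨c, rfl, hc⟩
      exact ⟨b + c, rfl, hadd _ _ hb hc⟩
    · rintro c _ ⟨b, rfl, hb⟩
      exact ⟨c • b, rfl, hsmul _ _ hb⟩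
  rwa [Subtype.ext hba] at hb

/-- The pure tensor with factors in the roots as a function of the factor at the place `i`. -/
def rootAt {v : Family ξ} (hv : ∀ i, v.1 i ∈ root (π i)) (i : ℕ) :
    root (π i) →ₗ[ℂ] tensorRoot π ξ :=
  LinearMap.codRestrict _ ((tprodAt v i : H i →ₗ[ℂ] InfTensor ξ) ∘ₗ (root (π i)).subtype)
    fun a => tprod_mem_tensorRoot (update_mem_root hv a.2)

theorem coe_rootAt {v : Family ξ} (hv : ∀ i, v.1 i ∈ root (π i)) (i : ℕ) (a : root (π i)) :
    (rootAt hv i a : InfTensor ξ) = tprodAt v i a := rfl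

theorem rootAt_self {v : Family ξ} (hv : ∀ i, v.1 i ∈ root (π i)) (i : ℕ) :
    rootAt hv i ⟨v.1 i, hv i⟩ = ⟨tprod v, tprod_mem_tensorRoot hv⟩ :=
  Subtype.ext (tprodAt_self v i)

theorem IsMixable.exists_unit_family (hs : IsMixable π ξ μ) :
    ∃ v : Family ξ, (∀ i, v.1 i ∈ root (π i)) ∧ ∀ i, ⟪v.1 i, v.1 i⟫_ℂ = 1 := by
  classical
  choose r hr hr0 using fun i => Submodule.exists_mem_ne_zero_of_ne_bot (hs.root_ne_bot i)
  refine ⟨⟨fun i => if depth (π i) = 0 then ξ i else (‖r i‖ : ℂ)⁻¹ • r i,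
    hs.finite_depth.subset fun i hi h => hi (if_pos h)⟩, fun i => ?_, fun i => ?_⟩
  all_goals dsimp only; split_ifs with h
  · exact hs.mem_root i h
  · exact Submodule.smul_mem _ _ (hr i)
  · rw [inner_self_eq_norm_sq_to_K]
    simp
  · rw [inner_self_eq_norm_sq_to_K, norm_smul, norm_inv, Complex.norm_real, norm_norm,
      inv_mul_cancel₀ (norm_ne_zero_iff.2 (hr0 i))]
    simp

/-- Schur's lemma for the tensor product of the roots. -/
theorem IsMixable.tensor_form_eq (hs : IsMixable π ξ μ)
    (B : tensorRoot π ξ →ₗ⋆[ℂ] tensorRoot π ξ →ₗ[ℂ] ℂ)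
    (hS : ∀ i g, SuppIn (depth (π i)) g → ∀ u v u' v' : tensorRoot π ξ,
      (u' : InfTensor ξ) = placeRep π ξ i g⁻¹ u → (v' : InfTensor ξ) = placeRep π ξ i g v →
      B u v' = B u' v)
    (hA : ∀ i, ∀ x ∈ window (depth (π i)), ∀ u v u' v' : tensorRoot π ξ,
      (u' : InfTensor ξ) = opA (placeRep π ξ i) x u →
      (v' : InfTensor ξ) = opA (placeRep π ξ i) x v → B u v' = B u' v) :
    ∃ q : ℂ, ∀ u v, B u v = q * ⟪u, v⟫_ℂ := by
  classical
  obtain ⟨r, hr, hr1⟩ := hs.exists_unit_family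
  have hrr : ⟪tprod r, tprod r⟫_ℂ = 1 := by
    rw [inner_tprod]
    simp only [hr1, finprod_one]
  set q := B ⟨tprod r, tprod_mem_tensorRoot hr⟩ ⟨tprod r, tprod_mem_tensorRoot hr⟩ with hq
  -- With the factors at all other places fixed, the form is subject to Schur's lemma for the root
  -- of `π i`.
  have hplace : ∀ (v v' : Family ξ) (hv : ∀ i, v.1 i ∈ root (π i)) (hv' : ∀ i, v'.1 i ∈ root (π i))
      (i : ℕ), ∃ c : ℂ, ∀ a b, B (rootAt hv i a) (rootAt hv' i b) = c * ⟪a, b⟫_ℂ := by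
    intro v v' hv hv' i
    refine hs.form_eq_root i (sesqComp B (rootAt hv i) (rootAt hv' i))
      (fun g hg a b a' b' h1 h2 => ?_) (fun x hx a b a' b' h1 h2 => ?_)
    · exact hS i g hg _ _ _ _ (by rw [coe_rootAt, coe_rootAt, h1, placeRep_tprodAt])
        (by rw [coe_rootAt, coe_rootAt, h2, placeRep_tprodAt])
    · exact hA i x hx _ _ _ _
        (by rw [coe_rootAt, coe_rootAt, h1, opA_placeRep_tprodAt (hs.admissible i)])
        (by rw [coe_rootAt, coe_rootAt, h2, opA_placeRep_tprodAt (hs.admissible i)])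
  -- The factors are replaced by those of the reference family `r` of unit vectors one place at a
  -- time. The constant found at each place is the same for the given factors and for those of `r`.
  have hpure : ∀ (I : Finset ℕ) (v v' : Family ξ) (hv : ∀ i, v.1 i ∈ root (π i))
      (hv' : ∀ i, v'.1 i ∈ root (π i)), (∀ i ∉ I, v.1 i = r.1 i) → (∀ i ∉ I, v'.1 i = r.1 i) →
      B ⟨tprod v, tprod_mem_tensorRoot hv⟩ ⟨tprod v', tprod_mem_tensorRoot hv'⟩ =
        q * ⟪tprod v, tprod v'⟫_ℂ := by
    intro I
    induction I using Finset.induction_on with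
    | empty =>
      intro v v' hv hv' h h'
      obtain rfl : v = r := Family.ext' fun i => h i (Finset.notMem_empty i)
      obtain rfl : v' = v := Family.ext' fun i => h' i (Finset.notMem_empty i)
      rw [hrr, mul_one]
    | insert i I hi ih =>
      intro v v' hv hv' h h'
      have hri := hr i
      have h1 : ∀ u : Family ξ, (∀ j ∉ insert i I, u.1 j = r.1 j) → ∀ j ∉ I,
          (u.update i (r.1 i)).1 j = r.1 j := fun u hu j hj => by
        by_cases hji : j = i
        · subst hji
          rw [Family.update_same]
        · rw [Family.update_ne _ hji]
          exact hu j (by simp [hji, hj])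
      have h2 := ih _ _ (update_mem_root hv hri) (update_mem_root hv' hri) (h1 v h) (h1 v' h')
      obtain ⟨c, hc⟩ := hplace v v' hv hv' i
      have h3 := hc ⟨r.1 i, hri⟩ ⟨r.1 i, hri⟩
      have h4 := hc ⟨v.1 i, hv i⟩ ⟨v'.1 i, hv' i⟩
      rw [rootAt_self, rootAt_self] at h4
      change B (rootAt hv i ⟨r.1 i, hri⟩) (rootAt hv' i ⟨r.1 i, hri⟩) = _ at h2
      rw [h3, inner_tprod_eq _ _ i, Family.update_same, Family.update_same, hr1, one_mul] at h2
      have h5 : ⟪(⟨r.1 i, hri⟩ : root (π i)), ⟨r.1 i, hri⟩⟫_ℂ = 1 := hr1 i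
      rw [h5, mul_one] at h2
      have h6 : ∏ᶠ (j) (_ : j ≠ i), ⟪(v.update i (r.1 i)).1 j, (v'.update i (r.1 i)).1 j⟫_ℂ =
          ∏ᶠ (j) (_ : j ≠ i), ⟪v.1 j, v'.1 j⟫_ℂ :=
        finprod_congr fun j => finprod_congr fun hj => by
          rw [Family.update_ne _ hj, Family.update_ne _ hj]
      rw [h4, h2, inner_tprod_eq v v' i, h6]
      change _ * ⟪v.1 i, v'.1 i⟫_ℂ = _
      ring
  refine ⟨q, fun u v => hs.root_induction (Q := fun u => B u v = q * ⟪u, v⟫_ℂ) (fun a ha => ?_)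
    (by rw [map_zero, LinearMap.zero_apply, inner_zero_left, mul_zero]) (fun a b h1 h2 => ?_)
    (fun c a h1 => ?_) u⟩
  · refine hs.root_induction (Q := fun v => B ⟨tprod a, tprod_mem_tensorRoot ha⟩ v =
      q * ⟪(⟨tprod a, tprod_mem_tensorRoot ha⟩ : tensorRoot π ξ), v⟫_ℂ) (fun b hb => ?_)
      (by rw [map_zero, inner_zero_right, mul_zero]) (fun a b h1 h2 => ?_) (fun c b h1 => ?_) v
    · have hfin : ∀ v : Family ξ, {i | v.1 i ≠ r.1 i}.Finite := fun v =>
        (v.2.union r.2).subset fun i hi => by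
          by_contra h
          simp only [Set.mem_union, Set.mem_ofPred_eq, not_or, not_not] at h
          exact hi (h.1.trans h.2.symm)
      refine hpure ((hfin a).toFinset ∪ (hfin b).toFinset) a b ha hb (fun i hi => ?_)
        (fun i hi => ?_)
      all_goals
        simp only [Finset.mem_union, Set.Finite.mem_toFinset, Set.mem_ofPred_eq, not_or,
          not_not] at hi
      · exact hi.1
      · exact hi.2
    · rw [map_add, h1, h2, inner_add_right, mul_add]
    · have h2 := inner_smul_right (⟨tprod a, tprod_mem_tensorRoot ha⟩ : tensorRoot π ξ) b c
      rw [map_smul, h1, smul_eq_mul]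
      refine Eq.trans ?_ (congrArg (q * ·) h2.symm)
      ring
  · rw [map_add, LinearMap.add_apply, h1, h2, inner_add_left, mul_add]
  · have h2 := inner_smul_left a v c
    rw [LinearMap.map_smulₛₗ, LinearMap.smul_apply, h1, smul_eq_mul]
    refine Eq.trans ?_ (congrArg (q * ·) h2.symm)
    ring

/-! ### Eigenvectors of the operators `A_x` on the root words -/

section Young

variable {V : Type*} [NormedAddCommGroup V] [InnerProductSpace ℂ V] {ρ : URep V}
  {L : YoungDistribution}

theorem YoungDistribution.span_vec (L : YoungDistribution) :
    Submodule.span ℂ (Set.range L.vec) = ⊤ := by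
  refine Submodule.map_injective_of_injective (f := L.youngModule.subtype)
    L.youngModule.injective_subtype ?_
  rw [Submodule.map_span, ← Set.range_comp, Submodule.map_top, Submodule.range_subtype]
  rfl

theorem YoungDistribution.Cell.pt_ne_bot (z : L.Cell) : L z.pt ≠ ⊥ := fun h => by
  have h1 : z.1.2 ∈ L z.pt := z.2
  rw [h] at h1
  exact YoungDiagram.notMem_bot _ h1

theorem HasYoungDistribution.root_le_span (h : HasYoungDistribution ρ L) {y : NZ}
    (hy : y ∈ window (depth ρ)) : root ρ ≤ Submodule.span ℂ {a | a ∈ root ρ ∧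
      ∃ t ∈ {t : ℝ | L t ≠ ⊥}, opA ρ y a = (t : ℂ) • a} := by
  obtain ⟨e, φ, -, h2, -, h4⟩ := h
  rw [← h2, LinearMap.range_eq_map, ← L.span_vec, Submodule.map_span, Submodule.span_le]
  rintro _ ⟨_, ⟨τ, rfl⟩, rfl⟩
  refine Submodule.subset_span ⟨Submodule.subset_span ⟨_, ⟨τ, rfl⟩, rfl⟩,
    (τ⁻¹ (e.symm ⟨y, hy⟩)).pt, (τ⁻¹ (e.symm ⟨y, hy⟩)).pt_ne_bot, ?_⟩
  have := h4 (e.symm ⟨y, hy⟩) τ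
  rwa [Equiv.apply_symm_apply] at this

end Young

variable {H : ℕ → Type*} [∀ i, NormedAddCommGroup (H i)] [∀ i, InnerProductSpace ℂ (H i)]
  {ξ : ∀ i, Metric.sphere (0 : H i) 1} {π : ∀ i, URep (H i)} {p : Weights} {μ : ℕ → Measure ℝ}
  {ρ : URep (MixSpace ξ p)} [∀ i, CompleteSpace (H i)]

/-- The roots are spanned by eigenvectors of the operators `A_y` with eigenvalues in given sets. -/
def HasEigenvaluesIn (π : ∀ i, URep (H i)) (E : ℕ → Set ℝ) : Prop :=
  ∀ i, ∀ y ∈ window (depth (π i)), root (π i) ≤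
    Submodule.span ℂ {a | a ∈ root (π i) ∧ ∃ t ∈ E i, opA (π i) y a = (t : ℂ) • a}

theorem IsMixable.eigen_induction (hs : IsMixable π ξ μ) {E : ℕ → Set ℝ}
    (hE : HasEigenvaluesIn π E) {i : ℕ} {y : NZ} (hy : y ∈ window (depth (π i)))
    {Q : tensorRoot π ξ → Prop}
    (heigen : ∀ a : tensorRoot π ξ, (∃ t ∈ E i, opA (placeRep π ξ i) y a = (t : ℂ) • (a : InfTensor ξ)) → Q a)
    (hzero : Q 0) (hadd : ∀ a b, Q a → Q b → Q (a + b)) (hsmul : ∀ (c : ℂ) a, Q a → Q (c • a))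
    (a : tensorRoot π ξ) : Q a := by
  refine hs.root_induction (fun v hv => ?_) hzero hadd hsmul a
  have key : ∀ b ∈ Submodule.span ℂ {a | a ∈ root (π i) ∧ ∃ t ∈ E i, opA (π i) y a = (t : ℂ) • a},
      ∃ hb : b ∈ root (π i), Q (rootAt hv i ⟨b, hb⟩) := by
    intro b hb
    induction hb using Submodule.span_induction with
    | mem b hb =>
      obtain ⟨hb, t, ht, h⟩ := hb
      refine ⟨hb, heigen _ ⟨t, ht, ?_⟩⟩
      rw [coe_rootAt, opA_placeRep_tprodAt (hs.admissible i), h, map_smul]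
    | zero =>
      refine ⟨zero_mem _, ?_⟩
      have : rootAt hv i ⟨0, zero_mem _⟩ = 0 := (rootAt hv i).map_zero
      rwa [this]
    | add b c _ _ h1 h2 =>
      obtain ⟨hb, h1⟩ := h1
      obtain ⟨hc, h2⟩ := h2
      refine ⟨add_mem hb hc, ?_⟩
      have := (rootAt hv i).map_add ⟨b, hb⟩ ⟨c, hc⟩
      exact this ▸ hadd _ _ h1 h2
    | smul c b _ h1 =>
      obtain ⟨hb, h1⟩ := h1
      refine ⟨Submodule.smul_mem _ c hb, ?_⟩
      have := (rootAt hv i).map_smul c ⟨b, hb⟩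
      exact this ▸ hsmul _ _ h1
  obtain ⟨hb, h⟩ := key _ (hE i y hy (hv i))
  rwa [← rootAt_self hv i]

theorem RootWord.exists_label (w : RootWord π) {i : ℕ} {y : NZ} (hy : y ∈ window (depth (π i))) :
    ∃ x, w.1 x = i ∧ w.label x = y := by
  rw [← w.half_eq i] at hy
  obtain ⟨x, hx, hxi, hxy⟩ := exists_lab_eq w.good wordExt_mem_symColorings hy
  rw [wordExt_of_mem hx] at hxi
  refine ⟨⟨x, hx⟩, hxi, ?_⟩
  rw [RootWord.label, hxi]
  exact hxy

/-- The lift of `g` preserves the coloring and moves only points of color `i` whose labels lie in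
the window of size `d_i`; these are points of the window. -/
theorem RootWord.exists_place_perm (w : RootWord π) {i : ℕ} {g : G}
    (hg : SuppIn (depth (π i)) g) :
    ∃ τ, w.perm τ = w ∧ coc (ofWindow _ τ) (wordExt w.1) = singleG i g := by
  obtain ⟨k, h1, h2, -⟩ := exists_lift w.good i g
  have hk : SuppIn (totalDepth π) k := fun x hx => by
    have h3 := coc_lab w.good k (f := wordExt w.1) (x := x) rfl
    have h4 : wordExt w.1 (k.1 x) = wordExt w.1 x := by
      conv_lhs => rw [← h1]
      exact colorAct_apply_apply k _ x
    refine lab_injOn w.good (i := wordExt w.1 x) h4 rfl ?_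
    rw [h1, h2] at h3
    rw [← h3]
    by_cases hi : wordExt w.1 x = i
    · rw [hi, singleG_same]
      refine hg _ fun h5 => hx ?_
      rw [← w.half_eq i] at h5
      exact (lab_mem_window_iff w.good wordExt_mem_symColorings hi).1 h5
    · rw [singleG_ne hi]
      rfl
  obtain ⟨τ, rfl⟩ := hk.exists_ofWindow
  refine ⟨τ, Subtype.ext (funext fun x => ?_), h2⟩
  have := congrFun h1 x
  rw [← RootWord.wordExt_perm, wordExt_apply, wordExt_apply] at this
  exact this

section Single

variable [Fintype (RootWord π)]

open Classical in
theorem rootPerm_single (hs : IsMixable π ξ μ) (τ : Equiv.Perm (window (totalDepth π)))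
    (w : RootWord π) (a : tensorRoot π ξ) :
    rootPerm hs τ (Pi.single w a) = Pi.single (w.perm τ)
      ⟨tensorAct π (coc (ofWindow _ τ) (wordExt w.1)) a, hs.tensorAct_mem (w.suppIn_coc τ) a.2⟩ := by
  funext w'
  refine Subtype.ext ?_
  change tensorAct π (coc (ofWindow _ τ) (wordExt (w'.perm τ.symm).1))
    (((Pi.single w a : RootWord π → tensorRoot π ξ) (w'.perm τ.symm) : tensorRoot π ξ) :
      InfTensor ξ) = _
  by_cases h : w' = w.perm τ
  · subst h
    rw [Pi.single_eq_same, RootWord.perm_symm_perm, Pi.single_eq_same]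
  · rw [Pi.single_eq_of_ne h, Pi.single_eq_of_ne (fun h' => h (by
      rw [← h', RootWord.perm_perm_symm]))]
    exact (isLinearMap_tensorAct π _).map_zero

open Classical in
theorem rootOp_single (hs : IsMixable π ξ μ) (x : window (totalDepth π)) (w : RootWord π)
    {a b : tensorRoot π ξ} (h : opA (placeRep π ξ (w.1 x)) (w.label x) a = (b : InfTensor ξ)) :
    rootOp hs p x (Pi.single w a) = (p (w.1 x) : ℂ) • Pi.single w b := by
  funext w'
  refine Subtype.ext ?_
  change (p (w'.1 x) : ℂ) • opA (placeRep π ξ (w'.1 x)) (w'.label x)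
    ((Pi.single w a : RootWord π → tensorRoot π ξ) w') =
      (p (w.1 x) : ℂ) • ((Pi.single w b : RootWord π → tensorRoot π ξ) w' : InfTensor ξ)
  by_cases hw : w' = w
  · subst hw
    rw [Pi.single_eq_same, Pi.single_eq_same, h]
  · rw [Pi.single_eq_of_ne hw, Pi.single_eq_of_ne hw, Submodule.coe_zero, map_zero, smul_zero,
      smul_zero]

end Single

/-! ### Irreducibility for disjoint supports -/

variable {H : ℕ → Type*} [∀ i, NormedAddCommGroup (H i)] [∀ i, InnerProductSpace ℂ (H i)]
  {ξ : ∀ i, Metric.sphere (0 : H i) 1} {π : ∀ i, URep (H i)} {p : Weights} {μ : ℕ → Measure ℝ}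
  {ρ : URep (MixSpace ξ p)} [∀ i, CompleteSpace (H i)] [Fintype (RootWord π)]

namespace IsMixAction

variable (h : IsMixAction π ξ p ρ) (hs : IsMixable π ξ μ) (W : Subrep (mixture π ξ p ρ))
include h hs

theorem inner_proj_rootOp (x : window (totalDepth π)) (u v : RootWord π → tensorRoot π ξ) :
    ⟪rootVec ρ u, W.carrier.starProjection (rootVec ρ (rootOp hs p x v))⟫_ℂ =
      ⟪rootVec ρ (rootOp hs p x u), W.carrier.starProjection (rootVec ρ v)⟫_ℂ := by
  rw [← h.opA_rootVec hs, ← h.opA_rootVec hs, W.proj_opA h.isAdmissible_mixture,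
    inner_opA_left h.isAdmissible_mixture]

theorem inner_proj_rootPerm (τ : Equiv.Perm (window (totalDepth π)))
    (u v : RootWord π → tensorRoot π ξ) :
    ⟪rootVec ρ (rootPerm hs τ u), W.carrier.starProjection (rootVec ρ (rootPerm hs τ v))⟫_ℂ =
      ⟪rootVec ρ u, W.carrier.starProjection (rootVec ρ v)⟫_ℂ := by
  rw [← h.ofWindow_rootVec hs, ← h.ofWindow_rootVec hs, W.proj_rho, LinearIsometryEquiv.inner_map_map]

omit h hs in
open Classical in
/-- The matrix entries of the projection on an invariant subspace. -/
def projEntry (W : Subrep (mixture π ξ p ρ)) (w' w : RootWord π) :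
    tensorRoot π ξ →ₗ⋆[ℂ] tensorRoot π ξ →ₗ[ℂ] ℂ :=
  sesqComp (innerₛₗ ℂ) (rootVec ρ ∘ₗ LinearMap.single ℂ (fun _ => tensorRoot π ξ) w')
    ((W.carrier.starProjection : _ →ₗ[ℂ] _) ∘ₗ rootVec ρ ∘ₗ LinearMap.single ℂ (fun _ => tensorRoot π ξ) w)

omit h hs in
open Classical in
theorem projEntry_apply (w' w : RootWord π) (b a : tensorRoot π ξ) : projEntry W w' w b a =
    ⟪rootVec ρ (Pi.single w' b), W.carrier.starProjection (rootVec ρ (Pi.single w a))⟫_ℂ := rfl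

/-- The two words differ at some `x`. The operator `A_x` is self-adjoint, commutes with the
projection, and has eigenvalues `p i * t` and `p j * s` with `i ≠ j` on the two components. These
are different, so the matrix entry vanishes. -/
theorem projEntry_of_ne {E : ℕ → Set ℝ} (hE : HasEigenvaluesIn π E)
    (hdisj : ∀ i j, i ≠ j → ∀ t ∈ E i, ∀ s ∈ E j, p i * t ≠ p j * s) {w' w : RootWord π}
    (hne : w' ≠ w) (b a : tensorRoot π ξ) : projEntry W w' w b a = 0 := by
  classical
  obtain ⟨x, hx⟩ : ∃ x, w'.1 x ≠ w.1 x := by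
    by_contra! h
    exact hne (Subtype.ext (funext h))
  refine hs.eigen_induction hE (w'.label_mem x) (Q := fun b => projEntry W w' w b a = 0)
    (fun b hb => ?_) (by rw [map_zero, LinearMap.zero_apply]) (fun b c h1 h2 => by
      rw [map_add, LinearMap.add_apply, h1, h2, add_zero]) (fun c b h1 => by
      rw [LinearMap.map_smulₛₗ, LinearMap.smul_apply, h1, smul_zero]) b
  refine hs.eigen_induction hE (w.label_mem x) (Q := fun a => projEntry W w' w b a = 0)
    (fun a ha => ?_) (by rw [map_zero]) (fun b c h1 h2 => by
      rw [map_add, h1, h2, add_zero]) (fun c b h1 => by rw [map_smul, h1, smul_zero]) a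
  obtain ⟨s, hs', hb⟩ := hb
  obtain ⟨t, ht, ha⟩ := ha
  have h1 := h.inner_proj_rootOp hs W x (Pi.single w' b) (Pi.single w a)
  rw [rootOp_single hs x w (b := (t : ℂ) • a) ha, rootOp_single hs x w' (b := (s : ℂ) • b) hb,
    map_smul, map_smul, map_smul, inner_smul_left, inner_smul_right, ← projEntry_apply,
    ← projEntry_apply, map_smul, LinearMap.map_smulₛₗ, LinearMap.smul_apply, smul_eq_mul,
    smul_eq_mul, Complex.conj_ofReal, Complex.conj_ofReal, ← mul_assoc, ← mul_assoc] at h1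
  have h2 : ((p (w.1 x) : ℂ) * t - p (w'.1 x) * s) * projEntry W w' w b a = 0 := by
    rw [sub_mul, h1, sub_self]
  refine (mul_eq_zero.1 h2).resolve_left fun h3 => hdisj _ _ hx s hs' t ht ?_
  have h4 := sub_eq_zero.1 h3
  exact_mod_cast h4.symm

/-- Permutations that preserve the word realize the permutations at every single place, and each
`A_x` is a nonzero multiple of an operator at one place. So the entry satisfies the assumptions of
Schur's lemma for the tensor product. -/
theorem exists_projEntry_self (w : RootWord π) :
    ∃ q : ℂ, ∀ u v, projEntry W w w u v = q * ⟪u, v⟫_ℂ := by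
  classical
  refine hs.tensor_form_eq _ (fun i g hg u v u' v' hu hv => ?_) fun i y hy u v u' v' hu hv => ?_
  · obtain ⟨τ, h1, h2⟩ := w.exists_place_perm hg
    have hp : ∀ a b : tensorRoot π ξ, (b : InfTensor ξ) = placeRep π ξ i g a →
        rootPerm hs τ (Pi.single w a) = Pi.single w b := by
      intro a b hab
      rw [rootPerm_single hs]
      simp only [h1, h2]
      congr 1
      exact Subtype.ext (hab.symm)
    rw [projEntry_apply, projEntry_apply, ← hp v v' hv, ← hp u' u (by rw [hu, rho_rho_inv]),
      h.inner_proj_rootPerm hs]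
  · obtain ⟨x, rfl, rfl⟩ := w.exists_label hy
    have h1 := h.inner_proj_rootOp hs W x (Pi.single w u) (Pi.single w v)
    rw [rootOp_single hs x w hu.symm, rootOp_single hs x w hv.symm, map_smul, map_smul, map_smul,
      inner_smul_left, inner_smul_right, Complex.conj_ofReal] at h1
    exact mul_left_cancel₀ (Complex.ofReal_ne_zero.2 (p.pos _).ne') h1

theorem isIrreducible_mixture {E : ℕ → Set ℝ} (hE : HasEigenvaluesIn π E)
    (hdisj : ∀ i j, i ≠ j → ∀ t ∈ E i, ∀ s ∈ E j, p i * t ≠ p j * s) :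
    IsIrreducible (mixture π ξ p ρ) := by
  classical
  have hadm := h.isAdmissible_mixture
  have hne := h.fixed_mixture_ne_bot hs
  obtain ⟨f, hf, hf0⟩ := hs.exists_family
  obtain ⟨r, hr0⟩ : ∃ r, r ∈ fixed (mixture π ξ p ρ) (totalDepth π) ∧ r ≠ 0 :=
    Submodule.exists_mem_ne_zero_of_ne_bot hne
  refine ⟨⟨⟨r, 0, hr0.2⟩⟩, fun W => ?_⟩
  choose q hq using h.exists_projEntry_self hs W
  obtain ⟨w₀⟩ := exists_rootWord hs.finite_depth
  -- The permutations of the window act transitively on the root words.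
  have hconst : ∀ w, q w = q w₀ := by
    intro w
    obtain ⟨τ, rfl⟩ := w₀.exists_perm w
    let a : tensorRoot π ξ := ⟨tprod f, tprod_mem_tensorRoot hf⟩
    let a' : tensorRoot π ξ := ⟨tensorAct π (coc (ofWindow _ τ) (wordExt w₀.1)) a,
      hs.tensorAct_mem (w₀.suppIn_coc τ) a.2⟩
    have h1 := h.inner_proj_rootPerm hs W τ (Pi.single w₀ a) (Pi.single w₀ a)
    rw [rootPerm_single hs, ← projEntry_apply, ← projEntry_apply, hq, hq] at h1
    have h2 : ⟪(a' : InfTensor ξ), (a' : InfTensor ξ)⟫_ℂ = ⟪tprod f, tprod f⟫_ℂ := (tensorRep π _).inner_map_map (tprod f) (tprod f)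
    have h3 : ⟪tprod f, tprod f⟫_ℂ ≠ 0 := inner_self_ne_zero.2 hf0
    change _ * ⟪(a' : InfTensor ξ), (a' : InfTensor ξ)⟫_ℂ = _ * ⟪tprod f, tprod f⟫_ℂ at h1
    rw [h2] at h1
    exact mul_right_cancel₀ h3 h1
  set c : ℂ := q w₀ / (weight p (totalDepth π) w₀.1 : ℂ) with hc
  have hsum : ∀ v : RootWord π → tensorRoot π ξ, rootVec ρ v = ∑ w, rootVec ρ (Pi.single w (v w)) :=
    fun v => by rw [← map_sum, Finset.univ_sum_single]
  have hproj : ∀ v, W.carrier.starProjection (rootVec ρ v) = c • rootVec ρ v := by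
    intro v
    rw [← map_smul]
    refine h.eq_rootVec hs (mem_fixed_proj W (h.rootVec_mem_fixed v)) fun u => ?_
    rw [map_smul, inner_smul_right, inner_rootVec, hsum u, hsum v, map_sum, sum_inner,
      Finset.mul_sum]
    refine Finset.sum_congr rfl fun w _ => ?_
    rw [inner_sum, Finset.sum_eq_single w (fun w' _ hw => by
      rw [← projEntry_apply, h.projEntry_of_ne hs W hE hdisj hw.symm]) (by simp),
      ← projEntry_apply, hq, hconst, hc, RootWord.weight_eq w w₀, ← mul_assoc,
      div_mul_cancel₀ _ (weight_ne_zero w₀)]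
  have hproj' : ∀ v ∈ fixed (mixture π ξ p ρ) (totalDepth π),
      W.carrier.starProjection v = c • v := by
    intro v hv
    rw [← h.range_rootVec hs] at hv
    obtain ⟨v, rfl⟩ := hv
    exact hproj v
  -- The projection is a scalar on the root, so this scalar is `0` or `1`, and cyclicity extends the
  -- conclusion to the whole space.
  have hcc : c * c = c := by
    have h1 : W.carrier.starProjection (W.carrier.starProjection r) =
        W.carrier.starProjection r :=
      Submodule.starProjection_eq_self_iff.2 (W.carrier.starProjection_apply_mem r)
    rw [hproj' r hr0.1, map_smul, hproj' r hr0.1, smul_smul] at h1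
    exact smul_left_injective ℂ hr0.2 h1
  rcases mul_eq_zero.1 (show c * (c - 1) = 0 by rw [mul_sub, hcc, mul_one, sub_self]) with h0 | h0
  · left
    refine h.isCyclicFixed_mixture.eq_bot W ?_
    rw [Submodule.eq_bot_iff]
    rintro v ⟨hv, hv'⟩
    have := hproj' v hv'
    rwa [h0, zero_smul, Submodule.starProjection_eq_self_iff.2 hv] at this
  · right
    refine h.isCyclicFixed_mixture W fun v hv => ?_
    have := hproj' v hv
    rw [sub_eq_zero.1 h0, one_smul] at this
    exact Submodule.starProjection_eq_self_iff.1 this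

end IsMixAction

/-! ### Joint eigenspaces of two operators -/

section EigenPair

variable {V : Type*} [NormedAddCommGroup V] [InnerProductSpace ℂ V] {ρ : URep V}

/-- The joint eigenspace of the operators `A_a`, `A_b` with eigenvalue `t`. -/
def eigenPair (ρ : URep V) (t : ℝ) (a b : NZ) : Submodule ℂ V where
  carrier := {v | opA ρ a v = (t : ℂ) • v ∧ opA ρ b v = (t : ℂ) • v}
  add_mem' := by
    rintro u v ⟨h1, h2⟩ ⟨h3, h4⟩
    exact ⟨by rw [map_add, h1, h3, smul_add], by rw [map_add, h2, h4, smul_add]⟩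
  zero_mem' := by simp
  smul_mem' := by
    rintro c v ⟨h1, h2⟩
    exact ⟨by rw [map_smul, h1, smul_comm], by rw [map_smul, h2, smul_comm]⟩

theorem isClosed_eigenPair (t : ℝ) (a b : NZ) : IsClosed (eigenPair ρ t a b : Set V) :=
  (isClosed_eq (by fun_prop) (by fun_prop)).inter (isClosed_eq (by fun_prop) (by fun_prop))

variable [CompleteSpace V]

instance instProjEigenPair (t : ℝ) (a b : NZ) : (eigenPair ρ t a b).HasOrthogonalProjection :=
  haveI := (isClosed_eigenPair (ρ := ρ) t a b).completeSpace_coe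
  inferInstance

variable (hρ : IsAdmissible ρ) {t : ℝ} {a b : NZ}
include hρ

theorem rho_mem_eigenPair (g : G) {v : V} (hv : v ∈ eigenPair ρ t a b) :
    ρ g v ∈ eigenPair ρ t (g.1 a) (g.1 b) :=
  ⟨by rw [← rho_opA hρ, hv.1, map_smul], by rw [← rho_opA hρ, hv.2, map_smul]⟩

theorem proj_eigenPair_rho (g : G) (v : V) :
    (eigenPair ρ t (g.1 a) (g.1 b)).starProjection (ρ g v) =
      ρ g ((eigenPair ρ t a b).starProjection v) := by
  refine Submodule.eq_starProjection_of_mem_orthogonal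
    (rho_mem_eigenPair hρ g (Submodule.starProjection_apply_mem _ _)) ?_
  rw [← map_sub, Submodule.mem_orthogonal]
  intro u hu
  rw [inner_rho_right]
  have h1 := rho_mem_eigenPair hρ g⁻¹ hu
  have h2 : ∀ x, (g⁻¹).1 (g.1 x) = x := inv_apply_self' g
  rw [h2, h2] at h1
  exact (Submodule.mem_orthogonal _ _).1 (Submodule.sub_starProjection_mem_orthogonal v) _ h1

theorem opA_mem_eigenPair (c : NZ) {v : V} (hv : v ∈ eigenPair ρ t a b) :
    opA ρ c v ∈ eigenPair ρ t a b :=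
  ⟨by rw [opA_comm hρ, hv.1, map_smul], by rw [opA_comm hρ, hv.2, map_smul]⟩

theorem proj_eigenPair_opA (c : NZ) (v : V) :
    (eigenPair ρ t a b).starProjection (opA ρ c v) =
      opA ρ c ((eigenPair ρ t a b).starProjection v) :=
  starProjection_comm (T := opA ρ c) (T' := opA ρ c) (fun _ _ => map_sub _ _ _)
    (fun u v => inner_opA_left hρ c u v) (fun _ => opA_mem_eigenPair hρ c)
    (fun _ => opA_mem_eigenPair hρ c) v

omit hρ in
theorem opA_swap_eigenPair (c : NZ) {v : V} (hv : v ∈ eigenPair ρ t a b) :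
    opA ρ ((transposition a b).1 c) v = opA ρ c v := by
  by_cases h1 : c = a
  · rw [h1, transposition_left, hv.1, hv.2]
  by_cases h2 : c = b
  · rw [h2, transposition_right, hv.1, hv.2]
  rw [transposition_of_ne h1 h2]

theorem proj_eigenPair_eigenvector {v : V} {s s' : ℝ} (ha : opA ρ a v = (s : ℂ) • v)
    (hb : opA ρ b v = (s' : ℂ) • v) :
    (eigenPair ρ t a b).starProjection v = v ∨ (eigenPair ρ t a b).starProjection v = 0 := by
  have key : ∀ (c : NZ) (r : ℝ), opA ρ c v = (r : ℂ) • v → r ≠ t →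
      (∀ u ∈ eigenPair ρ t a b, opA ρ c u = (t : ℂ) • u) →
      (eigenPair ρ t a b).starProjection v = 0 := by
    intro c r hc hr hu
    refine Submodule.eq_starProjection_of_mem_orthogonal (zero_mem _) ?_
    rw [sub_zero, Submodule.mem_orthogonal]
    intro u hu'
    have h1 := inner_opA_left hρ c u v
    rw [hu u hu', hc, inner_smul_left, inner_smul_right, Complex.conj_ofReal] at h1
    have h2 : ((t : ℂ) - r) * ⟪u, v⟫_ℂ = 0 := by rw [sub_mul, h1, sub_self]
    refine (mul_eq_zero.1 h2).resolve_left fun h3 => hr ?_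
    exact_mod_cast (sub_eq_zero.1 h3).symm
  by_cases h1 : s = t
  · by_cases h2 : s' = t
    · left
      subst h1
      subst h2
      exact Submodule.starProjection_eq_self_iff.2 ⟨ha, hb⟩
    · exact Or.inr (key b s' hb h2 fun u hu => hu.2)
  · exact Or.inr (key a s ha h1 fun u hu => hu.1)

end EigenPair

/-! ### Joint eigenvectors in the root -/

section Young

variable {V : Type*} [NormedAddCommGroup V] [InnerProductSpace ℂ V] {ρ : URep V}
  {L : YoungDistribution}

/-- Every vector `φ (L.vec τ)` is a joint eigenvector, and each cell of `L` contributes its point as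
an eigenvalue. These vectors span the root, so one of them is not zero. -/
theorem HasYoungDistribution.exists_eigenvector (h : HasYoungDistribution ρ L)
    (hne : root ρ ≠ ⊥) : ∃ v ∈ root ρ, v ≠ 0 ∧
      (∀ y ∈ window (depth ρ), ∃ t : ℝ, opA ρ y v = (t : ℂ) • v) ∧
      ∀ t : ℝ, L t ≠ ⊥ → ∃ y ∈ window (depth ρ), opA ρ y v = (t : ℂ) • v := by
  obtain ⟨e, φ, -, h2, -, h4⟩ := h
  obtain ⟨τ, hτ⟩ : ∃ τ, φ (L.vec τ) ≠ 0 := by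
    by_contra! h0
    refine hne ?_
    rw [← h2, LinearMap.range_eq_map, ← L.span_vec, Submodule.map_span, eq_bot_iff,
      Submodule.span_le]
    rintro _ ⟨_, ⟨τ, rfl⟩, rfl⟩
    exact h0 τ
  refine ⟨_, h2 ▸ ⟨_, rfl⟩, hτ, fun y hy => ⟨(τ⁻¹ (e.symm ⟨y, hy⟩)).pt, ?_⟩, fun t ht => ?_⟩
  · have := h4 (e.symm ⟨y, hy⟩) τ
    rwa [Equiv.apply_symm_apply] at this
  · obtain ⟨c, hc⟩ : ∃ c, c ∈ L t := by
      by_contra! h0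
      refine ht ?_
      rw [eq_bot_iff]
      intro c hc
      exact absurd hc (h0 c)
    let z : L.Cell := ⟨(t, c), hc⟩
    refine ⟨e (τ z), (e (τ z)).2, ?_⟩
    have := h4 (τ z) τ
    rwa [show τ⁻¹ (τ z) = z from τ.symm_apply_apply z] at this

end Young

open Classical in
theorem ofWindow_swap {n : ℕ} (a b : window n) :
    ofWindow n (Equiv.swap a b) = transposition a b := by
  refine G.ext' fun x => ?_
  by_cases hx : x ∈ window n
  · obtain ⟨x, rfl⟩ : ∃ y : window n, (y : NZ) = x := ⟨⟨x, hx⟩, rfl⟩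
    rw [ofWindow_apply]
    by_cases h1 : x = a
    · rw [h1, Equiv.swap_apply_left, transposition_left]
    by_cases h2 : x = b
    · rw [h2, Equiv.swap_apply_right, transposition_right]
    rw [Equiv.swap_apply_of_ne_of_ne h1 h2, transposition_of_ne (fun h => h1 (Subtype.ext h))
      fun h => h2 (Subtype.ext h)]
  · rw [suppIn_ofWindow n _ x hx, transposition_of_ne
      (fun h => hx (by rw [h]; exact a.2)) fun h => hx (by rw [h]; exact b.2)]

/-! ### An invariant form that exchanges two colors -/

variable {H : ℕ → Type*} [∀ i, NormedAddCommGroup (H i)] [∀ i, InnerProductSpace ℂ (H i)]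
  {ξ : ∀ i, Metric.sphere (0 : H i) 1} {π : ∀ i, URep (H i)} {p : Weights} {μ : ℕ → Measure ℝ}
  {ρ : URep (MixSpace ξ p)} [∀ i, CompleteSpace (H i)] [Fintype (RootWord π)]

open Classical in
/-- The restriction to the colorings with colors `i`, `j` at `a`, `b`. -/
def colorRestrict (ξ : ∀ i, Metric.sphere (0 : H i) 1) (i j : ℕ) (a b : window (totalDepth π)) :
    (RootWord π → tensorRoot π ξ) →ₗ[ℂ] (RootWord π → tensorRoot π ξ) where
  toFun v w := if w.1 a = i ∧ w.1 b = j then v w else 0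
  map_add' u v := by
    funext w
    by_cases h : w.1 a = i ∧ w.1 b = j <;> simp [h]
  map_smul' c v := by
    funext w
    by_cases h : w.1 a = i ∧ w.1 b = j <;> simp [h]

theorem colorRestrict_of_pos {i j : ℕ} {a b : window (totalDepth π)} {w : RootWord π}
    (h : w.1 a = i ∧ w.1 b = j) (v : RootWord π → tensorRoot π ξ) :
    colorRestrict ξ i j a b v w = v w := if_pos h

theorem colorRestrict_of_neg {i j : ℕ} {a b : window (totalDepth π)} {w : RootWord π}
    (h : ¬(w.1 a = i ∧ w.1 b = j)) (v : RootWord π → tensorRoot π ξ) :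
    colorRestrict ξ i j a b v w = 0 := if_neg h

theorem colorRestrict_rootPerm (hs : IsMixable π ξ μ) (i j : ℕ) (a b : window (totalDepth π))
    (τ : Equiv.Perm (window (totalDepth π))) (v : RootWord π → tensorRoot π ξ) :
    colorRestrict ξ i j (τ a) (τ b) (rootPerm hs τ v) =
      rootPerm hs τ (colorRestrict ξ i j a b v) := by
  funext w
  have h1 : ∀ x, (w.perm τ.symm).1 x = w.1 (τ x) := fun x => rfl
  refine Subtype.ext ?_
  by_cases h : w.1 (τ a) = i ∧ w.1 (τ b) = j
  · rw [colorRestrict_of_pos h]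
    change tensorAct π _ _ = tensorAct π _ _
    dsimp only
    rw [colorRestrict_of_pos (w := w.perm τ.symm) h]
  · rw [colorRestrict_of_neg h]
    change 0 = tensorAct π _ _
    dsimp only
    rw [colorRestrict_of_neg (w := w.perm τ.symm) h]
    exact (isLinearMap_tensorAct π _).map_zero.symm

theorem colorRestrict_rootOp (hs : IsMixable π ξ μ) (i j : ℕ) (a b x : window (totalDepth π))
    (v : RootWord π → tensorRoot π ξ) :
    colorRestrict ξ i j a b (rootOp hs p x v) = rootOp hs p x (colorRestrict ξ i j a b v) := by
  funext w
  refine Subtype.ext ?_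
  by_cases h : w.1 a = i ∧ w.1 b = j
  · rw [colorRestrict_of_pos h]
    change (p (w.1 x) : ℂ) • opA (placeRep π ξ (w.1 x)) (w.label x) _ =
      (p (w.1 x) : ℂ) • opA (placeRep π ξ (w.1 x)) (w.label x) _
    rw [colorRestrict_of_pos h]
  · rw [colorRestrict_of_neg h]
    change 0 = (p (w.1 x) : ℂ) • opA (placeRep π ξ (w.1 x)) (w.label x) _
    rw [colorRestrict_of_neg h, Submodule.coe_zero, map_zero, smul_zero]

namespace IsMixAction

variable (h : IsMixAction π ξ p ρ) (hs : IsMixable π ξ μ)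
include h hs

/-- Schur's lemma for sesquilinear forms on the root of an irreducible mixture. -/
theorem form_eq_rootVec (hirr : IsIrreducible (mixture π ξ p ρ))
    (B : (RootWord π → tensorRoot π ξ) →ₗ⋆[ℂ] (RootWord π → tensorRoot π ξ) →ₗ[ℂ] ℂ)
    (hS : ∀ τ u v, B (rootPerm hs τ u) (rootPerm hs τ v) = B u v)
    (hA : ∀ x u v, B u (rootOp hs p x v) = B (rootOp hs p x u) v) :
    ∃ c : ℂ, ∀ u v, B u v = c * ⟪rootVec ρ u, rootVec ρ v⟫_ℂ := by
  have := h.finiteDimensional_fixed hs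
  obtain ⟨P, hP⟩ := LinearMap.exists_leftInverse_of_injective (rootVec (π := π) ρ)
    (LinearMap.ker_eq_bot.2 rootVec_injective)
  have hP' : ∀ v, P (rootVec ρ v) = v := fun v => congrArg (fun f => f v) hP
  obtain ⟨c, hc⟩ := hirr.form_eq h.isAdmissible_mixture (fun _ => h.fixed_mixture_eq_bot hs)
    (fun m u hu v hv => h.inner_opA_pow_central hs m hu hv) (h.fixed_mixture_ne_bot hs)
    (sesqComp B P P) (fun g hg u hu v hv => by
      rw [← h.range_rootVec hs] at hu hv
      obtain ⟨u, rfl⟩ := hu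
      obtain ⟨v, rfl⟩ := hv
      obtain ⟨τ, rfl⟩ := hg.exists_ofWindow
      have h1 : mixture π ξ p ρ (ofWindow _ τ)⁻¹ (rootVec ρ u) ∈
          fixed (mixture π ξ p ρ) (totalDepth π) :=
        hg.inv.rho_mem_fixed (h.rootVec_mem_fixed u)
      rw [← h.range_rootVec hs] at h1
      obtain ⟨u', hu'⟩ := h1
      rw [← hu', h.ofWindow_rootVec hs]
      change B (P _) (P _) = B (P _) (P _)
      have h2 : rootVec ρ u = rootVec ρ (rootPerm hs τ u') := by
        rw [← h.ofWindow_rootVec hs, hu', rho_rho_inv]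
      rw [h2, hP', hP', hP', hP', hS]) fun x hx u hu v hv => by
      rw [← h.range_rootVec hs] at hu hv
      obtain ⟨u, rfl⟩ := hu
      obtain ⟨v, rfl⟩ := hv
      have h1 := h.opA_rootVec hs ⟨x, hx⟩
      dsimp only at h1
      rw [h1, h1]
      change B (P _) (P _) = B (P _) (P _)
      rw [hP', hP', hP', hP', hA]
  refine ⟨c, fun u v => ?_⟩
  rw [← hc _ (h.rootVec_mem_fixed u) _ (h.rootVec_mem_fixed v)]
  change _ = B (P _) (P _)
  rw [hP', hP']

omit h hs in
/-- The sesquilinear form of the operator that exchanges points of colors `i`, `j` in the joint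
eigenspaces of their operators `A`. -/
def swapForm (ρ : URep (MixSpace ξ p)) (i j : ℕ) (t : ℝ) :
    (RootWord π → tensorRoot π ξ) →ₗ⋆[ℂ] (RootWord π → tensorRoot π ξ) →ₗ[ℂ] ℂ :=
  ∑ q : window (totalDepth π) × window (totalDepth π), sesqComp (innerₛₗ ℂ)
    (((mixture π ξ p ρ (transposition q.1 q.2)).toLinearEquiv : _ →ₗ[ℂ] _) ∘ₗ rootVec (π := π) ρ)
    ((eigenPair (mixture π ξ p ρ) t q.1 q.2).starProjection.toLinearMap ∘ₗ
      rootVec (π := π) ρ ∘ₗ colorRestrict ξ i j q.1 q.2)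

omit h hs in
theorem swapForm_apply (i j : ℕ) (t : ℝ) (u v : RootWord π → tensorRoot π ξ) :
    swapForm ρ i j t u v = ∑ q : window (totalDepth π) × window (totalDepth π),
      ⟪mixture π ξ p ρ (transposition q.1 q.2) (rootVec ρ u),
        (eigenPair (mixture π ξ p ρ) t q.1 q.2).starProjection
          (rootVec ρ (colorRestrict ξ i j q.1 q.2 v))⟫_ℂ := by
  simp only [swapForm, LinearMap.sum_apply]
  rfl

/-- A permutation of the window only renames the pairs over which the form is summed. -/
theorem swapForm_rootPerm (i j : ℕ) (t : ℝ) (τ : Equiv.Perm (window (totalDepth π)))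
    (u v : RootWord π → tensorRoot π ξ) :
    swapForm ρ i j t (rootPerm hs τ u) (rootPerm hs τ v) = swapForm ρ i j t u v := by
  have hadm := h.isAdmissible_mixture
  rw [swapForm_apply, swapForm_apply, ← Equiv.sum_comp (Equiv.prodCongr τ τ)]
  refine Finset.sum_congr rfl fun q _ => ?_
  obtain ⟨a, b⟩ := q
  change ⟪mixture π ξ p ρ (transposition (τ a) (τ b)) (rootVec ρ (rootPerm hs τ u)),
    (eigenPair (mixture π ξ p ρ) t (τ a) (τ b)).starProjection
      (rootVec ρ (colorRestrict ξ i j (τ a) (τ b) (rootPerm hs τ v)))⟫_ℂ = _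
  rw [colorRestrict_rootPerm, ← h.ofWindow_rootVec hs, ← h.ofWindow_rootVec hs,
    ← ofWindow_apply, ← ofWindow_apply, proj_eigenPair_rho hadm, ← rho_mul, ← mul_transposition,
    rho_mul, LinearIsometryEquiv.inner_map_map]

/-- The transposition exchanges `A_a` and `A_b`, and these agree on the joint eigenspace. So the
projection to it followed by the transposition commutes with every `A_x`. -/
theorem swapForm_rootOp (i j : ℕ) (t : ℝ) (x : window (totalDepth π))
    (u v : RootWord π → tensorRoot π ξ) :
    swapForm ρ i j t u (rootOp hs p x v) = swapForm ρ i j t (rootOp hs p x u) v := by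
  have hadm := h.isAdmissible_mixture
  rw [swapForm_apply, swapForm_apply]
  refine Finset.sum_congr rfl fun q _ => ?_
  rw [colorRestrict_rootOp, ← h.opA_rootVec hs, ← h.opA_rootVec hs, proj_eigenPair_opA hadm,
    rho_opA hadm, inner_opA_left hadm, opA_swap_eigenPair _ (Submodule.starProjection_apply_mem _ _)]

end IsMixAction

/-! ### Reducibility for intersecting supports -/

variable {H : ℕ → Type*} [∀ i, NormedAddCommGroup (H i)] [∀ i, InnerProductSpace ℂ (H i)]
  {ξ : ∀ i, Metric.sphere (0 : H i) 1} {π : ∀ i, URep (H i)} {p : Weights} {μ : ℕ → Measure ℝ}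
  {ρ : URep (MixSpace ξ p)} [∀ i, CompleteSpace (H i)]

/-- There are joint eigenvectors in the roots with given sets of eigenvalues. -/
def HasEigenvectors (π : ∀ i, URep (H i)) (E : ℕ → Set ℝ) : Prop :=
  ∀ i, ∃ v ∈ root (π i), v ≠ 0 ∧
    (∀ y ∈ window (depth (π i)), ∃ t : ℝ, opA (π i) y v = (t : ℂ) • v) ∧
    ∀ t ∈ E i, ∃ y ∈ window (depth (π i)), opA (π i) y v = (t : ℂ) • v

theorem IsMixable.exists_eigenfamily (hs : IsMixable π ξ μ) {E : ℕ → Set ℝ}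
    (hE : HasEigenvectors π E) : ∃ f : Family ξ, (∀ i, f.1 i ∈ root (π i)) ∧ tprod f ≠ 0 ∧
      (∀ i, ∀ y ∈ window (depth (π i)), ∃ t : ℝ, opA (π i) y (f.1 i) = (t : ℂ) • f.1 i) ∧
      ∀ i, ∀ t ∈ E i, ∃ y ∈ window (depth (π i)), opA (π i) y (f.1 i) = (t : ℂ) • f.1 i := by
  classical
  choose v hv hv0 h1 h2 using hE
  let f : Family ξ := ⟨fun i => if depth (π i) = 0 then ξ i else v i,
    hs.finite_depth.subset fun i hi h => hi (if_pos h)⟩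
  have hf : ∀ i, (depth (π i) = 0 ∧ f.1 i = ξ i) ∨ (depth (π i) ≠ 0 ∧ f.1 i = v i) := fun i => by
    by_cases h : depth (π i) = 0
    · exact Or.inl ⟨h, if_pos h⟩
    · exact Or.inr ⟨h, if_neg h⟩
  have hw : ∀ i, depth (π i) = 0 → ∀ y, y ∉ window (depth (π i)) := fun i h => by
    rw [h]
    exact notMem_window_zero
  refine ⟨f, fun i => ?_, fun h => ?_, fun i y hy => ?_, fun i t ht => ?_⟩
  · rcases hf i with ⟨h, hfi⟩ | ⟨h, hfi⟩
    · rw [hfi]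
      exact hs.mem_root i h
    · rw [hfi]
      exact hv i
  · have h3 : ⟪tprod f, tprod f⟫_ℂ ≠ 0 := by
      rw [inner_tprod]
      refine finprod_induction (· ≠ 0) one_ne_zero (fun _ _ => mul_ne_zero)
        fun i => inner_self_ne_zero.2 ?_
      rcases hf i with ⟨h, hfi⟩ | ⟨h, hfi⟩
      · rw [hfi]
        exact ne_zero_of_mem_unit_sphere (ξ i)
      · rw [hfi]
        exact hv0 i
    exact h3 (by rw [h, inner_zero_left])
  · rcases hf i with ⟨h, hfi⟩ | ⟨h, hfi⟩
    · exact absurd hy (hw i h y)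
    · rw [hfi]
      exact h1 i y hy
  · rcases hf i with ⟨h, hfi⟩ | ⟨h, hfi⟩
    · obtain ⟨y, hy, -⟩ := h2 i t ht
      exact absurd hy (hw i h y)
    · rw [hfi]
      exact h2 i t ht

variable [Fintype (RootWord π)]

open Classical in
theorem inner_rootVec_single_of_ne {w w' : RootWord π} (h : w ≠ w') (a b : tensorRoot π ξ) :
    ⟪rootVec ρ (Pi.single w a), rootVec ρ (Pi.single w' b)⟫_ℂ = 0 := by
  rw [inner_rootVec]
  refine Finset.sum_eq_zero fun w'' _ => ?_
  by_cases h1 : w'' = w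
  · rw [Pi.single_eq_of_ne (i' := w'') (fun h2 => h (h1.symm.trans h2)), inner_zero_right, mul_zero]
  · rw [Pi.single_eq_of_ne h1, inner_zero_left, mul_zero]

open Classical in
theorem colorRestrict_single (i j : ℕ) (a b : window (totalDepth π)) (w : RootWord π)
    (v : tensorRoot π ξ) :
    colorRestrict ξ i j a b (Pi.single w v) = if w.1 a = i ∧ w.1 b = j then Pi.single w v else 0 := by
  funext w'
  by_cases h : w' = w
  · subst h
    split_ifs with h
    · exact colorRestrict_of_pos h _
    · exact colorRestrict_of_neg h _
  · have h0 : colorRestrict ξ i j a b (Pi.single w v) w' = 0 := by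
      by_cases h' : w'.1 a = i ∧ w'.1 b = j
      · rw [colorRestrict_of_pos h', Pi.single_eq_of_ne h]
      · exact colorRestrict_of_neg h' _
    rw [h0]
    split_ifs
    · rw [Pi.single_eq_of_ne h]
    · rfl

theorem RootWord.swap_ne {w : RootWord π} {a b : window (totalDepth π)} (h : w.1 a ≠ w.1 b) :
    w.perm (Equiv.swap a b) ≠ w := fun he => h (by
  have := congrFun (congrArg Subtype.val he) b
  rwa [RootWord.perm_apply, Equiv.symm_swap, Equiv.swap_apply_right] at this)

/-- If `a' ≠ a`, the color that the first exchange puts at `a` stays there, and similarly for `b`.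
This singles out one summand of `swapForm`. -/
theorem RootWord.swap_swap_ne {w : RootWord π} {a b a' b' : window (totalDepth π)}
    (h : w.1 a ≠ w.1 b) (ha : w.1 a' = w.1 a) (hb : w.1 b' = w.1 b) (hne : ¬(a' = a ∧ b' = b)) :
    (w.perm (Equiv.swap a b)).perm (Equiv.swap a' b') ≠ w := fun he => hne (by
  have hx : ∀ x, w.1 (Equiv.swap a b (Equiv.swap a' b' x)) = w.1 x := fun x =>
    congrFun (congrArg Subtype.val he) x
  have hab : a ≠ b := fun h' => h (by rw [h'])
  constructor
  · by_contra h1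
    have h2 := hx a
    have h3 : a ≠ b' := fun h' => h (by rw [h', hb])
    rw [Equiv.swap_apply_of_ne_of_ne (Ne.symm h1) h3, Equiv.swap_apply_left] at h2
    exact h h2.symm
  · by_contra h1
    have h2 := hx b
    have h3 : b ≠ a' := fun h' => h (by rw [← ha, ← h'])
    rw [Equiv.swap_apply_of_ne_of_ne h3 (Ne.symm h1), Equiv.swap_apply_right] at h2
    exact h h2)

namespace IsMixAction

variable (h : IsMixAction π ξ p ρ) (hs : IsMixable π ξ μ)
include h hs

-- By Schur's lemma the form `swapForm` would be `c` times the inner product. Let `r` be a joint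
-- eigenvector that lives on one word. Its pairing with itself is zero, since exchanging points of
-- different colors changes the word; so `c = 0`. But if `a` and `b` have the colors `i` and `j` and
-- the common eigenvalue, the pairing of `(a b) r` with `r` is `⟪r, r⟫ ≠ 0`.
open Classical in
theorem not_isIrreducible_mixture {E : ℕ → Set ℝ} (hE : HasEigenvectors π E) {i j : ℕ}
    (hij : i ≠ j) {s t : ℝ} (hi : s ∈ E i) (hj : t ∈ E j) (hst : p i * s = p j * t) :
    ¬IsIrreducible (mixture π ξ p ρ) := fun hirr => by
  have hadm := h.isAdmissible_mixture
  obtain ⟨c, hc⟩ := h.form_eq_rootVec hs hirr (swapForm ρ i j (p i * s))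
    (fun τ u v => h.swapForm_rootPerm hs i j _ τ u v) fun x u v => h.swapForm_rootOp hs i j _ x u v
  obtain ⟨f, hf, hf0, h1, h2⟩ := hs.exists_eigenfamily hE
  obtain ⟨w⟩ := exists_rootWord hs.finite_depth
  let v : tensorRoot π ξ := ⟨tprod f, tprod_mem_tensorRoot hf⟩
  have hv0 : v ≠ 0 := fun h0 => hf0 (congrArg Subtype.val h0)
  have hplace : ∀ (i : ℕ) (y : NZ) (t : ℝ), opA (π i) y (f.1 i) = (t : ℂ) • f.1 i →
      opA (placeRep π ξ i) y (v : InfTensor ξ) = (((t : ℂ) • v : tensorRoot π ξ) : InfTensor ξ) := by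
    intro i y t ht
    change opA (placeRep π ξ i) y (tprod f) = (t : ℂ) • tprod f
    rw [← tprodAt_self f i, opA_placeRep_tprodAt (hs.admissible i), ht, map_smul]
  set r := rootVec ρ (Pi.single w v : RootWord π → tensorRoot π ξ) with hr
  have hrr : ⟪r, r⟫_ℂ ≠ 0 := by
    refine inner_self_ne_zero.2 fun h0 => hv0 ?_
    have := rootVec_injective (h0.trans (map_zero (rootVec ρ)).symm)
    simpa using congrFun this w
  have heig : ∀ x : window (totalDepth π), ∀ t : ℝ,
      opA (π (w.1 x)) (w.label x) (f.1 (w.1 x)) = (t : ℂ) • f.1 (w.1 x) →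
      opA (mixture π ξ p ρ) x r = ((p (w.1 x) * t : ℝ) : ℂ) • r := by
    intro x t ht
    rw [hr, h.opA_rootVec hs, rootOp_single hs x w (hplace _ _ _ ht), Pi.single_smul, map_smul,
      map_smul, smul_smul, Complex.ofReal_mul]
  have hproj : ∀ a b : window (totalDepth π),
      (eigenPair (mixture π ξ p ρ) (p i * s) a b).starProjection r = r ∨
      (eigenPair (mixture π ξ p ρ) (p i * s) a b).starProjection r = 0 := by
    intro a b
    obtain ⟨t₁, ht₁⟩ := h1 _ _ (w.label_mem a)
    obtain ⟨t₂, ht₂⟩ := h1 _ _ (w.label_mem b)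
    exact proj_eigenPair_eigenvector hadm (heig a t₁ ht₁) (heig b t₂ ht₂)
  obtain ⟨y₁, hy₁, hf₁⟩ := h2 i s hi
  obtain ⟨y₂, hy₂, hf₂⟩ := h2 j t hj
  obtain ⟨a, ha, hay⟩ := w.exists_label hy₁
  obtain ⟨b, hb, hby⟩ := w.exists_label hy₂
  have hab : w.1 a ≠ w.1 b := by rwa [ha, hb]
  have hra : opA (mixture π ξ p ρ) a r = ((p i * s : ℝ) : ℂ) • r := by
    subst ha
    exact heig a s (by rwa [hay])
  have hrb : opA (mixture π ξ p ρ) b r = ((p i * s : ℝ) : ℂ) • r := by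
    subst hb
    rw [hst]
    exact heig b t (by rwa [hby])
  have hprojab : (eigenPair (mixture π ξ p ρ) (p i * s) a b).starProjection r = r :=
    Submodule.starProjection_eq_self_iff.2 ⟨hra, hrb⟩
  have hC : ∀ a' b', rootVec ρ (colorRestrict ξ i j a' b' (Pi.single w v)) =
      if w.1 a' = i ∧ w.1 b' = j then r else 0 := by
    intro a' b'
    rw [colorRestrict_single]
    split_ifs
    · rfl
    · exact map_zero _
  have hterm : ∀ (w' : RootWord π) (u : tensorRoot π ξ) (a' b' : window (totalDepth π)),
      (w.1 a' = i → w.1 b' = j → w'.perm (Equiv.swap a' b') ≠ w) →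
      ⟪mixture π ξ p ρ (transposition a' b') (rootVec ρ (Pi.single w' u)),
        (eigenPair (mixture π ξ p ρ) (p i * s) a' b').starProjection
          (rootVec ρ (colorRestrict ξ i j a' b' (Pi.single w v)))⟫_ℂ = 0 := by
    intro w' u a' b' hne
    rw [hC]
    split_ifs with hcol
    · rcases hproj a' b' with h3 | h3
      · rw [h3, ← ofWindow_swap, h.ofWindow_rootVec hs, rootPerm_single hs, hr]
        exact inner_rootVec_single_of_ne (hne hcol.1 hcol.2) _ _
      · rw [h3, inner_zero_right]
    · rw [map_zero, inner_zero_right]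
  have hc0 : c = 0 := by
    have h3 := hc (Pi.single w v) (Pi.single w v)
    rw [swapForm_apply, Finset.sum_eq_zero] at h3
    · exact (mul_eq_zero.1 h3.symm).resolve_right hrr
    · rintro ⟨a', b'⟩ -
      exact hterm _ _ _ _ fun h4 h5 => RootWord.swap_ne (by rwa [h4, h5])
  have h3 := hc (rootPerm hs (Equiv.swap a b) (Pi.single w v)) (Pi.single w v)
  rw [hc0, zero_mul, swapForm_apply, Finset.sum_eq_single (a, b)] at h3
  · dsimp only at h3
    rw [hC, if_pos ⟨ha, hb⟩, hprojab, ← h.ofWindow_rootVec hs, ofWindow_swap, ← rho_mul,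
      transposition_mul_self, rho_one] at h3
    exact hrr h3
  · rintro ⟨a', b'⟩ - hne
    rw [rootPerm_single hs]
    exact hterm _ _ _ _ fun h4 h5 => RootWord.swap_swap_ne hab (h4.trans ha.symm)
      (h5.trans hb.symm) fun h6 => hne (Prod.ext h6.1 h6.2)
  · exact fun h' => absurd (Finset.mem_univ _) h'

end IsMixAction

/-! ### Permutations of disjoint unions -/

section Sigma

variable {ι : Type*} {α : ι → Type*}

theorem exists_sigmaCongrRight (g : Equiv.Perm (Σ i, α i)) (hg : ∀ x, (g x).1 = x.1) :
    ∃ h : ∀ i, Equiv.Perm (α i), g = Equiv.Perm.sigmaCongrRight h := by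
  have hg' : ∀ x, (g.symm x).1 = x.1 := fun x => by
    rw [← hg (g.symm x), Equiv.apply_symm_apply]
  have h1 : ∀ i a, ∃ b, g ⟨i, a⟩ = ⟨i, b⟩ := fun i a => by
    have := hg ⟨i, a⟩
    revert this
    generalize g ⟨i, a⟩ = y
    obtain ⟨j, b⟩ := y
    rintro rfl
    exact ⟨b, rfl⟩
  have h2 : ∀ i a, ∃ b, g.symm ⟨i, a⟩ = ⟨i, b⟩ := fun i a => by
    have := hg' ⟨i, a⟩
    revert this
    generalize g.symm ⟨i, a⟩ = y
    obtain ⟨j, b⟩ := y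
    rintro rfl
    exact ⟨b, rfl⟩
  choose f hf using h1
  choose f' hf' using h2
  refine ⟨fun i => ⟨f i, f' i, fun a => ?_, fun a => ?_⟩, Equiv.ext fun ⟨i, a⟩ => hf i a⟩
  · have := hf' i (f i a)
    rw [← hf, Equiv.symm_apply_apply] at this
    exact (eq_of_heq (Sigma.mk.inj this).2).symm
  · have := hf i (f' i a)
    rw [← hf', Equiv.apply_symm_apply] at this
    exact (eq_of_heq (Sigma.mk.inj this).2).symm

variable [Fintype ι] [DecidableEq ι] [∀ i, Fintype (α i)] [∀ i, DecidableEq (α i)]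

/-- Both sides are homomorphisms on a product of groups, so it suffices to compare them on
transpositions in one factor. -/
theorem sign_sigmaCongrRight (g : ∀ i, Equiv.Perm (α i)) :
    Equiv.Perm.sign (Equiv.Perm.sigmaCongrRight g) = ∏ i, Equiv.Perm.sign (g i) := by
  let f₁ : (∀ i, Equiv.Perm (α i)) →* ℤˣ :=
    Equiv.Perm.sign.comp (Equiv.Perm.sigmaCongrRightHom α)
  let f₂ : (∀ i, Equiv.Perm (α i)) →* ℤˣ :=
    { toFun := fun g => ∏ i, Equiv.Perm.sign (g i)
      map_one' := by simp
      map_mul' := fun g h => by simp [Finset.prod_mul_distrib] }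
  have h : f₁ = f₂ := by
    refine MonoidHom.pi_ext fun i σ => ?_
    have h2 : f₂ (Pi.mulSingle i σ) = Equiv.Perm.sign σ := by
      change ∏ j, Equiv.Perm.sign ((Pi.mulSingle i σ : ∀ i, Equiv.Perm (α i)) j) = _
      rw [Finset.prod_eq_single i (fun j _ hj => by rw [Pi.mulSingle_eq_of_ne hj, map_one])
        (by simp), Pi.mulSingle_eq_same]
    rw [h2]
    clear h2
    induction σ using Equiv.Perm.swap_induction_on with
    | one => rw [Pi.mulSingle_one, map_one, map_one]
    | swap_mul σ x y hxy ih =>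
      have h3 : Equiv.Perm.sigmaCongrRight (Pi.mulSingle i (Equiv.swap x y)) =
          Equiv.swap (⟨i, x⟩ : Σ i, α i) ⟨i, y⟩ := by
        refine Equiv.ext fun ⟨j, a⟩ => ?_
        change (⟨j, (Pi.mulSingle i (Equiv.swap x y) : ∀ i, Equiv.Perm (α i)) j a⟩ : Σ i, α i) = _
        by_cases hj : j = i
        · subst hj
          rw [Pi.mulSingle_eq_same]
          by_cases h1 : a = x
          · rw [h1, Equiv.swap_apply_left, Equiv.swap_apply_left]
          by_cases h2 : a = y
          · rw [h2, Equiv.swap_apply_right, Equiv.swap_apply_right]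
          rw [Equiv.swap_apply_of_ne_of_ne h1 h2, Equiv.swap_apply_of_ne_of_ne] <;>
            simpa
        · rw [Pi.mulSingle_eq_of_ne hj, Equiv.swap_apply_of_ne_of_ne (by simp [hj])
            (by simp [hj])]
          rfl
      rw [Pi.mulSingle_mul, map_mul, map_mul, ih]
      congr 1
      change Equiv.Perm.sign (Equiv.Perm.sigmaCongrRight _) = _
      rw [h3, Equiv.Perm.sign_swap hxy, Equiv.Perm.sign_swap (by simpa using hxy)]
  exact congrArg (fun f => f g) h

end Sigma

/-! ### Young symmetrizers of unions -/

namespace YoungDistribution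

open Classical in
theorem coeff_symmetrizer (L : YoungDistribution) (g : Equiv.Perm L.Cell) :
    L.symmetrizer.coeff g = ∑ r : {σ // L.IsRowPerm σ}, ∑ c : {σ // L.IsColPerm σ},
      if r.1 * c.1 = g then ((Equiv.Perm.sign c.1 : ℤ) : ℂ) else 0 := by
  rw [symmetrizer, Finset.sum_mul_sum, MonoidAlgebra.coeff_sum, Finsupp.finsetSum_apply]
  refine Finset.sum_congr rfl fun r _ => ?_
  rw [MonoidAlgebra.coeff_sum, Finsupp.finsetSum_apply]
  refine Finset.sum_congr rfl fun c _ => ?_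
  rw [MonoidAlgebra.single_mul_single, one_mul, MonoidAlgebra.coeff_single, Finsupp.single_apply]

theorem coeff_gen (L : YoungDistribution) (τ y : Equiv.Perm L.Cell) :
    (L.gen τ).coeff y = L.symmetrizer.coeff (τ⁻¹ * y) := by
  rw [gen, MonoidAlgebra.coeff_single_mul_eq_mul_coeff (τ⁻¹ * y), one_mul]
  intro m _
  exact eq_inv_mul_iff_mul_eq.symm

end YoungDistribution

/-- The cells of `M` are the cells of the distributions `L i`, with the points multiplied by
`c i` and different colors at different points. -/
structure CellUnion {ι : Type*} (L : ι → YoungDistribution) (c : ι → ℝ) (M : YoungDistribution) where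
  equiv : (Σ i, (L i).Cell) ≃ M.Cell
  pt_equiv : ∀ i q, (equiv ⟨i, q⟩).pt = c i * q.pt
  pos_equiv : ∀ i q, (equiv ⟨i, q⟩).1.2 = q.1.2
  pos : ∀ i, 0 < c i
  color_eq : ∀ (i j) (q : (L i).Cell) (q' : (L j).Cell), c i * q.pt = c j * q'.pt → i = j

namespace CellUnion

variable {ι : Type*} {L : ι → YoungDistribution} {c : ι → ℝ} {M : YoungDistribution}
  (U : CellUnion L c M)

/-- The color of a cell. -/
def color (z : M.Cell) : ι := (U.equiv.symm z).1

@[simp] theorem color_equiv (x : Σ i, (L i).Cell) : U.color (U.equiv x) = x.1 := by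
  rw [color, Equiv.symm_apply_apply]

theorem exists_equiv (z : M.Cell) : ∃ q : (L (U.color z)).Cell, U.equiv ⟨U.color z, q⟩ = z :=
  ⟨(U.equiv.symm z).2, U.equiv.apply_symm_apply z⟩

theorem color_eq_of_pt {z z' : M.Cell} (h : z.pt = z'.pt) : U.color z = U.color z' := by
  obtain ⟨q, hq⟩ := U.exists_equiv z
  obtain ⟨q', hq'⟩ := U.exists_equiv z'
  rw [← hq, ← hq', U.pt_equiv, U.pt_equiv] at h
  exact U.color_eq _ _ _ _ h

/-- The permutation of the cells of `M` that is composed of permutations of the cells of the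
distributions `L i`. -/
def glue (g : ∀ i, Equiv.Perm (L i).Cell) : Equiv.Perm M.Cell :=
  U.equiv.permCongr (Equiv.Perm.sigmaCongrRight g)

theorem glue_equiv (g : ∀ i, Equiv.Perm (L i).Cell) (i : ι) (q : (L i).Cell) :
    U.glue g (U.equiv ⟨i, q⟩) = U.equiv ⟨i, g i q⟩ := by
  rw [glue, Equiv.permCongr_apply, Equiv.symm_apply_apply]
  rfl

theorem glue_mul (g h : ∀ i, Equiv.Perm (L i).Cell) : U.glue (g * h) = U.glue g * U.glue h := by
  refine Equiv.ext fun z => ?_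
  obtain ⟨⟨i, q⟩, rfl⟩ := U.equiv.surjective z
  rw [Equiv.Perm.mul_apply, glue_equiv, glue_equiv, glue_equiv]
  rfl

theorem glue_injective : Function.Injective U.glue := fun g h hgh => by
  funext i
  refine Equiv.ext fun q => ?_
  have := congrArg (fun f => f (U.equiv ⟨i, q⟩)) hgh
  simp only [glue_equiv] at this
  exact eq_of_heq (Sigma.mk.inj (U.equiv.injective this)).2

theorem exists_glue (g : Equiv.Perm M.Cell) (hg : ∀ z, U.color (g z) = U.color z) :
    ∃ h, U.glue h = g := by
  obtain ⟨h, hh⟩ := exists_sigmaCongrRight (U.equiv.symm.permCongr g) fun x => by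
    rw [Equiv.permCongr_apply, Equiv.symm_symm]
    have := hg (U.equiv x)
    rwa [color_equiv] at this
  refine ⟨h, Equiv.ext fun z => ?_⟩
  rw [glue, ← hh]
  simp [Equiv.permCongr_apply]

theorem isRowPerm_glue {g : ∀ i, Equiv.Perm (L i).Cell} :
    M.IsRowPerm (U.glue g) ↔ ∀ i, (L i).IsRowPerm (g i) := by
  constructor
  · intro h i q
    have := h (U.equiv ⟨i, q⟩)
    rw [glue_equiv, U.pt_equiv, U.pt_equiv, U.pos_equiv, U.pos_equiv] at this
    exact ⟨mul_left_cancel₀ (U.pos i).ne' this.1, this.2⟩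
  · intro h z
    obtain ⟨⟨i, q⟩, rfl⟩ := U.equiv.surjective z
    rw [glue_equiv, U.pt_equiv, U.pt_equiv, U.pos_equiv, U.pos_equiv, (h i q).1, (h i q).2]
    exact ⟨rfl, rfl⟩

theorem isColPerm_glue {g : ∀ i, Equiv.Perm (L i).Cell} :
    M.IsColPerm (U.glue g) ↔ ∀ i, (L i).IsColPerm (g i) := by
  constructor
  · intro h i q
    have := h (U.equiv ⟨i, q⟩)
    rw [glue_equiv, U.pt_equiv, U.pt_equiv, U.pos_equiv, U.pos_equiv] at this
    exact ⟨mul_left_cancel₀ (U.pos i).ne' this.1, this.2⟩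
  · intro h z
    obtain ⟨⟨i, q⟩, rfl⟩ := U.equiv.surjective z
    rw [glue_equiv, U.pt_equiv, U.pt_equiv, U.pos_equiv, U.pos_equiv, (h i q).1, (h i q).2]
    exact ⟨rfl, rfl⟩

/-- Row permutations of the union. -/
def rowEquiv : (∀ i, {σ // (L i).IsRowPerm σ}) ≃ {σ // M.IsRowPerm σ} :=
  Equiv.ofBijective (fun r => ⟨U.glue fun i => (r i).1, U.isRowPerm_glue.2 fun i => (r i).2⟩)
    ⟨fun r s h => funext fun i => Subtype.ext
      (congrFun (U.glue_injective (congrArg Subtype.val h)) i), fun r => by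
      obtain ⟨h, hh⟩ := U.exists_glue r.1 fun z => U.color_eq_of_pt (r.2 z).1
      exact ⟨fun i => ⟨h i, U.isRowPerm_glue.1 (hh ▸ r.2) i⟩, Subtype.ext hh⟩⟩

/-- Column permutations of the union. -/
def colEquiv : (∀ i, {σ // (L i).IsColPerm σ}) ≃ {σ // M.IsColPerm σ} :=
  Equiv.ofBijective (fun r => ⟨U.glue fun i => (r i).1, U.isColPerm_glue.2 fun i => (r i).2⟩)
    ⟨fun r s h => funext fun i => Subtype.ext
      (congrFun (U.glue_injective (congrArg Subtype.val h)) i), fun r => by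
      obtain ⟨h, hh⟩ := U.exists_glue r.1 fun z => U.color_eq_of_pt (r.2 z).1
      exact ⟨fun i => ⟨h i, U.isColPerm_glue.1 (hh ▸ r.2) i⟩, Subtype.ext hh⟩⟩

/-- Row and column permutations preserve the point of a cell, and the point determines the color. -/
theorem symmetrizer_eq_zero {g : Equiv.Perm M.Cell} (h : ∃ z, U.color (g z) ≠ U.color z) :
    M.symmetrizer.coeff g = 0 := by
  classical
  rw [YoungDistribution.coeff_symmetrizer]
  refine Finset.sum_eq_zero fun r _ => Finset.sum_eq_zero fun c _ => if_neg ?_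
  rintro rfl
  obtain ⟨z, hz⟩ := h
  exact hz ((U.color_eq_of_pt (r.2 (c.1 z)).1).trans (U.color_eq_of_pt (c.2 z).1))

variable [Fintype ι]

theorem sign_glue (g : ∀ i, Equiv.Perm (L i).Cell) :
    Equiv.Perm.sign (U.glue g) = ∏ i, Equiv.Perm.sign (g i) := by
  classical
  rw [glue, Equiv.Perm.sign_permCongr, sign_sigmaCongrRight]

/-- The row and column groups of the union are products of those of the parts, and the sign is
multiplicative, so the double sum factors. -/
theorem symmetrizer_glue (g : ∀ i, Equiv.Perm (L i).Cell) :
    M.symmetrizer.coeff (U.glue g) = ∏ i, (L i).symmetrizer.coeff (g i) := by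
  classical
  simp only [YoungDistribution.coeff_symmetrizer]
  rw [Fintype.prod_sum, ← U.rowEquiv.sum_comp]
  refine Finset.sum_congr rfl fun r _ => ?_
  rw [Fintype.prod_sum, ← U.colEquiv.sum_comp]
  refine Finset.sum_congr rfl fun s _ => ?_
  change (if U.glue (fun i => (r i).1) * U.glue (fun i => (s i).1) = U.glue g then
    ((Equiv.Perm.sign (U.glue fun i => (s i).1) : ℤ) : ℂ) else 0) = _
  rw [← glue_mul, sign_glue]
  by_cases h : (fun i => (r i).1) * (fun i => (s i).1) = g
  · rw [if_pos (congrArg U.glue h)]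
    push_cast
    refine Finset.prod_congr rfl fun i _ => ?_
    exact (if_pos (congrFun h i)).symm
  · rw [if_neg fun h' => h (U.glue_injective h')]
    obtain ⟨i, hi⟩ := Function.ne_iff.1 h
    exact (Finset.prod_eq_zero (Finset.mem_univ i) (if_neg hi)).symm

end CellUnion

/-! ### Permutations of the cells, words and labels -/

variable {H : ℕ → Type*} [∀ i, NormedAddCommGroup (H i)] [∀ i, InnerProductSpace ℂ (H i)]
  {π : ∀ i, URep (H i)} {p : Weights} {L : ℕ → YoungDistribution} {M : YoungDistribution}
  [∀ i, CompleteSpace (H i)] [Fintype (RootWord π)]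

theorem RootWord.label_injective {w : RootWord π} {x y : window (totalDepth π)}
    (h : w.1 x = w.1 y) (hl : w.label x = w.label y) : x = y := by
  refine Subtype.ext (lab_injOn w.good (i := w.1 x) (wordExt_apply x)
    ((wordExt_apply y).trans h.symm) ?_)
  rw [RootWord.label, RootWord.label, ← h] at hl
  exact hl

/-- The places with nonzero depth. -/
abbrev Place (π : ∀ i, URep (H i)) : Type := {i // depth (π i) ≠ 0}

/-- Numberings of the cells of a union of distributions and of the cells of its parts. -/
structure Numbering (π : ∀ i, URep (H i)) (p : Weights) (L : ℕ → YoungDistribution)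
    (M : YoungDistribution) extends
    CellUnion (fun i : Place π => L i) (fun i => p i) M where
  part : ∀ i, (L i).Cell ≃ window (depth (π i))
  whole : M.Cell ≃ window (totalDepth π)

namespace Numbering

variable (U : Numbering π p L M)

/-- The colors of the points after a permutation of the cells. -/
def word (τ : Equiv.Perm M.Cell) : RootWord π :=
  ⟨fun x => (U.color (τ.symm (U.whole.symm x))).1, isRootWord_iff.2 fun i => by
    by_cases hi : depth (π i) = 0
    · have : IsEmpty {x // (U.color (τ.symm (U.whole.symm x))).1 = i} :=
        ⟨fun x => (U.color (τ.symm (U.whole.symm x.1))).2 (by rw [x.2, hi])⟩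
      rw [hi, mul_zero, Nat.card_of_isEmpty]
    · let e₁ : {x // (U.color (τ.symm (U.whole.symm x))).1 = i} ≃ {x : Σ i : Place π, (L i).Cell //
          x.1 = ⟨i, hi⟩} :=
        ((U.whole.symm.trans τ.symm).trans U.equiv.symm).subtypeEquiv fun x =>
          (Subtype.ext_iff (a1 := U.color (τ.symm (U.whole.symm x))) (a2 := ⟨i, hi⟩)).symm
      let e₂ : {x : Σ i : Place π, (L i).Cell // x.1 = ⟨i, hi⟩} ≃ (L i).Cell :=
        Equiv.sigmaSubtype (β := fun i : Place π => (L i).Cell) ⟨i, hi⟩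
      rw [Nat.card_congr ((e₁.trans e₂).trans (U.part i)), Nat.card_eq_fintype_card, card_window]⟩

theorem word_apply (τ : Equiv.Perm M.Cell) (x : window (totalDepth π)) :
    (U.word τ).1 x = (U.color (τ.symm (U.whole.symm x))).1 := rfl

theorem word_whole (τ : Equiv.Perm M.Cell) (i : Place π) (q : (L i).Cell) :
    (U.word τ).1 (U.whole (τ (U.equiv ⟨i, q⟩))) = i := by
  rw [word_apply, Equiv.symm_apply_apply, Equiv.symm_apply_apply, CellUnion.color_equiv]

theorem color_eq_word (τ : Equiv.Perm M.Cell) (z : M.Cell) :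
    (U.color z).1 = (U.word τ).1 (U.whole (τ z)) := by
  rw [word_apply, Equiv.symm_apply_apply, Equiv.symm_apply_apply]

/-- The label of the image of a cell. -/
def placeFun (τ : Equiv.Perm M.Cell) (i : Place π) (q : (L i).Cell) : (L i).Cell :=
  (U.part i).symm ⟨(U.word τ).label (U.whole (τ (U.equiv ⟨i, q⟩))), by
    have h := (U.word τ).label_mem (U.whole (τ (U.equiv ⟨i, q⟩)))
    rwa [U.word_whole τ i q] at h⟩

theorem placeFun_injective (τ : Equiv.Perm M.Cell) (i : Place π) :
    Function.Injective (U.placeFun τ i) := fun q q' h => by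
  have h1 := congrArg Subtype.val ((U.part i).symm.injective h)
  have h2 := RootWord.label_injective ((U.word_whole τ i q).trans (U.word_whole τ i q').symm) h1
  exact eq_of_heq (Sigma.mk.inj (U.equiv.injective (τ.injective (U.whole.injective h2)))).2

/-- The permutation of the cells of the `i`-th distribution given by a permutation of all cells. -/
def place (τ : Equiv.Perm M.Cell) (i : Place π) : Equiv.Perm (L i).Cell :=
  Equiv.ofBijective _ (Finite.injective_iff_bijective.1 (U.placeFun_injective τ i))

theorem part_place (τ : Equiv.Perm M.Cell) (i : Place π) (q : (L i).Cell) :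
    (U.part i (U.place τ i q) : NZ) = (U.word τ).label (U.whole (τ (U.equiv ⟨i, q⟩))) := by
  change (U.part i ((U.part i).symm _) : NZ) = _
  rw [Equiv.apply_symm_apply]

/-- Permutations with the same word differ by one that preserves colors, and within a color a point
is determined by its label. -/
theorem eq_mul_glue {τ y : Equiv.Perm M.Cell} (h : U.word y = U.word τ) :
    τ⁻¹ * y = U.glue fun i => (U.place τ i)⁻¹ * U.place y i := by
  rw [inv_mul_eq_iff_eq_mul]
  refine Equiv.ext fun z => ?_
  obtain ⟨⟨i, q⟩, rfl⟩ := U.equiv.surjective z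
  rw [Equiv.Perm.mul_apply, CellUnion.glue_equiv]
  set q' := (U.place τ i)⁻¹ (U.place y i q) with hq'
  refine U.whole.injective (RootWord.label_injective (w := U.word τ) ?_ ?_)
  · change _ = (U.word τ).1 (U.whole (τ (U.equiv ⟨i, q'⟩)))
    rw [U.word_whole τ i q', ← h, U.word_whole y i q]
  · change _ = (U.word τ).label (U.whole (τ (U.equiv ⟨i, q'⟩)))
    rw [← part_place, ← h, ← part_place, hq']
    exact congrArg (fun q => (U.part i q : NZ)) ((U.place τ i).apply_symm_apply _).symm

theorem exists_color_ne {τ y : Equiv.Perm M.Cell} (h : U.word y ≠ U.word τ) :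
    ∃ z, U.color ((τ⁻¹ * y) z) ≠ U.color z := by
  by_contra! h1
  refine h (Subtype.ext (funext fun x => ?_))
  obtain ⟨x, rfl⟩ := U.whole.surjective x
  obtain ⟨z, rfl⟩ := y.surjective x
  rw [← color_eq_word, ← h1 z, U.color_eq_word τ, Equiv.Perm.mul_apply]
  exact congrArg (fun x => (U.word τ).1 (U.whole x)) (τ.apply_symm_apply (y z))

variable [Fintype (Place π)]

-- The coefficient is that of the symmetrizer at `τ⁻¹ * y`, which factors over the places if this
-- permutation preserves colors and vanishes otherwise. It expresses the induced module as a direct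
-- sum, over the root words, of tensor products of the modules of the parts.
open Classical in
theorem coeff_gen (τ y : Equiv.Perm M.Cell) : (M.gen τ).coeff y =
    if U.word y = U.word τ then ∏ i : Place π, ((L i).gen (U.place τ i)).coeff (U.place y i)
    else 0 := by
  rw [YoungDistribution.coeff_gen]
  split_ifs with h
  · rw [U.eq_mul_glue h, CellUnion.symmetrizer_glue]
    exact Finset.prod_congr rfl fun i _ => (YoungDistribution.coeff_gen _ _ _).symm
  · exact U.symmetrizer_eq_zero (U.exists_color_ne h)

omit [Fintype (Place π)] in
theorem exists_perm (w : RootWord π) (g : ∀ i : Place π, Equiv.Perm (L i).Cell) :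
    ∃ τ, U.word τ = w ∧ U.place τ = g := by
  have h1 : ∀ (i : Place π) (q : (L i).Cell), ∃ x, w.1 x = i ∧ w.label x = U.part i (g i q) :=
    fun i q => w.exists_label (U.part i (g i q)).2
  choose f hf hfl using h1
  let F : M.Cell → M.Cell := fun z =>
    U.whole.symm (f (U.equiv.symm z).1 (U.equiv.symm z).2)
  have hF : Function.Injective F := fun z z' h => by
    have h2 := U.whole.symm.injective h
    refine U.equiv.symm.injective ?_
    generalize U.equiv.symm z = a at h2
    generalize U.equiv.symm z' = b at h2
    obtain ⟨i, q⟩ := a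
    obtain ⟨j, q'⟩ := b
    dsimp only at h2
    have hij : i = j := Subtype.ext (by rw [← hf i q, ← hf j q', h2])
    subst hij
    have h3 : (U.part i (g i q) : NZ) = U.part i (g i q') := by rw [← hfl, ← hfl, h2]
    rw [(g i).injective ((U.part i).injective (Subtype.ext h3))]
  let τ : Equiv.Perm M.Cell := Equiv.ofBijective F (Finite.injective_iff_bijective.1 hF)
  have hτ : ∀ i q, U.whole (τ (U.equiv ⟨i, q⟩)) = f i q := fun i q => by
    change U.whole (U.whole.symm (f (U.equiv.symm (U.equiv ⟨i, q⟩)).1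
      (U.equiv.symm (U.equiv ⟨i, q⟩)).2)) = _
    rw [Equiv.apply_symm_apply, Equiv.symm_apply_apply]
  have hw : U.word τ = w := Subtype.ext (funext fun x => by
    obtain ⟨x, rfl⟩ := U.whole.surjective x
    obtain ⟨z, rfl⟩ := τ.surjective x
    obtain ⟨⟨i, q⟩, rfl⟩ := U.equiv.surjective z
    rw [word_whole, hτ, hf])
  refine ⟨τ, hw, funext fun i => Equiv.ext fun q => (U.part i).injective (Subtype.ext ?_)⟩
  rw [part_place, hw, hτ, hfl]

end Numbering

/-! ### Linear maps from relations, and dual families -/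

section LinearAlgebra

theorem exists_linearMap_of_relations {X A B : Type*} [Fintype X] [AddCommGroup A] [Module ℂ A]
    [AddCommGroup B] [Module ℂ B] (f : X → A) (g : X → B)
    (hf : Submodule.span ℂ (Set.range f) = ⊤)
    (h : ∀ c : X → ℂ, ∑ x, c x • f x = 0 ↔ ∑ x, c x • g x = 0) :
    ∃ φ : A →ₗ[ℂ] B, Function.Injective φ ∧ LinearMap.range φ = Submodule.span ℂ (Set.range g) ∧
      ∀ x, φ (f x) = g x := by
  classical
  let P := Fintype.linearCombination ℂ f
  let Q := Fintype.linearCombination ℂ g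
  have hP : LinearMap.range P = ⊤ := by rw [Fintype.range_linearCombination, hf]
  have hk : LinearMap.ker P ≤ LinearMap.ker Q := fun c hc => by
    rw [LinearMap.mem_ker, Fintype.linearCombination_apply] at hc ⊢
    exact (h c).1 hc
  let φ : A →ₗ[ℂ] B := (LinearMap.ker P).liftQ Q hk ∘ₗ
    (P.quotKerEquivOfSurjective (LinearMap.range_eq_top.1 hP)).symm.toLinearMap
  have hφ : ∀ c, φ (P c) = Q c := fun c => by
    have : (P.quotKerEquivOfSurjective (LinearMap.range_eq_top.1 hP)).symm (P c) =
        (LinearMap.ker P).mkQ c := by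
      rw [LinearEquiv.symm_apply_eq]
      rfl
    change (LinearMap.ker P).liftQ Q hk
      ((P.quotKerEquivOfSurjective (LinearMap.range_eq_top.1 hP)).symm (P c)) = _
    rw [this]
    rfl
  have hφf : ∀ x, φ (f x) = g x := fun x => by
    have := hφ (Pi.single x 1)
    simpa [P, Q, Fintype.linearCombination_apply_single] using this
  refine ⟨φ, ?_, ?_, hφf⟩
  · rw [← LinearMap.ker_eq_bot, LinearMap.ker_eq_bot']
    intro a ha
    obtain ⟨c, rfl⟩ := LinearMap.range_eq_top.1 hP a
    rw [hφ, Fintype.linearCombination_apply] at ha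
    rw [Fintype.linearCombination_apply]
    exact (h c).2 ha
  · rw [LinearMap.range_eq_map, ← hf, Submodule.map_span, ← Set.range_comp]
    exact congrArg _ (congrArg _ (funext hφf))

/-- The Riesz vectors of functionals that separate points span the space. -/
theorem exists_dual_family {X A V : Type*} [AddCommGroup A] [Module ℂ A] [FiniteDimensional ℂ A]
    [NormedAddCommGroup V] [InnerProductSpace ℂ V] (φ : A →ₗ[ℂ] V) (hφ : Function.Injective φ)
    (l : X → A →ₗ[ℂ] ℂ) (hl : ∀ a, (∀ x, l x a = 0) → a = 0) :
    ∃ r : X → V, (∀ x a, ⟪r x, φ a⟫_ℂ = l x a) ∧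
      Submodule.span ℂ (Set.range r) = LinearMap.range φ := by
  let e := LinearEquiv.ofInjective φ hφ
  have : FiniteDimensional ℂ (LinearMap.range φ) := inferInstance
  have : CompleteSpace (LinearMap.range φ) := FiniteDimensional.complete ℂ _
  let r : X → LinearMap.range φ := fun x => (InnerProductSpace.toDual ℂ (LinearMap.range φ)).symm
    (LinearMap.toContinuousLinearMap (l x ∘ₗ e.symm.toLinearMap))
  have hr : ∀ x a, ⟪r x, e a⟫_ℂ = l x a := fun x a => by
    rw [InnerProductSpace.toDual_symm_apply]
    change l x (e.symm (e a)) = _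
    rw [LinearEquiv.symm_apply_apply]
  refine ⟨fun x => r x, fun x a => hr x a, ?_⟩
  have hs : Submodule.span ℂ (Set.range r) = ⊤ := by
    rw [← Submodule.orthogonal_eq_bot_iff, Submodule.eq_bot_iff]
    intro v hv
    obtain ⟨a, rfl⟩ := e.surjective v
    rw [hl a fun x => ?_, map_zero]
    rw [← hr]
    exact (Submodule.mem_orthogonal _ _).1 hv _ (Submodule.subset_span ⟨x, rfl⟩)
  have := congrArg (Submodule.map (LinearMap.range φ).subtype) hs
  rwa [Submodule.map_span, ← Set.range_comp, Submodule.map_top, Submodule.range_subtype] at this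

end LinearAlgebra

/-! ### The isomorphism between the root and the Young module -/

variable {H : ℕ → Type*} [∀ i, NormedAddCommGroup (H i)] [∀ i, InnerProductSpace ℂ (H i)]
  {ξ : ∀ i, Metric.sphere (0 : H i) 1} {π : ∀ i, URep (H i)} {p : Weights} {μ : ℕ → Measure ℝ}
  {ρ : URep (MixSpace ξ p)} {L : ℕ → YoungDistribution} {M : YoungDistribution}
  [∀ i, CompleteSpace (H i)]

namespace IsMixable

variable (hs : IsMixable π ξ μ)

open Classical in
/-- The family with given vectors at the places with nonzero depth. -/
def family (hs : IsMixable π ξ μ) (a : ∀ i : Place π, H i) : Family ξ :=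
  ⟨fun i => if h : depth (π i) ≠ 0 then a ⟨i, h⟩ else ξ i,
    hs.finite_depth.subset fun i hi => by
      by_contra h
      exact hi (dif_neg h)⟩

theorem family_apply (a : ∀ i : Place π, H i) (i : Place π) : (hs.family a).1 i = a i :=
  dif_pos i.2

theorem family_apply_of_depth (a : ∀ i : Place π, H i) {i : ℕ} (hi : depth (π i) = 0) :
    (hs.family a).1 i = ξ i := dif_neg (not_not.2 hi)

theorem family_mem {a : ∀ i : Place π, H i} (ha : ∀ i : Place π, a i ∈ root (π i)) (i : ℕ) :
    (hs.family a).1 i ∈ root (π i) := by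
  by_cases hi : depth (π i) = 0
  · rw [hs.family_apply_of_depth a hi]
    exact hs.mem_root i hi
  · have := hs.family_apply a ⟨i, hi⟩
    exact this ▸ ha ⟨i, hi⟩

theorem inner_family [Fintype (Place π)] (a b : ∀ i : Place π, H i) :
    ⟪tprod (hs.family a), tprod (hs.family b)⟫_ℂ = ∏ i : Place π, ⟪a i, b i⟫_ℂ := by
  rw [inner_tprod, finprod_eq_prod_of_mulSupport_subset (s := hs.finite_depth.toFinset),
    Finset.prod_subtype (p := fun i => depth (π i) ≠ 0) _ (fun i => by simp)]
  · refine Finset.prod_congr rfl fun i _ => ?_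
    rw [family_apply, family_apply]
  · intro i hi
    rw [Set.Finite.coe_toFinset]
    intro h
    exact hi (Family.inner_eq_one _ _ i (hs.family_apply_of_depth a h)
      (hs.family_apply_of_depth b h))

theorem submodule_eq_top (S : ∀ i : Place π, Set (H i))
    (hS : ∀ i : Place π, Submodule.span ℂ (S i) = root (π i)) (P : Submodule ℂ (tensorRoot π ξ))
    (hP : ∀ (a : ∀ i : Place π, H i) (ha : ∀ i : Place π, a i ∈ root (π i)), (∀ i, a i ∈ S i) →
      ⟨tprod (hs.family a), tprod_mem_tensorRoot (hs.family_mem ha)⟩ ∈ P) : P = ⊤ := by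
  classical
  rw [eq_top_iff]
  intro x _
  have key : (x : InfTensor ξ) ∈ P.map (tensorRoot π ξ).subtype := by
    refine hs.pure_induction (Q := fun u => u ∈ P.map (tensorRoot π ξ).subtype) (fun v hv => ?_)
      (zero_mem _) (fun _ _ => add_mem) (fun c _ => Submodule.smul_mem _ c) x.2
    let T : ∀ i, Set (H i) := fun i => if h : depth (π i) ≠ 0 then S ⟨i, h⟩ else {(ξ i : H i)}
    have hT : ∀ i : Place π, T i = S i := fun i => dif_pos i.2
    have hT0 : ∀ i, depth (π i) = 0 → T i = {(ξ i : H i)} := fun i hi => dif_neg (not_not.2 hi)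
    refine (Submodule.span_le.2 ?_) (tprod_mem_span T (hs.finite_depth.toFinset ∪ v.2.toFinset) v
      (fun i hi => ?_) (fun i _ => ?_))
    · rintro _ ⟨s, h1, rfl⟩
      have h2 : s = hs.family fun i => s.1 i := Subtype.ext (funext fun i => by
        by_cases hi : depth (π i) = 0
        · have := h1 i
          rw [hT0 i hi] at this
          rw [hs.family_apply_of_depth _ hi]
          exact this
        · exact (hs.family_apply (fun i => s.1 i) ⟨i, hi⟩).symm)
      have h3 : ∀ i : Place π, s.1 i ∈ S i := fun i => hT i ▸ h1 i
      have h4 : ∀ i : Place π, s.1 i ∈ root (π i) := fun i =>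
        hS i ▸ Submodule.subset_span (h3 i)
      exact ⟨_, hP (fun i => s.1 i) h4 h3, (congrArg tprod h2).symm⟩
    · simp only [Finset.mem_union, Set.Finite.mem_toFinset, Set.mem_ofPred_eq, not_or,
        not_not] at hi
      rw [hT0 i hi.1, hi.2]
      rfl
    · by_cases hi : depth (π i) = 0
      · rw [hT0 i hi, ← hs.root_eq_span hi]
        exact hv i
      · have := hT ⟨i, hi⟩
        rw [this, hS]
        exact hv i
  obtain ⟨y, hy, hyx⟩ := key
  rwa [← Subtype.ext hyx]

end IsMixable

theorem hasYoungDistribution_of_depth_eq {V : Type*} [NormedAddCommGroup V]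
    [InnerProductSpace ℂ V] {ρ : URep V} {d : ℕ} (hd : depth ρ = d) (e : M.Cell ≃ window d)
    (φ : M.youngModule →ₗ[ℂ] V) (hφ : Function.Injective φ) (hr : LinearMap.range φ = root ρ)
    (hperm : ∀ σ τ : Equiv.Perm M.Cell,
      ρ (ofWindow d (e.permCongr σ)) (φ (M.vec τ)) = φ (M.vec (σ * τ)))
    (hop : ∀ (z : M.Cell) (τ : Equiv.Perm M.Cell),
      opA ρ (e z).1 (φ (M.vec τ)) = ((τ⁻¹ z).pt : ℂ) • φ (M.vec τ)) :
    HasYoungDistribution ρ M := by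
  subst hd
  exact ⟨e, φ, hφ, hr, hperm, hop⟩

/-- Isomorphisms of the roots with the modules given by Young distributions. -/
structure RootModel (U : Numbering π p L M) where
  toMap : ∀ i : Place π, (L i).youngModule →ₗ[ℂ] H i
  injective : ∀ i, Function.Injective (toMap i)
  range_eq : ∀ i : Place π, LinearMap.range (toMap i) = root (π i)
  perm : ∀ (i : Place π) (σ τ : Equiv.Perm (L i).Cell),
    π i (ofWindow _ ((U.part i).permCongr σ)) (toMap i ((L i).vec τ)) =
      toMap i ((L i).vec (σ * τ))
  op : ∀ (i : Place π) (z : (L i).Cell) (τ : Equiv.Perm (L i).Cell),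
    opA (π i) (U.part i z).1 (toMap i ((L i).vec τ)) =
      ((τ⁻¹ z).pt : ℂ) • toMap i ((L i).vec τ)

namespace RootModel

variable [Fintype (RootWord π)] {U : Numbering π p L M} (R : RootModel U) (hs : IsMixable π ξ μ)

theorem toMap_mem (i : Place π) (v : (L i).youngModule) : R.toMap i v ∈ root (π i) :=
  R.range_eq i ▸ LinearMap.mem_range_self _ v

/-- The vectors at the places given by a permutation of all cells. -/
def place (τ : Equiv.Perm M.Cell) (i : Place π) : H i := R.toMap i ((L i).vec (U.place τ i))

theorem place_mem (τ : Equiv.Perm M.Cell) (i : Place π) : R.place τ i ∈ root (π i) :=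
  R.toMap_mem i _

/-- The tensor given by a permutation of all cells. -/
def tensor (τ : Equiv.Perm M.Cell) : tensorRoot π ξ :=
  ⟨tprod (hs.family (R.place τ)), tprod_mem_tensorRoot (hs.family_mem (R.place_mem τ))⟩

open Classical in
/-- The values of the vector given by a permutation of all cells. -/
def values (τ : Equiv.Perm M.Cell) : RootWord π → tensorRoot π ξ :=
  Pi.single (U.word τ) (R.tensor hs τ)

theorem span_values : Submodule.span ℂ (Set.range (R.values hs)) = ⊤ := by
  classical
  rw [eq_top_iff]
  intro u _
  rw [← Finset.univ_sum_single u]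
  refine sum_mem fun w _ => ?_
  have h1 : (Submodule.span ℂ (Set.range (R.values hs))).comap
      (LinearMap.single ℂ (fun _ : RootWord π => tensorRoot π ξ) w) = ⊤ := by
    refine hs.submodule_eq_top (fun i => Set.range fun σ => R.toMap i ((L i).vec σ)) (fun i => ?_)
      _ fun a ha h => ?_
    · rw [← R.range_eq i, LinearMap.range_eq_map, ← (L i).span_vec, Submodule.map_span,
        ← Set.range_comp]
      rfl
    · choose g hg using h
      obtain ⟨τ, hw, hτ⟩ := U.exists_perm w g
      refine Submodule.subset_span ⟨τ, ?_⟩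
      rw [values, hw]
      refine congrArg (Pi.single w) (Subtype.ext (congrArg (fun a => tprod (hs.family a)) ?_))
      funext i
      rw [place, hτ]
      exact hg i
  have h2 : u w ∈ (⊤ : Submodule ℂ (tensorRoot π ξ)) := trivial
  rw [← h1] at h2
  exact h2

theorem exists_dual : ∃ r : ∀ i : Place π, Equiv.Perm (L i).Cell → H i,
    (∀ i σ v, ⟪r i σ, R.toMap i v⟫_ℂ = v.1.coeff σ) ∧
      ∀ i : Place π, Submodule.span ℂ (Set.range (r i)) = root (π i) := by
  have h : ∀ i : Place π, ∃ r : Equiv.Perm (L i).Cell → H i,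
      (∀ σ v, ⟪r σ, R.toMap i v⟫_ℂ = v.1.coeff σ) ∧
        Submodule.span ℂ (Set.range r) = root (π i) := fun i => by
    have : FiniteDimensional ℂ (L i).youngModule :=
      FiniteDimensional.span_of_finite ℂ (Set.finite_range _)
    let l : Equiv.Perm (L i).Cell → (L i).youngModule →ₗ[ℂ] ℂ := fun σ =>
      { toFun := fun v => v.1.coeff σ
        map_add' := fun _ _ => rfl
        map_smul' := fun _ _ => rfl }
    obtain ⟨r, h1, h2⟩ := exists_dual_family (R.toMap i) (R.injective i) l fun a ha =>
      Subtype.ext (MonoidAlgebra.ext (Finsupp.ext ha))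
    exact ⟨r, h1, h2.trans (R.range_eq i)⟩
  choose r h1 h2 using h
  exact ⟨r, h1, h2⟩

/-- Vectors dual to the coordinate functionals of the parts give tensors `t y` whose inner products
with the values of `R.values hs τ` are the coefficients of `M.gen τ`. These tensors span at every
word, so a combination vanishes on one side exactly when it vanishes on the other. -/
theorem relations [Fintype (Place π)] (c : Equiv.Perm M.Cell → ℂ) :
    ∑ τ, c τ • M.vec τ = 0 ↔ ∑ τ, c τ • R.values hs τ = 0 := by
  classical
  obtain ⟨r, h1, h2⟩ := R.exists_dual
  have hr : ∀ (i : Place π) σ, r i σ ∈ root (π i) := fun i σ =>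
    h2 i ▸ Submodule.subset_span ⟨σ, rfl⟩
  let t : Equiv.Perm M.Cell → tensorRoot π ξ := fun y =>
    ⟨tprod (hs.family fun i => r i (U.place y i)),
      tprod_mem_tensorRoot (hs.family_mem fun i => hr i _)⟩
  have hpair : ∀ τ y, ⟪t y, R.values hs τ (U.word y)⟫_ℂ = (M.gen τ).coeff y := fun τ y => by
    rw [U.coeff_gen, values]
    split_ifs with h
    · rw [h, Pi.single_eq_same, Submodule.coe_inner]
      change ⟪tprod (hs.family _), tprod (hs.family _)⟫_ℂ = _
      rw [hs.inner_family]
      exact Finset.prod_congr rfl fun i _ => h1 i _ _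
    · rw [Pi.single_eq_of_ne h, inner_zero_right]
  have hpair' : ∀ y, ⟪t y, (∑ τ, c τ • R.values hs τ) (U.word y)⟫_ℂ =
      (∑ τ, c τ • M.vec τ : M.youngModule).1.coeff y := fun y => by
    rw [Finset.sum_apply, inner_sum, AddSubmonoidClass.coe_finsetSum, MonoidAlgebra.coeff_sum,
      Finsupp.finsetSum_apply]
    refine Finset.sum_congr rfl fun τ _ => ?_
    have h3 := inner_smul_right (𝕜 := ℂ) (t y) (R.values hs τ (U.word y)) (c τ)
    exact h3.trans (by rw [hpair]; rfl)
  constructor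
  · intro h
    funext w
    have h3 : (ℂ ∙ (∑ τ, c τ • R.values hs τ) w)ᗮ = ⊤ := by
      refine hs.submodule_eq_top (fun i => Set.range (r i)) h2 _ fun a ha hS => ?_
      choose g hg using hS
      obtain ⟨y, rfl, hy⟩ := U.exists_perm w g
      rw [Submodule.mem_orthogonal_singleton_iff_inner_left]
      have h4 := hpair' y
      rw [h] at h4
      have h5 : t y = ⟨tprod (hs.family a), tprod_mem_tensorRoot (hs.family_mem ha)⟩ :=
        Subtype.ext (congrArg (fun a => tprod (hs.family a)) (funext fun i => by
          exact (congrArg (r i) (congrFun hy i)).trans (hg i)))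
      rw [← h5, h4]
      rfl
    have h4 : (∑ τ, c τ • R.values hs τ) w ∈ (ℂ ∙ (∑ τ, c τ • R.values hs τ) w)ᗮ := by
      rw [h3]
      trivial
    exact inner_self_eq_zero.1 (Submodule.mem_orthogonal_singleton_iff_inner_left.1 h4)
  · intro h
    refine Subtype.ext (MonoidAlgebra.ext (Finsupp.ext fun y => ?_))
    rw [← hpair', h]
    exact inner_zero_right _

theorem word_mul (κ τ : Equiv.Perm M.Cell) :
    U.word (κ * τ) = (U.word τ).perm (U.whole.permCongr κ) := by
  refine Subtype.ext (funext fun x => ?_)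
  rw [RootWord.perm_apply, Numbering.word_apply, Numbering.word_apply]
  have h1 : (κ * τ).symm (U.whole.symm x) = τ.symm (κ.symm (U.whole.symm x)) := rfl
  have h2 : U.whole.symm ((U.whole.permCongr κ).symm x) = κ.symm (U.whole.symm x) := by
    rw [Equiv.symm_apply_eq]
    rfl
  rw [h1, h2]

/-- For a point of color `i`, the label before the permutation is read off from `U.place τ i` and
the label after it from `U.place (κ * τ) i`. -/
theorem coc_eq (κ τ : Equiv.Perm M.Cell) (i : Place π) :
    (coc (ofWindow _ (U.whole.permCongr κ)) (wordExt (U.word τ).1)).1 i =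
      ofWindow _ ((U.part i).permCongr (U.place (κ * τ) i * (U.place τ i)⁻¹)) := by
  refine G.ext' fun y => ?_
  by_cases hy : y ∈ window (depth (π i))
  · obtain ⟨q, hq⟩ : ∃ q, (U.part i (U.place τ i q) : NZ) = y :=
      ⟨(U.place τ i).symm ((U.part i).symm ⟨y, hy⟩), by simp⟩
    have h1 := U.part_place τ i q
    set x := U.whole (τ (U.equiv ⟨i, q⟩)) with hx
    have hxi : (U.word τ).1 x = i := U.word_whole τ i q
    have h2 : y = lab (wordExt (U.word τ).1) i x := by
      rw [← hq, h1, RootWord.label, hxi]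
    have h3 : (ofWindow _ (U.whole.permCongr κ)).1 x = U.whole ((κ * τ) (U.equiv ⟨i, q⟩)) := by
      rw [ofWindow_apply, Equiv.permCongr_apply, hx, Equiv.symm_apply_apply]
      rfl
    have h4 : (U.place τ i)⁻¹ (U.place τ i q) = q := (U.place τ i).symm_apply_apply q
    have h5 := coc_lab (U.word τ).good (ofWindow _ (U.whole.permCongr κ))
      ((wordExt_apply x).trans hxi)
    rw [h3, ← RootWord.wordExt_perm, ← word_mul, ← h2] at h5
    refine h5.trans ?_
    have h6 := U.part_place (κ * τ) i q
    rw [RootWord.label, U.word_whole] at h6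
    rw [← h6, ← hq, ofWindow_apply, Equiv.permCongr_apply, Equiv.symm_apply_apply]
    exact congrArg (fun q => (U.part i (U.place (κ * τ) i q) : NZ)) h4.symm
  · rw [(U.word τ).suppIn_coc _ _ y hy, suppIn_ofWindow _ _ y hy]

theorem rootPerm_values (κ τ : Equiv.Perm M.Cell) :
    rootPerm hs (U.whole.permCongr κ) (R.values hs τ) = R.values hs (κ * τ) := by
  classical
  rw [values, rootPerm_single, values, word_mul]
  refine congrArg _ (Subtype.ext ?_)
  change tensorAct π _ (tprod (hs.family (R.place τ))) = tprod (hs.family (R.place (κ * τ)))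
  rw [tensorAct_tprod]
  refine congrArg tprod (Subtype.ext (funext fun i => ?_))
  change π i ((coc (ofWindow _ (U.whole.permCongr κ)) (wordExt (U.word τ).1)).1 i)
    ((hs.family (R.place τ)).1 i) = _
  by_cases hi : depth (π i) = 0
  · have h1 : (coc (ofWindow _ (U.whole.permCongr κ)) (wordExt (U.word τ).1)).1 i = 1 :=
      G.ext' fun y => (U.word τ).suppIn_coc _ i y (by rw [hi]; exact notMem_window_zero y)
    rw [h1, map_one, hs.family_apply_of_depth _ hi, hs.family_apply_of_depth _ hi]
    rfl
  · obtain ⟨j, rfl⟩ : ∃ j : Place π, (j : ℕ) = i := ⟨⟨i, hi⟩, rfl⟩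
    rw [coc_eq, hs.family_apply, hs.family_apply, place, R.perm, inv_mul_cancel_right]
    rfl

/-- At the place `i` the operator has the point of a cell of `L i` as eigenvalue. The factor `p i`
of `rootOp` turns it into the point of the corresponding cell of the union. -/
theorem rootOp_values (τ : Equiv.Perm M.Cell) (z : M.Cell) :
    rootOp hs p (U.whole z) (R.values hs τ) = ((τ⁻¹ z).pt : ℂ) • R.values hs τ := by
  classical
  obtain ⟨⟨⟨i, q⟩, h⟩⟩ : Nonempty {a : Σ i : Place π, (L i).Cell // τ (U.equiv a) = z} :=
    ⟨⟨U.equiv.symm (τ.symm z), by simp⟩⟩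
  have hz : τ⁻¹ z = U.equiv ⟨i, q⟩ := by
    rw [← h]
    exact τ.symm_apply_apply _
  have h1 : opA (placeRep π ξ ((U.word τ).1 (U.whole z))) ((U.word τ).label (U.whole z))
      (R.tensor hs τ) = (((q.pt : ℂ) • R.tensor hs τ : tensorRoot π ξ) : InfTensor ξ) := by
    rw [← h, U.word_whole τ i q, ← U.part_place]
    change opA (placeRep π ξ i) _ (tprod (hs.family (R.place τ))) =
      (q.pt : ℂ) • tprod (hs.family (R.place τ))
    rw [← tprodAt_self _ (i : ℕ), opA_placeRep_tprodAt (hs.admissible i), ← map_smul,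
      hs.family_apply, place, R.op]
    have h4 : (U.place τ i)⁻¹ (U.place τ i q) = q := (U.place τ i).symm_apply_apply q
    rw [h4]
  rw [values, rootOp_single hs _ _ h1, hz, U.pt_equiv, ← h, U.word_whole, Complex.ofReal_mul,
    mul_smul]
  congr 1
  exact Pi.single_smul' _ _ _

include R hs in
theorem hasYoungDistribution [Fintype (Place π)] (h : IsMixAction π ξ p ρ) :
    HasYoungDistribution (mixture π ξ p ρ) M := by
  obtain ⟨φ, h1, h2, h3⟩ := exists_linearMap_of_relations M.vec (R.values hs) M.span_vec
    (R.relations hs)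
  refine hasYoungDistribution_of_depth_eq (h.depth_mixture hs) U.whole (rootVec ρ ∘ₗ φ)
    (rootVec_injective.comp h1) ?_ (fun σ τ => ?_) fun z τ => ?_
  · rw [LinearMap.range_comp, h2, R.span_values, ← LinearMap.range_eq_map, h.root_mixture hs]
  · rw [LinearMap.comp_apply, LinearMap.comp_apply, h3, h3, h.ofWindow_rootVec hs,
      R.rootPerm_values]
  · rw [LinearMap.comp_apply, h3, h.opA_rootVec hs, R.rootOp_values, map_smul]

end RootModel

/-! ### The union of the rescaled distributions -/

section Union

variable {p : Weights} {L : ℕ → YoungDistribution}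

/-- The supports of the rescaled distributions are disjoint. -/
def DisjointSupports (p : Weights) (L : ℕ → YoungDistribution) : Prop :=
  ∀ i j, i ≠ j → {x | L i (x / p i) ≠ ⊥} ∩ {x | L j (x / p j) ≠ ⊥} = ∅

theorem disjointSupports_iff : DisjointSupports p L ↔
    ∀ i j, i ≠ j → ∀ t ∈ {t : ℝ | L i t ≠ ⊥}, ∀ s ∈ {s : ℝ | L j s ≠ ⊥}, p i * t ≠ p j * s := by
  refine forall_congr' fun i => forall_congr' fun j => imp_congr_right fun _ => ?_
  have hi := (p.pos i).ne'
  have hj := (p.pos j).ne'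
  constructor
  · intro h t ht s hs hts
    have : p i * t ∈ ({x | L i (x / p i) ≠ ⊥} ∩ {x | L j (x / p j) ≠ ⊥} : Set ℝ) := by
      refine ⟨?_, ?_⟩
      · rw [Set.mem_ofPred_eq, mul_div_cancel_left₀ _ hi]
        exact ht
      · rw [Set.mem_ofPred_eq, hts, mul_div_cancel_left₀ _ hj]
        exact hs
    rw [h] at this
    exact this
  · intro h
    rw [Set.eq_empty_iff_forall_notMem]
    rintro x ⟨h1, h2⟩
    exact h _ h1 _ h2 (by rw [mul_div_cancel₀ _ hi, mul_div_cancel₀ _ hj])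

theorem YoungDistribution.eq_bot_of_size (L : YoungDistribution) (h : L.size = 0) (x : ℝ) :
    L x = ⊥ := by
  have := Fintype.card_eq_zero_iff.1 h
  rw [eq_bot_iff]
  intro c hc
  exact (this.false (⟨(x, c), hc⟩ : L.Cell)).elim

open Classical in
/-- The diagram at `x` of the union of the rescaled distributions. -/
def unionFun (p : Weights) (L : ℕ → YoungDistribution) (x : ℝ) : YoungDiagram :=
  if h : ∃ i, L i (x / p i) ≠ ⊥ then L h.choose (x / p h.choose) else ⊥

theorem unionFun_eq (h : DisjointSupports p L) {x : ℝ} {i : ℕ} (hi : L i (x / p i) ≠ ⊥) :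
    unionFun p L x = L i (x / p i) := by
  have h1 : ∃ i, L i (x / p i) ≠ ⊥ := ⟨i, hi⟩
  have h2 : h1.choose = i := by
    by_contra hne
    have : x ∈ (∅ : Set ℝ) := h _ _ hne ▸ ⟨h1.choose_spec, hi⟩
    exact this
  rw [unionFun, dif_pos h1, h2]

theorem exists_of_unionFun_ne {x : ℝ} (h : unionFun p L x ≠ ⊥) : ∃ i, L i (x / p i) ≠ ⊥ := by
  by_contra h1
  exact h (dif_neg h1)

/-- The union of the rescaled distributions. -/
def youngUnion (p : Weights) (L : ℕ → YoungDistribution) (hfin : {i | (L i).size ≠ 0}.Finite) :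
    YoungDistribution where
  toFun := unionFun p L
  finite_supp := by
    refine (hfin.biUnion fun i _ => (L i).finite_supp.image fun t => p i * t).subset fun x hx => ?_
    obtain ⟨i, hi⟩ := exists_of_unionFun_ne hx
    exact Set.mem_biUnion (fun h => hi ((L i).eq_bot_of_size h _))
      ⟨x / p i, hi, mul_div_cancel₀ _ (p.pos i).ne'⟩
  supp_subset := by
    intro x hx
    obtain ⟨i, hi⟩ := exists_of_unionFun_ne hx
    have h1 : |x / p i| ≤ 1 := abs_le.2 ((L i).supp_subset hi)
    refine abs_le.1 ?_
    rw [abs_div, abs_of_pos (p.pos i), div_le_one (p.pos i)] at h1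
    exact h1.trans (p.le_one i)

theorem mem_youngUnion (h : DisjointSupports p L) (hfin : {i | (L i).size ≠ 0}.Finite) (x : ℝ)
    (c : ℕ × ℕ) : c ∈ youngUnion p L hfin x ↔ ∃ i, c ∈ L i (x / p i) := by
  change c ∈ unionFun p L x ↔ _
  constructor
  · intro hc
    obtain ⟨i, hi⟩ := exists_of_unionFun_ne (p := p) (L := L) (x := x) fun h0 =>
      YoungDiagram.notMem_bot c (h0 ▸ hc)
    exact ⟨i, unionFun_eq h hi ▸ hc⟩
  · rintro ⟨i, hi⟩
    rwa [unionFun_eq h fun h0 => YoungDiagram.notMem_bot c (h0 ▸ hi)]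

end Union

/-! ### The cells of the union -/

variable {H : ℕ → Type*} [∀ i, NormedAddCommGroup (H i)] [∀ i, InnerProductSpace ℂ (H i)]
  {ξ : ∀ i, Metric.sphere (0 : H i) 1} {π : ∀ i, URep (H i)} {p : Weights} {μ : ℕ → Measure ℝ}
  {ρ : URep (MixSpace ξ p)} {L : ℕ → YoungDistribution}

/-- The cells of the union are the cells of the distributions. -/
def youngCellUnion (h : DisjointSupports p L) (hfin : {i | (L i).size ≠ 0}.Finite)
    (hL : ∀ i, (L i).size = 2 * depth (π i)) :
    CellUnion (fun i : Place π => L i) (fun i => p i) (youngUnion p L hfin) where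
  equiv := Equiv.ofBijective (fun a => ⟨(p a.1 * a.2.pt, a.2.1.2),
      (mem_youngUnion h hfin _ _).2 ⟨a.1, by
        dsimp only
        rw [mul_div_cancel_left₀ _ (p.pos _).ne']
        exact a.2.2⟩⟩) (by
    constructor
    · rintro ⟨i, q⟩ ⟨j, q'⟩ hq
      have h1 : ((p i * q.pt, q.1.2) : ℝ × ℕ × ℕ) = (p j * q'.pt, q'.1.2) :=
        congrArg Subtype.val hq
      have h2 : p i * q.pt = p j * q'.pt := congrArg Prod.fst h1
      have hij : i = j := by
        by_contra hne
        exact disjointSupports_iff.1 h i j (fun h => hne (Subtype.ext h)) _ q.pt_ne_bot _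
          q'.pt_ne_bot h2
      subst hij
      have h3 : q = q' := Subtype.ext (Prod.ext (mul_left_cancel₀ (p.pos _).ne' h2)
        (Prod.mk.inj h1).2)
      rw [h3]
    · rintro ⟨⟨x, c⟩, hc⟩
      obtain ⟨i, hi⟩ := (mem_youngUnion h hfin _ _).1 hc
      have hd : depth (π i) ≠ 0 := fun h0 => by
        rw [(L i).eq_bot_of_size (by rw [hL, h0])] at hi
        exact YoungDiagram.notMem_bot c hi
      exact ⟨⟨⟨i, hd⟩, ⟨(x / p i, c), hi⟩⟩,
        Subtype.ext (Prod.ext (mul_div_cancel₀ _ (p.pos _).ne') rfl)⟩)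
  pt_equiv := fun i q => rfl
  pos_equiv := fun i q => rfl
  pos := fun i => p.pos i
  color_eq := fun i j q q' hq => by
    by_contra hne
    exact disjointSupports_iff.1 h i j (fun h => hne (Subtype.ext h)) _ q.pt_ne_bot _
      q'.pt_ne_bot hq

theorem exists_whole {M : YoungDistribution} (hd : {i | depth (π i) ≠ 0}.Finite)
    (U : CellUnion (fun i : Place π => L i) (fun i => p i) M)
    (hL : ∀ i, (L i).size = 2 * depth (π i)) : Nonempty (M.Cell ≃ window (totalDepth π)) := by
  have : Fintype (Place π) := hd.fintype
  refine ⟨Fintype.equivOfCardEq ?_⟩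
  rw [← Fintype.card_congr U.equiv, Fintype.card_sigma, card_window, totalDepth,
    finsum_eq_sum_of_support_subset (s := hd.toFinset) _ (by
      rw [Set.Finite.coe_toFinset]
      exact fun i hi => hi),
    Finset.sum_subtype (p := fun i => depth (π i) ≠ 0) _ (fun i => by simp), Finset.mul_sum]
  exact Finset.sum_congr rfl fun i _ => hL i

/-! ### Assembly of the theorem -/

section Main

variable [∀ i, CompleteSpace (H i)]

theorem isMixable_of_hasYoungDistribution (hirr : ∀ i, IsIrreducible (π i))
    (hadm : ∀ i, IsAdmissible (π i)) (hμ : ∀ i, HasThomaMeasure (π i) (μ i))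
    (hL : ∀ i, HasYoungDistribution (π i) (L i)) (hsum : Summable fun i => ((L i).size : ℝ))
    (hξ : ∀ i, depth (π i) = 0 → (ξ i : H i) ∈ fixed (π i) 0) : IsMixable π ξ μ where
  irreducible := hirr
  admissible := hadm
  thoma := hμ
  finiteDimensional_root i := (hL i).finiteDimensional_root
  finite_depth := by
    -- The terms of the summable family are natural numbers, so all but finitely many of them
    -- vanish.
    have h1 : {i | ¬ ((L i).size : ℝ) < 1}.Finite := by
      have := hsum.tendsto_cofinite_zero.eventually (gt_mem_nhds one_pos)
      rwa [eventually_cofinite] at this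
    refine h1.subset fun i hi => ?_
    rw [Set.mem_ofPred_eq, (hL i).size_eq, not_lt]
    have h2 : 1 ≤ depth (π i) := Nat.one_le_iff_ne_zero.2 hi
    exact_mod_cast (by omega : 1 ≤ 2 * depth (π i))
  mem_root i h := by
    rw [root, h]
    exact hξ i h

variable (h : IsMixAction π ξ p ρ) (hs : IsMixable π ξ μ)
  (hL : ∀ i, HasYoungDistribution (π i) (L i))
include h hs hL

theorem IsMixAction.isIrreducible_mixture_iff :
    IsIrreducible (mixture π ξ p ρ) ↔ DisjointSupports p L := by
  have := finite_rootWord hs.finite_depth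
  have := Fintype.ofFinite (RootWord π)
  rw [disjointSupports_iff]
  constructor
  · intro hirr
    by_contra! hne
    obtain ⟨i, j, hij, t, ht, s, hs', hts⟩ := hne
    exact h.not_isIrreducible_mixture hs (E := fun i => {t : ℝ | L i t ≠ ⊥})
      (fun i => (hL i).exists_eigenvector (hs.root_ne_bot i)) hij ht hs' hts hirr
  · exact h.isIrreducible_mixture hs (E := fun i => {t : ℝ | L i t ≠ ⊥})
      fun i y hy => (hL i).root_le_span hy

theorem IsMixAction.exists_youngDistribution_mixture (hd : DisjointSupports p L) :
    ∃ M : YoungDistribution, (∀ x c, c ∈ M x ↔ ∃ i, c ∈ L i (x / p i)) ∧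
      HasYoungDistribution (mixture π ξ p ρ) M := by
  have := finite_rootWord hs.finite_depth
  have := Fintype.ofFinite (RootWord π)
  have : Fintype (Place π) := hs.finite_depth.fintype
  have hsize : ∀ i, (L i).size = 2 * depth (π i) := fun i => (hL i).size_eq
  have hfin : {i | (L i).size ≠ 0}.Finite := hs.finite_depth.subset fun i hi h0 => hi (by
    rw [hsize, h0])
  refine ⟨youngUnion p L hfin, mem_youngUnion hd hfin, ?_⟩
  choose e φ h1 h2 h3 h4 using hL
  let U := youngCellUnion (π := π) hd hfin hsize
  let N : Numbering π p L (youngUnion p L hfin) :=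
    { U with
      part := e
      whole := (exists_whole hs.finite_depth U hsize).some }
  let R : RootModel N := ⟨fun i => φ i, fun i => h1 i, fun i => h2 i, fun i => h3 i, fun i => h4 i⟩
  exact R.hasYoungDistribution hs h

end Main

end Mixture

end

theorem theorem7 {H : ℕ → Type*} [∀ i, NormedAddCommGroup (H i)]
    [∀ i, InnerProductSpace ℂ (H i)] [∀ i, CompleteSpace (H i)]
    (π : ∀ i, Mixture.URep (H i)) (p : Mixture.Weights)
    (μ : ℕ → Measure ℝ) (L : ℕ → Mixture.YoungDistribution)
    (hirr : ∀ i, Mixture.IsIrreducible (π i)) (hadm : ∀ i, Mixture.IsAdmissible (π i))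
    (hμ : ∀ i, Mixture.HasThomaMeasure (π i) (μ i))
    (hL : ∀ i, Mixture.HasYoungDistribution (π i) (L i))
    (hsum : Summable fun i => ((L i).size : ℝ))
    (ξ : ∀ i, Metric.sphere (0 : H i) 1)
    (hξ : ∀ i, Mixture.depth (π i) = 0 → (ξ i : H i) ∈ Mixture.fixed (π i) 0) :
    (∃ ρ : Mixture.URep (Mixture.MixSpace ξ p), Mixture.IsMixAction π ξ p ρ) ∧
    ∀ ρ : Mixture.URep (Mixture.MixSpace ξ p), Mixture.IsMixAction π ξ p ρ →
      Mixture.IsAdmissible (Mixture.mixture π ξ p ρ) ∧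
      (∃ (ι : Type) (W : ι → Mixture.Subrep (Mixture.mixture π ξ p ρ)),
        Nonempty ι ∧
        (∀ j k, j ≠ k → (W j).carrier ⟂ (W k).carrier) ∧
        (⨆ j, (W j).carrier).topologicalClosure = ⊤ ∧
        ∀ j, Mixture.IsIrreducible (W j).rep ∧ Mixture.IsAdmissible (W j).rep ∧
          Mixture.HasThomaMeasure (W j).rep (Mixture.mixMeasure p μ)) ∧
      (Mixture.IsIrreducible (Mixture.mixture π ξ p ρ) ↔
        ∀ i j, i ≠ j → {x | L i (x / p i) ≠ ⊥} ∩ {x | L j (x / p j) ≠ ⊥} = ∅) ∧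
      ((∀ i j, i ≠ j → {x | L i (x / p i) ≠ ⊥} ∩ {x | L j (x / p j) ≠ ⊥} = ∅) →
        ∃ M : Mixture.YoungDistribution,
          (∀ x c, c ∈ M x ↔ ∃ i, c ∈ L i (x / p i)) ∧
          Mixture.HasYoungDistribution (Mixture.mixture π ξ p ρ) M) := by
  have hs := Mixture.isMixable_of_hasYoungDistribution (ξ := ξ) hirr hadm hμ hL hsum hξ
  have := Mixture.finite_rootWord hs.finite_depth
  have := Fintype.ofFinite (Mixture.RootWord π)
  -- The explicit action shows that the claim about all `ρ` is not vacuous.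
  refine ⟨⟨Mixture.mixAction π ξ p, Mixture.isMixAction_mixAction π⟩, fun ρ h =>
    ⟨h.isAdmissible_mixture, h.exists_decomposition_mixture hs, h.isIrreducible_mixture_iff hs hL,
      h.exists_youngDistribution_mixture hs hL⟩⟩
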